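/- **Lemma (local energy error estimate).** Let $N\in\{2,3\}$ and let $\Omega\subset\mathbb R^N$ be a polygon ($N=2$) or a polyhedron ($N=3$), possibly nonconvex, i.e. a domain that is the interior of its closure and whose closure is a finite union of closed nondegenerate $N$-simplices. Let $r\ge 1$ and $K>0$. There is a constant $C>0$, depending only on $\Omega,r,K$, such that the following holds. *Finite elements.* Let $h>0$ and let $\mathcal T$ be a conforming triangulation of $\Omega$ that is quasi-uniform with mesh size $h$ and constant $K$: the diameter $h_\tau$ and the inscribed-ball radius $\rho_\tau$ of every cell $\tau$ satisfy $K^{-1}h\le\rho_\tau\le h_\tau\le Kh$. Let $S_h\subset H^1_0(\Omega)$ be the space of continuous functions vanishing on $\partial\Omega$ whose restriction to each cell is a polynomial of degree at most $r$. Let $x_i$ be the Lagrange nodes of $S_h$ in $\Omega$, $\Phi_i\in S_h$ the nodal basis, $\tau_i$ the union of the cells containing $x_i$, and $P_h^{(i)}v$ the $L^2(\tau_i)$-projection of $v$ onto the restrictions of $S_h$ to $\tau_i$. Let $I_h:L^2(\Omega)\to S_h$ be the Clément-type operator $I_hv=\sum_i (P_h^{(i)}v)(x_i)\,\Phi_i$.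 *Dyadic decomposition.* Put $d_j=2^{-j}$. Let $C_*\ge 16$ and let $J_*$ be an integer with $2^{-J_*}=C_*h$, $h<1/(4C_*)$. Fix $x_0\in\Omega$ and let $\mathcal Q=(0,1)\times\Omega$. For $j\ge1$ let $$Q_j=\{(t,x)\in\mathcal Q:\ d_j\le\max(|x-x_0|,t^{1/2})\le 2d_j\},\qquad \Omega_j=\{x\in\Omega:\ d_j\le|x-x_0|\le2d_j\}.$$ Let $Q_*=\{(t,x)\in\mathcal Q:\max(|x-x_0|,t^{1/2})\le d_{J_*}\}$ and $\Omega_*=\{x\in\Omega:|x-x_0|\le d_{J_*}\}$, and let $$Q_0=\mathcal Q\setminus\Big(\bigcup_{j=1}^{J_*}Q_j\cup Q_*\Big),\qquad \Omega_0=\Omega\setminus\Big(\bigcup_{j=1}^{J_*}\Omega_j\cup\Omega_*\Big),\qquad Q_j=\Omega_j=\emptyset\ \ (j<0).$$ Put $Q_j'=Q_{j-1}\cup Q_j\cup Q_{j+1}$, $\Omega_j'=\Omega_{j-1}\cup\Omega_j\cup\Omega_{j+1}$ and $\Omega_j''=\Omega_{j-2}\cup\Omega_j'\cup\Omega_{j+2}$.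 For $k=0,1$ let $$\|v\|_{k,D}=\Big(\int_D\sum_{|\beta|\le k}|\partial^\beta v|^2dx\Big)^{1/2},\qquad |||v|||_{k,Q}=\Big(\int_Q\sum_{|\beta|\le k}|\partial^\beta v|^2dx\,dt\Big)^{1/2},$$ where $\partial^\beta$ are weak derivatives in $x$ only. The value is $+\infty$ if a weak derivative fails to exist in $L^2$. The index $k=0$ is omitted. *Statement.* Let $T\ge1$, $\phi\in L^2(0,T;H^1_0(\Omega))\cap H^1(0,T;L^2(\Omega))$ and $\phi_h\in H^1(0,T;S_h)$ satisfy $$(\partial_t(\phi-\phi_h),\chi_h)+(\nabla(\phi-\phi_h),\nabla\chi_h)=0\qquad\forall\,\chi_h\in S_h,\ \text{a.e. } t\in(0,T),$$ where $(\cdot,\cdot)$ is the $L^2(\Omega)$ inner product. Let $j\ge0$ be an integer and suppose that $\phi(0)=0$ a.e. in $\Omega_j''$. Then for every $\epsilon\in(0,1)$ $$\begin{aligned} &|||\partial_t(\phi-\phi_h)|||_{Q_j}+d_j^{-1}|||\phi-\phi_h|||_{1,Q_j}\\ &\le C\epsilon^{-3}\big(I_j(\phi_h(0))+X_j(I_h\phi-\phi)+d_j^{-2}|||\phi-\phi_h|||_{Q_j'}\big)\\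 &\quad+\big(Ch^{1/2}d_j^{-1/2}+C\epsilon^{-1}hd_j^{-1}+\epsilon\big)\big(|||\partial_t(\phi-\phi_h)|||_{Q_j'}+d_j^{-1}|||\phi-\phi_h|||_{1,Q_j'}\big), \end{aligned}$$ where $$I_j(w)=\|w\|_{1,\Omega_j'}+d_j^{-1}\|w\|_{\Omega_j'},$$ $$X_j(\eta)=d_j|||\partial_t\eta|||_{1,Q_j'}+|||\partial_t\eta|||_{Q_j'}+d_j^{-1}|||\eta|||_{1,Q_j'}+d_j^{-2}|||\eta|||_{Q_j'}.$$ In particular $C$ is independent of $h,\mathcal T,C_*,J_*,T,x_0,j,\epsilon,\phi,\phi_h$. -/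

import Mathlib

open Set MeasureTheory Filter Topology
open scoped ENNReal ContDiff

noncomputable section

namespace HeatFEM

/-- The Euclidean space `ℝ^N`. -/
abbrev Sp (N : ℕ) : Type := EuclideanSpace ℝ (Fin N)

variable {N : ℕ}

/-! ### Polygonal and polyhedral domains, triangulations -/

/-- A polygon (`N = 2`) or polyhedron (`N = 3`), possibly nonconvex: a (nonempty, connected, open)
domain which is the interior of its closure and whose closure is a finite union of nondegenerate
closed `N`-simplices. -/
structure IsPolyhedralDomain (Ω : Set (Sp N)) : Prop where
  isOpen : IsOpen Ω
  isConnected : IsConnected Ω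
  interior_closure : interior (closure Ω) = Ω
  closure_eq : ∃ F : Finset (Finset (Sp N)),
    (∀ s ∈ F, s.card = N + 1 ∧ AffineIndependent ℝ ((↑) : s → Sp N)) ∧
      closure Ω = ⋃ s ∈ F, convexHull ℝ (s : Set (Sp N))

/-- The vertex sets of the top-dimensional simplices (triangles or tetrahedra). -/
def cells (𝒯 : Geometry.SimplicialComplex ℝ (Sp N)) : Set (Finset (Sp N)) :=
  {s | s ∈ 𝒯.faces ∧ s.card = N + 1}

/-- `𝒯` is a (conforming) triangulation of `Ω`, quasi-uniform with mesh size `h` and constant `K`: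
every cell has diameter at most `K h` and contains a closed ball of radius `K⁻¹ h`. -/
structure IsQuasiUniformTriangulation (Ω : Set (Sp N))
    (𝒯 : Geometry.SimplicialComplex ℝ (Sp N)) (K h : ℝ) : Prop where
  finite : 𝒯.faces.Finite
  pure : ∀ s ∈ 𝒯.faces, ∃ t ∈ cells 𝒯, s ⊆ t
  space_eq : 𝒯.space = closure Ω
  diam_le : ∀ s ∈ cells 𝒯, Metric.diam (convexHull ℝ (s : Set (Sp N))) ≤ K * h
  ball_subset : ∀ s ∈ cells 𝒯, ∃ c,
    Metric.closedBall c (K⁻¹ * h) ⊆ convexHull ℝ (s : Set (Sp N))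

/-! ### `L²` and Sobolev spaces -/

/-- `L²(Ω)`. -/
abbrev L2 (Ω : Set (Sp N)) : Type := Lp ℝ 2 (volume.restrict Ω)

/-- `L²(Ω)^N`. -/
abbrev L2Vec (Ω : Set (Sp N)) : Type := Lp (Sp N) 2 (volume.restrict Ω)

/-- Smooth functions with compact support in `U`. -/
def IsTestFun (U : Set (Sp N)) (ψ : Sp N → ℝ) : Prop :=
  ContDiff ℝ ∞ ψ ∧ HasCompactSupport ψ ∧ tsupport ψ ⊆ U

/-- `H¹₀(Ω)`: the closure in the `H¹` norm of the test functions. An element is a pair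
`(u, ∇u)` in `L²(Ω) × L²(Ω)^N`, so that the norm is the full `H¹` norm. -/
def H10 (Ω : Set (Sp N)) : Submodule ℝ (WithLp 2 (L2 Ω × L2Vec Ω)) :=
  (Submodule.span ℝ {u | ∃ ψ : Sp N → ℝ, IsTestFun Ω ψ ∧
    u.fst =ᵐ[volume.restrict Ω] ψ ∧
    u.snd =ᵐ[volume.restrict Ω] (fun x => gradient ψ x)}).topologicalClosure

/-- The inclusion `H¹₀(Ω) → L²(Ω)`. -/
def H10.val {Ω : Set (Sp N)} : H10 Ω →L[ℝ] L2 Ω :=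
  (WithLp.fstL 2 ℝ (L2 Ω) (L2Vec Ω)).comp (H10 Ω).subtypeL

/-- The gradient `H¹₀(Ω) → L²(Ω)^N`. -/
def H10.grad {Ω : Set (Sp N)} : H10 Ω →L[ℝ] L2Vec Ω :=
  (WithLp.sndL 2 ℝ (L2 Ω) (L2Vec Ω)).comp (H10 Ω).subtypeL

/-- `G` is the weak gradient of `w` in the open set `U`. -/
def HasWeakGradOn (U : Set (Sp N)) (w : Sp N → ℝ) (G : Sp N → Sp N) : Prop :=
  ∀ ψ : Sp N → ℝ, IsTestFun U ψ →
    ∫ x in U, w x • gradient ψ x = - ∫ x in U, ψ x • G x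

/-- `‖w‖_D`, the `L²(D)` norm. -/
def norm0 (D : Set (Sp N)) (w : Sp N → ℝ) : ℝ≥0∞ :=
  eLpNorm w 2 (volume.restrict D)

/-- `‖w‖_{1,D} = (∫_D |w|² + |∇w|²)^{1/2}`; it is `∞` if `w` has no square integrable weak
gradient in the interior of `D`. -/
def norm1 (D : Set (Sp N)) (w : Sp N → ℝ) : ℝ≥0∞ :=
  ⨅ (G : Sp N → Sp N) (_ : MemLp G 2 (volume.restrict D) ∧ HasWeakGradOn (interior D) w G),
    (norm0 D w ^ 2 + eLpNorm G 2 (volume.restrict D) ^ 2) ^ (1 / 2 : ℝ)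

/-- The time slice `{x : (t, x) ∈ Q}`. -/
def slice (Q : Set (ℝ × Sp N)) (t : ℝ) : Set (Sp N) := {x | (t, x) ∈ Q}

/-- `|||v|||_Q = (∫∫_Q |v|² dx dt)^{1/2}`. -/
def stNorm0 {Ω : Set (Sp N)} (Q : Set (ℝ × Sp N)) (v : ℝ → L2 Ω) : ℝ≥0∞ :=
  (∫⁻ t, norm0 (slice Q t) (v t) ^ 2) ^ (1 / 2 : ℝ)

/-- `|||v|||_{1,Q} = (∫∫_Q |v|² + |∇v|² dx dt)^{1/2}`, with the spatial gradient `∇`. -/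
def stNorm1 {Ω : Set (Sp N)} (Q : Set (ℝ × Sp N)) (v : ℝ → L2 Ω) : ℝ≥0∞ :=
  (∫⁻ t, norm1 (slice Q t) (v t) ^ 2) ^ (1 / 2 : ℝ)

/-! ### Functions of time with values in a normed space -/

section Time

variable {X : Type*} [NormedAddCommGroup X] [NormedSpace ℝ X]

/-- `u ∈ L²(0,T;X)`. -/
def MemL2Time (T : ℝ) (u : ℝ → X) : Prop := MemLp u 2 (volume.restrict (Ioo 0 T))

/-- `u' ∈ L²(0,T;X)` is the weak derivative of `u` on `(0,T)`. -/
def IsTimeDeriv (T : ℝ) (u u' : ℝ → X) : Prop :=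
  MemL2Time T u' ∧ ∀ η : ℝ → ℝ, ContDiff ℝ ∞ η → HasCompactSupport η → tsupport η ⊆ Ioo 0 T →
    ∫ t in Ioo 0 T, deriv η t • u t = - ∫ t in Ioo 0 T, η t • u' t

/-- `u ∈ H¹(0,T;X)`. -/
def MemH1Time (T : ℝ) (u : ℝ → X) : Prop := MemL2Time T u ∧ ∃ u', IsTimeDeriv T u u'

/-- The weak derivative `∂ₜu` of `u ∈ H¹(0,T;X)` (unique up to a null set of times). -/
def timeDeriv (T : ℝ) (u : ℝ → X) : ℝ → X := Classical.epsilon fun u' => IsTimeDeriv T u u'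

/-- The value `u(0)` of `u ∈ H¹(0,T;X)`: the value at `0` of the representative of `u` that is
continuous on `[0,T]`. -/
def initialValue (T : ℝ) (u : ℝ → X) : X := Classical.epsilon fun u₀ =>
  ∃ v : ℝ → X, ContinuousOn v (Icc 0 T) ∧ v =ᵐ[volume.restrict (Ioo 0 T)] u ∧ v 0 = u₀

end Time

/-! ### The Lagrange finite element space and the operator `I_h` -/

/-- Continuous functions, zero outside `Ω` (in particular on its boundary), that are polynomials of
degree at most `r` on each cell. -/
def feFun (Ω : Set (Sp N)) (𝒯 : Geometry.SimplicialComplex ℝ (Sp N)) (r : ℕ) :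
    Submodule ℝ (Sp N → ℝ) where
  carrier := {f | Continuous f ∧ (∀ x, x ∉ Ω → f x = 0) ∧
    ∀ s ∈ cells 𝒯, ∃ p : MvPolynomial (Fin N) ℝ, p.totalDegree ≤ r ∧
      ∀ x ∈ convexHull ℝ (s : Set (Sp N)), f x = MvPolynomial.eval (fun i => x i) p}
  zero_mem' := ⟨continuous_const, fun _ _ => rfl, fun _ _ => ⟨0, by simp, by simp⟩⟩
  add_mem' := by
    rintro f g ⟨hf, hf0, hfp⟩ ⟨hg, hg0, hgp⟩
    refine ⟨hf.add hg, fun x hx => by simp [hf0 x hx, hg0 x hx], fun s hs => ?_⟩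
    obtain ⟨p, hp, hpe⟩ := hfp s hs
    obtain ⟨q, hq, hqe⟩ := hgp s hs
    exact ⟨p + q, (MvPolynomial.totalDegree_add p q).trans (max_le hp hq),
      fun x hx => by simp [hpe x hx, hqe x hx]⟩
  smul_mem' := by
    rintro c f ⟨hf, hf0, hfp⟩
    refine ⟨hf.const_smul c, fun x hx => by simp [hf0 x hx], fun s hs => ?_⟩
    obtain ⟨p, hp, hpe⟩ := hfp s hs
    exact ⟨c • p, (MvPolynomial.totalDegree_smul_le c p).trans hp,
      fun x hx => by simp [hpe x hx, MvPolynomial.smul_eval]⟩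

/-- The finite element space `S_h ⊆ H¹₀(Ω)` of degree `r` on the triangulation `𝒯`. -/
def Sh (Ω : Set (Sp N)) (𝒯 : Geometry.SimplicialComplex ℝ (Sp N)) (r : ℕ) :
    Submodule ℝ (H10 Ω) where
  carrier := {u | ∃ f ∈ feFun Ω 𝒯 r, H10.val u =ᵐ[volume.restrict Ω] f}
  zero_mem' := by
    refine ⟨0, Submodule.zero_mem _, ?_⟩
    rw [map_zero]
    exact Lp.coeFn_zero _ _ _
  add_mem' := by
    rintro u v ⟨f, hf, hfu⟩ ⟨g, hg, hgv⟩
    refine ⟨f + g, Submodule.add_mem _ hf hg, ?_⟩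
    rw [map_add]
    exact (Lp.coeFn_add _ _).trans (hfu.add hgv)
  smul_mem' := by
    rintro c u ⟨f, hf, hfu⟩
    refine ⟨c • f, Submodule.smul_mem _ c hf, ?_⟩
    rw [map_smul]
    exact (Lp.coeFn_smul _ _).trans (hfu.const_smul c)

/-- The finite element nodes in `Ω`: the points of `Ω` that have barycentric coordinates in
`r⁻¹ ℕ` with respect to some cell. -/
def nodes (Ω : Set (Sp N)) (𝒯 : Geometry.SimplicialComplex ℝ (Sp N)) (r : ℕ) : Set (Sp N) :=
  {z | z ∈ Ω ∧ ∃ s ∈ cells 𝒯, ∃ m : Sp N → ℕ, ∑ v ∈ s, m v = r ∧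
    z = ∑ v ∈ s, ((m v : ℝ) / r) • v}

/-- The nodal basis function `Φ_z`. -/
def nodalBasis (Ω : Set (Sp N)) (𝒯 : Geometry.SimplicialComplex ℝ (Sp N)) (r : ℕ) (z : Sp N) :
    Sp N → ℝ :=
  Classical.epsilon fun Φ => Φ ∈ feFun Ω 𝒯 r ∧ Φ z = 1 ∧ ∀ y ∈ nodes Ω 𝒯 r, y ≠ z → Φ y = 0

/-- The patch of a node: the union of the closed cells that contain it. -/
def patch (𝒯 : Geometry.SimplicialComplex ℝ (Sp N)) (z : Sp N) : Set (Sp N) :=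
  ⋃ s ∈ {s ∈ cells 𝒯 | z ∈ convexHull ℝ (s : Set (Sp N))}, convexHull ℝ (s : Set (Sp N))

/-- The `L²` projection of `v` onto the restrictions to the patch of `z` of the finite element
functions (given by some finite element function with this restriction). -/
def localProj (Ω : Set (Sp N)) (𝒯 : Geometry.SimplicialComplex ℝ (Sp N)) (r : ℕ) (z : Sp N)
    (v : Sp N → ℝ) : Sp N → ℝ :=
  Classical.epsilon fun p => p ∈ feFun Ω 𝒯 r ∧
    ∀ χ ∈ feFun Ω 𝒯 r, ∫ x in patch 𝒯 z ∩ Ω, (v x - p x) * χ x = 0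

open Classical in
/-- The class in `L²(Ω)` of a square integrable function. -/
def toL2 (Ω : Set (Sp N)) (f : Sp N → ℝ) : L2 Ω :=
  if hf : MemLp f 2 (volume.restrict Ω) then hf.toLp f else 0

/-- The Clément type operator `I_h v = ∑_z (P_z v)(z) Φ_z`, where `z` runs through the nodes in `Ω`
and `P_z` is the local `L²` projection on the patch of `z`. -/
def Ih (Ω : Set (Sp N)) (𝒯 : Geometry.SimplicialComplex ℝ (Sp N)) (r : ℕ) (v : L2 Ω) : L2 Ω :=
  toL2 Ω fun x => ∑ᶠ z ∈ nodes Ω 𝒯 r, localProj Ω 𝒯 r z v z * nodalBasis Ω 𝒯 r z x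

/-! ### The dyadic decomposition -/

/-- `d_j = 2^{-j}`. -/
def dy (j : ℤ) : ℝ := (2 : ℝ) ^ (-j)

/-- The space-time cylinder `(0,1) × Ω`. -/
def cyl (Ω : Set (Sp N)) : Set (ℝ × Sp N) := Ioo 0 1 ×ˢ Ω

/-- `max(|x - x₀|, t^{1/2})`. -/
def pDist (x₀ : Sp N) (p : ℝ × Sp N) : ℝ := max ‖p.2 - x₀‖ (Real.sqrt p.1)

/-- The annuli that are `Q_j` for `j ≥ 1`. -/
def QAnn (Ω : Set (Sp N)) (x₀ : Sp N) (j : ℤ) : Set (ℝ × Sp N) :=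
  {p ∈ cyl Ω | dy j ≤ pDist x₀ p ∧ pDist x₀ p ≤ 2 * dy j}

/-- The annuli that are `Ω_j` for `j ≥ 1`. -/
def OmAnn (Ω : Set (Sp N)) (x₀ : Sp N) (j : ℤ) : Set (Sp N) :=
  {x ∈ Ω | dy j ≤ ‖x - x₀‖ ∧ ‖x - x₀‖ ≤ 2 * dy j}

/-- `Q_j` for every integer `j`, where `J` is the index `J_*` of the innermost set. -/
def Qj (Ω : Set (Sp N)) (x₀ : Sp N) (J j : ℤ) : Set (ℝ × Sp N) :=
  if 1 ≤ j then QAnn Ω x₀ j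
  else if j = 0 then
    cyl Ω \ ((⋃ i ∈ Icc 1 J, QAnn Ω x₀ i) ∪ {p ∈ cyl Ω | pDist x₀ p ≤ dy J})
  else ∅

/-- `Ω_j` for every integer `j`, where `J` is the index `J_*` of the innermost set. -/
def Omj (Ω : Set (Sp N)) (x₀ : Sp N) (J j : ℤ) : Set (Sp N) :=
  if 1 ≤ j then OmAnn Ω x₀ j
  else if j = 0 then
    Ω \ ((⋃ i ∈ Icc 1 J, OmAnn Ω x₀ i) ∪ {x ∈ Ω | ‖x - x₀‖ ≤ dy J})
  else ∅

/-- `Q_j'`. -/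
def Qj' (Ω : Set (Sp N)) (x₀ : Sp N) (J j : ℤ) : Set (ℝ × Sp N) :=
  Qj Ω x₀ J (j - 1) ∪ Qj Ω x₀ J j ∪ Qj Ω x₀ J (j + 1)

/-- `Ω_j'`. -/
def Omj' (Ω : Set (Sp N)) (x₀ : Sp N) (J j : ℤ) : Set (Sp N) :=
  Omj Ω x₀ J (j - 1) ∪ Omj Ω x₀ J j ∪ Omj Ω x₀ J (j + 1)

/-- `Ω_j''`. -/
def Omj'' (Ω : Set (Sp N)) (x₀ : Sp N) (J j : ℤ) : Set (Sp N) :=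
  Omj Ω x₀ J (j - 2) ∪ Omj' Ω x₀ J j ∪ Omj Ω x₀ J (j + 2)

/-! ### The quantities in the estimate -/

/-- `|||∂ₜe|||_Q + d_j^{-1} |||e|||_{1,Q}`. -/
def energyNorm {Ω : Set (Sp N)} (T : ℝ) (j : ℤ) (Q : Set (ℝ × Sp N)) (e : ℝ → L2 Ω) : ℝ≥0∞ :=
  stNorm0 Q (timeDeriv T e) + ENNReal.ofReal (dy j)⁻¹ * stNorm1 Q e

/-- `I_j(w) = ‖w‖_{1,Ω_j'} + d_j^{-1} ‖w‖_{Ω_j'}`. -/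
def initTerm {Ω : Set (Sp N)} (x₀ : Sp N) (J j : ℤ) (w : L2 Ω) : ℝ≥0∞ :=
  norm1 (Omj' Ω x₀ J j) w + ENNReal.ofReal (dy j)⁻¹ * norm0 (Omj' Ω x₀ J j) w

/-- `X_j(η) = d_j |||∂ₜη|||_{1,Q_j'} + |||∂ₜη|||_{Q_j'} + d_j^{-1} |||η|||_{1,Q_j'}
  + d_j^{-2} |||η|||_{Q_j'}`. -/
def interpTerm {Ω : Set (Sp N)} (T : ℝ) (x₀ : Sp N) (J j : ℤ) (η : ℝ → L2 Ω) : ℝ≥0∞ :=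
  ENNReal.ofReal (dy j) * stNorm1 (Qj' Ω x₀ J j) (timeDeriv T η) +
    stNorm0 (Qj' Ω x₀ J j) (timeDeriv T η) +
    ENNReal.ofReal (dy j)⁻¹ * stNorm1 (Qj' Ω x₀ J j) η +
    ENNReal.ofReal ((dy j)⁻¹ ^ 2) * stNorm0 (Qj' Ω x₀ J j) η

end HeatFEM

end

/-!
Write `e = φ - φ_h`, let `η = I_h φ - φ` be the interpolation error, and `y = e + η = I_h φ - φ_h`,
which has values in `S_h`. The Galerkin relation says that
`(y', χ) + (∇y, ∇χ) = (η', χ) + (∇η, ∇χ)` for all `χ` in `S_h`. The estimate is an energy estimate for `y`, localized by cutoffs; the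
energy of `e` is recovered by the triangle inequality.

*Discrete cutoffs.* If `ω` is a Lipschitz cutoff function of slope `1/δ`, then `ω² χ` is not in
`S_h`. The test functions are its Lagrange interpolants `M χ`. On a cell, `M χ - ω(x)² χ` has a
factor `ω² - ω(x)²`, of size `h/δ`, at all the nodes, and inverse inequalities for polynomials
(`polyFun_inverse`) give the superapproximation estimates `‖M χ - ω² χ‖ ≤ C (h/δ) ‖χ‖` and
`‖∇(M χ) - ω² ∇χ‖ ≤ C δ⁻¹ ‖χ‖`, with norms over the cells that meet the support of `ω`
(`exists_superapproximation_cell`, `exists_isDiscreteCutoff`). The structure `IsDiscreteCutoff`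
keeps only these facts, so that the energy argument takes place in Hilbert spaces.

*The energy argument.* The test function `M₂ y` bounds the integral of `‖ω₂ ∇y‖²` and the terminal
value of `‖ω₂ y‖²` (`energy_first`), and the test function `M₁ y'` bounds the integral of
`‖ω₁ y'‖²` (`energy_second`). The superapproximation error of `M₁ y'` costs the factor `h/δ` in front of
the energy in the outer region, whence `(h/δ)^{1/2}` in the estimate. In `(∇η, ∇(M₁ y'))` the time
derivative is moved to `∇η`, since there is no bound for `∇y'`. The two cutoffs are nested so that
the second estimate can use the first, and Young's inequality with a small parameter yields
`energy_combined`.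

*Regularity.* The relation between `e`, `η` and `y` holds for representatives that are primitives
of their weak derivatives in time (`exists_isPrimOn_of_weakDeriv`, `exists_discretePart`); the
operator `I_h` commutes with these derivatives because it is a continuous linear map, and it is
local (`exists_Ih_clm`). Finite element functions are in `H¹₀` because they are Lipschitz and
vanish outside `Ω` (`LipschitzWith.exists_H10`). That `∂ₜη` has a finite norm with spatial
derivatives in a region gives a weak gradient for almost every time; it is measurable in time
because the weak gradient is a closed operator, whose graph is a Polish space
(`exists_aestronglyMeasurable_graph`), and it is the time derivative of `∇η`
(`exists_isPrimOn_grad`).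

*The dyadic regions.* Together these give an estimate on the sublevel sets of an arbitrary
`1`-Lipschitz function (`exists_sublevel_estimate`), with cutoffs in space that are functions of
this function and arbitrary cutoffs in time. The region `Q_j` is covered by two cylinders of size
comparable to `d_j` (`isCoveredBy_Qj`): for small times it lies over an annulus, near which `φ(0)`
vanishes, so that `y(0)` is `-φ_h(0)`; for later times it lies over a ball, and a cutoff in time
removes the initial value (`exists_dyadic_estimate`). All this requires that `h` is small compared
with `d_j`. If it is not, the factor `C (h/d_j)^{1/2}` on the right hand side is at least `1`, and
there is nothing to prove (`one_le_mul_sqrt`).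
-/


namespace HeatFEM

/-! ### Primitives and weak derivatives in time -/

section Prim

variable {X Y Z : Type*} [NormedAddCommGroup X] [NormedSpace ℝ X]
  [NormedAddCommGroup Y] [NormedSpace ℝ Y] [NormedAddCommGroup Z] [NormedSpace ℝ Z]

/-- On `[a, b]` the function `u` is the primitive `u a + ∫ₐ u'` of the integrable function `u'`;
thus `u` is absolutely continuous there with derivative `u'` almost everywhere. -/
structure IsPrimOn (a b : ℝ) (u u' : ℝ → X) : Prop where
  int : IntegrableOn u' (Ioc a b)
  eq : ∀ t ∈ Icc a b, u t = u a + ∫ s in Ioc a t, u' s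

namespace IsPrimOn

variable {a b : ℝ} {u u' : ℝ → X} {v v' : ℝ → Y}

theorem continuousOn (hu : IsPrimOn a b u u') : ContinuousOn u (Icc a b) := by
  have h1 : ContinuousOn (fun t => u a + ∫ s in Ioc a t, u' s) (Icc a b) :=
    continuousOn_const.add
      (intervalIntegral.continuousOn_primitive
        ((integrableOn_Icc_iff_integrableOn_Ioc).2 hu.int))
  exact h1.congr hu.eq

theorem bounded (hu : IsPrimOn a b u u') : ∃ C, ∀ t ∈ Icc a b, ‖u t‖ ≤ C :=
  isCompact_Icc.exists_bound_of_continuousOn hu.continuousOn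

theorem aestronglyMeasurable (hu : IsPrimOn a b u u') :
    AEStronglyMeasurable u (volume.restrict (Ioc a b)) :=
  (hu.continuousOn.mono Ioc_subset_Icc_self).aestronglyMeasurable measurableSet_Ioc

theorem const (a b : ℝ) (x : X) : IsPrimOn a b (fun _ => x) (fun _ => (0 : X)) :=
  ⟨by simp [IntegrableOn], by simp⟩

theorem mono {c d : ℝ} [CompleteSpace X] (hu : IsPrimOn a b u u') (hc : a ≤ c) (hd : d ≤ b) :
    IsPrimOn c d u u' := by
  refine ⟨hu.int.mono_set (Ioc_subset_Ioc hc hd), fun t ht => ?_⟩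
  rw [hu.eq t ⟨hc.trans ht.1, ht.2.trans hd⟩, hu.eq c ⟨hc, (ht.1.trans ht.2).trans hd⟩, add_assoc]
  congr 1
  rw [← setIntegral_union (Ioc_disjoint_Ioc_of_le le_rfl) measurableSet_Ioc
    (hu.int.mono_set (Ioc_subset_Ioc_right ((ht.1.trans ht.2).trans hd)))
    (hu.int.mono_set (Ioc_subset_Ioc hc (ht.2.trans hd))),
    Ioc_union_Ioc_eq_Ioc hc ht.1]

theorem clm [CompleteSpace X] [CompleteSpace Y] (L : X →L[ℝ] Y) (hu : IsPrimOn a b u u') :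
    IsPrimOn a b (fun t => L (u t)) (fun t => L (u' t)) := by
  refine ⟨L.integrable_comp hu.int, fun t ht => ?_⟩
  rw [hu.eq t ht, map_add, L.integral_comp_comm]
  exact hu.int.mono_set (Ioc_subset_Ioc_right ht.2)

theorem add {w w' : ℝ → X} (hu : IsPrimOn a b u u') (hw : IsPrimOn a b w w') :
    IsPrimOn a b (fun t => u t + w t) (fun t => u' t + w' t) := by
  refine ⟨hu.int.add hw.int, fun t ht => ?_⟩
  rw [integral_add (hu.int.mono_set (Ioc_subset_Ioc_right ht.2))
    (hw.int.mono_set (Ioc_subset_Ioc_right ht.2)), hu.eq t ht, hw.eq t ht]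
  abel

theorem neg (hu : IsPrimOn a b u u') : IsPrimOn a b (fun t => - u t) (fun t => - u' t) := by
  refine ⟨hu.int.neg, fun t ht => ?_⟩
  rw [integral_neg, hu.eq t ht]
  abel

theorem sub {w w' : ℝ → X} (hu : IsPrimOn a b u u') (hw : IsPrimOn a b w w') :
    IsPrimOn a b (fun t => u t - w t) (fun t => u' t - w' t) := by
  simpa [sub_eq_add_neg] using hu.add hw.neg

theorem of_hasDerivAt {f f' : ℝ → ℝ} (hf : ∀ t, HasDerivAt f (f' t) t) (hf' : Continuous f') :
    IsPrimOn a b f f' := by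
  refine ⟨(hf'.integrableOn_Icc).mono_set Ioc_subset_Icc_self, fun t ht => ?_⟩
  rw [← intervalIntegral.integral_of_le ht.1,
    intervalIntegral.integral_eq_sub_of_hasDerivAt (fun s _ => hf s)
      (hf'.intervalIntegrable _ _)]
  ring

theorem integral_eq_sub [CompleteSpace X] (hu : IsPrimOn a b u u') {s t : ℝ} (hs : s ∈ Icc a b)
    (ht : t ∈ Icc a b) (hst : s ≤ t) : ∫ r in Ioc s t, u' r = u t - u s := by
  rw [(hu.mono hs.1 le_rfl).eq t ⟨hst, ht.2⟩]
  abel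

theorem integrable_left (B : X →L[ℝ] Y →L[ℝ] Z) (hu : IsPrimOn a b u u')
    {w : ℝ → Y} (hw : IntegrableOn w (Ioc a b)) :
    IntegrableOn (fun t => B (u t) (w t)) (Ioc a b) := by
  obtain ⟨C, hC⟩ := hu.bounded
  refine Integrable.mono' (g := fun t => ‖B‖ * C * ‖w t‖) (hw.norm.const_mul _)
    (B.aestronglyMeasurable_comp₂ hu.aestronglyMeasurable hw.aestronglyMeasurable) ?_
  filter_upwards [ae_restrict_mem measurableSet_Ioc] with t ht
  refine (B.le_opNorm₂ _ _).trans ?_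
  gcongr
  exact hC t (Ioc_subset_Icc_self ht)

/-- The product rule for a continuous bilinear map. By Fubini's theorem both sides are the
integral of `B (u' s) (v' r)` over a square, cut into two triangles by its diagonal. -/
theorem bilin [CompleteSpace X] [CompleteSpace Y] [CompleteSpace Z] (B : X →L[ℝ] Y →L[ℝ] Z)
    (hu : IsPrimOn a b u u') (hv : IsPrimOn a b v v') :
    IsPrimOn a b (fun t => B (u t) (v t)) (fun t => B (u' t) (v t) + B (u t) (v' t)) := by
  have I1 : IntegrableOn (fun t => B (u t) (v' t)) (Ioc a b) := hu.integrable_left B hv.int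
  have I2 : IntegrableOn (fun t => B (u' t) (v t)) (Ioc a b) :=
    hv.integrable_left B.flip hu.int
  refine ⟨I2.add I1, fun t ht => ?_⟩
  set μ : Measure ℝ := volume.restrict (Ioc a t) with hμ
  have hsub : Ioc a t ⊆ Ioc a b := Ioc_subset_Ioc_right ht.2
  have hu' : Integrable u' μ := hu.int.mono_set hsub
  have hv' : Integrable v' μ := hv.int.mono_set hsub
  have hF : Integrable (fun z : ℝ × ℝ => B (u' z.1) (v' z.2)) (μ.prod μ) := by
    refine hu'.op_fst_snd (op := fun x y => B x y) (by fun_prop)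
      ⟨‖B‖, fun x y => B.le_opNorm₂ x y⟩ hv'
  have hS : MeasurableSet {z : ℝ × ℝ | z.2 ≤ z.1} := measurableSet_le measurable_snd measurable_fst
  -- the slices of the triangle `r ≤ s`
  have hc1 : ∀ s ∈ Ioc a t, B (u' s) (v s) = B (u' s) (v a) +
      ∫ r, {z : ℝ × ℝ | z.2 ≤ z.1}.indicator (fun z => B (u' z.1) (v' z.2)) (s, r) ∂μ := by
    intro s hs
    rw [hv.eq s ⟨hs.1.le, hs.2.trans ht.2⟩, map_add, ← ContinuousLinearMap.integral_comp_comm _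
      (hv.int.mono_set (Ioc_subset_Ioc_right (hs.2.trans ht.2)))]
    congr 1
    rw [hμ, ← integral_indicator measurableSet_Ioc, ← integral_indicator measurableSet_Ioc]
    refine integral_congr_ae (Eventually.of_forall fun r => ?_)
    simp only [indicator, mem_Ioc, mem_ofPred_eq]
    grind
  -- the slices of the complementary triangle `s < r`
  have hc2 : ∀ r ∈ Ioc a t, B (u r) (v' r) = B (u a) (v' r) +
      ∫ s, {z : ℝ × ℝ | z.2 ≤ z.1}ᶜ.indicator (fun z => B (u' z.1) (v' z.2)) (s, r) ∂μ := by
    intro r hr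
    have h1 : B (∫ s in Ioo a r, u' s) (v' r) = ∫ s in Ioo a r, B (u' s) (v' r) :=
      ((B.flip (v' r)).integral_comp_comm
        ((hu.int.mono_set (Ioc_subset_Ioc_right (hr.2.trans ht.2))).mono_set
          Ioo_subset_Ioc_self)).symm
    rw [hu.eq r ⟨hr.1.le, hr.2.trans ht.2⟩, map_add, add_apply,
      integral_Ioc_eq_integral_Ioo, h1]
    congr 1
    rw [hμ, ← integral_indicator measurableSet_Ioo, ← integral_indicator measurableSet_Ioc]
    refine integral_congr_ae (Eventually.of_forall fun s => ?_)
    simp only [indicator, mem_Ioc, mem_Ioo, mem_ofPred_eq, mem_compl_iff]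
    grind
  have J1 := (hF.indicator hS).integral_prod_left
  have J2 := (hF.indicator hS.compl).integral_prod_right
  have e1 : ∫ s, B (u' s) (v s) ∂μ = B (∫ s, u' s ∂μ) (v a) +
      ∫ z, {z : ℝ × ℝ | z.2 ≤ z.1}.indicator (fun z => B (u' z.1) (v' z.2)) z ∂(μ.prod μ) := by
    rw [integral_prod _ (hF.indicator hS), ← ContinuousLinearMap.flip_apply,
      ← ContinuousLinearMap.integral_comp_comm _ hu', ← integral_add
        (ContinuousLinearMap.integrable_comp _ hu') J1]
    exact setIntegral_congr_fun measurableSet_Ioc hc1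
  have e2 : ∫ s, B (u s) (v' s) ∂μ = B (u a) (∫ s, v' s ∂μ) +
      ∫ z, {z : ℝ × ℝ | z.2 ≤ z.1}ᶜ.indicator (fun z => B (u' z.1) (v' z.2)) z ∂(μ.prod μ) := by
    rw [integral_prod_symm _ (hF.indicator hS.compl),
      ← ContinuousLinearMap.integral_comp_comm _ hv', ← integral_add
        (ContinuousLinearMap.integrable_comp _ hv') J2]
    exact setIntegral_congr_fun measurableSet_Ioc hc2
  have e3 : ∫ z, {z : ℝ × ℝ | z.2 ≤ z.1}.indicator (fun z => B (u' z.1) (v' z.2)) z ∂(μ.prod μ) +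
      ∫ z, {z : ℝ × ℝ | z.2 ≤ z.1}ᶜ.indicator (fun z => B (u' z.1) (v' z.2)) z ∂(μ.prod μ) =
      B (∫ s, u' s ∂μ) (∫ s, v' s ∂μ) := by
    rw [integral_indicator hS, integral_indicator hS.compl, integral_add_compl hS hF,
      integral_prod _ hF, ← ContinuousLinearMap.flip_apply,
      ← ContinuousLinearMap.integral_comp_comm _ hu']
    refine integral_congr_ae (Eventually.of_forall fun s => ?_)
    simp only [ContinuousLinearMap.flip_apply]
    exact ContinuousLinearMap.integral_comp_comm _ hv'
  rw [integral_add (I2.mono_set hsub) (I1.mono_set hsub), e1, e2, hu.eq t ht, hv.eq t ht]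
  simp only [map_add, add_apply]
  rw [← e3]
  abel

end IsPrimOn

end Prim

end HeatFEM

namespace HeatFEM

set_option linter.unusedSectionVars false

/-! ### Functions with weak derivative in time -/

section WeakTime

variable {X Y : Type*} [NormedAddCommGroup X] [NormedSpace ℝ X] [CompleteSpace X]
  [NormedAddCommGroup Y] [NormedSpace ℝ Y] [CompleteSpace Y]

theorem exists_Icc_of_tsupport {a b : ℝ} (hab : a < b) {K : Set ℝ} (hK : IsCompact K)
    (hKs : K ⊆ Ioo a b) : ∃ c d, a < c ∧ c ≤ d ∧ d < b ∧ K ⊆ Icc c d := by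
  rcases K.eq_empty_or_nonempty with rfl | hne
  · exact ⟨(a + b) / 2, (a + b) / 2, by linarith, le_rfl, by linarith, by simp⟩
  · have h1 := hKs (hK.sInf_mem hne)
    have h2 := hKs (hK.sSup_mem hne)
    exact ⟨sInf K, sSup K, h1.1, csInf_le_csSup hne hK.bddBelow hK.bddAbove, h2.2,
      fun x hx => ⟨csInf_le hK.bddBelow hx, le_csSup hK.bddAbove hx⟩⟩

/-- A test function with vanishing integral is the derivative of a test function. -/
theorem exists_test_primitive {a b : ℝ} (hab : a < b) {θ : ℝ → ℝ} (hθ : ContDiff ℝ ∞ θ)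
    (hc : HasCompactSupport θ) (hs : tsupport θ ⊆ Ioo a b) (h0 : ∫ t in Ioo a b, θ t = 0) :
    ∃ η : ℝ → ℝ, ContDiff ℝ ∞ η ∧ HasCompactSupport η ∧ tsupport η ⊆ Ioo a b ∧ deriv η = θ := by
  obtain ⟨c, d, hac, hcd, hdb, hsub⟩ := exists_Icc_of_tsupport hab hc hs
  have hz : ∀ t, t ∉ Icc c d → θ t = 0 := fun t ht =>
    image_eq_zero_of_notMem_tsupport fun h => ht (hsub h)
  have hd : ∀ t, HasDerivAt (fun t => ∫ s in a..t, θ s) (θ t) t := fun t =>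
    intervalIntegral.integral_hasDerivAt_right (hθ.continuous.intervalIntegrable _ _)
      (hθ.continuous.stronglyMeasurableAtFilter _ _) hθ.continuous.continuousAt
  have hder : deriv (fun t => ∫ s in a..t, θ s) = θ := funext fun t => (hd t).deriv
  have hsupp : Function.support (fun t => ∫ s in a..t, θ s) ⊆ Icc c d := by
    intro t ht
    by_contra hn
    apply ht
    rcases lt_or_ge t c with h | h
    · simp only
      rw [intervalIntegral.integral_congr (g := fun _ => (0 : ℝ)), intervalIntegral.integral_zero]
      intro s hs
      refine hz s fun hs' => ?_
      have := hs.2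
      have h3 := hs'.1
      rcases le_max_iff.1 this with h4 | h4 <;> linarith
    · have h : d < t := by
        by_contra h'
        exact hn ⟨h, not_lt.1 h'⟩
      -- to the right of the support the primitive is the total integral of `θ`
      have e1 : ∫ s in a..t, θ s = ∫ s in a..b, θ s := by
        rw [← intervalIntegral.integral_add_adjacent_intervals
          (hθ.continuous.intervalIntegrable a t) (hθ.continuous.intervalIntegrable t b),
          left_eq_add, intervalIntegral.integral_congr (g := fun _ => (0 : ℝ)),
          intervalIntegral.integral_zero]
        intro s hs
        refine hz s fun hs' => ?_
        have := hs.1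
        have h3 := hs'.2
        rcases min_le_iff.1 this with h4 | h4 <;> linarith
      simp only
      rw [e1, intervalIntegral.integral_of_le hab.le, integral_Ioc_eq_integral_Ioo, h0]
  have hts : tsupport (fun t => ∫ s in a..t, θ s) ⊆ Icc c d := closure_minimal hsupp isClosed_Icc
  refine ⟨fun t => ∫ s in a..t, θ s, ?_, ?_, hts.trans (Icc_subset_Ioo hac hdb), hder⟩
  · rw [contDiff_infty_iff_deriv, hder]
    exact ⟨fun t => (hd t).differentiableAt, hθ⟩
  · exact HasCompactSupport.of_support_subset_isCompact isCompact_Icc hsupp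

theorem exists_bump_Ioo {a b : ℝ} (hab : a < b) :
    ∃ ψ : ℝ → ℝ, ContDiff ℝ ∞ ψ ∧ HasCompactSupport ψ ∧ tsupport ψ ⊆ Ioo a b ∧
      ∫ t in Ioo a b, ψ t = 1 := by
  let f : ContDiffBump ((a + b) / 2) := ⟨(b - a) / 8, (b - a) / 4, by linarith, by linarith⟩
  have hs : tsupport (f.normed volume) ⊆ Ioo a b := by
    rw [f.tsupport_normed_eq]
    intro t ht
    rw [Metric.mem_closedBall, Real.dist_eq, abs_le] at ht
    have : f.rOut = (b - a) / 4 := rfl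
    constructor <;> linarith [ht.1, ht.2]
  refine ⟨f.normed volume, f.contDiff_normed, f.hasCompactSupport_normed, hs, ?_⟩
  rw [setIntegral_eq_integral_of_forall_compl_eq_zero, f.integral_normed]
  exact fun t ht => image_eq_zero_of_notMem_tsupport fun h => ht (hs h)

/-- The lemma of du Bois-Reymond: a function with vanishing weak derivative is constant. -/
theorem ae_eq_const_of_weakDeriv_eq_zero {a b : ℝ} (hab : a < b) {f : ℝ → X}
    (hf : IntegrableOn f (Ioo a b))
    (h : ∀ η : ℝ → ℝ, ContDiff ℝ ∞ η → HasCompactSupport η → tsupport η ⊆ Ioo a b →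
      ∫ t in Ioo a b, deriv η t • f t = 0) :
    ∃ c, ∀ᵐ t ∂(volume.restrict (Ioo a b)), f t = c := by
  obtain ⟨ψ₀, h1, h2, h3, h4⟩ := exists_bump_Ioo hab
  have hint : ∀ g : ℝ → ℝ, ContDiff ℝ ∞ g → HasCompactSupport g →
      ∀ w : ℝ → X, IntegrableOn w (Ioo a b) → IntegrableOn (fun t => g t • w t) (Ioo a b) := by
    intro g hg hgc w hw
    obtain ⟨C, hC⟩ := hgc.exists_bound_of_continuous hg.continuous
    exact Integrable.bdd_smul hw _ hg.continuous.aestronglyMeasurable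
      (Eventually.of_forall hC)
  have hgi : ∀ g : ℝ → ℝ, ContDiff ℝ ∞ g → IntegrableOn g (Ioo a b) := fun g hg =>
    (hg.continuous.integrableOn_Icc).mono_set Ioo_subset_Icc_self
  set c := ∫ t in Ioo a b, ψ₀ t • f t with hc
  refine ⟨c, ?_⟩
  have hfc : IntegrableOn (fun t => f t - c) (Ioo a b) := hf.sub (by simp [IntegrableOn])
  have key := isOpen_Ioo.ae_eq_zero_of_integral_contDiff_smul_eq_zero (μ := volume)
    (f := fun t => f t - c) hfc.locallyIntegrableOn ?_
  · filter_upwards [ae_restrict_of_ae key, ae_restrict_mem measurableSet_Ioo] with t ht hm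
    exact sub_eq_zero.1 (ht hm)
  intro ψ hψ hψc hψs
  rw [← setIntegral_eq_integral_of_forall_compl_eq_zero (s := Ioo a b) (fun t ht => by
    rw [image_eq_zero_of_notMem_tsupport fun h => ht (hψs h), zero_smul])]
  set m := ∫ t in Ioo a b, ψ t with hm
  -- `ψ - m ψ₀` has vanishing integral, hence a primitive that is a test function
  obtain ⟨η, e1, e2, e3, e4⟩ := exists_test_primitive hab (θ := fun t => ψ t - m * ψ₀ t)
    (hψ.sub (contDiff_const.mul h1)) (hψc.sub h2.mul_left)
    ((tsupport_sub _ _).trans (union_subset hψs ((tsupport_mul_subset_right).trans h3))) (by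
      rw [integral_sub (hgi _ hψ) ((hgi _ h1).const_mul _), integral_const_mul, h4]
      simp [hm])
  have := h η e1 e2 e3
  rw [e4] at this
  simp only [sub_smul, mul_smul] at this
  have hm0 : IntegrableOn (fun t => m • ψ₀ t • f t) (Ioo a b) := (hint _ h1 h2 _ hf).smul m
  rw [integral_sub (hint _ hψ hψc _ hf) hm0, integral_smul] at this
  simp only [smul_sub]
  rw [integral_sub (hint _ hψ hψc _ hf) (hint _ hψ hψc _ (by simp [IntegrableOn])),
    integral_smul_const, ← hm]
  exact this

/-- A function with an integrable weak derivative is almost everywhere equal to a primitive of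
this derivative. -/
theorem exists_isPrimOn_of_weakDeriv {a b : ℝ} (hab : a < b) {u u' : ℝ → X}
    (hu : IntegrableOn u (Ioo a b)) (hu' : IntegrableOn u' (Ioo a b))
    (h : ∀ η : ℝ → ℝ, ContDiff ℝ ∞ η → HasCompactSupport η → tsupport η ⊆ Ioo a b →
      ∫ t in Ioo a b, deriv η t • u t = - ∫ t in Ioo a b, η t • u' t) :
    ∃ w, IsPrimOn a b w u' ∧ w =ᵐ[volume.restrict (Ioo a b)] u := by
  have hu'c : IntegrableOn u' (Ioc a b) := (integrableOn_Ioc_iff_integrableOn_Ioo).2 hu'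
  have hW : IsPrimOn a b (fun t => ∫ s in Ioc a t, u' s) u' := ⟨hu'c, by simp⟩
  have hWi : IntegrableOn (fun t => ∫ s in Ioc a t, u' s) (Ioo a b) :=
    (hW.continuousOn.integrableOn_Icc).mono_set Ioo_subset_Icc_self
  obtain ⟨c, hc⟩ := ae_eq_const_of_weakDeriv_eq_zero hab (hu.sub hWi) (by
    intro η h1 h2 h3
    have hη : IsPrimOn a b η (deriv η) := IsPrimOn.of_hasDerivAt
      (fun t => ((h1.differentiable (by simp)) t).hasDerivAt) (h1.continuous_deriv (by simp))
    have hd : ∀ w : ℝ → X, IntegrableOn w (Ioo a b) →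
        IntegrableOn (fun t => deriv η t • w t) (Ioo a b) := by
      intro w hw
      obtain ⟨C, hC⟩ := (h2.deriv).exists_bound_of_continuous (h1.continuous_deriv (by simp))
      exact Integrable.bdd_smul hw _ (h1.continuous_deriv (by simp)).aestronglyMeasurable
        (Eventually.of_forall hC)
    -- integration by parts for the primitive of `u'`
    have hp := (hη.bilin (ContinuousLinearMap.lsmul ℝ ℝ) hW).eq b ⟨hab.le, le_rfl⟩
    have h0 : ∀ t, t ∉ Ioo a b → η t = 0 := fun t ht =>
      image_eq_zero_of_notMem_tsupport fun h => ht (h3 h)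
    simp only [ContinuousLinearMap.lsmul_apply, h0 b (by simp), h0 a (by simp), zero_smul,
      zero_add] at hp
    have hηu : IntegrableOn (fun t => η t • u' t) (Ioo a b) :=
      (hη.integrable_left (ContinuousLinearMap.lsmul ℝ ℝ) hu'c).mono_set Ioo_subset_Ioc_self
    rw [integral_Ioc_eq_integral_Ioo, integral_add (hd _ hWi) hηu] at hp
    simp only [Pi.sub_apply, smul_sub]
    rw [integral_sub (hd _ hu) (hd _ hWi), h η h1 h2 h3, sub_eq_zero]
    have := eq_neg_of_add_eq_zero_left hp.symm
    rw [this])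
  refine ⟨fun t => c + ∫ s in Ioc a t, u' s, ⟨hu'c, by simp⟩, ?_⟩
  filter_upwards [hc] with t ht
  rw [← ht]
  simp

theorem MemL2Time.integrableOn {T : ℝ} {u : ℝ → X} (hu : MemL2Time T u) :
    IntegrableOn u (Ioo 0 T) :=
  MemLp.integrable (by norm_num) hu

theorem IsTimeDeriv.exists_isPrimOn {T : ℝ} (hT : 0 < T) {u u' : ℝ → X} (hu : MemL2Time T u)
    (h : IsTimeDeriv T u u') :
    ∃ w, IsPrimOn 0 T w u' ∧ w =ᵐ[volume.restrict (Ioo 0 T)] u :=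
  exists_isPrimOn_of_weakDeriv hT hu.integrableOn h.1.integrableOn h.2

theorem IsTimeDeriv.unique {T : ℝ} {u u' u'' : ℝ → X}
    (h : IsTimeDeriv T u u') (h' : IsTimeDeriv T u u'') :
    u' =ᵐ[volume.restrict (Ioo 0 T)] u'' := by
  have hint : IntegrableOn (fun t => u' t - u'' t) (Ioo 0 T) :=
    h.1.integrableOn.sub h'.1.integrableOn
  have key := isOpen_Ioo.ae_eq_zero_of_integral_contDiff_smul_eq_zero (μ := volume)
    (f := fun t => u' t - u'' t) hint.locallyIntegrableOn ?_
  · filter_upwards [ae_restrict_of_ae key, ae_restrict_mem measurableSet_Ioo] with t ht hm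
    exact sub_eq_zero.1 (ht hm)
  intro ψ hψ hψc hψs
  have hi : ∀ w : ℝ → X, IntegrableOn w (Ioo 0 T) →
      IntegrableOn (fun t => ψ t • w t) (Ioo 0 T) := by
    intro w hw
    obtain ⟨C, hC⟩ := hψc.exists_bound_of_continuous hψ.continuous
    exact Integrable.bdd_smul hw _ hψ.continuous.aestronglyMeasurable
      (Eventually.of_forall hC)
  rw [← setIntegral_eq_integral_of_forall_compl_eq_zero (s := Ioo 0 T) (fun t ht => by
    rw [image_eq_zero_of_notMem_tsupport fun h => ht (hψs h), zero_smul])]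
  simp only [smul_sub]
  rw [integral_sub (hi _ h.1.integrableOn) (hi _ h'.1.integrableOn), sub_eq_zero, ← neg_inj,
    ← h.2 ψ hψ hψc hψs, ← h'.2 ψ hψ hψc hψs]

theorem MemH1Time.isTimeDeriv {T : ℝ} {u : ℝ → X} (h : MemH1Time T u) :
    IsTimeDeriv T u (timeDeriv T u) :=
  Classical.epsilon_spec h.2

theorem IsTimeDeriv.timeDeriv_ae {T : ℝ} {u u' : ℝ → X} (h : IsTimeDeriv T u u') :
    timeDeriv T u =ᵐ[volume.restrict (Ioo 0 T)] u' :=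
  IsTimeDeriv.unique (Classical.epsilon_spec (p := fun u' => IsTimeDeriv T u u') ⟨u', h⟩) h

theorem MemL2Time.clm {T : ℝ} (L : X →L[ℝ] Y) {u : ℝ → X} (hu : MemL2Time T u) :
    MemL2Time T (fun t => L (u t)) :=
  L.comp_memLp' hu

theorem test_smul_integrable {a b : ℝ} {η : ℝ → ℝ} (hη : Continuous η) (hc : HasCompactSupport η)
    {w : ℝ → X} (hw : IntegrableOn w (Ioo a b)) : IntegrableOn (fun t => η t • w t) (Ioo a b) := by
  obtain ⟨C, hC⟩ := hc.exists_bound_of_continuous hη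
  exact Integrable.bdd_smul hw _ hη.aestronglyMeasurable (Eventually.of_forall hC)

theorem IsTimeDeriv.clm {T : ℝ} (L : X →L[ℝ] Y) {u u' : ℝ → X} (hu : MemL2Time T u)
    (h : IsTimeDeriv T u u') : IsTimeDeriv T (fun t => L (u t)) (fun t => L (u' t)) := by
  refine ⟨h.1.clm L, fun η h1 h2 h3 => ?_⟩
  simp only [← map_smul]
  rw [L.integral_comp_comm (test_smul_integrable (h1.continuous_deriv (by simp)) h2.deriv
    hu.integrableOn), L.integral_comp_comm (test_smul_integrable h1.continuous h2
    h.1.integrableOn), h.2 η h1 h2 h3, map_neg]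

theorem IsTimeDeriv.sub {T : ℝ} {u u' v v' : ℝ → X} (hu : MemL2Time T u) (hv : MemL2Time T v)
    (h : IsTimeDeriv T u u') (h' : IsTimeDeriv T v v') :
    IsTimeDeriv T (fun t => u t - v t) (fun t => u' t - v' t) := by
  refine ⟨h.1.sub h'.1, fun η h1 h2 h3 => ?_⟩
  have hc := h1.continuous_deriv (n := ∞) (by simp)
  simp only [smul_sub]
  rw [integral_sub (test_smul_integrable hc h2.deriv hu.integrableOn)
      (test_smul_integrable hc h2.deriv hv.integrableOn),
    integral_sub (test_smul_integrable h1.continuous h2 h.1.integrableOn)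
      (test_smul_integrable h1.continuous h2 h'.1.integrableOn),
    h.2 η h1 h2 h3, h'.2 η h1 h2 h3]
  abel

theorem initialValue_eq {T : ℝ} (hT : 0 < T) {u w : ℝ → X} (hw : ContinuousOn w (Icc 0 T))
    (h : w =ᵐ[volume.restrict (Ioo 0 T)] u) : initialValue T u = w 0 := by
  obtain ⟨v, h1, h2, h3⟩ := Classical.epsilon_spec (p := fun u₀ =>
    ∃ v : ℝ → X, ContinuousOn v (Icc 0 T) ∧ v =ᵐ[volume.restrict (Ioo 0 T)] u ∧ v 0 = u₀)
    ⟨w 0, w, hw, h, rfl⟩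
  have : v =ᵐ[volume.restrict (Icc 0 T)] w := by
    rw [← Measure.restrict_congr_set Ioo_ae_eq_Icc]
    exact h2.trans h.symm
  have := Measure.eqOn_Icc_of_ae_eq volume hT.ne this h1 hw ⟨le_rfl, hT.le⟩
  rw [← this, h3]
  rfl

end WeakTime

end HeatFEM

namespace HeatFEM

/-! ### The energy argument in Hilbert space -/

set_option linter.unusedSectionVars false

section Energy

variable {X H G : Type*} [NormedAddCommGroup X] [NormedSpace ℝ X] [CompleteSpace X]
  [NormedAddCommGroup H] [InnerProductSpace ℝ H] [CompleteSpace H]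
  [NormedAddCommGroup G] [InnerProductSpace ℝ G] [CompleteSpace G]

/-- An abstract discrete cutoff. In the application `v χ` and `g χ` are a finite element function
and its gradient, `m` and `n` are the multiplication by a cutoff function `ω` on functions and on
vector fields, `M χ` is the finite element interpolant of `ω² χ`, and `P`, `R` are the
multiplication by a function that is `1` on every cell that meets the support of `ω`. The last two
fields are the superapproximation estimates. -/
structure IsDiscreteCutoff (v : X →L[ℝ] H) (g : X →L[ℝ] G) (M : X →L[ℝ] X) (m P : H →L[ℝ] H)
    (n R : G →L[ℝ] G) (c h δ : ℝ) : Prop where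
  symm_m : ∀ a b, inner ℝ (m a) b = inner ℝ a (m b)
  symm_n : ∀ a b, inner ℝ (n a) b = inner ℝ a (n b)
  symm_P : ∀ a b, inner ℝ (P a) b = inner ℝ a (P b)
  symm_R : ∀ a b, inner ℝ (R a) b = inner ℝ a (R b)
  m_contr : ∀ a, ‖m a‖ ≤ ‖a‖
  n_contr : ∀ a, ‖n a‖ ≤ ‖a‖
  m_le : ∀ a, ‖m a‖ ≤ ‖P a‖
  n_le : ∀ a, ‖n a‖ ≤ ‖R a‖
  loc_v : ∀ χ, P (v (M χ) - m (m (v χ))) = v (M χ) - m (m (v χ))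
  loc_g : ∀ χ, R (g (M χ) - n (n (g χ))) = g (M χ) - n (n (g χ))
  est_v : ∀ χ, ‖v (M χ) - m (m (v χ))‖ ≤ c * (h / δ) * ‖P (v χ)‖
  est_g : ∀ χ, ‖g (M χ) - n (n (g χ))‖ ≤ c * δ⁻¹ * ‖P (v χ)‖

namespace IsDiscreteCutoff

variable {v : X →L[ℝ] H} {g : X →L[ℝ] G} {M : X →L[ℝ] X} {m P : H →L[ℝ] H}
    {n R : G →L[ℝ] G} {c h δ : ℝ}

theorem norm_g_le (hM : IsDiscreteCutoff v g M m P n R c h δ) (χ : X) :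
    ‖g (M χ)‖ ≤ ‖n (g χ)‖ + c * δ⁻¹ * ‖P (v χ)‖ := by
  have h1 : g (M χ) = n (n (g χ)) + (g (M χ) - n (n (g χ))) := by abel
  rw [h1]
  exact (norm_add_le _ _).trans (add_le_add (hM.n_contr _) (hM.est_g χ))

theorem norm_v_le (hM : IsDiscreteCutoff v g M m P n R c h δ) (hc : 0 ≤ c) (hδ : 0 < δ)
    (hh : h ≤ δ) (χ : X) : ‖v (M χ)‖ ≤ (1 + c) * ‖P (v χ)‖ := by
  have h1 : v (M χ) = m (m (v χ)) + (v (M χ) - m (m (v χ))) := by abel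
  have h2 : h / δ ≤ 1 := (div_le_one hδ).2 hh
  have h3 := hM.est_v χ
  have h4 := (hM.m_contr (m (v χ))).trans (hM.m_le (v χ))
  have h5 : c * (h / δ) * ‖P (v χ)‖ ≤ c * 1 * ‖P (v χ)‖ := by gcongr
  rw [h1]
  refine (norm_add_le _ _).trans ?_
  linarith

theorem inner_v (hM : IsDiscreteCutoff v g M m P n R c h δ) (a : H) (χ : X) :
    |inner ℝ a (v (M χ)) - inner ℝ (m a) (m (v χ))| ≤ ‖P a‖ * (c * (h / δ) * ‖P (v χ)‖) := by
  rw [hM.symm_m, ← inner_sub_right, ← hM.loc_v, ← hM.symm_P]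
  exact (abs_real_inner_le_norm _ _).trans (by gcongr; exact hM.est_v χ)

theorem inner_g (hM : IsDiscreteCutoff v g M m P n R c h δ) (a : G) (χ : X) :
    |inner ℝ a (g (M χ)) - inner ℝ (n a) (n (g χ))| ≤ ‖R a‖ * (c * δ⁻¹ * ‖P (v χ)‖) := by
  rw [hM.symm_n, ← inner_sub_right, ← hM.loc_g, ← hM.symm_R]
  exact (abs_real_inner_le_norm _ _).trans (by gcongr; exact hM.est_g χ)

end IsDiscreteCutoff

theorem young_mul (x y : ℝ) {s : ℝ} (hs : 0 < s) : x * y ≤ s ^ 2 * x ^ 2 + s⁻¹ ^ 2 * y ^ 2 / 4 := by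
  have h1 : s * s⁻¹ = 1 := mul_inv_cancel₀ hs.ne'
  have h2 : (s * x - s⁻¹ * y / 2) ^ 2 =
      s ^ 2 * x ^ 2 - s * s⁻¹ * (x * y) + s⁻¹ ^ 2 * y ^ 2 / 4 := by
    ring
  have h3 := sq_nonneg (s * x - s⁻¹ * y / 2)
  rw [h2, h1] at h3
  linarith

/-- The energy inequality at a fixed time, from the test function `M y`. -/
theorem energy_pointwise {v : X →L[ℝ] H} {g : X →L[ℝ] G} {M : X →L[ℝ] X} {m P : H →L[ℝ] H}
    {n R : G →L[ℝ] G} {c h δ : ℝ} (hM : IsDiscreteCutoff v g M m P n R c h δ) (hc : 0 ≤ c)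
    (hδ : 0 < δ) (h0 : 0 ≤ h) (hh : h ≤ δ) {κ : ℝ} (hκ : 0 < κ) (hκ1 : κ ≤ 1)
    {y y' : X} {p : H} {q : G}
    (heq : inner ℝ (v y') (v (M y)) + inner ℝ (g y) (g (M y)) =
      inner ℝ p (v (M y)) + inner ℝ q (g (M y))) :
    δ⁻¹ ^ 2 * inner ℝ (m (v y')) (m (v y)) + δ⁻¹ ^ 2 * ‖n (g y)‖ ^ 2 / 2 ≤
      κ ^ 2 * (‖P (v y')‖ ^ 2 + δ⁻¹ ^ 2 * ‖R (g y)‖ ^ 2) +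
      2 * (1 + c) ^ 2 * (κ⁻¹ ^ 2 * (δ⁻¹ ^ 4 * ‖P (v y)‖ ^ 2) + ‖p‖ ^ 2 + δ⁻¹ ^ 2 * ‖q‖ ^ 2) := by
  have a1 := (abs_le.1 (hM.inner_v (v y') y)).1
  have a2 := (abs_le.1 (hM.inner_g (g y) y)).1
  have a3 := (real_inner_le_norm p (v (M y))).trans
    (mul_le_mul_of_nonneg_left (hM.norm_v_le hc hδ hh y) (norm_nonneg p))
  have a4 := (real_inner_le_norm q (g (M y))).trans
    (mul_le_mul_of_nonneg_left (hM.norm_g_le y) (norm_nonneg q))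
  rw [real_inner_self_eq_norm_sq] at a2
  have hk : h / δ ≤ 1 := (div_le_one hδ).2 hh
  have hk0 : 0 ≤ h / δ := by positivity
  have hκi : 1 ≤ κ⁻¹ := (one_le_inv₀ hκ).2 hκ1
  set D := δ⁻¹ with hD
  have hD0 : 0 < D := inv_pos.2 hδ
  set Y := ‖P (v y)‖
  set Y' := ‖P (v y')‖
  set Z := ‖R (g y)‖
  set A := ‖n (g y)‖
  have nY : 0 ≤ Y := norm_nonneg _
  have nY' : 0 ≤ Y' := norm_nonneg _
  have nZ : 0 ≤ Z := norm_nonneg _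
  have b1 : inner ℝ (m (v y')) (m (v y)) + A ^ 2 ≤ ‖p‖ * ((1 + c) * Y) + ‖q‖ * (A + c * D * Y)
      + Z * (c * D * Y) + Y' * (c * 1 * Y) := by
    have : Y' * (c * (h / δ) * Y) ≤ Y' * (c * 1 * Y) := by gcongr
    linarith
  -- the terms with `Y'` and `Z` get the small factor `κ²`, and `A` is absorbed on the left
  have y1 := young_mul (D ^ 0 * Y') (c * D ^ 2 * Y) hκ
  have y2 := young_mul (D * Z) (c * D ^ 2 * Y) hκ
  have y3 := young_mul ‖p‖ ((1 + c) * D ^ 2 * Y) one_pos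
  have y4 := young_mul (D * A) (D * ‖q‖) (s := Real.sqrt 2⁻¹) (by positivity)
  have y5 := young_mul (D * ‖q‖) (c * D ^ 2 * Y) one_pos
  rw [inv_pow, Real.sq_sqrt (by norm_num)] at y4
  have b2 := mul_le_mul_of_nonneg_left b1 (sq_nonneg D)
  have hsq : 1 ≤ κ⁻¹ ^ 2 := one_le_pow₀ hκi
  have hW : 0 ≤ D ^ 4 * Y ^ 2 := by positivity
  have hW1 : 0 ≤ (κ⁻¹ ^ 2 - 1) * (D ^ 4 * Y ^ 2) := mul_nonneg (by linarith) hW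
  have hp2 := sq_nonneg ‖p‖
  have hq2 : 0 ≤ D ^ 2 * ‖q‖ ^ 2 := by positivity
  have hcW : 0 ≤ c * (κ⁻¹ ^ 2 * (D ^ 4 * Y ^ 2)) := by positivity
  have hccW1 : 0 ≤ (c + c ^ 2) * ((κ⁻¹ ^ 2 - 1) * (D ^ 4 * Y ^ 2)) := by positivity
  have hccW : 0 ≤ c ^ 2 * (κ⁻¹ ^ 2 * (D ^ 4 * Y ^ 2)) := by positivity
  have hcp : 0 ≤ (c + c ^ 2) * ‖p‖ ^ 2 := by positivity
  have hcq : 0 ≤ (c + c ^ 2) * (D ^ 2 * ‖q‖ ^ 2) := by positivity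
  simp only [one_pow, inv_one, pow_zero, one_mul, inv_inv] at y1 y2 y3 y4 y5
  have hp3 : 0 ≤ c * ‖p‖ ^ 2 := by positivity
  have hq3 : 0 ≤ c * (D ^ 2 * ‖q‖ ^ 2) := by positivity
  have hcW1 : 0 ≤ c * ((κ⁻¹ ^ 2 - 1) * (D ^ 4 * Y ^ 2)) := by positivity
  linarith

/-- The energy inequality at a fixed time, from the test function `M y'`. -/
theorem energy_pointwise' {v : X →L[ℝ] H} {g : X →L[ℝ] G} {M : X →L[ℝ] X} {m P P' : H →L[ℝ] H}
    {n R : G →L[ℝ] G} {c h δ : ℝ} (hM : IsDiscreteCutoff v g M m P n R c h δ) (hc : 0 ≤ c)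
    (hδ : 0 < δ) (h0 : 0 ≤ h) (hh : h ≤ δ) (hP : ∀ a, ‖P a‖ ≤ ‖P' a‖)
    {ε : ℝ} (hε : 0 < ε) {y y' : X} {p : H} {q : G}
    (heq : inner ℝ (v y') (v (M y')) + inner ℝ (g y) (g (M y')) =
      inner ℝ p (v (M y')) + inner ℝ q (g (M y'))) :
    ‖m (v y')‖ ^ 2 + inner ℝ (n (g y)) (n (g y')) - inner ℝ q (g (M y')) ≤
      (c * (h / δ) + 2 * ε ^ 2) * ‖P' (v y')‖ ^ 2 +
      (1 + c) ^ 2 * ε⁻¹ ^ 2 * (δ⁻¹ ^ 2 * ‖R (g y)‖ ^ 2 + ‖p‖ ^ 2) := by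
  have a1 := (abs_le.1 (hM.inner_v (v y') y')).1
  have a2 := (abs_le.1 (hM.inner_g (g y) y')).1
  have a3 := (real_inner_le_norm p (v (M y'))).trans
    (mul_le_mul_of_nonneg_left (hM.norm_v_le hc hδ hh y') (norm_nonneg p))
  rw [real_inner_self_eq_norm_sq] at a1
  have hk0 : 0 ≤ h / δ := by positivity
  set D := δ⁻¹ with hD
  have hD0 : 0 < D := inv_pos.2 hδ
  have hle := hP (v y')
  set Y := ‖P (v y')‖
  set Y' := ‖P' (v y')‖
  set Z := ‖R (g y)‖
  have nY : 0 ≤ Y := norm_nonneg _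
  have nZ : 0 ≤ Z := norm_nonneg _
  -- `Y` gets the small factor `ε²` in both products; the term with `h / δ` is left as it is
  have y1 := young_mul Y ((1 + c) * ‖p‖) hε
  have y2 := young_mul Y (c * D * Z) hε
  have hYY : Y ^ 2 ≤ Y' ^ 2 := by gcongr
  have e1 : (c * (h / δ) + 2 * ε ^ 2) * Y ^ 2 ≤ (c * (h / δ) + 2 * ε ^ 2) * Y' ^ 2 := by gcongr
  have w1 : 0 ≤ ε⁻¹ ^ 2 * (D ^ 2 * Z ^ 2) := by positivity
  have w2 : 0 ≤ (1 + c) ^ 2 * (ε⁻¹ ^ 2 * ‖p‖ ^ 2) := by positivity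
  have w3 : 0 ≤ c * (ε⁻¹ ^ 2 * (D ^ 2 * Z ^ 2)) := by positivity
  have w4 : 0 ≤ c ^ 2 * (ε⁻¹ ^ 2 * (D ^ 2 * Z ^ 2)) := by positivity
  linarith

/-- An absolutely continuous function is bounded by the `L²` norms of itself and its derivative. -/
theorem IsPrimOn.norm_sq_le {a b : ℝ} {q q' : ℝ → G} (hq : IsPrimOn a b q q') (hab : a < b)
    (hq2 : MemLp q' 2 (volume.restrict (Ioc a b))) {s : ℝ} (hs : s ∈ Icc a b) :
    ‖q s‖ ^ 2 ≤ 2 * (b - a)⁻¹ * (∫ t in Ioc a b, ‖q t‖ ^ 2) +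
      2 * (b - a) * ∫ t in Ioc a b, ‖q' t‖ ^ 2 := by
  set I := ∫ t in Ioc a b, ‖q' t‖ ^ 2 with hI
  have hi2 : IntegrableOn (fun t => ‖q' t‖ ^ 2) (Ioc a b) := by
    simpa [IntegrableOn] using hq2.integrable_norm_pow (p := 2) (by norm_num)
  have hi1 : IntegrableOn (fun t => ‖q' t‖) (Ioc a b) := hq.int.norm
  -- the Cauchy-Schwarz inequality, from the variance of `‖q'‖`
  have hJ : (∫ t in Ioc a b, ‖q' t‖) ^ 2 ≤ (b - a) * I := by
    set J := ∫ t in Ioc a b, ‖q' t‖ with hJ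
    have hl : 0 < b - a := by linarith
    have h0 : 0 ≤ ∫ t in Ioc a b, (‖q' t‖ - (b - a)⁻¹ * J) ^ 2 :=
      integral_nonneg fun t => sq_nonneg _
    have e : ∀ t, (‖q' t‖ - (b - a)⁻¹ * J) ^ 2 =
        ‖q' t‖ ^ 2 - 2 * (b - a)⁻¹ * J * ‖q' t‖ + ((b - a)⁻¹ * J) ^ 2 := fun t => by ring
    simp only [e] at h0
    have hi3 : IntegrableOn (fun t => 2 * (b - a)⁻¹ * J * ‖q' t‖) (Ioc a b) := hi1.const_mul _
    have hi4 : IntegrableOn (fun t => ‖q' t‖ ^ 2 - 2 * (b - a)⁻¹ * J * ‖q' t‖) (Ioc a b) :=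
      hi2.sub hi3
    rw [integral_add hi4 (integrableOn_const (by simp)), integral_sub hi2 hi3, integral_const_mul,
      ← hJ, ← hI, setIntegral_const] at h0
    simp only [Measure.real, Real.volume_Ioc, ENNReal.toReal_ofReal hl.le, smul_eq_mul] at h0
    have e2 : I - 2 * (b - a)⁻¹ * J * J + (b - a) * ((b - a)⁻¹ * J) ^ 2 =
        I - (b - a)⁻¹ * J ^ 2 := by
      field_simp
      ring
    rw [e2] at h0
    have : (b - a) * ((b - a)⁻¹ * J ^ 2) ≤ (b - a) * I := by gcongr; linarith
    rwa [mul_inv_cancel_left₀ hl.ne'] at this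
  have hdiff : ∀ t ∈ Icc a b, ‖q s‖ ≤ ‖q t‖ + ∫ t in Ioc a b, ‖q' t‖ := by
    intro t ht
    have hle : ∀ x ∈ Icc a b, ∀ z ∈ Icc a b, x ≤ z → ‖q z - q x‖ ≤ ∫ t in Ioc a b, ‖q' t‖ := by
      intro x hx z hz hxz
      rw [← hq.integral_eq_sub hx hz hxz]
      refine (norm_integral_le_integral_norm _).trans ?_
      exact setIntegral_mono_set hi1 (Eventually.of_forall fun _ => norm_nonneg _)
        (Ioc_subset_Ioc hx.1 hz.2).eventuallyLE
    have : ‖q s - q t‖ ≤ ∫ t in Ioc a b, ‖q' t‖ := by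
      rcases le_total t s with h | h
      · exact hle t ht s hs h
      · rw [norm_sub_rev]
        exact hle s hs t ht h
    have h2 : q s = q t + (q s - q t) := by abel
    calc ‖q s‖ = ‖q t + (q s - q t)‖ := by rw [← h2]
      _ ≤ _ := (norm_add_le _ _).trans (by gcongr)
  have hpt : ∀ t ∈ Ioc a b, ‖q s‖ ^ 2 ≤ 2 * ‖q t‖ ^ 2 + 2 * ((b - a) * I) := by
    intro t ht
    have h1 := hdiff t (Ioc_subset_Icc_self ht)
    have h2 : 0 ≤ ∫ t in Ioc a b, ‖q' t‖ := integral_nonneg fun _ => norm_nonneg _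
    have h3 : ‖q s‖ ^ 2 ≤ (‖q t‖ + ∫ t in Ioc a b, ‖q' t‖) ^ 2 := by gcongr
    linarith [sq_nonneg (‖q t‖ - ∫ t in Ioc a b, ‖q' t‖)]
  have hqi : IntegrableOn (fun t => ‖q t‖ ^ 2) (Ioc a b) :=
    ((hq.continuousOn.norm.pow 2).integrableOn_Icc).mono_set Ioc_subset_Icc_self
  have hq3 : IntegrableOn (fun t => 2 * ‖q t‖ ^ 2) (Ioc a b) := hqi.const_mul 2
  have hc (x : ℝ) : IntegrableOn (fun _ => x) (Ioc a b) := integrableOn_const (by simp)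
  have := setIntegral_mono_on (hc _) (show IntegrableOn (fun t => 2 * ‖q t‖ ^ 2 +
    2 * ((b - a) * I)) (Ioc a b) from hq3.add (hc _)) measurableSet_Ioc hpt
  have hl : 0 < b - a := by linarith
  rw [integral_add hq3 (hc _), integral_const_mul,
    setIntegral_const, setIntegral_const] at this
  simp only [Measure.real, Real.volume_Ioc, ENNReal.toReal_ofReal hl.le, smul_eq_mul] at this
  have h4 := mul_le_mul_of_nonneg_left this (inv_pos.2 hl).le
  rw [inv_mul_cancel_left₀ hl.ne'] at h4
  refine h4.trans (le_of_eq ?_)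
  field_simp

end Energy

end HeatFEM

namespace HeatFEM

set_option linter.unusedSectionVars false

/-! ### The energy estimates integrated in time -/

section EnergyIntegrated

variable {X H G : Type*} [NormedAddCommGroup X] [NormedSpace ℝ X] [CompleteSpace X]
  [NormedAddCommGroup H] [InnerProductSpace ℝ H] [CompleteSpace H]
  [NormedAddCommGroup G] [InnerProductSpace ℝ G] [CompleteSpace G]

theorem integrableOn_sq_of_memLp {a b : ℝ} {f : ℝ → H}
    (hf : MemLp f 2 (volume.restrict (Ioc a b))) : IntegrableOn (fun t => ‖f t‖ ^ 2) (Ioc a b) := by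
  simpa [IntegrableOn] using hf.integrable_norm_pow (p := 2) (by norm_num)

theorem IsPrimOn.integrableOn_sq {a b : ℝ} {u u' : ℝ → H} (hu : IsPrimOn a b u u') :
    IntegrableOn (fun t => ‖u t‖ ^ 2) (Ioc a b) :=
  ((hu.continuousOn.norm.pow 2).integrableOn_Icc).mono_set Ioc_subset_Icc_self

theorem IsPrimOn.inner {a b : ℝ} {u u' w w' : ℝ → H} (hu : IsPrimOn a b u u')
    (hw : IsPrimOn a b w w') :
    IsPrimOn a b (fun t => inner ℝ (u t) (w t)) (fun t => inner ℝ (u' t) (w t) +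
      inner ℝ (u t) (w' t)) :=
  hu.bilin (innerSL ℝ) hw

theorem IsPrimOn.mul {a b : ℝ} {u u' w w' : ℝ → ℝ} (hu : IsPrimOn a b u u')
    (hw : IsPrimOn a b w w') :
    IsPrimOn a b (fun t => u t * w t) (fun t => u' t * w t + u t * w' t) :=
  hu.bilin (ContinuousLinearMap.mul ℝ ℝ) hw

theorem IsPrimOn.integrableOn_mul {a b : ℝ} {u u' w : ℝ → ℝ} (hu : IsPrimOn a b u u')
    (hw : IntegrableOn w (Ioc a b)) : IntegrableOn (fun t => u t * w t) (Ioc a b) :=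
  hu.integrable_left (ContinuousLinearMap.mul ℝ ℝ) hw

theorem sub_le_integral_of_isPrimOn {a b : ℝ} (hab : a ≤ b) {F F' Φ : ℝ → ℝ}
    (hF : IsPrimOn a b F F') (hΦ : IntegrableOn Φ (Ioc a b))
    (h : ∀ᵐ t ∂(volume.restrict (Ioc a b)), F' t ≤ Φ t) :
    F b - F a ≤ ∫ t in Ioc a b, Φ t := by
  rw [← hF.integral_eq_sub ⟨le_rfl, hab⟩ ⟨hab, le_rfl⟩ hab]
  exact integral_mono_ae hF.int hΦ h

variable {v : X →L[ℝ] H} {g : X →L[ℝ] G} {c h δ t₀ t₁ : ℝ}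

/-- The energy estimate for `y`, from the test function `a M y`; the bounds hold for the terminal
value and for the dissipation. -/
theorem energy_first {M : X →L[ℝ] X} {m P : H →L[ℝ] H} {n R : G →L[ℝ] G}
    (hM : IsDiscreteCutoff v g M m P n R c h δ) (hc : 0 ≤ c) (hδ : 0 < δ) (h0 : 0 ≤ h)
    (hh : h ≤ δ) (ht : t₀ ≤ t₁) {y y' : ℝ → X} (hy : IsPrimOn t₀ t₁ y y')
    (hy' : MemLp y' 2 (volume.restrict (Ioc t₀ t₁)))
    {p : ℝ → H} (hp : MemLp p 2 (volume.restrict (Ioc t₀ t₁)))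
    {q q' : ℝ → G} (hq : IsPrimOn t₀ t₁ q q')
    {a a' : ℝ → ℝ} (ha : IsPrimOn t₀ t₁ a a') (ha0 : ∀ t, 0 ≤ a t) (ha1 : ∀ t, a t ≤ 1)
    (ha' : ∀ t, |a' t| ≤ c * δ⁻¹ ^ 2)
    (heq : ∀ᵐ t ∂(volume.restrict (Ioc t₀ t₁)), ∀ χ,
      inner ℝ (v (y' t)) (v (M χ)) + inner ℝ (g (y t)) (g (M χ)) =
      inner ℝ (p t) (v (M χ)) + inner ℝ (q t) (g (M χ)))
    {κ : ℝ} (hκ : 0 < κ) (hκ1 : κ ≤ 1) :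
    a t₁ * (δ⁻¹ ^ 2 / 2 * ‖m (v (y t₁))‖ ^ 2) +
      δ⁻¹ ^ 2 / 2 * (∫ t in Ioc t₀ t₁, a t * ‖n (g (y t))‖ ^ 2) ≤
    a t₀ * (δ⁻¹ ^ 2 / 2 * ‖m (v (y t₀))‖ ^ 2) +
      κ ^ 2 * ((∫ t in Ioc t₀ t₁, ‖P (v (y' t))‖ ^ 2) +
        δ⁻¹ ^ 2 * (∫ t in Ioc t₀ t₁, ‖R (g (y t))‖ ^ 2)) +
      3 * (1 + c) ^ 2 * (κ⁻¹ ^ 2 * (δ⁻¹ ^ 4 * (∫ t in Ioc t₀ t₁, ‖P (v (y t))‖ ^ 2)) +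
        (∫ t in Ioc t₀ t₁, ‖p t‖ ^ 2) + δ⁻¹ ^ 2 * (∫ t in Ioc t₀ t₁, ‖q t‖ ^ 2)) := by
  have hu : IsPrimOn t₀ t₁ (fun t => m (v (y t))) (fun t => m (v (y' t))) := hy.clm (m.comp v)
  -- the left hand side is the increment of `a ‖m y‖² / (2 δ²)`, up to the dissipation
  have hF := ha.mul (((IsPrimOn.const t₀ t₁ (δ⁻¹ ^ 2 / 2 : ℝ))).mul (hu.inner hu))
  have iA : IntegrableOn (fun t => a t * ‖n (g (y t))‖ ^ 2) (Ioc t₀ t₁) :=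
    ha.integrableOn_mul (hy.clm (n.comp g)).integrableOn_sq
  have iY' : IntegrableOn (fun t => ‖P (v (y' t))‖ ^ 2) (Ioc t₀ t₁) :=
    integrableOn_sq_of_memLp ((P.comp v).comp_memLp' hy')
  have iY : IntegrableOn (fun t => ‖P (v (y t))‖ ^ 2) (Ioc t₀ t₁) :=
    (hy.clm (P.comp v)).integrableOn_sq
  have iZ : IntegrableOn (fun t => ‖R (g (y t))‖ ^ 2) (Ioc t₀ t₁) :=
    (hy.clm (R.comp g)).integrableOn_sq
  have ip := integrableOn_sq_of_memLp hp
  have iq := hq.integrableOn_sq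
  have j1 := iA.const_mul (-(δ⁻¹ ^ 2 / 2))
  have j2 := iY'.const_mul (κ ^ 2)
  have j3 := iZ.const_mul (κ ^ 2 * δ⁻¹ ^ 2)
  have j4 := iY.const_mul (3 * (1 + c) ^ 2 * κ⁻¹ ^ 2 * δ⁻¹ ^ 4)
  have j5 := ip.const_mul (3 * (1 + c) ^ 2)
  have j6 := iq.const_mul (3 * (1 + c) ^ 2 * δ⁻¹ ^ 2)
  have key := sub_le_integral_of_isPrimOn ht hF
    (((((j1.add j2).add j3).add j4).add j5).add j6) (by
    filter_upwards [heq] with t he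
    have e1 := energy_pointwise hM hc hδ h0 hh hκ hκ1 (he (y t))
    have hR : 0 ≤ κ ^ 2 * (‖P (v (y' t))‖ ^ 2 + δ⁻¹ ^ 2 * ‖R (g (y t))‖ ^ 2) +
      2 * (1 + c) ^ 2 * (κ⁻¹ ^ 2 * (δ⁻¹ ^ 4 * ‖P (v (y t))‖ ^ 2) + ‖p t‖ ^ 2 +
        δ⁻¹ ^ 2 * ‖q t‖ ^ 2) := by positivity
    have e2 := mul_le_mul_of_nonneg_left e1 (ha0 t)
    have e3 := mul_le_of_le_one_left hR (ha1 t)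
    have e4 : a' t * (δ⁻¹ ^ 2 / 2 * ‖m (v (y t))‖ ^ 2) ≤
        c * δ⁻¹ ^ 2 * (δ⁻¹ ^ 2 / 2 * ‖P (v (y t))‖ ^ 2) := by
      refine mul_le_mul ((le_abs_self _).trans (ha' t)) ?_ (by positivity) (by positivity)
      have := hM.m_le (v (y t))
      gcongr
    have hκi : 1 ≤ κ⁻¹ ^ 2 := one_le_pow₀ ((one_le_inv₀ hκ).2 hκ1)
    have e5 : c * (δ⁻¹ ^ 4 * ‖P (v (y t))‖ ^ 2) ≤
        c * (κ⁻¹ ^ 2 * (δ⁻¹ ^ 4 * ‖P (v (y t))‖ ^ 2)) := by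
      have : 0 ≤ δ⁻¹ ^ 4 * ‖P (v (y t))‖ ^ 2 := by positivity
      have := le_mul_of_one_le_left this hκi
      gcongr
    have w1 : 0 ≤ (1 + c ^ 2 + c * (3 / 2)) * (κ⁻¹ ^ 2 * (δ⁻¹ ^ 4 * ‖P (v (y t))‖ ^ 2)) := by
      positivity
    have w2 : 0 ≤ (1 + c) ^ 2 * ‖p t‖ ^ 2 := by positivity
    have w3 : 0 ≤ (1 + c) ^ 2 * (δ⁻¹ ^ 2 * ‖q t‖ ^ 2) := by positivity
    simp only [Pi.add_apply, real_inner_self_eq_norm_sq, zero_mul, zero_add]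
    rw [real_inner_comm (m (v (y' t))) (m (v (y t)))]
    linarith)
  simp only [real_inner_self_eq_norm_sq] at key
  rw [integral_add' ((((j1.add j2).add j3).add j4).add j5) j6,
    integral_add' (((j1.add j2).add j3).add j4) j5, integral_add' ((j1.add j2).add j3) j4,
    integral_add' (j1.add j2) j3, integral_add' j1 j2] at key
  simp only [integral_const_mul] at key
  linarith

end EnergyIntegrated

end HeatFEM

namespace HeatFEM

set_option linter.unusedSectionVars false

theorem abs_half_sq_sub_le {A₁ A Q Y i : ℝ} (h : A₁ ^ 2 ≤ A ^ 2) (hi : |i| ≤ Q * (A + Y)) :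
    |A₁ ^ 2 / 2 - i| ≤ A ^ 2 + Q ^ 2 + Y ^ 2 := by
  have h1 := abs_sub (A₁ ^ 2 / 2) i
  rw [abs_of_nonneg (by positivity : 0 ≤ A₁ ^ 2 / 2)] at h1
  linarith [sq_nonneg (Q - A), sq_nonneg (Q - Y), sq_nonneg Y, add_sq Q A]

theorem half_sq_sub_le {A Q Y i : ℝ} (hi : -(Q * (A + Y)) ≤ i) :
    A ^ 2 / 2 - i ≤ Q ^ 2 + A ^ 2 + Y ^ 2 := by
  linarith [sq_nonneg (Q - A), sq_nonneg (Q - Y), sq_nonneg Y]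

theorem neg_half_sq_sub_le {A Q Y i : ℝ} (hi : i ≤ Q * (A + Y)) :
    -(A ^ 2 / 2 - i) ≤ Q ^ 2 + Y ^ 2 / 2 := by
  linarith [sq_nonneg (Q - A), sq_nonneg (Q - Y)]

theorem neg_le_weighted {A Q c D δ Y i : ℝ} (hδ : δ * D = 1) (hi : |i| ≤ Q * (A + c * D * Y)) :
    -i ≤ δ ^ 2 * Q ^ 2 + D ^ 2 * A ^ 2 / 2 + c ^ 2 * (D ^ 4 * Y ^ 2) / 2 := by
  have h1 := neg_abs_le i
  have h2 : Q * A = (δ * Q) * (D * A) := by linear_combination (- (Q * A)) * hδ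
  have h3 : Q * (c * D * Y) = (δ * Q) * (c * D ^ 2 * Y) := by
    linear_combination (- (Q * (c * D * Y))) * hδ
  linarith [sq_nonneg (δ * Q - D * A), sq_nonneg (δ * Q - c * D ^ 2 * Y)]

section EnergyIntegrated

variable {X H G : Type*} [NormedAddCommGroup X] [NormedSpace ℝ X] [CompleteSpace X]
  [NormedAddCommGroup H] [InnerProductSpace ℝ H] [CompleteSpace H]
  [NormedAddCommGroup G] [InnerProductSpace ℝ G] [CompleteSpace G]

variable {v : X →L[ℝ] H} {g : X →L[ℝ] G} {c h δ t₀ t₁ : ℝ}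

/-- The energy estimate for `y'`, from the test function `a₁ M y'`. The term `(q, ∇ M y')` is
integrated by parts in time, so that only the gradient of `M y` enters. -/
theorem energy_second {M : X →L[ℝ] X} {m₁ m₂ P : H →L[ℝ] H} {n₁ n₂ : G →L[ℝ] G}
    (hM : IsDiscreteCutoff v g M m₁ m₂ n₁ n₂ c h δ) (hP : ∀ a, ‖m₂ a‖ ≤ ‖P a‖)
    (hc : 0 ≤ c) (hδ : 0 < δ) (h0 : 0 ≤ h)
    (hh : h ≤ δ) (ht : t₀ ≤ t₁) {y y' : ℝ → X} (hy : IsPrimOn t₀ t₁ y y')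
    (hy' : MemLp y' 2 (volume.restrict (Ioc t₀ t₁)))
    {p : ℝ → H} (hp : MemLp p 2 (volume.restrict (Ioc t₀ t₁)))
    {q q' : ℝ → G} (hq : IsPrimOn t₀ t₁ q q') (hq' : MemLp q' 2 (volume.restrict (Ioc t₀ t₁)))
    {a₁ a₁' a₂ a₂' : ℝ → ℝ} (ha : IsPrimOn t₀ t₁ a₁ a₁') (hb : IsPrimOn t₀ t₁ a₂ a₂')
    (ha0 : ∀ t, 0 ≤ a₁ t) (hab : ∀ t, a₁ t ≤ a₂ t) (hb1 : ∀ t, a₂ t ≤ 1)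
    (ha' : ∀ t, |a₁' t| ≤ c * δ⁻¹ ^ 2 * a₂ t)
    (heq : ∀ᵐ t ∂(volume.restrict (Ioc t₀ t₁)), ∀ χ,
      inner ℝ (v (y' t)) (v (M χ)) + inner ℝ (g (y t)) (g (M χ)) =
      inner ℝ (p t) (v (M χ)) + inner ℝ (q t) (g (M χ)))
    {ε : ℝ} (hε : 0 < ε) (hε1 : ε ≤ 1) :
    (∫ t in Ioc t₀ t₁, a₁ t * ‖m₁ (v (y' t))‖ ^ 2) +
      a₁ t₁ * (‖n₁ (g (y t₁))‖ ^ 2 / 2 - inner ℝ (q t₁) (g (M (y t₁)))) ≤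
    a₁ t₀ * (‖n₁ (g (y t₀))‖ ^ 2 / 2 - inner ℝ (q t₀) (g (M (y t₀)))) +
      (c * (h / δ) + 2 * ε ^ 2) * (∫ t in Ioc t₀ t₁, ‖P (v (y' t))‖ ^ 2) +
      3 * (1 + c) ^ 3 * (ε⁻¹ ^ 2 * (δ⁻¹ ^ 2 * (∫ t in Ioc t₀ t₁, a₂ t * ‖n₂ (g (y t))‖ ^ 2) +
        (∫ t in Ioc t₀ t₁, ‖p t‖ ^ 2)) + δ⁻¹ ^ 4 * (∫ t in Ioc t₀ t₁, ‖P (v (y t))‖ ^ 2) +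
        δ⁻¹ ^ 2 * (∫ t in Ioc t₀ t₁, ‖q t‖ ^ 2) + δ ^ 2 * (∫ t in Ioc t₀ t₁, ‖q' t‖ ^ 2)) := by
  have hu : IsPrimOn t₀ t₁ (fun t => n₁ (g (y t))) (fun t => n₁ (g (y' t))) := hy.clm (n₁.comp g)
  have hw : IsPrimOn t₀ t₁ (fun t => g (M (y t))) (fun t => g (M (y' t))) := hy.clm (g.comp M)
  -- the increment of `a₁ (‖n₁ ∇y‖² / 2 - (q, ∇ M y))` contains the terms without a sign
  have hF := ha.mul (((IsPrimOn.const t₀ t₁ (1 / 2 : ℝ)).mul (hu.inner hu)).sub (hq.inner hw))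
  have iA : IntegrableOn (fun t => a₂ t * ‖n₂ (g (y t))‖ ^ 2) (Ioc t₀ t₁) :=
    hb.integrableOn_mul (hy.clm (n₂.comp g)).integrableOn_sq
  have iB : IntegrableOn (fun t => a₁ t * ‖m₁ (v (y' t))‖ ^ 2) (Ioc t₀ t₁) :=
    ha.integrableOn_mul (integrableOn_sq_of_memLp ((m₁.comp v).comp_memLp' hy'))
  have iY' : IntegrableOn (fun t => ‖P (v (y' t))‖ ^ 2) (Ioc t₀ t₁) :=
    integrableOn_sq_of_memLp ((P.comp v).comp_memLp' hy')
  have iY : IntegrableOn (fun t => ‖P (v (y t))‖ ^ 2) (Ioc t₀ t₁) :=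
    (hy.clm (P.comp v)).integrableOn_sq
  have ip := integrableOn_sq_of_memLp hp
  have iq := hq.integrableOn_sq
  have iq' := integrableOn_sq_of_memLp hq'
  have j1 := iB.const_mul (-1)
  have j2 := iY'.const_mul (c * (h / δ) + 2 * ε ^ 2)
  have j3 := iA.const_mul (3 * (1 + c) ^ 3 * ε⁻¹ ^ 2 * δ⁻¹ ^ 2)
  have j4 := ip.const_mul (3 * (1 + c) ^ 3 * ε⁻¹ ^ 2)
  have j5 := iY.const_mul (3 * (1 + c) ^ 3 * δ⁻¹ ^ 4)
  have j6 := iq.const_mul (3 * (1 + c) ^ 3 * δ⁻¹ ^ 2)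
  have j7 := iq'.const_mul (3 * (1 + c) ^ 3 * δ ^ 2)
  have hδδ : δ * δ⁻¹ = 1 := mul_inv_cancel₀ hδ.ne'
  have key := sub_le_integral_of_isPrimOn ht hF
    ((((((j1.add j2).add j3).add j4).add j5).add j6).add j7) (by
    filter_upwards [heq] with t he
    have e1 := energy_pointwise' hM hc hδ h0 hh hP hε (he (y' t))
    have e2 := mul_le_mul_of_nonneg_left e1 (ha0 t)
    have k1 := (hM.norm_g_le (y t)).trans (add_le_add_left (hM.n_le (g (y t))) _)
    have k2 := hM.n_le (g (y t))
    have k3 : c * δ⁻¹ * ‖m₂ (v (y t))‖ ≤ c * δ⁻¹ * ‖P (v (y t))‖ := by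
      have := hP (v (y t)); gcongr
    have k4 := (abs_real_inner_le_norm (q t) (g (M (y t)))).trans
      (mul_le_mul_of_nonneg_left (k1.trans (add_le_add_right k3 _)) (norm_nonneg _))
    have k5 := (abs_real_inner_le_norm (q' t) (g (M (y t)))).trans
      (mul_le_mul_of_nonneg_left (k1.trans (add_le_add_right k3 _)) (norm_nonneg _))
    have ha1 := (hab t).trans (hb1 t)
    have hb0 := (ha0 t).trans (hab t)
    have hDpos : 0 < δ⁻¹ := inv_pos.2 hδ
    have k6 : ‖n₁ (g (y t))‖ ^ 2 ≤ ‖n₂ (g (y t))‖ ^ 2 := by gcongr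
    have q0 : 0 ≤ ‖q t‖ := norm_nonneg _
    set A := ‖n₂ (g (y t))‖
    set Y := ‖P (v (y t))‖
    set Y' := ‖P (v (y' t))‖
    set Q := ‖q t‖
    set Q' := ‖q' t‖
    set D := δ⁻¹
    have l1 : |‖n₁ (g (y t))‖ ^ 2 / 2 - inner ℝ (q t) (g (M (y t)))| ≤
        A ^ 2 + Q ^ 2 + c ^ 2 * (D ^ 2 * Y ^ 2) := by
      have h1 := abs_half_sq_sub_le (by gcongr : ‖n₁ (g (y t))‖ ^ 2 ≤ A ^ 2) k4
      rwa [mul_pow, mul_pow, mul_assoc] at h1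
    have l2 : a₁' t * (‖n₁ (g (y t))‖ ^ 2 / 2 - inner ℝ (q t) (g (M (y t)))) ≤
        c * D ^ 2 * a₂ t * (A ^ 2 + Q ^ 2 + c ^ 2 * (D ^ 2 * Y ^ 2)) := by
      refine (le_abs_self _).trans ?_
      rw [abs_mul]
      exact mul_le_mul (ha' t) l1 (abs_nonneg _) (by positivity)
    have l3 : c * D ^ 2 * a₂ t * (Q ^ 2 + c ^ 2 * (D ^ 2 * Y ^ 2)) ≤
        c * D ^ 2 * (Q ^ 2 + c ^ 2 * (D ^ 2 * Y ^ 2)) :=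
      mul_le_mul_of_nonneg_right (mul_le_of_le_one_right (by positivity) (hb1 t)) (by positivity)
    have l4 : - inner ℝ (q' t) (g (M (y t))) ≤
        δ ^ 2 * Q' ^ 2 + D ^ 2 * A ^ 2 / 2 + c ^ 2 * (D ^ 4 * Y ^ 2) / 2 := neg_le_weighted hδδ k5
    have l5 := mul_le_mul_of_nonneg_left l4 (ha0 t)
    have l6 : a₁ t * (δ ^ 2 * Q' ^ 2 + c ^ 2 * (D ^ 4 * Y ^ 2) / 2) ≤
        δ ^ 2 * Q' ^ 2 + c ^ 2 * (D ^ 4 * Y ^ 2) / 2 :=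
      mul_le_of_le_one_left (by positivity) ha1
    have l7 : a₁ t * (D ^ 2 * A ^ 2) ≤ a₂ t * (D ^ 2 * A ^ 2) :=
      mul_le_mul_of_nonneg_right (hab t) (by positivity)
    have l8 : a₁ t * ((c * (h / δ) + 2 * ε ^ 2) * Y' ^ 2) ≤ (c * (h / δ) + 2 * ε ^ 2) * Y' ^ 2 :=
      mul_le_of_le_one_left (by positivity) ha1
    have l9 : a₁ t * ((1 + c) ^ 2 * ε⁻¹ ^ 2 * (D ^ 2 * A ^ 2)) ≤
        (1 + c) ^ 2 * ε⁻¹ ^ 2 * (a₂ t * (D ^ 2 * A ^ 2)) := by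
      have := mul_le_mul_of_nonneg_left l7 (by positivity : 0 ≤ (1 + c) ^ 2 * ε⁻¹ ^ 2)
      linarith
    have l10 : a₁ t * ((1 + c) ^ 2 * ε⁻¹ ^ 2 * ‖p t‖ ^ 2) ≤ (1 + c) ^ 2 * ε⁻¹ ^ 2 * ‖p t‖ ^ 2 :=
      mul_le_of_le_one_left (by positivity) ha1
    have hεi : 1 ≤ ε⁻¹ ^ 2 := one_le_pow₀ ((one_le_inv₀ hε).2 hε1)
    have z1 : (1 + c) * (a₂ t * (D ^ 2 * A ^ 2)) ≤
        (1 + c) * (ε⁻¹ ^ 2 * (a₂ t * (D ^ 2 * A ^ 2))) := by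
      have := le_mul_of_one_le_left (by positivity : 0 ≤ a₂ t * (D ^ 2 * A ^ 2)) hεi
      gcongr
    have z2 : 0 ≤ (c + c ^ 2 * 8 + 3 * c ^ 3) * (ε⁻¹ ^ 2 * (a₂ t * (D ^ 2 * A ^ 2))) := by
      positivity
    have z3 : 0 ≤ (a₂ t * (D ^ 2 * A ^ 2)) := by positivity
    have z4 : 0 ≤ (2 + 7 * c + c ^ 2 * 8 + 3 * c ^ 3) * (ε⁻¹ ^ 2 * ‖p t‖ ^ 2) := by positivity
    have z5 : 0 ≤ (3 + 9 * c + (17 / 2) * c ^ 2 + 2 * c ^ 3) * (D ^ 4 * Y ^ 2) := by positivity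
    have z6 : 0 ≤ (3 + 8 * c + 9 * c ^ 2 + 3 * c ^ 3) * (D ^ 2 * Q ^ 2) := by positivity
    have z7 : 0 ≤ (2 + 9 * c + 9 * c ^ 2 + 3 * c ^ 3) * (δ ^ 2 * Q' ^ 2) := by positivity
    have z8 : 0 ≤ (5 * c) * (ε⁻¹ ^ 2 * (a₂ t * (D ^ 2 * A ^ 2))) := by positivity
    have z9 : 0 ≤ (ε⁻¹ ^ 2 * (a₂ t * (D ^ 2 * A ^ 2))) := by positivity
    simp only [Pi.add_apply, real_inner_self_eq_norm_sq, zero_mul, zero_add]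
    rw [real_inner_comm (n₁ (g (y t))) (n₁ (g (y' t)))]
    linarith only [e2, l2, l3, l5, l6, l7, l8, l9, l10, z1, z2, z3, z4, z5, z6, z7, z8, z9])
  simp only [real_inner_self_eq_norm_sq] at key
  rw [integral_add' ((((((j1.add j2).add j3).add j4).add j5).add j6)) j7,
    integral_add' (((((j1.add j2).add j3).add j4).add j5)) j6,
    integral_add' ((((j1.add j2).add j3).add j4)) j5,
    integral_add' (((j1.add j2).add j3)) j4, integral_add' ((j1.add j2)) j3,
    integral_add' j1 j2] at key
  simp only [integral_const_mul] at key
  linarith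

set_option maxHeartbeats 1000000 in
/-- The local energy estimate for `v y' + ∇ y = v p + ∇* q` tested with discrete functions: the
energy of `y` in the inner region is bounded by data, by `L²` norms of `y` in the outer region, and
by a small multiple of the energy of `y` there. -/
theorem energy_combined {M₁ M₂ : X →L[ℝ] X} {m₁ m₂ P : H →L[ℝ] H} {n₁ n₂ R : G →L[ℝ] G}
    (hM₁ : IsDiscreteCutoff v g M₁ m₁ m₂ n₁ n₂ c h δ)
    (hM₂ : IsDiscreteCutoff v g M₂ m₂ P n₂ R c h δ)
    (hc : 0 ≤ c) (hδ : 0 < δ) (h0 : 0 ≤ h)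
    (hh : h ≤ δ) (ht : t₀ < t₁) (hl : t₁ - t₀ ≤ c * δ ^ 2) (hl' : (t₁ - t₀)⁻¹ ≤ c * δ⁻¹ ^ 2)
    {y y' : ℝ → X} (hy : IsPrimOn t₀ t₁ y y')
    (hy' : MemLp y' 2 (volume.restrict (Ioc t₀ t₁)))
    {p : ℝ → H} (hp : MemLp p 2 (volume.restrict (Ioc t₀ t₁)))
    {q q' : ℝ → G} (hq : IsPrimOn t₀ t₁ q q') (hq' : MemLp q' 2 (volume.restrict (Ioc t₀ t₁)))
    {a₁ a₁' a₂ a₂' : ℝ → ℝ} (ha : IsPrimOn t₀ t₁ a₁ a₁') (hb : IsPrimOn t₀ t₁ a₂ a₂')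
    (ha0 : ∀ t, 0 ≤ a₁ t) (hab : ∀ t, a₁ t ≤ a₂ t) (hb1 : ∀ t, a₂ t ≤ 1)
    (ha' : ∀ t, |a₁' t| ≤ c * δ⁻¹ ^ 2 * a₂ t) (hb' : ∀ t, |a₂' t| ≤ c * δ⁻¹ ^ 2)
    (heq : ∀ᵐ t ∂(volume.restrict (Ioc t₀ t₁)), ∀ χ, χ ∈ range M₁ ∪ range M₂ →
      inner ℝ (v (y' t)) (v χ) + inner ℝ (g (y t)) (g χ) =
      inner ℝ (p t) (v χ) + inner ℝ (q t) (g χ))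
    {ε : ℝ} (hε : 0 < ε) (hε1 : ε ≤ 1) :
    (∫ t in Ioc t₀ t₁, a₁ t * ‖m₁ (v (y' t))‖ ^ 2) +
      δ⁻¹ ^ 2 * (∫ t in Ioc t₀ t₁, a₂ t * ‖n₂ (g (y t))‖ ^ 2) ≤
    (c * (h / δ) + 100 * (1 + c) ^ 5 * ε ^ 2) * ((∫ t in Ioc t₀ t₁, ‖P (v (y' t))‖ ^ 2) +
        δ⁻¹ ^ 2 * (∫ t in Ioc t₀ t₁, ‖R (g (y t))‖ ^ 2)) +
      100 * (1 + c) ^ 5 * ε⁻¹ ^ 6 *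
        (a₂ t₀ * (‖R (g (y t₀))‖ ^ 2 + δ⁻¹ ^ 2 * ‖P (v (y t₀))‖ ^ 2) +
        δ⁻¹ ^ 4 * (∫ t in Ioc t₀ t₁, ‖P (v (y t))‖ ^ 2) + (∫ t in Ioc t₀ t₁, ‖p t‖ ^ 2) +
        δ⁻¹ ^ 2 * (∫ t in Ioc t₀ t₁, ‖q t‖ ^ 2) + δ ^ 2 * (∫ t in Ioc t₀ t₁, ‖q' t‖ ^ 2)) := by
  have hb0 : ∀ t, 0 ≤ a₂ t := fun t => (ha0 t).trans (hab t)
  have E1 := energy_first hM₂ hc hδ h0 hh ht.le hy hy' hp hq hb hb0 hb1 hb'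
    (heq.mono fun t h χ => h _ (Or.inr ⟨χ, rfl⟩)) (κ := ε ^ 2) (by positivity)
    (pow_le_one₀ hε.le hε1)
  have E2 := energy_second hM₁ hM₂.m_le hc hδ h0 hh ht.le hy hy' hp hq hq' ha hb ha0 hab hb1 ha'
    (heq.mono fun t h χ => h _ (Or.inl ⟨χ, rfl⟩)) hε hε1
  have T0 := hq.norm_sq_le ht hq' (s := t₀) ⟨le_rfl, ht.le⟩
  have T1 := hq.norm_sq_le ht hq' (s := t₁) ⟨ht.le, le_rfl⟩
  have g0 := (abs_le.1 (abs_real_inner_le_norm (q t₀) (g (M₁ (y t₀))))).1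
  have g1 := (abs_le.1 (abs_real_inner_le_norm (q t₁) (g (M₁ (y t₁))))).2
  have k0 := mul_le_mul_of_nonneg_left (hM₁.norm_g_le (y t₀)) (norm_nonneg (q t₀))
  have k1 := mul_le_mul_of_nonneg_left (hM₁.norm_g_le (y t₁)) (norm_nonneg (q t₁))
  have s0 := (hM₁.n_le (g (y t₀))).trans (hM₂.n_le (g (y t₀)))
  have s1 := hM₂.m_le (v (y t₀))
  have hD0 : 0 < δ⁻¹ := inv_pos.2 hδ
  set IY := ∫ t in Ioc t₀ t₁, ‖P (v (y t))‖ ^ 2 with hIY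
  set IY' := ∫ t in Ioc t₀ t₁, ‖P (v (y' t))‖ ^ 2 with hIY'
  set IZ := ∫ t in Ioc t₀ t₁, ‖R (g (y t))‖ ^ 2 with hIZ
  set IP := ∫ t in Ioc t₀ t₁, ‖p t‖ ^ 2 with hIP
  set IQ := ∫ t in Ioc t₀ t₁, ‖q t‖ ^ 2 with hIQ
  set IQ' := ∫ t in Ioc t₀ t₁, ‖q' t‖ ^ 2 with hIQ'
  set IA := ∫ t in Ioc t₀ t₁, a₂ t * ‖n₂ (g (y t))‖ ^ 2 with hIA
  set IB := ∫ t in Ioc t₀ t₁, a₁ t * ‖m₁ (v (y' t))‖ ^ 2 with hIB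
  have nIY : 0 ≤ IY := integral_nonneg fun _ => by positivity
  have nIY' : 0 ≤ IY' := integral_nonneg fun _ => by positivity
  have nIZ : 0 ≤ IZ := integral_nonneg fun _ => by positivity
  have nIP : 0 ≤ IP := integral_nonneg fun _ => by positivity
  have nIQ : 0 ≤ IQ := integral_nonneg fun _ => by positivity
  have nIQ' : 0 ≤ IQ' := integral_nonneg fun _ => by positivity
  have nIA : 0 ≤ IA := integral_nonneg fun t => mul_nonneg (hb0 t) (by positivity)
  set D := δ⁻¹
  set W := a₂ t₀ * (‖R (g (y t₀))‖ ^ 2 + D ^ 2 * ‖P (v (y t₀))‖ ^ 2) +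
        D ^ 4 * IY + IP + D ^ 2 * IQ + δ ^ 2 * IQ' with hW
  set S := IY' + D ^ 2 * IZ with hS
  have nS : 0 ≤ S := by positivity
  have nI0 : 0 ≤ a₂ t₀ * (‖R (g (y t₀))‖ ^ 2 + D ^ 2 * ‖P (v (y t₀))‖ ^ 2) :=
    mul_nonneg (hb0 _) (by positivity)
  have hεi : 1 ≤ ε⁻¹ := (one_le_inv₀ hε).2 hε1
  have hεε : ε * ε⁻¹ = 1 := mul_inv_cancel₀ hε.ne'
  have t1 : 0 ≤ D ^ 4 * IY := by positivity
  have t2 : 0 ≤ D ^ 2 * IQ := by positivity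
  have t3 : 0 ≤ δ ^ 2 * IQ' := by positivity
  have nW : 0 ≤ W := by positivity
  -- the trace of `q`
  have TT : 2 * (t₁ - t₀)⁻¹ * IQ + 2 * (t₁ - t₀) * IQ' ≤ 2 * c * W := by
    have h1 : 2 * (t₁ - t₀)⁻¹ * IQ ≤ 2 * (c * D ^ 2) * IQ := by gcongr
    have h2 : 2 * (t₁ - t₀) * IQ' ≤ 2 * (c * δ ^ 2) * IQ' := by gcongr
    have h3 : D ^ 2 * IQ + δ ^ 2 * IQ' ≤ W := by linarith
    have h4 := mul_le_mul_of_nonneg_left h3 (by positivity : 0 ≤ 2 * c)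
    linarith
  -- the first energy estimate
  set B := ε ^ 4 * S + 4 * (1 + c) ^ 2 * ε⁻¹ ^ 4 * W with hB
  have e4 : 1 ≤ ε⁻¹ ^ 4 := one_le_pow₀ hεi
  have E1' : a₂ t₁ * (D ^ 2 / 2 * ‖m₂ (v (y t₁))‖ ^ 2) + D ^ 2 / 2 * IA ≤ B := by
    refine E1.trans ?_
    have r1 : a₂ t₀ * (D ^ 2 / 2 * ‖m₂ (v (y t₀))‖ ^ 2) ≤
        a₂ t₀ * (‖R (g (y t₀))‖ ^ 2 + D ^ 2 * ‖P (v (y t₀))‖ ^ 2) := by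
      refine mul_le_mul_of_nonneg_left ?_ (hb0 _)
      have : ‖m₂ (v (y t₀))‖ ^ 2 ≤ ‖P (v (y t₀))‖ ^ 2 := by gcongr
      have := mul_le_mul_of_nonneg_left this (sq_nonneg D)
      have h3 : 0 ≤ D ^ 2 * ‖P (v (y t₀))‖ ^ 2 := by positivity
      linarith only [this, h3, sq_nonneg ‖R (g (y t₀))‖]
    have r2 : (ε ^ 2)⁻¹ ^ 2 * (D ^ 4 * IY) + IP + D ^ 2 * IQ ≤ ε⁻¹ ^ 4 * W := by
      have h1 : (ε ^ 2)⁻¹ ^ 2 = ε⁻¹ ^ 4 := by rw [inv_pow, inv_pow]; ring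
      rw [h1]
      have h2 : D ^ 4 * IY + IP + D ^ 2 * IQ ≤ W := by linarith
      have h3 := mul_le_mul_of_nonneg_left h2 (by positivity : 0 ≤ ε⁻¹ ^ 4)
      have h4 := le_mul_of_one_le_left nIP e4
      have h5 := le_mul_of_one_le_left t2 e4
      linarith
    have r3 := mul_le_mul_of_nonneg_left r2 (by positivity : 0 ≤ 3 * (1 + c) ^ 2)
    have r4 : W ≤ (1 + c) ^ 2 * (ε⁻¹ ^ 4 * W) := by
      have h1 := le_mul_of_one_le_left nW e4
      have h2 : (1:ℝ) ≤ (1 + c) ^ 2 := one_le_pow₀ (by linarith)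
      exact h1.trans (le_mul_of_one_le_left (by positivity) h2)
    have r5 : (ε ^ 2) ^ 2 * S = ε ^ 4 * S := by ring
    rw [r5, hB]
    linarith
  have nB : 0 ≤ B := by positivity
  have nm2 : 0 ≤ a₂ t₁ * (D ^ 2 / 2 * ‖m₂ (v (y t₁))‖ ^ 2) := mul_nonneg (hb0 _) (by positivity)
  have IAle : D ^ 2 * IA ≤ 2 * B := by linarith
  -- the boundary terms of the second energy estimate
  have bd1 : - (a₁ t₁ * (‖n₁ (g (y t₁))‖ ^ 2 / 2 - inner ℝ (q t₁) (g (M₁ (y t₁))))) ≤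
      2 * c * W + c ^ 2 * B := by
    have h1 : - (‖n₁ (g (y t₁))‖ ^ 2 / 2 - inner ℝ (q t₁) (g (M₁ (y t₁)))) ≤
        ‖q t₁‖ ^ 2 + c ^ 2 * (D ^ 2 / 2 * ‖m₂ (v (y t₁))‖ ^ 2) := by
      refine (neg_half_sq_sub_le (g1.trans k1)).trans (le_of_eq ?_)
      ring
    have h2 := mul_le_mul_of_nonneg_left h1 (ha0 t₁)
    have h3 := mul_le_of_le_one_left (sq_nonneg ‖q t₁‖) ((hab t₁).trans (hb1 t₁))
    have h4 := mul_le_mul_of_nonneg_right (hab t₁)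
      (by positivity : 0 ≤ c ^ 2 * (D ^ 2 / 2 * ‖m₂ (v (y t₁))‖ ^ 2))
    have h5 : a₂ t₁ * (D ^ 2 / 2 * ‖m₂ (v (y t₁))‖ ^ 2) ≤ B := by
      have : 0 ≤ D ^ 2 / 2 * IA := by positivity
      linarith
    have h6 := mul_le_mul_of_nonneg_left h5 (sq_nonneg c)
    linarith
  have bd0 : a₁ t₀ * (‖n₁ (g (y t₀))‖ ^ 2 / 2 - inner ℝ (q t₀) (g (M₁ (y t₀)))) ≤
      2 * c * W + (1 + c ^ 2) * W := by
    have h1 : (‖n₁ (g (y t₀))‖ ^ 2 / 2 - inner ℝ (q t₀) (g (M₁ (y t₀)))) ≤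
        ‖q t₀‖ ^ 2 + (1 + c ^ 2) * (‖R (g (y t₀))‖ ^ 2 + D ^ 2 * ‖P (v (y t₀))‖ ^ 2) := by
      have h2 : ‖n₁ (g (y t₀))‖ ^ 2 ≤ ‖R (g (y t₀))‖ ^ 2 := by gcongr
      have h3 : D ^ 2 * ‖m₂ (v (y t₀))‖ ^ 2 ≤ D ^ 2 * ‖P (v (y t₀))‖ ^ 2 := by gcongr
      have h4 : 0 ≤ D ^ 2 * ‖P (v (y t₀))‖ ^ 2 := by positivity
      have h5 := mul_le_mul_of_nonneg_left h3 (sq_nonneg c)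
      have h6 : 0 ≤ c ^ 2 * (D ^ 2 * ‖P (v (y t₀))‖ ^ 2) := by positivity
      have h7 : 0 ≤ c ^ 2 * ‖R (g (y t₀))‖ ^ 2 := by positivity
      have h8 := half_sq_sub_le ((neg_le_neg k0).trans g0)
      have h9 : (c * D * ‖m₂ (v (y t₀))‖) ^ 2 = c ^ 2 * (D ^ 2 * ‖m₂ (v (y t₀))‖ ^ 2) := by ring
      linarith only [h2, h4, h5, h6, h7, h8, h9]
    have h2 := mul_le_mul_of_nonneg_left h1 (ha0 t₀)
    have h3 := mul_le_of_le_one_left (sq_nonneg ‖q t₀‖) ((hab t₀).trans (hb1 t₀))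
    have h4 := mul_le_mul_of_nonneg_right (hab t₀)
      (by positivity : 0 ≤ (1 + c ^ 2) * (‖R (g (y t₀))‖ ^ 2 + D ^ 2 * ‖P (v (y t₀))‖ ^ 2))
    have h5 : a₂ t₀ * (‖R (g (y t₀))‖ ^ 2 + D ^ 2 * ‖P (v (y t₀))‖ ^ 2) ≤ W := by linarith
    have h6 := mul_le_mul_of_nonneg_left h5 (by positivity : 0 ≤ 1 + c ^ 2)
    linarith
  have e2 : 1 ≤ ε⁻¹ ^ 2 := one_le_pow₀ hεi
  have mid : ε⁻¹ ^ 2 * (D ^ 2 * IA + IP) + D ^ 4 * IY + D ^ 2 * IQ + δ ^ 2 * IQ' ≤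
      ε⁻¹ ^ 2 * (2 * B + W) := by
    have h1 : D ^ 2 * IA + IP + (D ^ 4 * IY + D ^ 2 * IQ + δ ^ 2 * IQ') ≤ 2 * B + W := by linarith
    have h2 := mul_le_mul_of_nonneg_left h1 (by positivity : 0 ≤ ε⁻¹ ^ 2)
    have h3 := le_mul_of_one_le_left (by positivity : 0 ≤ D ^ 4 * IY + D ^ 2 * IQ + δ ^ 2 * IQ') e2
    linarith
  have mid' := mul_le_mul_of_nonneg_left mid (by positivity : 0 ≤ 3 * (1 + c) ^ 3)
  have hS' : (c * (h / δ) + 2 * ε ^ 2) * IY' ≤ (c * (h / δ) + 2 * ε ^ 2) * S := by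
    have : 0 ≤ D ^ 2 * IZ := by positivity
    have h2 : IY' ≤ S := by linarith
    gcongr
  -- collect
  have hBε : ε⁻¹ ^ 2 * B = ε ^ 2 * S + 4 * (1 + c) ^ 2 * (ε⁻¹ ^ 6 * W) := by
    rw [hB]
    have h1 : ε⁻¹ ^ 2 * ε ^ 4 = ε ^ 2 := by
      have : ε⁻¹ ^ 2 * ε ^ 4 = ε ^ 2 * (ε * ε⁻¹) ^ 2 := by ring
      rw [this, hεε]; ring
    linear_combination S * h1
  have nBε : B ≤ ε⁻¹ ^ 2 * B := le_mul_of_one_le_left nB e2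
  have nWε : W ≤ ε⁻¹ ^ 6 * W := le_mul_of_one_le_left nW (one_le_pow₀ hεi)
  have nWε2 : ε⁻¹ ^ 2 * W ≤ ε⁻¹ ^ 6 * W := by
    gcongr ?_ * W
    exact pow_le_pow_right₀ hεi (by norm_num)
  have total : IB + D ^ 2 * IA ≤ (c * (h / δ) + 2 * ε ^ 2) * S + (c ^ 2 + 6 * (1 + c) ^ 3 + 2) *
      (ε⁻¹ ^ 2 * B) + (4 * c + 1 + c ^ 2 + 3 * (1 + c) ^ 3) * (ε⁻¹ ^ 6 * W) := by
    have h1 := mul_le_mul_of_nonneg_left nBε (by positivity : 0 ≤ c ^ 2 + 2)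
    have h2 := mul_le_mul_of_nonneg_left nWε (by positivity : 0 ≤ 4 * c + 1 + c ^ 2)
    have h3 := mul_le_mul_of_nonneg_left nWε2 (by positivity : 0 ≤ 3 * (1 + c) ^ 3)
    linarith
  rw [hBε] at total
  refine total.trans ?_
  have c1 : 2 + (c ^ 2 + 6 * (1 + c) ^ 3 + 2) ≤ 100 * (1 + c) ^ 5 := by
    have h3 : (1 + c) ^ 3 ≤ (1 + c) ^ 5 := pow_le_pow_right₀ (by linarith) (by norm_num)
    have h2 : (1 + c) ^ 2 ≤ (1 + c) ^ 5 := pow_le_pow_right₀ (by linarith) (by norm_num)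
    have h0 : 4 + c ^ 2 ≤ 4 * (1 + c) ^ 2 := by linarith only [sq_nonneg c, hc]
    linarith only [h0, h2, h3, pow_nonneg (add_nonneg zero_le_one hc) 5]
  have c2 : (c ^ 2 + 6 * (1 + c) ^ 3 + 2) * (4 * (1 + c) ^ 2) +
      (4 * c + 1 + c ^ 2 + 3 * (1 + c) ^ 3) ≤ 100 * (1 + c) ^ 5 := by
    have h0 : c ^ 2 + 2 ≤ 2 * (1 + c) ^ 2 := by linarith only [sq_nonneg c, hc]
    have h3 : (1 + c) ^ 3 ≤ (1 + c) ^ 5 := pow_le_pow_right₀ (by linarith) (by norm_num)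
    have h2 : (1 + c) ^ 2 ≤ (1 + c) ^ 5 := pow_le_pow_right₀ (by linarith) (by norm_num)
    have h4 : (1 + c) ^ 4 ≤ (1 + c) ^ 5 := pow_le_pow_right₀ (by linarith) (by norm_num)
    have h5 := mul_le_mul_of_nonneg_right h0 (by positivity : 0 ≤ 4 * (1 + c) ^ 2)
    have h6 : 4 * c + 1 + c ^ 2 ≤ 4 * (1 + c) ^ 2 := by linarith only [sq_nonneg c, hc]
    have h7 : 2 * (1 + c) ^ 2 * (4 * (1 + c) ^ 2) = 8 * (1 + c) ^ 4 := by ring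
    have h8 : 6 * (1 + c) ^ 3 * (4 * (1 + c) ^ 2) = 24 * (1 + c) ^ 5 := by ring
    linarith
  have f1 := mul_le_mul_of_nonneg_right c1 (by positivity : 0 ≤ ε ^ 2 * S)
  have f2 := mul_le_mul_of_nonneg_right c2 (by positivity : 0 ≤ ε⁻¹ ^ 6 * W)
  linarith

end EnergyIntegrated

end HeatFEM

namespace HeatFEM

/-! ### Polynomial functions and inverse inequalities -/

section Poly

variable {N : ℕ}

/-- The evaluation of polynomials as functions on `ℝ^N`. -/
noncomputable def evalFun (N : ℕ) : MvPolynomial (Fin N) ℝ →ₗ[ℝ] (Sp N → ℝ) where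
  toFun p x := MvPolynomial.eval (fun i => x i) p
  map_add' p q := by ext; simp
  map_smul' c p := by ext; simp [MvPolynomial.smul_eval]

/-- The functions on `ℝ^N` given by polynomials of degree at most `r`. -/
noncomputable def polyFun (N r : ℕ) : Submodule ℝ (Sp N → ℝ) :=
  (MvPolynomial.restrictTotalDegree (Fin N) ℝ r).map (evalFun N)

theorem mem_polyFun {r : ℕ} {f : Sp N → ℝ} : f ∈ polyFun N r ↔
    ∃ p : MvPolynomial (Fin N) ℝ, p.totalDegree ≤ r ∧
      ∀ x, f x = MvPolynomial.eval (fun i => x i) p := by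
  simp only [polyFun, Submodule.mem_map, MvPolynomial.mem_restrictTotalDegree]
  exact exists_congr fun p => and_congr_right fun _ => ⟨fun h x => by rw [← h]; rfl,
    fun h => funext fun x => (h x).symm⟩

instance (r : ℕ) : FiniteDimensional ℝ (polyFun N r) := by
  unfold polyFun; infer_instance

theorem polyFun_mono {r s : ℕ} (h : r ≤ s) : polyFun N r ≤ polyFun N s := by
  intro f hf
  rw [mem_polyFun] at hf ⊢
  obtain ⟨p, hp, hpe⟩ := hf
  exact ⟨p, hp.trans h, hpe⟩

theorem polyFun_mul {r s : ℕ} {f g : Sp N → ℝ} (hf : f ∈ polyFun N r) (hg : g ∈ polyFun N s) :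
    (fun x => f x * g x) ∈ polyFun N (r + s) := by
  rw [mem_polyFun] at hf hg ⊢
  obtain ⟨p, hp, hpe⟩ := hf
  obtain ⟨q, hq, hqe⟩ := hg
  exact ⟨p * q, (MvPolynomial.totalDegree_mul p q).trans (add_le_add hp hq),
    fun x => by simp [hpe, hqe]⟩

theorem polyFun_const (r : ℕ) (c : ℝ) : (fun _ : Sp N => c) ∈ polyFun N r :=
  mem_polyFun.2 ⟨MvPolynomial.C c, by simp, by simp⟩

theorem polyFun_coord (i : Fin N) : (fun x : Sp N => x i) ∈ polyFun N 1 :=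
  mem_polyFun.2 ⟨MvPolynomial.X i, by simp, by simp⟩

theorem polyFun_prod {ι : Type*} (s : Finset ι) (d : ι → ℕ) (f : ι → Sp N → ℝ)
    (hf : ∀ i ∈ s, f i ∈ polyFun N (d i)) :
    (fun x => ∏ i ∈ s, f i x) ∈ polyFun N (∑ i ∈ s, d i) := by
  classical
  induction s using Finset.induction_on with
  | empty => simpa using polyFun_const 0 1
  | insert a s ha ih =>
    simp only [Finset.prod_insert ha, Finset.sum_insert ha]
    exact polyFun_mul (hf a (by simp)) (ih fun i hi => hf i (by simp [hi]))

theorem polyFun_pow {f : Sp N → ℝ} (hf : f ∈ polyFun N 1) (n : ℕ) :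
    (fun x => f x ^ n) ∈ polyFun N n := by
  simpa using polyFun_prod (Finset.range n) (fun _ => 1) (fun _ => f) (fun _ _ => hf)

theorem polyFun_sum {ι : Type*} (s : Finset ι) {r : ℕ} (f : ι → Sp N → ℝ)
    (hf : ∀ i ∈ s, f i ∈ polyFun N r) : (fun x => ∑ i ∈ s, f i x) ∈ polyFun N r := by
  have := Submodule.sum_mem _ hf
  convert! this using 1
  ext x
  simp

theorem polyFun_const_mul {r : ℕ} {f : Sp N → ℝ} (hf : f ∈ polyFun N r) (c : ℝ) :
    (fun x => c * f x) ∈ polyFun N r :=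
  (polyFun N r).smul_mem c hf

theorem polyFun_linear (L : Sp N →ₗ[ℝ] ℝ) : (fun x => L x) ∈ polyFun N 1 := by
  have : (fun x => L x) = fun x : Sp N => ∑ i, L (EuclideanSpace.single i 1) * x i := by
    ext x
    conv_lhs => rw [← (EuclideanSpace.basisFun (Fin N) ℝ).sum_repr x]
    simp [mul_comm]
  rw [this]
  exact polyFun_sum _ _ fun i _ => polyFun_const_mul (polyFun_coord i) _

theorem polyFun_affine (A : Sp N →ᵃ[ℝ] ℝ) : (fun x => A x) ∈ polyFun N 1 := by
  have : (fun x => A x) = (fun x => A.linear x) + fun _ => A 0 := by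
    ext x
    simpa using A.map_vadd 0 x
  rw [this]
  exact (polyFun N 1).add_mem (polyFun_linear A.linear) (polyFun_const 1 _)

theorem polyFun_comp {r : ℕ} {f : Sp N → ℝ} (hf : f ∈ polyFun N r) (ℓ : Sp N → Sp N)
    (hℓ : ∀ i, (fun x => ℓ x i) ∈ polyFun N 1) : (fun x => f (ℓ x)) ∈ polyFun N r := by
  obtain ⟨p, hp, hpe⟩ := mem_polyFun.1 hf
  simp only [hpe, MvPolynomial.eval_eq']
  refine polyFun_sum _ _ fun d hd => polyFun_const_mul ?_ _
  refine polyFun_mono ?_ (polyFun_prod Finset.univ (fun i => d i) _ fun i _ => polyFun_pow (hℓ i) _)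
  refine le_trans ?_ ((MvPolynomial.le_totalDegree hd).trans hp)
  rw [Finsupp.sum_fintype _ _ (by simp)]

theorem contDiff_of_mem_polyFun {r : ℕ} {f : Sp N → ℝ} (hf : f ∈ polyFun N r) {n : WithTop ℕ∞} :
    ContDiff ℝ n f := by
  obtain ⟨p, hp, hpe⟩ := mem_polyFun.1 hf
  rw [funext hpe]
  simp only [MvPolynomial.eval_eq']
  fun_prop

theorem continuous_of_mem_polyFun {r : ℕ} {f : Sp N → ℝ} (hf : f ∈ polyFun N r) : Continuous f :=
  (contDiff_of_mem_polyFun hf (n := 0)).continuous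

/-- A polynomial function that vanishes on a nonempty open set vanishes. -/
theorem eq_zero_of_mem_polyFun {r : ℕ} {f : Sp N → ℝ} (hf : f ∈ polyFun N r) {U : Set (Sp N)}
    (hU : IsOpen U) (hne : U.Nonempty) (h : ∀ x ∈ U, f x = 0) : f = 0 := by
  obtain ⟨x, hx⟩ := hne
  have han : AnalyticOnNhd ℝ f univ := (contDiff_of_mem_polyFun hf (n := ω)).analyticOnNhd
  have := han.eqOn_zero_of_preconnected_of_eventuallyEq_zero isPreconnected_univ (mem_univ x)
    (Filter.eventually_of_mem (hU.mem_nhds hx) h)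
  exact funext fun y => this (mem_univ y)

/-- On a finite dimensional space, every linear map is bounded by an injective one. -/
theorem exists_bound_of_injective {V E F : Type*} [AddCommGroup V] [Module ℝ V]
    [FiniteDimensional ℝ V] [NormedAddCommGroup E] [NormedSpace ℝ E]
    [NormedAddCommGroup F] [NormedSpace ℝ F] (S : V →ₗ[ℝ] E) (hS : Function.Injective S)
    (T : V →ₗ[ℝ] F) : ∃ C, 0 ≤ C ∧ ∀ x, ‖T x‖ ≤ C * ‖S x‖ := by
  let e := LinearEquiv.ofInjective S hS
  let L : LinearMap.range S →L[ℝ] F := (T.comp e.symm.toLinearMap).toContinuousLinearMap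
  refine ⟨‖L‖, L.opNorm_nonneg, fun x => ?_⟩
  have h1 := L.le_opNorm (e x)
  have h2 : L (e x) = T x := by simp [L]
  rw [h2] at h1
  exact h1

/-- The inverse inequalities on balls of fixed size: the polynomials form a finite dimensional
space, and the mean square over a ball is definite on it. -/
theorem polyFun_inverse_unit (N r : ℕ) {k K : ℝ} (hk : 0 < k) :
    ∃ C, 0 ≤ C ∧ ∀ f ∈ polyFun N r, ∀ x ∈ Metric.closedBall (0 : Sp N) K,
      f x ^ 2 ≤ C * ∫ y in Metric.closedBall (0 : Sp N) k, f y ^ 2 ∧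
      ‖fderiv ℝ f x‖ ^ 2 ≤ C * ∫ y in Metric.closedBall (0 : Sp N) k, f y ^ 2 := by
  have : CompactSpace (Metric.closedBall (0 : Sp N) K) :=
    isCompact_iff_compactSpace.1 (isCompact_closedBall _ _)
  have hmem : ∀ f ∈ polyFun N r, MemLp f 2 (volume.restrict (Metric.closedBall (0 : Sp N) k)) := by
    intro f hf
    refine (memLp_two_iff_integrable_sq ?_).2 ?_
    · exact (continuous_of_mem_polyFun hf).aestronglyMeasurable
    · exact ((continuous_of_mem_polyFun hf).pow 2).continuousOn.integrableOn_compact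
        (isCompact_closedBall _ _)
  let S : polyFun N r →ₗ[ℝ] Lp ℝ 2 (volume.restrict (Metric.closedBall (0 : Sp N) k)) :=
    { toFun := fun f => (hmem f.1 f.2).toLp f.1
      map_add' := fun f g => MemLp.toLp_add (hmem _ f.2) (hmem _ g.2)
      map_smul' := fun c f => MemLp.toLp_const_smul c (hmem _ f.2) }
  have hdiff : ∀ f : polyFun N r, Differentiable ℝ f.1 := fun f =>
    (contDiff_of_mem_polyFun f.2 (n := 1)).differentiable (by simp)
  let T₁ : polyFun N r →ₗ[ℝ] C(Metric.closedBall (0 : Sp N) K, ℝ) :=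
    { toFun := fun f => ⟨fun x => f.1 x, (continuous_of_mem_polyFun f.2).comp
      continuous_subtype_val⟩
      map_add' := fun f g => by ext; simp
      map_smul' := fun c f => by ext; simp }
  let T₂ : polyFun N r →ₗ[ℝ] C(Metric.closedBall (0 : Sp N) K, Sp N →L[ℝ] ℝ) :=
    { toFun := fun f => ⟨fun x => fderiv ℝ f.1 x, ((contDiff_of_mem_polyFun f.2
          (n := 1)).continuous_fderiv (by simp)).comp continuous_subtype_val⟩
      map_add' := fun f g => by
        ext1 x
        exact fderiv_add (hdiff f x) (hdiff g x)
      map_smul' := fun c f => by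
        ext1 x
        exact fderiv_const_smul (hdiff f x) c }
  have hnorm : ∀ f : polyFun N r, ‖S f‖ ^ 2 =
      ∫ y in Metric.closedBall (0 : Sp N) k, f.1 y ^ 2 := by
    intro f
    rw [← real_inner_self_eq_norm_sq, L2.inner_def]
    refine integral_congr_ae ?_
    filter_upwards [(hmem f.1 f.2).coeFn_toLp] with y hy
    change inner ℝ (((hmem f.1 f.2).toLp f.1) y) (((hmem f.1 f.2).toLp f.1) y) = _
    rw [hy]
    simp [sq]
  have hS : Function.Injective S := by
    rw [← LinearMap.ker_eq_bot, LinearMap.ker_eq_bot']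
    intro f hf
    have h1 : (f.1 : Sp N → ℝ) =ᵐ[volume.restrict (Metric.ball (0 : Sp N) k)] fun _ => 0 := by
      refine ae_restrict_of_ae_restrict_of_subset Metric.ball_subset_closedBall ?_
      have h2 := (hmem f.1 f.2).coeFn_toLp
      have h3 : ((hmem f.1 f.2).toLp f.1) = 0 := hf
      rw [h3] at h2
      exact h2.symm.trans (Lp.coeFn_zero _ _ _)
    have h4 := Measure.eqOn_open_of_ae_eq h1 Metric.isOpen_ball
      (continuous_of_mem_polyFun f.2).continuousOn continuousOn_const
    exact Subtype.ext (eq_zero_of_mem_polyFun f.2 Metric.isOpen_ball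
      ⟨0, Metric.mem_ball_self hk⟩ h4)
  obtain ⟨C₁, -, hC₁⟩ := exists_bound_of_injective S hS T₁
  obtain ⟨C₂, -, hC₂⟩ := exists_bound_of_injective
    (F := C(Metric.closedBall (0 : Sp N) K, Sp N →L[ℝ] ℝ)) S hS T₂
  refine ⟨C₁ ^ 2 + C₂ ^ 2, by positivity, fun f hf x hx => ?_⟩
  have h4 : ‖f x‖ ≤ C₁ * ‖S ⟨f, hf⟩‖ :=
    ((T₁ ⟨f, hf⟩).norm_coe_le_norm ⟨x, hx⟩).trans (hC₁ ⟨f, hf⟩)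
  have h5 : ‖fderiv ℝ f x‖ ≤ C₂ * ‖S ⟨f, hf⟩‖ :=
    ((T₂ ⟨f, hf⟩).norm_coe_le_norm ⟨x, hx⟩).trans (hC₂ ⟨f, hf⟩)
  rw [← hnorm ⟨f, hf⟩, add_mul, ← mul_pow, ← mul_pow]
  constructor
  · rw [← sq_abs, ← Real.norm_eq_abs]
    exact (pow_le_pow_left₀ (norm_nonneg _) h4 2).trans (le_add_of_nonneg_right (sq_nonneg _))
  · exact (pow_le_pow_left₀ (norm_nonneg _) h5 2).trans (le_add_of_nonneg_left (sq_nonneg _))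

open scoped Pointwise in
/-- The inverse inequalities for polynomials of bounded degree, on concentric balls of comparable
radii: bounds for a polynomial and its derivative in terms of its mean square. -/
theorem polyFun_inverse (N r : ℕ) {K : ℝ} (hK : 0 < K) :
    ∃ C, 0 ≤ C ∧ ∀ (c : Sp N) (h : ℝ), 0 < h → ∀ f ∈ polyFun N r,
      ∀ x ∈ Metric.closedBall c (K * h),
      f x ^ 2 * volume.real (Metric.closedBall c (K * h)) ≤
        C * ∫ y in Metric.closedBall c (K⁻¹ * h), f y ^ 2 ∧
      h ^ 2 * ‖fderiv ℝ f x‖ ^ 2 * volume.real (Metric.closedBall c (K * h)) ≤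
        C * ∫ y in Metric.closedBall c (K⁻¹ * h), f y ^ 2 := by
  obtain ⟨C, hC0, hC⟩ := polyFun_inverse_unit N r (K := K) (inv_pos.2 hK)
  refine ⟨C * volume.real (Metric.closedBall (0 : Sp N) K), by positivity, ?_⟩
  intro c h hh f hf x hx
  -- scaling to balls of fixed size
  set g : Sp N → ℝ := fun y => f (c + h • y) with hg
  have hgp : g ∈ polyFun N r := polyFun_comp hf (fun y => c + h • y) fun i => by
    have := (polyFun N 1).add_mem (polyFun_const (N := N) 1 (c i))
      (polyFun_const_mul (polyFun_coord i) h)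
    convert this using 1
    ext x
    simp
  obtain ⟨x', rfl⟩ : ∃ x', x = c + h • x' := ⟨h⁻¹ • (x - c), by
    rw [smul_inv_smul₀ hh.ne']; abel⟩
  have hx' : x' ∈ Metric.closedBall (0 : Sp N) K := by
    rw [mem_closedBall_iff_norm, add_sub_cancel_left, norm_smul, Real.norm_of_nonneg hh.le,
      mul_comm] at hx
    rw [mem_closedBall_zero_iff]
    exact le_of_mul_le_mul_right hx hh
  obtain ⟨h1, h2⟩ := hC g hgp x' hx'
  have hfd : fderiv ℝ g x' = h • fderiv ℝ f (c + h • x') := by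
    have hd : HasFDerivAt (fun y : Sp N => c + h • y) (h • ContinuousLinearMap.id ℝ (Sp N)) x' :=
      ((hasFDerivAt_id x').const_smul h).const_add c
    have := (((contDiff_of_mem_polyFun hf (n := 1)).differentiable (by simp)
      (c + h • x')).hasFDerivAt.comp x' hd).fderiv
    rw [hg]
    refine Eq.trans this ?_
    ext z
    simp
  have hball : ∀ ρ, h • Metric.closedBall (0 : Sp N) ρ = Metric.closedBall 0 (ρ * h) := by
    intro ρ
    rw [smul_closedBall' hh.ne', smul_zero, Real.norm_of_nonneg hh.le, mul_comm]
  have hvol : volume.real (Metric.closedBall c (K * h)) =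
      h ^ N * volume.real (Metric.closedBall (0 : Sp N) K) := by
    rw [Measure.real, Measure.real, Measure.addHaar_closedBall_center volume c (K * h), ← hball,
      Measure.addHaar_smul]
    simp [abs_of_pos hh, ENNReal.toReal_mul, hh.le]
  have hint : ∫ y in Metric.closedBall (0 : Sp N) K⁻¹, g y ^ 2 =
      (h ^ N)⁻¹ * ∫ y in Metric.closedBall c (K⁻¹ * h), f y ^ 2 := by
    have e1 := Measure.setIntegral_comp_smul_of_pos (volume : Measure (Sp N))
      (fun y => f (c + y) ^ 2) (Metric.closedBall 0 K⁻¹) hh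
    rw [hball] at e1
    simp only [hg]
    rw [e1, finrank_euclideanSpace_fin, smul_eq_mul]
    congr 1
    have e2 := (measurePreserving_add_left (volume : Measure (Sp N)) c).setIntegral_preimage_emb
      (measurableEmbedding_addLeft c) (fun y => f y ^ 2) (Metric.closedBall c (K⁻¹ * h))
    rw [← e2]
    congr 2
    ext y
    simp
  rw [hint] at h1 h2
  have hhN : 0 < h ^ N := by positivity
  have hV : 0 ≤ volume.real (Metric.closedBall (0 : Sp N) K) := measureReal_nonneg
  rw [hvol]
  set I := ∫ y in Metric.closedBall c (K⁻¹ * h), f y ^ 2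
  set V := volume.real (Metric.closedBall (0 : Sp N) K)
  have hcancel : (h ^ N)⁻¹ * (h ^ N) = 1 := inv_mul_cancel₀ hhN.ne'
  constructor
  · have := mul_le_mul_of_nonneg_right h1 (mul_nonneg hhN.le hV)
    calc _ ≤ _ := this
      _ = C * V * I * ((h ^ N)⁻¹ * h ^ N) := by ring
      _ = _ := by rw [hcancel, mul_one]
  · rw [hfd, norm_smul, Real.norm_of_nonneg hh.le, mul_pow] at h2
    have := mul_le_mul_of_nonneg_right h2 (mul_nonneg hhN.le hV)
    calc _ ≤ _ := this
      _ = C * V * I * ((h ^ N)⁻¹ * h ^ N) := by ring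
      _ = _ := by rw [hcancel, mul_one]

end Poly

end HeatFEM

namespace HeatFEM

/-! ### Barycentric coordinates and Lagrange interpolation on a simplex -/

section Simplex

variable {N : ℕ}

/-- The vertex set of a nondegenerate `N`-simplex. -/
def IsCell (s : Finset (Sp N)) : Prop := s.card = N + 1 ∧ AffineIndependent ℝ ((↑) : s → Sp N)

/-- The vertices of a nondegenerate simplex as an affine basis. -/
noncomputable def cellBasis (s : Finset (Sp N)) (hs : IsCell s) : AffineBasis s ℝ (Sp N) :=
  ⟨(↑), hs.2, by
    rw [hs.2.affineSpan_eq_top_iff_card_eq_finrank_add_one]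
    simp [hs.1]⟩

open Classical in
/-- The barycentric coordinate of `x` at the vertex `v` of the simplex `s`; it is `0` if `v` is not
a vertex of `s`. -/
noncomputable def bary (s : Finset (Sp N)) (v x : Sp N) : ℝ :=
  if h : IsCell s ∧ v ∈ s then (cellBasis s h.1).coord ⟨v, h.2⟩ x else 0

variable {s : Finset (Sp N)}

theorem bary_eq (hs : IsCell s) {v : Sp N} (hv : v ∈ s) (x : Sp N) :
    bary s v x = (cellBasis s hs).coord ⟨v, hv⟩ x := by
  rw [bary, dif_pos ⟨hs, hv⟩]

theorem bary_of_notMem {v : Sp N} (hv : v ∉ s) (x : Sp N) : bary s v x = 0 := by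
  rw [bary, dif_neg fun h => hv h.2]

theorem bary_mem_polyFun (s : Finset (Sp N)) (v : Sp N) : bary s v ∈ polyFun N 1 := by
  by_cases h : IsCell s ∧ v ∈ s
  · have := polyFun_affine ((cellBasis s h.1).coord ⟨v, h.2⟩)
    convert this using 1
    ext x
    exact bary_eq h.1 h.2 x
  · have : bary s v = fun _ => (0 : ℝ) := by ext x; rw [bary, dif_neg h]
    rw [this]
    exact polyFun_const 1 0

theorem sum_bary (hs : IsCell s) (x : Sp N) : ∑ v ∈ s, bary s v x = 1 := by
  rw [← (cellBasis s hs).sum_coord_apply_eq_one x, ← Finset.sum_coe_sort]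
  exact Finset.sum_congr rfl fun v _ => bary_eq hs v.2 x

theorem sum_bary_smul (hs : IsCell s) (x : Sp N) : ∑ v ∈ s, bary s v x • v = x := by
  conv_rhs => rw [← (cellBasis s hs).linear_combination_coord_eq_self x]
  rw [← Finset.sum_coe_sort]
  exact Finset.sum_congr rfl fun v _ => by rw [bary_eq hs v.2 x]; rfl

theorem bary_combination (hs : IsCell s) {w : Sp N → ℝ} (hw : ∑ v ∈ s, w v = 1) {v : Sp N}
    (hv : v ∈ s) : bary s v (∑ u ∈ s, w u • u) = w v := by
  have h1 : ∑ u : s, w u = 1 := by rw [Finset.sum_coe_sort s w, hw]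
  have h2 : ∑ u ∈ s, w u • u = (Finset.univ : Finset s).affineCombination ℝ (cellBasis s hs)
      (fun u => w u) := by
    rw [Finset.affineCombination_eq_linear_combination _ _ _ h1, ← Finset.sum_coe_sort]
    rfl
  rw [bary_eq hs hv, h2, (cellBasis s hs).coord_apply_combination_of_mem (Finset.mem_univ _) h1]

theorem mem_convexHull_iff_bary (hs : IsCell s) {x : Sp N} :
    x ∈ convexHull ℝ (s : Set (Sp N)) ↔ ∀ v ∈ s, 0 ≤ bary s v x := by
  have h := (cellBasis s hs).convexHull_eq_nonneg_coord
  have hr : range (cellBasis s hs) = (s : Set (Sp N)) := by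
    change range ((↑) : s → Sp N) = _
    simp
  rw [hr] at h
  rw [h]
  exact ⟨fun H v hv => by rw [bary_eq hs hv]; exact H _, fun H v => by
    have := H v.1 v.2
    rwa [bary_eq hs v.2] at this⟩

theorem bary_le_one (hs : IsCell s) {x : Sp N} (hx : x ∈ convexHull ℝ (s : Set (Sp N)))
    (v : Sp N) : bary s v x ≤ 1 := by
  by_cases hv : v ∈ s
  · rw [← sum_bary hs x]
    exact Finset.single_le_sum (f := fun v => bary s v x)
      (fun u hu => (mem_convexHull_iff_bary hs).1 hx u hu) hv
  · rw [bary_of_notMem hv]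
    exact zero_le_one

/-- On a common subsimplex the barycentric coordinates of two simplices agree; in particular they
vanish at the other vertices. -/
theorem bary_eq_of_mem_subface {s t u : Finset (Sp N)} (hs : IsCell s) (ht : IsCell t)
    (hus : u ⊆ s) (hut : u ⊆ t) {x : Sp N} (hx : x ∈ convexHull ℝ (u : Set (Sp N))) (v : Sp N) :
    bary s v x = bary t v x ∧ (v ∉ u → bary s v x = 0) := by
  classical
  obtain ⟨w, hw0, hw1, hwx⟩ := Finset.mem_convexHull'.1 hx
  have key : ∀ q : Finset (Sp N), IsCell q → u ⊆ q → bary q v x = if v ∈ u then w v else 0 := by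
    intro q hq huq
    by_cases hv : v ∈ q
    · have e1 : ∑ y ∈ q, (if y ∈ u then w y else 0) = 1 := by
        rw [← hw1, Finset.sum_ite_mem, Finset.inter_eq_right.2 huq]
      have e2 : ∑ y ∈ q, (if y ∈ u then w y else 0) • y = x := by
        rw [← hwx]
        simp only [ite_smul, zero_smul]
        rw [Finset.sum_ite_mem, Finset.inter_eq_right.2 huq]
      have := bary_combination hq e1 hv
      rwa [e2] at this
    · rw [bary_of_notMem hv, if_neg fun h => hv (huq h)]
  rw [key s hs hus, key t ht hut]
  exact ⟨rfl, fun hv => if_neg hv⟩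

/-- The Lagrange node with barycentric coordinates `m v / r`. -/
noncomputable def lagNode (s : Finset (Sp N)) (r : ℕ) (m : Sp N → ℕ) : Sp N :=
  ∑ v ∈ s, ((m v : ℝ) / r) • v

/-- The Lagrange polynomial of degree `r` at the node of index `m`, as a product of affine
functions of the barycentric coordinates. -/
noncomputable def lagPoly (s : Finset (Sp N)) (r : ℕ) (m : Sp N → ℕ) (x : Sp N) : ℝ :=
  ∏ v ∈ s, ∏ k ∈ Finset.range (m v), (r * bary s v x - k) / (m v - k)

open Classical in
/-- The indices of the Lagrange nodes of degree `r` of the simplex `s`. -/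
noncomputable def lagIdx (s : Finset (Sp N)) (r : ℕ) : Finset (Sp N → ℕ) :=
  Finset.piAntidiag s r

theorem mem_lagIdx {r : ℕ} {m : Sp N → ℕ} :
    m ∈ lagIdx s r ↔ ∑ v ∈ s, m v = r ∧ ∀ v, m v ≠ 0 → v ∈ s := by
  classical
  rw [lagIdx, Finset.mem_piAntidiag]

theorem lagPoly_mem_polyFun {r : ℕ} {m : Sp N → ℕ} (hm : m ∈ lagIdx s r) :
    lagPoly s r m ∈ polyFun N r := by
  have h := (mem_lagIdx.1 hm).1
  have : (fun x => ∏ v ∈ s, ∏ k ∈ Finset.range (m v), (r * bary s v x - k) / (m v - k)) ∈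
      polyFun N (∑ v ∈ s, ∑ k ∈ Finset.range (m v), 1) := by
    refine polyFun_prod _ _ _ fun v _ => polyFun_prod _ _ _ fun k _ => ?_
    have h1 := (polyFun N 1).add_mem (polyFun_const_mul (bary_mem_polyFun s v)
      ((r : ℝ) / (m v - k))) (polyFun_const 1 (-(k : ℝ) / (m v - k)))
    convert h1 using 1
    ext x
    simp only [Pi.add_apply]
    ring
  simp only [Finset.sum_const, Finset.card_range, smul_eq_mul, mul_one, h] at this
  exact this

theorem bary_lagNode (hs : IsCell s) {r : ℕ} (hr : 1 ≤ r) {m : Sp N → ℕ} (hm : m ∈ lagIdx s r)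
    {v : Sp N} (hv : v ∈ s) : bary s v (lagNode s r m) = m v / r := by
  have hr0 : (r : ℝ) ≠ 0 := by positivity
  refine bary_combination hs (w := fun v => (m v : ℝ) / r) ?_ hv
  rw [← Finset.sum_div, ← Nat.cast_sum, (mem_lagIdx.1 hm).1, div_self hr0]

theorem lagNode_mem_convexHull (hs : IsCell s) {r : ℕ} (hr : 1 ≤ r) {m : Sp N → ℕ}
    (hm : m ∈ lagIdx s r) : lagNode s r m ∈ convexHull ℝ (s : Set (Sp N)) := by
  rw [mem_convexHull_iff_bary hs]
  intro v hv
  rw [bary_lagNode hs hr hm hv]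
  positivity

theorem lagPoly_lagNode (hs : IsCell s) {r : ℕ} (hr : 1 ≤ r) {m m' : Sp N → ℕ}
    (hm : m ∈ lagIdx s r) (hm' : m' ∈ lagIdx s r) [Decidable (m = m')] :
    lagPoly s r m (lagNode s r m') = if m = m' then 1 else 0 := by
  have hr0 : (r : ℝ) ≠ 0 := by positivity
  have hval : ∀ v ∈ s, (r : ℝ) * bary s v (lagNode s r m') = m' v := fun v hv => by
    rw [bary_lagNode hs hr hm' hv]; field_simp
  split_ifs with h
  · subst h
    refine Finset.prod_eq_one fun v hv => Finset.prod_eq_one fun k hk => ?_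
    rw [hval v hv, div_self]
    have : (k : ℝ) < m v := by exact_mod_cast Finset.mem_range.1 hk
    exact (sub_pos.2 this).ne'
  -- different indices of the same degree: the factor with `k = m' v` vanishes for some `v`
  · obtain ⟨v, hv, hlt⟩ : ∃ v ∈ s, m' v < m v := by
      by_contra! hle
      have heq := (Finset.sum_eq_sum_iff_of_le hle).1
        ((mem_lagIdx.1 hm).1.trans (mem_lagIdx.1 hm').1.symm)
      refine h (funext fun v => ?_)
      by_cases hv : v ∈ s
      · exact heq v hv
      · have h1 : m v = 0 := by_contra fun h0 => hv ((mem_lagIdx.1 hm).2 v h0)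
        have h2 : m' v = 0 := by_contra fun h0 => hv ((mem_lagIdx.1 hm').2 v h0)
        rw [h1, h2]
    refine Finset.prod_eq_zero hv (Finset.prod_eq_zero (Finset.mem_range.2 hlt) ?_)
    rw [hval v hv, sub_self, zero_div]

theorem abs_lagPoly_le (hs : IsCell s) {r : ℕ} (hr : 1 ≤ r) {m : Sp N → ℕ}
    (hm : m ∈ lagIdx s r) {x : Sp N} (hx : x ∈ convexHull ℝ (s : Set (Sp N))) :
    |lagPoly s r m x| ≤ (r : ℝ) ^ r := by
  have h := (mem_lagIdx.1 hm).1
  have hr1 : (1 : ℝ) ≤ r := by exact_mod_cast hr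
  rw [lagPoly, Finset.abs_prod]
  calc ∏ v ∈ s, |∏ k ∈ Finset.range (m v), (r * bary s v x - k) / (m v - k)|
      ≤ ∏ v ∈ s, (r : ℝ) ^ m v := by
        refine Finset.prod_le_prod (fun _ _ => abs_nonneg _) fun v hv => ?_
        rw [Finset.abs_prod]
        calc _ ≤ ∏ k ∈ Finset.range (m v), (r : ℝ) := by
              refine Finset.prod_le_prod (fun _ _ => abs_nonneg _) fun k hk => ?_
              have hk' : (k : ℝ) + 1 ≤ m v := by exact_mod_cast Finset.mem_range.1 hk
              have hmr : (m v : ℝ) ≤ r := by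
                rw [← h]
                exact_mod_cast Finset.single_le_sum (f := m) (fun _ _ => Nat.zero_le _) hv
              have h0 := (mem_convexHull_iff_bary hs).1 hx v hv
              have h1 := bary_le_one hs hx v
              have hk0 : (0 : ℝ) ≤ k := Nat.cast_nonneg k
              rw [abs_div, abs_of_pos (by linarith : (0 : ℝ) < m v - k),
                div_le_iff₀ (by linarith), abs_le]
              constructor <;> nlinarith
          _ = (r : ℝ) ^ m v := by simp
    _ = (r : ℝ) ^ r := by rw [Finset.prod_pow_eq_pow_sum, h]

open Classical in
/-- The span of the homogeneous monomials of degree `r` in the barycentric coordinates. -/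
noncomputable def baryMon (s : Finset (Sp N)) (r : ℕ) : Submodule ℝ (Sp N → ℝ) :=
  Submodule.span ℝ ((lagIdx s r).image (fun m x => ∏ v ∈ s, bary s v x ^ m v) : Finset (Sp N → ℝ))

open Classical in
theorem baryMon_mul {a b : ℕ} {f g : Sp N → ℝ} (hf : f ∈ baryMon s a) (hg : g ∈ baryMon s b) :
    f * g ∈ baryMon s (a + b) := by
  have h := Submodule.mul_mem_mul hf hg
  rw [baryMon, baryMon, Submodule.span_mul_span] at h
  refine Submodule.span_mono ?_ h
  rintro _ ⟨p, hp, q, hq, rfl⟩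
  simp only [Finset.coe_image, mem_image, SetLike.mem_coe, mem_lagIdx] at hp hq ⊢
  obtain ⟨m, hm, rfl⟩ := hp
  obtain ⟨m', hm', rfl⟩ := hq
  refine ⟨m + m', ⟨?_, fun v hv => ?_⟩, ?_⟩
  · simp [Finset.sum_add_distrib, hm.1, hm'.1]
  · by_cases h0 : m v = 0
    · exact hm'.2 v (by simpa [h0] using hv)
    · exact hm.2 v h0
  · ext x
    simp [pow_add, Finset.prod_mul_distrib]

theorem bary_mem_baryMon {v : Sp N} (hv : v ∈ s) : bary s v ∈ baryMon s 1 := by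
  classical
  refine Submodule.subset_span ?_
  simp only [Finset.coe_image, mem_image, SetLike.mem_coe, mem_lagIdx]
  refine ⟨Pi.single v 1, ⟨by simp [hv, Pi.single_apply], fun u hu => ?_⟩, ?_⟩
  · by_contra h
    have hne : u ≠ v := fun h' => h (by rw [h']; exact hv)
    exact hu (Pi.single_eq_of_ne hne 1)
  · ext x
    rw [Finset.prod_eq_single_of_mem v hv (fun u _ hu => by simp [hu])]
    simp

theorem sum_mul_bary_mem_baryMon (c : Sp N → ℝ) :
    (fun x => ∑ v ∈ s, c v * bary s v x) ∈ baryMon s 1 := by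
  have := Submodule.sum_mem (baryMon s 1) fun v hv =>
    (baryMon s 1).smul_mem (c v) (bary_mem_baryMon hv)
  convert! this using 1
  ext x
  simp

theorem one_mem_baryMon (hs : IsCell s) (r : ℕ) : (1 : Sp N → ℝ) ∈ baryMon s r := by
  classical
  induction r with
  | zero =>
    refine Submodule.subset_span ?_
    simp only [Finset.coe_image, mem_image, SetLike.mem_coe, mem_lagIdx]
    exact ⟨0, by simp, by ext; simp⟩
  | succ r ih =>
    have h1 : (1 : Sp N → ℝ) ∈ baryMon s 1 := by
      have := sum_mul_bary_mem_baryMon (s := s) (fun _ => 1)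
      simp only [one_mul, sum_bary hs] at this
      exact this
    simpa using baryMon_mul ih h1

theorem coord_mem_baryMon (hs : IsCell s) (i : Fin N) :
    (fun x : Sp N => x i) ∈ baryMon s 1 := by
  have := sum_mul_bary_mem_baryMon (s := s) (fun v => v i)
  convert this using 1
  ext x
  conv_lhs => rw [← sum_bary_smul hs x]
  simp [mul_comm]

theorem pow_mem_baryMon (hs : IsCell s) {f : Sp N → ℝ} (hf : f ∈ baryMon s 1) (n : ℕ) :
    f ^ n ∈ baryMon s n := by
  induction n with
  | zero => simpa using one_mem_baryMon hs 0
  | succ n ih => rw [pow_succ]; exact baryMon_mul ih hf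

theorem prod_mem_baryMon (hs : IsCell s) {ι : Type*} (q : Finset ι) (d : ι → ℕ)
    (f : ι → Sp N → ℝ) (hf : ∀ i ∈ q, f i ∈ baryMon s (d i)) :
    ∏ i ∈ q, f i ∈ baryMon s (∑ i ∈ q, d i) := by
  classical
  induction q using Finset.induction_on with
  | empty => simpa using one_mem_baryMon hs 0
  | insert a q ha ih =>
    rw [Finset.prod_insert ha, Finset.sum_insert ha]
    exact baryMon_mul (hf a (by simp)) (ih fun i hi => hf i (by simp [hi]))

/-- Polynomials are homogeneous in the barycentric coordinates: the missing degree is supplied by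
powers of the sum of the coordinates, which is `1`. -/
theorem polyFun_le_baryMon (hs : IsCell s) (r : ℕ) : polyFun N r ≤ baryMon s r := by
  intro f hf
  obtain ⟨p, hp, hpe⟩ := mem_polyFun.1 hf
  have : f = ∑ d ∈ p.support, p.coeff d • ∏ i : Fin N, (fun x : Sp N => x i) ^ d i := by
    ext x
    rw [hpe, MvPolynomial.eval_eq']
    simp
  rw [this]
  refine Submodule.sum_mem _ fun d hd => Submodule.smul_mem _ _ ?_
  have h1 := prod_mem_baryMon hs Finset.univ (fun i => d i) _
    fun i _ => pow_mem_baryMon hs (coord_mem_baryMon hs i) (d i)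
  have h2 : ∑ i, d i ≤ r := by
    refine le_trans ?_ ((MvPolynomial.le_totalDegree hd).trans hp)
    rw [Finsupp.sum_fintype _ _ (by simp)]
  have h3 := baryMon_mul h1 (one_mem_baryMon hs (r - ∑ i, d i))
  rwa [mul_one, Nat.add_sub_cancel' h2] at h3

/-- Unisolvence of the Lagrange nodes: a polynomial of degree at most `r` is its own interpolant.
The evaluation at the nodes is onto, since the Lagrange polynomials are dual to it, and the
polynomials are spanned by as many monomials in barycentric coordinates as there are nodes. -/
theorem eq_sum_lagPoly (hs : IsCell s) {r : ℕ} (hr : 1 ≤ r) {f : Sp N → ℝ} (hf : f ∈ polyFun N r)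
    (x : Sp N) : f x = ∑ m ∈ lagIdx s r, f (lagNode s r m) * lagPoly s r m x := by
  classical
  let E : polyFun N r →ₗ[ℝ] (lagIdx s r → ℝ) :=
    { toFun := fun f m => f.1 (lagNode s r m)
      map_add' := fun f g => rfl
      map_smul' := fun c f => rfl }
  have hmem : ∀ c : (Sp N → ℕ) → ℝ, (fun x => ∑ m ∈ lagIdx s r, c m * lagPoly s r m x) ∈
      polyFun N r :=
    fun c => polyFun_sum _ _ fun m hm => polyFun_const_mul (lagPoly_mem_polyFun hm) _
  have hnode : ∀ (c : (Sp N → ℕ) → ℝ), ∀ m ∈ lagIdx s r,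
      ∑ m' ∈ lagIdx s r, c m' * lagPoly s r m' (lagNode s r m) = c m := by
    intro c m hm
    rw [Finset.sum_eq_single_of_mem m hm fun m' hm' hne => by
      rw [lagPoly_lagNode hs hr hm' hm, if_neg hne, mul_zero],
      lagPoly_lagNode hs hr hm hm, if_pos rfl, mul_one]
  have hsurj : Function.Surjective E := by
    intro c
    refine ⟨⟨_, hmem fun m => if h : m ∈ lagIdx s r then c ⟨m, h⟩ else 0⟩, funext fun m => ?_⟩
    refine (hnode _ m.1 m.2).trans ?_
    simp
  have hle : Module.finrank ℝ (polyFun N r) ≤ Module.finrank ℝ (lagIdx s r → ℝ) := by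
    rw [Module.finrank_fintype_fun_eq_card, Fintype.card_coe]
    have : FiniteDimensional ℝ (baryMon s r) :=
      FiniteDimensional.span_of_finite ℝ (Finset.finite_toSet _)
    refine (Submodule.finrank_mono (polyFun_le_baryMon hs r)).trans ?_
    exact (finrank_span_finset_le_card _).trans Finset.card_image_le
  have hinj : Function.Injective E :=
    (LinearMap.injective_iff_surjective_of_finrank_eq_finrank
      (le_antisymm hle (LinearMap.finrank_le_finrank_of_surjective hsurj))).2 hsurj
  have : (⟨f, hf⟩ : polyFun N r) = ⟨_, hmem fun m => f (lagNode s r m)⟩ := by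
    refine hinj (funext fun m => ?_)
    exact (hnode (fun m => f (lagNode s r m)) m.1 m.2).symm
  exact congrFun (congrArg Subtype.val this) x

end Simplex

end HeatFEM

namespace HeatFEM

/-! ### Lagrange interpolation on a triangulation -/

section Triangulation

variable {N : ℕ} {Ω : Set (Sp N)} {𝒯 : Geometry.SimplicialComplex ℝ (Sp N)} {K h : ℝ} {r : ℕ}

theorem isCell_of_mem_cells {s : Finset (Sp N)} (hs : s ∈ cells 𝒯) : IsCell s :=
  ⟨hs.2, 𝒯.indep hs.1⟩

theorem isClosed_cell (s : Finset (Sp N)) : IsClosed (convexHull ℝ (s : Set (Sp N))) :=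
  (s.finite_toSet.isCompact_convexHull (𝕜 := ℝ)).isClosed

theorem isCompact_cell (s : Finset (Sp N)) : IsCompact (convexHull ℝ (s : Set (Sp N))) :=
  s.finite_toSet.isCompact_convexHull (𝕜 := ℝ)

namespace IsQuasiUniformTriangulation

theorem finite_cells (hT : IsQuasiUniformTriangulation Ω 𝒯 K h) : (cells 𝒯).Finite :=
  hT.finite.subset fun _ hs => hs.1

theorem closure_eq (hT : IsQuasiUniformTriangulation Ω 𝒯 K h) :
    closure Ω = ⋃ s ∈ cells 𝒯, convexHull ℝ (s : Set (Sp N)) := by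
  rw [← hT.space_eq]
  refine Subset.antisymm (fun x hx => ?_)
    (iUnion₂_subset fun s hs => 𝒯.convexHull_subset_space hs.1)
  obtain ⟨s, hs, hxs⟩ := 𝒯.mem_space_iff.1 hx
  obtain ⟨t, ht, hst⟩ := hT.pure s hs
  exact mem_iUnion₂.2 ⟨t, ht, convexHull_mono (by exact_mod_cast hst) hxs⟩

theorem exists_cell (hT : IsQuasiUniformTriangulation Ω 𝒯 K h) {x : Sp N} (hx : x ∈ closure Ω) :
    ∃ s ∈ cells 𝒯, x ∈ convexHull ℝ (s : Set (Sp N)) := by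
  rw [hT.closure_eq] at hx
  simpa using hx

theorem cell_subset (hT : IsQuasiUniformTriangulation Ω 𝒯 K h) {s : Finset (Sp N)}
    (hs : s ∈ cells 𝒯) : convexHull ℝ (s : Set (Sp N)) ⊆ closure Ω := by
  rw [hT.closure_eq]
  exact subset_biUnion_of_mem (u := fun s : Finset (Sp N) => convexHull ℝ (s : Set (Sp N))) hs

theorem interior_cell_subset (hT : IsQuasiUniformTriangulation Ω 𝒯 K h)
    (hΩ : IsPolyhedralDomain Ω) {s : Finset (Sp N)} (hs : s ∈ cells 𝒯) :
    interior (convexHull ℝ (s : Set (Sp N))) ⊆ Ω := by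
  rw [← hΩ.interior_closure]
  exact interior_mono (hT.cell_subset hs)

end IsQuasiUniformTriangulation

open Classical in
theorem inter_cells_subset {s t : Finset (Sp N)} (hs : s ∈ cells 𝒯) (ht : t ∈ cells 𝒯) {x : Sp N}
    (hxs : x ∈ convexHull ℝ (s : Set (Sp N))) (hxt : x ∈ convexHull ℝ (t : Set (Sp N))) :
    x ∈ convexHull ℝ ((s ∩ t : Finset (Sp N)) : Set (Sp N)) := by
  rw [Finset.coe_inter]
  exact 𝒯.inter_subset_convexHull hs.1 ht.1 ⟨hxs, hxt⟩

theorem bary_lineMap {s : Finset (Sp N)} (hs : IsCell s) {v : Sp N} (hv : v ∈ s) (x y : Sp N)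
    (θ : ℝ) : bary s v (AffineMap.lineMap x y θ) = (1 - θ) * bary s v x + θ * bary s v y := by
  rw [bary_eq hs hv, bary_eq hs hv, bary_eq hs hv, AffineMap.apply_lineMap,
    AffineMap.lineMap_apply_module]
  simp

/-- If a face contains a point of `Ω`, then its relative interior lies in `Ω`: the triangulation
looks the same near all points of the relative interior of a face. -/
theorem mem_of_face_meets (hT : IsQuasiUniformTriangulation Ω 𝒯 K h) (hΩ : IsPolyhedralDomain Ω)
    {s : Finset (Sp N)} (hs : s ∈ cells 𝒯) {x z : Sp N}
    (hx : x ∈ convexHull ℝ (s : Set (Sp N))) (hz : z ∈ convexHull ℝ (s : Set (Sp N)))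
    (hxz : ∀ v ∈ s, bary s v x = 0 → bary s v z = 0) (hzΩ : z ∈ Ω) : x ∈ Ω := by
  classical
  have hsc := isCell_of_mem_cells hs
  have hx0 := (mem_convexHull_iff_bary hsc).1 hx
  have hz0 := (mem_convexHull_iff_bary hsc).1 hz
  -- a point `y` of `Ω` in the relative interior of the carrier of `x`
  obtain ⟨θ, hθ0, hθ1, hyΩ⟩ : ∃ θ : ℝ, 0 < θ ∧ θ ≤ 1 ∧ AffineMap.lineMap z x θ ∈ Ω := by
    have hc : Continuous fun θ : ℝ => (AffineMap.lineMap z x θ : Sp N) :=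
      AffineMap.lineMap_continuous
    have h1 : ∀ᶠ θ in 𝓝 (0 : ℝ), AffineMap.lineMap z x θ ∈ Ω :=
      hc.continuousAt.eventually_mem (hΩ.isOpen.mem_nhds (by simpa using hzΩ))
    have h2 : ∀ᶠ θ in 𝓝[>] (0 : ℝ), AffineMap.lineMap z x θ ∈ Ω := h1.filter_mono nhdsWithin_le_nhds
    have h3 : ∀ᶠ θ in 𝓝[>] (0 : ℝ), θ ∈ Ioc (0 : ℝ) 1 := Ioc_mem_nhdsGT zero_lt_one
    obtain ⟨θ, h4, h5⟩ := (h2.and h3).exists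
    exact ⟨θ, h5.1, h5.2, h4⟩
  set y : Sp N := AffineMap.lineMap z x θ with hy
  set F : Finset (Sp N) := s.filter fun v => 0 < bary s v x with hF
  have hby : ∀ v ∈ s, bary s v y = (1 - θ) * bary s v z + θ * bary s v x := fun v hv =>
    bary_lineMap hsc hv z x θ
  have hyF : ∀ v ∈ F, 0 < bary s v y := fun v hv => by
    obtain ⟨hvs, hvx⟩ := Finset.mem_filter.1 hv
    rw [hby v hvs]
    have := mul_nonneg (sub_nonneg.2 hθ1) (hz0 v hvs)
    have := mul_pos hθ0 hvx
    linarith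
  have hys : y ∈ convexHull ℝ (s : Set (Sp N)) := by
    rw [mem_convexHull_iff_bary hsc]
    intro v hv
    rw [hby v hv]
    have := mul_nonneg (sub_nonneg.2 hθ1) (hz0 v hv)
    have := mul_nonneg hθ0.le (hx0 v hv)
    linarith
  have hFt : ∀ t ∈ cells 𝒯, y ∈ convexHull ℝ (t : Set (Sp N)) → F ⊆ t := by
    intro t ht hyt v hv
    have h1 := inter_cells_subset hs ht hys hyt
    have h2 := (bary_eq_of_mem_subface hsc (isCell_of_mem_cells ht) Finset.inter_subset_left
      Finset.inter_subset_right h1 v).2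
    by_contra hvt
    exact (hyF v hv).ne' (h2 fun h => hvt (Finset.mem_inter.1 h).2)
  -- a point `p` of the carrier such that `x` lies between `p` and `y`
  obtain ⟨σ, hσ0, hσ⟩ : ∃ σ : ℝ, 0 < σ ∧ ∀ v ∈ F, 0 ≤ bary s v (AffineMap.lineMap y x (1 + σ)) := by
    have h1 : ∀ v ∈ F, ∀ᶠ σ in 𝓝[>] (0 : ℝ), 0 ≤ bary s v (AffineMap.lineMap y x (1 + σ)) := by
      intro v hv
      obtain ⟨hvs, hvx⟩ := Finset.mem_filter.1 hv
      have hc : Continuous fun σ : ℝ => (1 - (1 + σ)) * bary s v y + (1 + σ) * bary s v x := by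
        fun_prop
      have h2 : ∀ᶠ σ in 𝓝 (0 : ℝ), 0 < (1 - (1 + σ)) * bary s v y + (1 + σ) * bary s v x :=
        hc.continuousAt.eventually (lt_mem_nhds (by simpa using hvx))
      filter_upwards [h2.filter_mono nhdsWithin_le_nhds] with σ hσ
      rw [bary_lineMap hsc hvs]
      exact hσ.le
    have h2 := (Filter.eventually_all_finset F).2 h1
    obtain ⟨σ, h3, h4⟩ := (h2.and self_mem_nhdsWithin).exists
    exact ⟨σ, h4, h3⟩
  set p : Sp N := AffineMap.lineMap y x (1 + σ) with hp
  have hpF : p ∈ convexHull ℝ (F : Set (Sp N)) := by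
    have hoff : ∀ v ∈ s, v ∉ F → bary s v p = 0 := by
      intro v hv hvF
      have h1 : bary s v x = 0 := le_antisymm (not_lt.1 fun h => hvF
        (Finset.mem_filter.2 ⟨hv, h⟩)) (hx0 v hv)
      rw [hp, bary_lineMap hsc hv, hby v hv, h1, hxz v hv h1]
      ring
    refine Finset.mem_convexHull'.2 ⟨fun v => bary s v p, fun v hv => hσ v hv, ?_, ?_⟩
    · rw [← sum_bary hsc p]
      exact Finset.sum_subset (Finset.filter_subset _ _) fun v hv hvF => hoff v hv hvF
    · exact (Finset.sum_subset (Finset.filter_subset _ _)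
        fun v hv hvF => by
          beta_reduce; rw [hoff v hv hvF, zero_smul]).trans (sum_bary_smul hsc p)
  -- near `y`, the set `Ω` is covered by the cells that contain `y`, hence `p`
  set U : Set (Sp N) := Ω ∩ (⋃ t ∈ {t ∈ cells 𝒯 | y ∉ convexHull ℝ (t : Set (Sp N))},
    convexHull ℝ (t : Set (Sp N)))ᶜ with hU
  have hUo : IsOpen U := hΩ.isOpen.inter (Set.Finite.isClosed_biUnion
    (hT.finite_cells.subset fun t ht => ht.1) fun t _ => isClosed_cell t).isOpen_compl
  have hyU : y ∈ U := ⟨hyΩ, by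
    simp only [mem_compl_iff, mem_iUnion, not_exists]
    exact fun t ht => ht.2⟩
  have hUp : ∀ w ∈ U, ∃ t ∈ cells 𝒯, w ∈ convexHull ℝ (t : Set (Sp N)) ∧
      p ∈ convexHull ℝ (t : Set (Sp N)) := by
    rintro w ⟨hwΩ, hwn⟩
    obtain ⟨t, ht, hwt⟩ := hT.exists_cell (subset_closure hwΩ)
    have hyt : y ∈ convexHull ℝ (t : Set (Sp N)) := by
      by_contra hyt
      exact hwn (mem_iUnion₂.2 ⟨t, ⟨ht, hyt⟩, hwt⟩)
    exact ⟨t, ht, hwt, convexHull_mono (by exact_mod_cast hFt t ht hyt) hpF⟩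
  -- the homothety with centre `p` that maps `y` to `x`
  rw [← hΩ.interior_closure, mem_interior]
  set κ : ℝ := (1 + σ) / σ with hκ
  have hκ1 : 1 < κ := by rw [hκ, lt_div_iff₀ hσ0]; linarith
  refine ⟨{w | AffineMap.lineMap p w κ ∈ U}, ?_, hUo.preimage ?_, ?_⟩
  · intro w hw
    obtain ⟨t, ht, hwt, hpt⟩ := hUp _ hw
    refine hT.cell_subset ht ?_
    have hconv := convex_convexHull ℝ (t : Set (Sp N))
    have : w = AffineMap.lineMap p (AffineMap.lineMap p w κ) κ⁻¹ := by
      rw [AffineMap.lineMap_lineMap_right, mul_comm, mul_inv_cancel₀ (by positivity)]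
      simp
    rw [this]
    exact hconv.lineMap_mem hpt hwt ⟨by positivity, inv_le_one_of_one_le₀ hκ1.le⟩
  · simp only [AffineMap.lineMap_apply_module]
    fun_prop
  · have : (AffineMap.lineMap p x κ : Sp N) = y := by
      rw [hp, AffineMap.lineMap_apply_module, AffineMap.lineMap_apply_module]
      have h1 : (1 - κ) * (1 - (1 + σ)) = 1 := by rw [hκ]; field_simp; ring
      have h2 : (1 - κ) * (1 + σ) + κ = 0 := by rw [hκ]; field_simp; ring
      rw [smul_add, smul_smul, smul_smul, h1, add_assoc, ← add_smul, h2]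
      simp
    rw [mem_ofPred_eq, this]
    exact hyU

theorem bary_ne_zero_of_lagPoly_ne_zero {s : Finset (Sp N)} {m : Sp N → ℕ} {x v : Sp N}
    (h : lagPoly s r m x ≠ 0) (hv : v ∈ s) (hm : m v ≠ 0) : bary s v x ≠ 0 := by
  intro h0
  refine h (Finset.prod_eq_zero hv (Finset.prod_eq_zero (Finset.mem_range.2
    (Nat.pos_of_ne_zero hm)) ?_))
  simp [h0]

/-- A Lagrange polynomial at a node in `Ω` vanishes on the boundary. -/
theorem lagPoly_eq_zero_of_notMem (hT : IsQuasiUniformTriangulation Ω 𝒯 K h)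
    (hΩ : IsPolyhedralDomain Ω) (hr : 1 ≤ r) {s : Finset (Sp N)} (hs : s ∈ cells 𝒯)
    {m : Sp N → ℕ} (hm : m ∈ lagIdx s r) {x : Sp N} (hx : x ∈ convexHull ℝ (s : Set (Sp N)))
    (hxΩ : x ∉ Ω) (hz : lagNode s r m ∈ Ω) : lagPoly s r m x = 0 := by
  by_contra hne
  have hsc := isCell_of_mem_cells hs
  refine hxΩ (mem_of_face_meets hT hΩ hs hx (lagNode_mem_convexHull hsc hr hm) ?_ hz)
  intro v hv h0
  rw [bary_lagNode hsc hr hm hv]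
  by_cases hmv : m v = 0
  · simp [hmv]
  · exact absurd h0 (bary_ne_zero_of_lagPoly_ne_zero hne hv hmv)

/-- The Lagrange interpolant on a cell of the function `g`. -/
noncomputable def cellInterp (r : ℕ) (g : Sp N → ℝ) (s : Finset (Sp N)) (x : Sp N) : ℝ :=
  ∑ m ∈ lagIdx s r, g (lagNode s r m) * lagPoly s r m x

theorem cellInterp_mem_polyFun (g : Sp N → ℝ) (s : Finset (Sp N)) :
    cellInterp r g s ∈ polyFun N r :=
  polyFun_sum _ _ fun _ hm => polyFun_const_mul (lagPoly_mem_polyFun hm) _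

/-- Conformity: on the intersection of two cells their interpolants agree. -/
theorem cellInterp_eq {s t : Finset (Sp N)} (hs : s ∈ cells 𝒯) (ht : t ∈ cells 𝒯) (g : Sp N → ℝ)
    {x : Sp N} (hxs : x ∈ convexHull ℝ (s : Set (Sp N))) (hxt : x ∈ convexHull ℝ (t : Set (Sp N))) :
    cellInterp r g s x = cellInterp r g t x := by
  classical
  set u := s ∩ t with hu
  have hxu := inter_cells_subset hs ht hxs hxt
  rw [← hu] at hxu
  have hsc := isCell_of_mem_cells hs
  have htc := isCell_of_mem_cells ht
  -- both sums reduce to the nodes of the common face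
  have key : ∀ q : Finset (Sp N), IsCell q → u ⊆ q → (∀ v, v ∉ u → bary q v x = 0) →
      cellInterp r g q x = ∑ m ∈ lagIdx u r, g (∑ v ∈ u, ((m v : ℝ) / r) • v) *
        ∏ v ∈ u, ∏ k ∈ Finset.range (m v), (r * bary q v x - k) / (m v - k) := by
    intro q hq huq h0
    have hzero : ∀ m ∈ lagIdx u r, ∀ v, v ∉ u → m v = 0 := fun m hm v hv =>
      by_contra fun h => hv ((mem_lagIdx.1 hm).2 v h)
    have hsub : lagIdx u r ⊆ lagIdx q r := by
      intro m hm
      have h1 := mem_lagIdx.1 hm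
      refine mem_lagIdx.2 ⟨?_, fun v hv => huq (h1.2 v hv)⟩
      rw [← h1.1]
      exact (Finset.sum_subset huq fun v _ hv => hzero m hm v hv).symm
    rw [cellInterp, ← Finset.sum_subset hsub]
    · refine Finset.sum_congr rfl fun m hm => ?_
      rw [lagNode, lagPoly]
      congr 1
      · rw [Finset.sum_subset huq fun v _ hv => by simp [hzero m hm v hv]]
      · exact (Finset.prod_subset huq fun v _ hv => by simp [hzero m hm v hv]).symm
    · intro m hm hmu
      obtain ⟨v, hv1, hv2⟩ : ∃ v, m v ≠ 0 ∧ v ∉ u := by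
        by_contra! hcon
        have h1 := mem_lagIdx.1 hm
        refine hmu (mem_lagIdx.2 ⟨?_, hcon⟩)
        rw [← h1.1]
        exact Finset.sum_subset huq fun v _ hv => by_contra fun h => hv (hcon v h)
      have : lagPoly q r m x = 0 := by
        by_contra hne
        exact bary_ne_zero_of_lagPoly_ne_zero hne ((mem_lagIdx.1 hm).2 v hv1) hv1 (h0 v hv2)
      rw [this, mul_zero]
  have hb := fun v => bary_eq_of_mem_subface hsc htc Finset.inter_subset_left
    Finset.inter_subset_right hxu v
  rw [key s hsc Finset.inter_subset_left fun v hv => (hb v).2 hv,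
    key t htc Finset.inter_subset_right fun v hv => by rw [← (hb v).1]; exact (hb v).2 hv]
  simp only [(hb _).1]

open Classical in
/-- The Lagrange interpolant on the triangulation, zero outside of the closure of `Ω`. -/
noncomputable def interp (𝒯 : Geometry.SimplicialComplex ℝ (Sp N)) (r : ℕ) (g : Sp N → ℝ)
    (x : Sp N) : ℝ :=
  if hx : ∃ s ∈ cells 𝒯, x ∈ convexHull ℝ (s : Set (Sp N)) then cellInterp r g hx.choose x else 0

theorem interp_eq {s : Finset (Sp N)} (hs : s ∈ cells 𝒯) (g : Sp N → ℝ) {x : Sp N}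
    (hx : x ∈ convexHull ℝ (s : Set (Sp N))) : interp 𝒯 r g x = cellInterp r g s x := by
  have hex : ∃ s ∈ cells 𝒯, x ∈ convexHull ℝ (s : Set (Sp N)) := ⟨s, hs, hx⟩
  rw [interp, dif_pos hex]
  exact cellInterp_eq hex.choose_spec.1 hs g hex.choose_spec.2 hx

theorem interp_mem_feFun (hT : IsQuasiUniformTriangulation Ω 𝒯 K h)
    (hΩ : IsPolyhedralDomain Ω) (hr : 1 ≤ r) {g : Sp N → ℝ} (hg : ∀ x, x ∉ Ω → g x = 0) :
    interp 𝒯 r g ∈ feFun Ω 𝒯 r := by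
  have hzero : ∀ x, x ∉ Ω → interp 𝒯 r g x = 0 := by
    intro x hx
    by_cases hex : ∃ s ∈ cells 𝒯, x ∈ convexHull ℝ (s : Set (Sp N))
    · obtain ⟨s, hs, hxs⟩ := hex
      rw [interp_eq hs g hxs]
      refine Finset.sum_eq_zero fun m hm => ?_
      by_cases hz : lagNode s r m ∈ Ω
      · rw [lagPoly_eq_zero_of_notMem hT hΩ hr hs hm hxs hx hz, mul_zero]
      · rw [hg _ hz, zero_mul]
    · rw [interp, dif_neg hex]
  refine ⟨?_, hzero, fun s hs => ?_⟩
  · have h1 : ContinuousOn (interp 𝒯 r g) (closure Ω) := by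
      rw [hT.closure_eq, biUnion_eq_iUnion]
      have := hT.finite_cells.to_subtype
      refine LocallyFinite.continuousOn_iUnion (locallyFinite_of_finite _)
        (fun s => isClosed_cell s.1) fun s => ?_
      exact (continuous_of_mem_polyFun (cellInterp_mem_polyFun g s.1)).continuousOn.congr
        fun x hx => interp_eq s.2 g hx
    have h2 : ContinuousOn (interp 𝒯 r g) Ωᶜ := continuousOn_const.congr hzero
    have h3 := h1.union_of_isClosed h2 isClosed_closure hΩ.isOpen.isClosed_compl
    have h4 : closure Ω ∪ Ωᶜ = univ :=
      eq_univ_of_forall fun x => (em (x ∈ Ω)).imp (fun h => subset_closure h) id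
    rwa [h4, continuousOn_univ] at h3
  · obtain ⟨p, hp, hpe⟩ := mem_polyFun.1 (cellInterp_mem_polyFun (r := r) g s)
    exact ⟨p, hp, fun x hx => by rw [interp_eq hs g hx, hpe]⟩

theorem exists_polyFun_of_mem_feFun {f : Sp N → ℝ} (hf : f ∈ feFun Ω 𝒯 r) {s : Finset (Sp N)}
    (hs : s ∈ cells 𝒯) : ∃ p ∈ polyFun N r, EqOn f p (convexHull ℝ (s : Set (Sp N))) := by
  obtain ⟨p, hp, hpe⟩ := hf.2.2 s hs
  exact ⟨_, mem_polyFun.2 ⟨p, hp, fun _ => rfl⟩, hpe⟩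

theorem eq_cellInterp_of_mem_feFun (hr : 1 ≤ r) {f : Sp N → ℝ} (hf : f ∈ feFun Ω 𝒯 r)
    {s : Finset (Sp N)} (hs : s ∈ cells 𝒯) {x : Sp N} (hx : x ∈ convexHull ℝ (s : Set (Sp N))) :
    f x = cellInterp r f s x := by
  obtain ⟨p, hp, hpe⟩ := exists_polyFun_of_mem_feFun hf hs
  have hsc := isCell_of_mem_cells hs
  rw [hpe hx, eq_sum_lagPoly hsc hr hp x]
  exact Finset.sum_congr rfl fun m hm => by rw [hpe (lagNode_mem_convexHull hsc hr hm)]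

theorem cellInterp_lagNode (hr : 1 ≤ r) (g : Sp N → ℝ) {s : Finset (Sp N)} (hs : IsCell s)
    {m : Sp N → ℕ} (hm : m ∈ lagIdx s r) :
    cellInterp r g s (lagNode s r m) = g (lagNode s r m) := by
  classical
  rw [cellInterp, Finset.sum_eq_single_of_mem m hm fun m' hm' hne => by
    rw [lagPoly_lagNode hs hr hm' hm, if_neg hne, mul_zero], lagPoly_lagNode hs hr hm hm,
    if_pos rfl, mul_one]

/-- The nodes in `Ω` are the points of `Ω` among the Lagrange nodes of the cells. -/
theorem mem_nodes_iff {z : Sp N} : z ∈ nodes Ω 𝒯 r ↔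
    z ∈ Ω ∧ ∃ s ∈ cells 𝒯, ∃ m ∈ lagIdx s r, z = lagNode s r m := by
  classical
  constructor
  · rintro ⟨hz, s, hs, m, hm, rfl⟩
    refine ⟨hz, s, hs, fun v => if v ∈ s then m v else 0, mem_lagIdx.2 ⟨?_, fun v hv => ?_⟩, ?_⟩
    · rw [← hm]
      exact Finset.sum_congr rfl fun v hv => if_pos hv
    · by_contra h
      exact hv (if_neg h)
    · exact Finset.sum_congr rfl fun v hv => by beta_reduce; rw [if_pos hv]
  · rintro ⟨hz, s, hs, m, hm, rfl⟩
    exact ⟨hz, s, hs, m, (mem_lagIdx.1 hm).1, rfl⟩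

theorem finite_nodes (hT : IsQuasiUniformTriangulation Ω 𝒯 K h) : (nodes Ω 𝒯 r).Finite := by
  refine (hT.finite_cells.biUnion fun s _ => ((lagIdx s r).finite_toSet.image
    (lagNode s r))).subset fun z hz => ?_
  obtain ⟨-, s, hs, m, hm, rfl⟩ := mem_nodes_iff.1 hz
  exact mem_biUnion hs ⟨m, hm, rfl⟩

/-- The nodal basis function exists. -/
theorem nodalBasis_spec (hT : IsQuasiUniformTriangulation Ω 𝒯 K h)
    (hΩ : IsPolyhedralDomain Ω) (hr : 1 ≤ r) {z : Sp N} (hz : z ∈ nodes Ω 𝒯 r) :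
    nodalBasis Ω 𝒯 r z ∈ feFun Ω 𝒯 r ∧ nodalBasis Ω 𝒯 r z z = 1 ∧
      ∀ y ∈ nodes Ω 𝒯 r, y ≠ z → nodalBasis Ω 𝒯 r z y = 0 := by
  classical
  refine Classical.epsilon_spec (p := fun Φ => Φ ∈ feFun Ω 𝒯 r ∧ Φ z = 1 ∧
    ∀ y ∈ nodes Ω 𝒯 r, y ≠ z → Φ y = 0) ⟨interp 𝒯 r fun y => if y = z then 1 else 0, ?_⟩
  have hval : ∀ y ∈ nodes Ω 𝒯 r, interp 𝒯 r (fun y => if y = z then (1 : ℝ) else 0) y =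
      if y = z then 1 else 0 := by
    intro y hy
    obtain ⟨-, s, hs, m, hm, rfl⟩ := mem_nodes_iff.1 hy
    have hsc := isCell_of_mem_cells hs
    rw [interp_eq hs _ (lagNode_mem_convexHull hsc hr hm), cellInterp_lagNode hr _ hsc hm]
  refine ⟨interp_mem_feFun hT hΩ hr fun x hx => if_neg fun he : x = z => hx (he ▸ hz.1), ?_, ?_⟩
  · rw [hval z hz, if_pos rfl]
  · intro y hy hne
    rw [hval y hy, if_neg hne]

/-- The nodal basis function of `z` vanishes on the cells that do not contain `z`. -/
theorem nodalBasis_eq_zero (hT : IsQuasiUniformTriangulation Ω 𝒯 K h)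
    (hΩ : IsPolyhedralDomain Ω) (hr : 1 ≤ r) {z : Sp N} (hz : z ∈ nodes Ω 𝒯 r)
    {s : Finset (Sp N)} (hs : s ∈ cells 𝒯) (hzs : z ∉ convexHull ℝ (s : Set (Sp N))) {x : Sp N}
    (hx : x ∈ convexHull ℝ (s : Set (Sp N))) : nodalBasis Ω 𝒯 r z x = 0 := by
  obtain ⟨h1, -, h3⟩ := nodalBasis_spec hT hΩ hr hz
  have hsc := isCell_of_mem_cells hs
  rw [eq_cellInterp_of_mem_feFun hr h1 hs hx]
  refine Finset.sum_eq_zero fun m hm => ?_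
  have hmem := lagNode_mem_convexHull hsc hr hm
  by_cases hΩm : lagNode s r m ∈ Ω
  · rw [h3 _ (mem_nodes_iff.2 ⟨hΩm, s, hs, m, hm, rfl⟩) fun h => hzs (h ▸ hmem), zero_mul]
  · rw [h1.2.1 _ hΩm, zero_mul]

end Triangulation

end HeatFEM

namespace HeatFEM

/-! ### Weak gradients -/

section WeakGradient

variable {N : ℕ} {Ω U : Set (Sp N)}

theorem norm_gradient (f : Sp N → ℝ) (x : Sp N) : ‖gradient f x‖ = ‖fderiv ℝ f x‖ :=
  LinearIsometryEquiv.norm_map _ _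

theorem norm_gradient_le {f : Sp N → ℝ} {L : NNReal} (hf : LipschitzWith L f) (x : Sp N) :
    ‖gradient f x‖ ≤ L := by
  rw [norm_gradient]
  exact norm_fderiv_le_of_lipschitz ℝ hf

theorem measurable_gradient (f : Sp N → ℝ) : Measurable (gradient f) :=
  (InnerProductSpace.toDual ℝ (Sp N)).symm.continuous.measurable.comp (measurable_fderiv ℝ f)

theorem continuous_gradient {f : Sp N → ℝ} (hf : ContDiff ℝ ∞ f) : Continuous (gradient f) :=
  (InnerProductSpace.toDual ℝ (Sp N)).symm.continuous.comp (hf.continuous_fderiv (by simp))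

theorem gradient_of_notMem_tsupport {f : Sp N → ℝ} {x : Sp N} (hx : x ∉ tsupport f) :
    gradient f x = 0 := by
  rw [← norm_eq_zero, norm_gradient, norm_eq_zero]
  by_contra h
  exact hx (support_fderiv_subset ℝ h)

theorem IsTestFun.mono {V : Set (Sp N)} {ψ : Sp N → ℝ} (h : IsTestFun U ψ) (hUV : U ⊆ V) :
    IsTestFun V ψ := ⟨h.1, h.2.1, h.2.2.trans hUV⟩

theorem IsTestFun.hasCompactSupport_gradient {ψ : Sp N → ℝ} (h : IsTestFun U ψ) :
    HasCompactSupport (gradient ψ) :=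
  (h.2.1.fderiv (𝕜 := ℝ)).comp_left (g := (InnerProductSpace.toDual ℝ (Sp N)).symm) (map_zero _)

theorem IsTestFun.exists_lipschitz {ψ : Sp N → ℝ} (h : IsTestFun U ψ) :
    ∃ L, LipschitzWith L ψ :=
  (h.1.of_le (m := 1) (by exact_mod_cast le_top)).lipschitzWith_of_hasCompactSupport h.2.1
    one_ne_zero

theorem IsTestFun.memLp {ψ : Sp N → ℝ} (h : IsTestFun U ψ) :
    MemLp ψ 2 (volume.restrict Ω) :=
  (h.1.continuous.memLp_of_hasCompactSupport h.2.1).restrict _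

theorem IsTestFun.memLp_gradient {ψ : Sp N → ℝ} (h : IsTestFun U ψ) :
    MemLp (gradient ψ) 2 (volume.restrict Ω) :=
  ((continuous_gradient h.1).memLp_of_hasCompactSupport h.hasCompactSupport_gradient).restrict _

/-- Integration by parts of a Lipschitz function against a test function. -/
theorem _root_.LipschitzWith.integral_mul_gradient {f : Sp N → ℝ} {L : NNReal}
    (hf : LipschitzWith L f) {ψ : Sp N → ℝ} (hψ : IsTestFun U ψ) (e : Sp N) :
    ∫ x in U, f x * inner ℝ e (gradient ψ x) = - ∫ x in U, ψ x * inner ℝ e (gradient f x) := by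
  obtain ⟨M, hM⟩ := hψ.exists_lipschitz
  have hout : ∀ x, x ∉ U → x ∉ tsupport ψ := fun x hx h => hx (hψ.2.2 h)
  rw [setIntegral_eq_integral_of_forall_compl_eq_zero fun x hx => by
      rw [gradient_of_notMem_tsupport (hout x hx), inner_zero_right, mul_zero],
    setIntegral_eq_integral_of_forall_compl_eq_zero fun x hx => by
      rw [image_eq_zero_of_notMem_tsupport (hout x hx), zero_mul]]
  have h := hf.integral_lineDeriv_mul_eq (μ := volume) hM hψ.2.1 e
  have h1 : ∫ x, lineDeriv ℝ f x e * ψ x = ∫ x, ψ x * inner ℝ e (gradient f x) := by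
    refine integral_congr_ae ?_
    filter_upwards [hf.ae_differentiableAt (μ := volume)] with x hx
    rw [hx.lineDeriv_eq_fderiv, real_inner_comm, inner_gradient_left, mul_comm]
  have h2 : ∫ x, lineDeriv ℝ ψ x (-e) * f x = - ∫ x, f x * inner ℝ e (gradient ψ x) := by
    rw [← integral_neg]
    refine integral_congr_ae (Eventually.of_forall fun x => ?_)
    have hx : DifferentiableAt ℝ ψ x := hψ.1.contDiffAt.differentiableAt (by simp)
    have he : inner ℝ e (gradient ψ x) = fderiv ℝ ψ x e := by
      rw [real_inner_comm, inner_gradient_left]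
    simp only [hx.lineDeriv_eq_fderiv, map_neg, he]
    ring
  rw [← h1, h, h2, neg_neg]

theorem hasWeakGradOn_of_inner {w : Sp N → ℝ} {G : Sp N → Sp N}
    (hw : MemLp w 2 (volume.restrict U)) (hG : MemLp G 2 (volume.restrict U))
    (h : ∀ ψ, IsTestFun U ψ → ∀ e, ∫ x in U, w x * inner ℝ e (gradient ψ x) =
      - ∫ x in U, ψ x * inner ℝ e (G x)) : HasWeakGradOn U w G := by
  intro ψ hψ
  refine ext_inner_left ℝ fun e => ?_
  have h1 : Integrable (fun x => w x • gradient ψ x) (volume.restrict U) :=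
    memLp_one_iff_integrable.1 (hψ.memLp_gradient.smul hw)
  have h2 : Integrable (fun x => ψ x • G x) (volume.restrict U) :=
    memLp_one_iff_integrable.1 (hG.smul hψ.memLp)
  rw [← integral_inner h1, inner_neg_right, ← integral_inner h2]
  simp only [real_inner_smul_right]
  exact h ψ hψ e

/-- A Lipschitz function has its gradient as weak gradient. -/
theorem _root_.LipschitzWith.hasWeakGradOn {f : Sp N → ℝ} {L : NNReal} (hf : LipschitzWith L f)
    (hf2 : MemLp f 2 (volume.restrict U)) (hg2 : MemLp (gradient f) 2 (volume.restrict U)) :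
    HasWeakGradOn U f (gradient f) :=
  hasWeakGradOn_of_inner hf2 hg2 fun _ hψ e => hf.integral_mul_gradient hψ e

theorem HasWeakGradOn.congr {w w' : Sp N → ℝ} {G G' : Sp N → Sp N} (h : HasWeakGradOn U w G)
    (hw : w =ᵐ[volume.restrict U] w') (hG : G =ᵐ[volume.restrict U] G') :
    HasWeakGradOn U w' G' := by
  intro ψ hψ
  rw [← integral_congr_ae (hw.smul (ae_eq_refl (gradient ψ))),
    ← integral_congr_ae ((ae_eq_refl ψ).smul hG)]
  exact h ψ hψ

theorem HasWeakGradOn.unique (hU : IsOpen U) {w : Sp N → ℝ} {G G' : Sp N → Sp N}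
    (h : HasWeakGradOn U w G) (h' : HasWeakGradOn U w G') (hG : MemLp G 2 (volume.restrict U))
    (hG' : MemLp G' 2 (volume.restrict U)) : G =ᵐ[volume.restrict U] G' := by
  have h1 : LocallyIntegrableOn (fun x => G x - G' x) U := by
    have h2 : LocallyIntegrable (fun x => G x - G' x) (volume.restrict U) :=
      (hG.sub hG').locallyIntegrable one_le_two
    rw [locallyIntegrableOn_iff hU.isLocallyClosed]
    intro k hkU hk
    have := h2.integrableOn_isCompact hk
    rwa [IntegrableOn, Measure.restrict_restrict hk.measurableSet,
      inter_eq_self_of_subset_left hkU] at this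
  have h3 := hU.ae_eq_zero_of_integral_contDiff_smul_eq_zero h1 fun ψ h4 h5 h6 => by
    have hψ : IsTestFun U ψ := ⟨h4, h5, h6⟩
    have h7 := h ψ hψ
    rw [h' ψ hψ, neg_inj] at h7
    have hi : ∀ {F : Sp N → Sp N}, MemLp F 2 (volume.restrict U) →
        Integrable (fun x => ψ x • F x) (volume.restrict U) := fun hF =>
      memLp_one_iff_integrable.1 (hF.smul hψ.memLp)
    rw [← setIntegral_eq_integral_of_forall_compl_eq_zero (s := U) fun x hx => by
      rw [image_eq_zero_of_notMem_tsupport fun hx' => hx (h6 hx'), zero_smul]]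
    simp only [smul_sub]
    rw [integral_sub (hi hG) (hi hG'), h7, sub_self]
  rw [EventuallyEq, ae_restrict_iff' hU.measurableSet]
  filter_upwards [h3] with x hx hxU
  exact sub_eq_zero.1 (hx hxU)

theorem HasWeakGradOn.mono {V : Set (Sp N)} {w : Sp N → ℝ} {G : Sp N → Sp N}
    (h : HasWeakGradOn V w G) (hUV : U ⊆ V) : HasWeakGradOn U w G := by
  intro ψ hψ
  have hout : ∀ x, x ∉ U → x ∉ tsupport ψ := fun x hx h => hx (hψ.2.2 h)
  have h1 : ∀ x, x ∉ U → w x • gradient ψ x = 0 := fun x hx => by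
    rw [gradient_of_notMem_tsupport (hout x hx), smul_zero]
  have h2 : ∀ x, x ∉ U → ψ x • G x = 0 := fun x hx => by
    rw [image_eq_zero_of_notMem_tsupport (hout x hx), zero_smul]
  rw [setIntegral_eq_integral_of_forall_compl_eq_zero h1,
    setIntegral_eq_integral_of_forall_compl_eq_zero h2,
    ← setIntegral_eq_integral_of_forall_compl_eq_zero fun x hx => h1 x fun h => hx (hUV h),
    ← setIntegral_eq_integral_of_forall_compl_eq_zero fun x hx => h2 x fun h => hx (hUV h)]
  exact h ψ (hψ.mono hUV)

/-! ### The space `H¹₀` -/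

/-- The weak gradient of an element of `H¹₀(Ω)` is its second component. -/
theorem H10.hasWeakGradOn (hUΩ : U ⊆ Ω) (u : H10 Ω) :
    HasWeakGradOn U (H10.val u) (H10.grad u) := by
  refine HasWeakGradOn.mono (V := Ω) (hasWeakGradOn_of_inner (Lp.memLp _) (Lp.memLp _)
    fun ψ hψ e => ?_) hUΩ
  -- the identity says that `u` is orthogonal to the pair `z`
  have hA : MemLp (fun x => inner ℝ e (gradient ψ x)) 2 (volume.restrict Ω) :=
    (hψ.memLp_gradient).const_inner e
  have hB : MemLp (fun x => ψ x • e) 2 (volume.restrict Ω) :=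
    (ContinuousLinearMap.toSpanSingleton ℝ e).comp_memLp' hψ.memLp
  set z : WithLp 2 (L2 Ω × L2Vec Ω) := WithLp.toLp 2 (hA.toLp _, hB.toLp _) with hz
  have hinner : ∀ p : WithLp 2 (L2 Ω × L2Vec Ω), inner ℝ z p =
      (∫ x in Ω, p.fst x * inner ℝ e (gradient ψ x)) + ∫ x in Ω, ψ x * inner ℝ e (p.snd x) := by
    intro p
    have h1 : inner ℝ z p = inner ℝ (hA.toLp _) p.fst + inner ℝ (hB.toLp _) p.snd := rfl
    rw [h1, L2.inner_def, L2.inner_def]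
    congr 1
    · refine integral_congr_ae ?_
      filter_upwards [hA.coeFn_toLp] with x hx
      rw [hx]
      rfl
    · refine integral_congr_ae ?_
      filter_upwards [hB.coeFn_toLp] with x hx
      rw [hx, real_inner_smul_left]
  have hle : H10 Ω ≤ (ℝ ∙ z)ᗮ := by
    refine Submodule.topologicalClosure_minimal _ (Submodule.span_le.2 ?_)
      (Submodule.isClosed_orthogonal _)
    rintro p ⟨ψ₀, hψ₀, h1, h2⟩
    obtain ⟨L, hL⟩ := hψ₀.exists_lipschitz
    have h3 : (fun x => p.fst x * inner ℝ e (gradient ψ x)) =ᵐ[volume.restrict Ω]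
        fun x => ψ₀ x * inner ℝ e (gradient ψ x) := by
      filter_upwards [h1] with x hx
      rw [hx]
    have h4 : (fun x => ψ x * inner ℝ e (p.snd x)) =ᵐ[volume.restrict Ω]
        fun x => ψ x * inner ℝ e (gradient ψ₀ x) := by
      filter_upwards [h2] with x hx
      rw [hx]
    rw [SetLike.mem_coe, Submodule.mem_orthogonal_singleton_iff_inner_right, hinner,
      integral_congr_ae h3, integral_congr_ae h4]
    exact add_eq_zero_iff_eq_neg.2 (hL.integral_mul_gradient hψ e)
  have := Submodule.mem_orthogonal_singleton_iff_inner_right.1 (hle u.2)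
  rw [hinner] at this
  exact add_eq_zero_iff_eq_neg.1 this

end WeakGradient
end HeatFEM

namespace HeatFEM

/-! ### Lipschitz functions in `H¹₀` -/

section LipschitzH10

variable {N : ℕ} {Ω U : Set (Sp N)}

/-- On a finite measure space, bounded a.e. convergence implies weak convergence in `L²`. -/
theorem exists_tendsto_inner_of_tendsto_ae {α E : Type*} [NormedAddCommGroup E]
    [InnerProductSpace ℝ E] [MeasurableSpace α] {μ : Measure α} [IsFiniteMeasure μ]
    {F : ℕ → Lp E 2 μ} {H : α → E} {B : ℝ} (hb : ∀ n, ∀ᵐ x ∂μ, ‖F n x‖ ≤ B)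
    (hlim : ∀ᵐ x ∂μ, Tendsto (fun n => F n x) atTop (𝓝 (H x))) :
    ∃ hH : MemLp H 2 μ, ∀ w : Lp E 2 μ,
      Tendsto (fun n => (inner ℝ w (F n) : ℝ)) atTop (𝓝 (inner ℝ w (hH.toLp H))) := by
  have hm : AEStronglyMeasurable H μ :=
    aestronglyMeasurable_of_tendsto_ae atTop (fun n => (Lp.memLp (F n)).1) hlim
  have hB : ∀ᵐ x ∂μ, ‖H x‖ ≤ B := by
    filter_upwards [hlim, ae_all_iff.2 hb] with x hx hx'
    exact le_of_tendsto hx.norm (Eventually.of_forall hx')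
  have hH : MemLp H 2 μ := MemLp.of_bound hm B hB
  refine ⟨hH, fun w => ?_⟩
  have h1 : (inner ℝ w (hH.toLp H) : ℝ) = ∫ x, inner ℝ (w x) (H x) ∂μ := by
    rw [L2.inner_def]
    refine integral_congr_ae ?_
    filter_upwards [hH.coeFn_toLp] with x hx
    rw [hx]
  rw [h1]
  simp only [L2.inner_def]
  refine tendsto_integral_of_dominated_convergence (fun x => ‖w x‖ * B)
    (fun n => (Lp.memLp w).1.inner (Lp.memLp (F n)).1) ?_ (fun n => ?_) ?_
  · exact (((Lp.memLp w).mono_exponent one_le_two).integrable le_rfl).norm.mul_const B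
  · filter_upwards [hb n] with x hx
    exact (norm_inner_le_norm _ _).trans (by gcongr)
  · filter_upwards [hlim] with x hx
    exact tendsto_const_nhds.inner hx

/-- A bounded a.e. limit of functions in `H¹₀` with bounded and a.e. convergent gradients is in
`H¹₀`: it is a weak limit, and `H¹₀` is weakly closed. -/
theorem H10.exists_of_tendsto_ae (hΩ : volume Ω ≠ ⊤) {u : ℕ → H10 Ω} {f : Sp N → ℝ}
    {G : Sp N → Sp N} {B : ℝ} (h1 : ∀ n, ∀ᵐ x ∂volume.restrict Ω, ‖H10.val (u n) x‖ ≤ B)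
    (h2 : ∀ n, ∀ᵐ x ∂volume.restrict Ω, ‖H10.grad (u n) x‖ ≤ B)
    (h3 : ∀ᵐ x ∂volume.restrict Ω, Tendsto (fun n => H10.val (u n) x) atTop (𝓝 (f x)))
    (h4 : ∀ᵐ x ∂volume.restrict Ω, Tendsto (fun n => H10.grad (u n) x) atTop (𝓝 (G x))) :
    ∃ v : H10 Ω, H10.val v =ᵐ[volume.restrict Ω] f ∧ H10.grad v =ᵐ[volume.restrict Ω] G := by
  have : IsFiniteMeasure (volume.restrict Ω) := isFiniteMeasure_restrict.2 hΩ
  obtain ⟨hf, h5⟩ := exists_tendsto_inner_of_tendsto_ae h1 h3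
  obtain ⟨hG, h6⟩ := exists_tendsto_inner_of_tendsto_ae h2 h4
  have hcl : (H10 Ω)ᗮᗮ = H10 Ω := by
    rw [Submodule.orthogonal_orthogonal_eq_closure]
    exact (Submodule.isClosed_topologicalClosure _).submodule_topologicalClosure_eq
  have hz : (WithLp.toLp 2 (hf.toLp f, hG.toLp G) : WithLp 2 (L2 Ω × L2Vec Ω)) ∈ H10 Ω := by
    rw [← hcl, Submodule.mem_orthogonal]
    intro w hw
    have h7 := (h5 w.fst).add (h6 w.snd)
    refine tendsto_nhds_unique (h7.congr fun n => ?_) tendsto_const_nhds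
    exact (Submodule.mem_orthogonal' _ _).1 hw _ (u n).2
  exact ⟨⟨_, hz⟩, hf.coeFn_toLp, hG.coeFn_toLp⟩

theorem IsTestFun.exists_H10 {ψ : Sp N → ℝ} (h : IsTestFun Ω ψ) :
    ∃ v : H10 Ω, H10.val v =ᵐ[volume.restrict Ω] ψ ∧
      H10.grad v =ᵐ[volume.restrict Ω] gradient ψ := by
  have h1 : MemLp ψ 2 (volume.restrict Ω) := h.memLp
  have h2 : MemLp (gradient ψ) 2 (volume.restrict Ω) := h.memLp_gradient
  exact ⟨⟨WithLp.toLp 2 (h1.toLp _, h2.toLp _), Submodule.le_topologicalClosure _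
    (Submodule.subset_span ⟨ψ, h, h1.coeFn_toLp, h2.coeFn_toLp⟩)⟩, h1.coeFn_toLp, h2.coeFn_toLp⟩

open ContinuousLinearMap in
/-- The gradient of a mollified Lipschitz function is the mollified gradient. -/
theorem _root_.LipschitzWith.hasFDerivAt_convolution {g : Sp N → ℝ} {L : NNReal}
    (hg : LipschitzWith L g) (φ : ContDiffBump (0 : Sp N)) (x : Sp N) :
    HasFDerivAt (convolution (φ.normed volume) g (lsmul ℝ ℝ) volume)
      (convolution (φ.normed volume) (fderiv ℝ g) (lsmul ℝ ℝ) volume x) x := by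
  have hφc : Continuous (φ.normed volume) := φ.continuous_normed
  have hφi : Integrable (φ.normed (volume : Measure (Sp N))) := φ.integrable_normed
  have hgm : Continuous g := hg.continuous
  refine (hasFDerivAt_integral_of_dominated_loc_of_lip (s := univ)
    (bound := fun t => L * φ.normed volume t)
    (F := fun x t => lsmul ℝ ℝ (φ.normed volume t) (g (x - t)))
    (F' := fun t => lsmul ℝ ℝ (φ.normed volume t) (fderiv ℝ g (x - t)))
    univ_mem ?_ ?_ ?_ ?_ ?_ ?_).2
  · refine Eventually.of_forall fun y => Continuous.aestronglyMeasurable ?_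
    simp only [lsmul_apply, smul_eq_mul]
    fun_prop
  · refine Continuous.integrable_of_hasCompactSupport ?_ ?_
    · simp only [lsmul_apply, smul_eq_mul]
      fun_prop
    · exact φ.hasCompactSupport_normed.mul_right
  · refine AEStronglyMeasurable.smul hφc.aestronglyMeasurable ?_
    exact ((measurable_fderiv ℝ g).comp (measurable_const.sub measurable_id)).aestronglyMeasurable
  · refine Eventually.of_forall fun t => LipschitzWith.lipschitzOnWith ?_
    refine LipschitzWith.of_dist_le_mul fun y z => ?_
    have h1 := φ.nonneg_normed (μ := volume) t
    simp only [lsmul_apply, smul_eq_mul, Real.dist_eq, ← mul_sub, abs_mul, Real.coe_nnabs]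
    rw [abs_of_nonneg h1, NNReal.abs_eq, mul_comm (L : ℝ), mul_assoc]
    gcongr
    simpa [Real.dist_eq] using hg.dist_le_mul (y - t) (z - t)
  · exact hφi.const_mul _
  · have h1 : ∀ᵐ t : Sp N, DifferentiableAt ℝ g (x - t) :=
      (quasiMeasurePreserving_sub_left volume x).ae hg.ae_differentiableAt
    filter_upwards [h1] with t ht
    have h2 : HasFDerivAt (fun y : Sp N => g (y - t)) (fderiv ℝ g (x - t)) x := by
      have h3 := ht.hasFDerivAt.comp x ((hasFDerivAt_id x).sub_const t)
      rwa [ContinuousLinearMap.comp_id] at h3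
    exact h2.const_smul (φ.normed volume t)

open ContinuousLinearMap in
/-- Lipschitz functions with compact support in `Ω` are in `H¹₀`, by mollification. -/
theorem _root_.LipschitzWith.exists_H10_of_tsupport_subset (hΩ : IsOpen Ω)
    (hΩb : Bornology.IsBounded Ω)
    {g : Sp N → ℝ} {L : NNReal} (hg : LipschitzWith L g) (hc : HasCompactSupport g)
    (hs : tsupport g ⊆ Ω) : ∃ v : H10 Ω, H10.val v =ᵐ[volume.restrict Ω] g ∧
      H10.grad v =ᵐ[volume.restrict Ω] gradient g := by
  obtain ⟨ρ, hρ, hρΩ⟩ := hc.isCompact.exists_cthickening_subset_open hΩ hs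
  obtain ⟨B, hB⟩ := hc.exists_bound_of_continuous hg.continuous
  let φ : ℕ → ContDiffBump (0 : Sp N) := fun n =>
    ⟨ρ / (n + 1) / 2, ρ / (n + 1), by positivity, half_lt_self (by positivity)⟩
  have hφr : ∀ n, (φ n).rOut ≤ ρ := fun n => by
    change ρ / ((n : ℝ) + 1) ≤ ρ
    exact div_le_self hρ.le (by linarith [n.cast_nonneg (α := ℝ)])
  have hφ0 : Tendsto (fun n => (φ n).rOut) atTop (𝓝 0) := by
    have := (tendsto_one_div_add_atTop_nhds_zero_nat (𝕜 := ℝ)).const_mul ρ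
    simpa [φ, div_eq_mul_inv] using this
  set ψ : ℕ → Sp N → ℝ := fun n => convolution ((φ n).normed volume) g (lsmul ℝ ℝ) volume with hψ
  have hgi : LocallyIntegrable g volume := hg.continuous.locallyIntegrable
  have htest : ∀ n, IsTestFun Ω (ψ n) := by
    intro n
    refine ⟨(φ n).hasCompactSupport_normed.contDiff_convolution_left _ (φ n).contDiff_normed hgi,
      (φ n).hasCompactSupport_normed.convolution _ hc, ?_⟩
    refine (closure_minimal ?_ Metric.isClosed_cthickening).trans hρΩ
    refine (support_convolution_subset _).trans ?_
    rintro _ ⟨a, ha, b, hb, rfl⟩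
    refine Metric.mem_cthickening_of_dist_le _ b _ _ (subset_tsupport _ hb) ?_
    rw [(φ n).support_normed_eq, mem_ball_zero_iff] at ha
    simpa using ha.le.trans (hφr n)
  have hgrad : ∀ n x, gradient (ψ n) x = (InnerProductSpace.toDual ℝ (Sp N)).symm
      (convolution ((φ n).normed volume) (fderiv ℝ g) (lsmul ℝ ℝ) volume x) := fun n x => by
    rw [gradient, (hg.hasFDerivAt_convolution (φ n) x).fderiv]
  have hgl : LocallyIntegrable (fderiv ℝ g) volume := by
    refine fun x => ⟨Metric.ball x 1, Metric.ball_mem_nhds _ one_pos, ?_⟩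
    exact Measure.integrableOn_of_bounded (M := L) measure_ball_lt_top.ne
      (measurable_fderiv ℝ g).aestronglyMeasurable
      (Eventually.of_forall fun y => norm_fderiv_le_of_lipschitz ℝ hg)
  choose v hv1 hv2 using fun n => (htest n).exists_H10
  refine H10.exists_of_tendsto_ae (B := max (B + L * ρ) L) hΩb.measure_lt_top.ne (u := v)
    (fun n => ?_) (fun n => ?_) ?_ ?_
  · filter_upwards [hv1 n] with x hx
    rw [hx]
    have h1 : dist (ψ n x) (g x) ≤ L * ρ :=
      (φ n).dist_normed_convolution_le hg.continuous.aestronglyMeasurable fun y hy =>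
        (hg.dist_le_mul y x).trans (by
          have := hφr n
          have := Metric.mem_ball.1 hy
          gcongr
          linarith)
    have h2 := hB x
    have h3 := norm_le_norm_add_norm_sub' (ψ n x) (g x)
    rw [dist_eq_norm] at h1
    exact le_max_of_le_left (by linarith)
  · filter_upwards [hv2 n] with x hx
    rw [hx, hgrad, LinearIsometryEquiv.norm_map]
    refine le_max_of_le_right ?_
    have h1 := norm_integral_le_of_norm_le (μ := volume)
      (f := fun t => lsmul ℝ ℝ ((φ n).normed volume t) (fderiv ℝ g (x - t)))
      (g := fun t => (φ n).normed volume t * L)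
      ((φ n).integrable_normed.mul_const _) (Eventually.of_forall fun t => by
        rw [lsmul_apply, norm_smul, Real.norm_of_nonneg ((φ n).nonneg_normed t)]
        have := (φ n).nonneg_normed (μ := volume) t
        gcongr
        exact norm_fderiv_le_of_lipschitz ℝ hg)
    rwa [integral_mul_const, (φ n).integral_normed, one_mul] at h1
  · filter_upwards [ae_all_iff.2 hv1] with x hx
    simp only [hx]
    exact ContDiffBump.convolution_tendsto_right_of_continuous hφ0 hg.continuous x
  · have h1 := ContDiffBump.ae_convolution_tendsto_right_of_locallyIntegrable (K := 2) hφ0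
      (Eventually.of_forall fun n => le_of_eq (by simp [φ]; ring)) hgl
    filter_upwards [ae_all_iff.2 hv2, ae_restrict_of_ae h1] with x hx h2
    simp only [hx, hgrad]
    exact ((InnerProductSpace.toDual ℝ (Sp N)).symm.continuous.tendsto _).comp h2

/-- Lipschitz functions that vanish outside the bounded open set `Ω` are in `H¹₀(Ω)`. They are
approximated by the truncations at small levels, which have compact support in `Ω`. -/
theorem _root_.LipschitzWith.exists_H10 (hΩ : IsOpen Ω) (hΩb : Bornology.IsBounded Ω)
    {f : Sp N → ℝ} {L : NNReal} (hf : LipschitzWith L f) (h0 : ∀ x, x ∉ Ω → f x = 0) :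
    ∃ v : H10 Ω, H10.val v =ᵐ[volume.restrict Ω] f ∧
      H10.grad v =ᵐ[volume.restrict Ω] gradient f := by
  classical
  have : IsFiniteMeasure (volume.restrict Ω) := isFiniteMeasure_restrict.2 hΩb.measure_lt_top.ne
  have hc : HasCompactSupport f := HasCompactSupport.intro' hΩb.isCompact_closure isClosed_closure
    fun x hx => h0 x fun h => hx (subset_closure h)
  obtain ⟨B, hB⟩ := hc.exists_bound_of_continuous hf.continuous
  let δ : ℕ → ℝ := fun n => 1 / ((n : ℝ) + 1)
  have hδ : ∀ n, 0 < δ n := fun n => by positivity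
  have hδ0 : Tendsto δ atTop (𝓝 0) := tendsto_one_div_add_atTop_nhds_zero_nat
  -- `f` minus its truncation at height `δ n`, which vanishes where `|f| ≤ δ n`
  let g : ℕ → Sp N → ℝ := fun n x => f x - max (-δ n) (min (δ n) (f x))
  have hgL : ∀ n, LipschitzWith (L + L) (g n) := fun n =>
    hf.sub ((hf.const_min (δ n)).const_max (-δ n))
  have hg0 : ∀ n x, |f x| ≤ δ n → g n x = 0 := fun n x hx => by
    have := abs_le.1 hx
    simp only [g, min_eq_right this.2, max_eq_right this.1, sub_self]
  have hgs : ∀ n, tsupport (g n) ⊆ {x | δ n ≤ |f x|} := fun n =>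
    closure_minimal (fun x hx => (not_le.1 fun h => hx (hg0 n x h)).le)
      (isClosed_le continuous_const hf.continuous.abs)
  have hgΩ : ∀ n, tsupport (g n) ⊆ Ω := fun n x hx => by
    by_contra h
    have := hgs n hx
    simp only [mem_ofPred_eq, h0 x h, abs_zero] at this
    exact (hδ n).not_ge this
  choose v hv1 hv2 using fun n => (hgL n).exists_H10_of_tsupport_subset hΩ hΩb
    (hc.mono fun x hx hfx => hx (hg0 n x (by simp [hfx, (hδ n).le]))) (hgΩ n)
  have hlim : ∀ x, Tendsto (fun n => g n x) atTop (𝓝 (f x)) := fun x => by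
    have h1 : Tendsto (fun n => max (-δ n) (min (δ n) (f x))) atTop (𝓝 0) := by
      refine tendsto_of_tendsto_of_tendsto_of_le_of_le (by simpa using hδ0.neg) hδ0
        (fun n => le_max_left _ _) fun n => max_le ?_ (min_le_left _ _)
      linarith [hδ n]
    simpa using tendsto_const_nhds.sub h1
  -- It does not matter that the limit of the gradients is only known to be `0` where `f` vanishes:
  -- it is a weak gradient of `f`, and these are unique.
  suffices h : ∃ u : H10 Ω, H10.val u =ᵐ[volume.restrict Ω] f ∧
      H10.grad u =ᵐ[volume.restrict Ω] fun x => if f x = 0 then 0 else gradient f x by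
    obtain ⟨u, hu1, -⟩ := h
    refine ⟨u, hu1, ?_⟩
    have hf2 : MemLp f 2 (volume.restrict Ω) :=
      (hf.continuous.memLp_of_hasCompactSupport hc).restrict _
    have hg2 : MemLp (gradient f) 2 (volume.restrict Ω) :=
      MemLp.of_bound (measurable_gradient f).aestronglyMeasurable L
        (Eventually.of_forall (norm_gradient_le hf))
    exact ((H10.hasWeakGradOn subset_rfl u).congr hu1 (ae_eq_refl _)).unique hΩ
      (hf.hasWeakGradOn hf2 hg2) (Lp.memLp _) hg2
  refine H10.exists_of_tendsto_ae (B := max (B + B) (L + L)) hΩb.measure_lt_top.ne (u := v)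
    (fun n => ?_) (fun n => ?_) ?_ ?_
  · filter_upwards [hv1 n] with x hx
    rw [hx]
    refine le_max_of_le_left ?_
    have h1 : |max (-δ n) (min (δ n) (f x))| ≤ |f x| := by
      have := hδ n
      rcases abs_cases (f x) with h | h <;> rw [abs_le] <;> constructor
      · exact (neg_nonpos.2 (abs_nonneg _)).trans (le_max_of_le_right (le_min this.le h.2))
      · exact max_le (by linarith [abs_nonneg (f x)]) ((min_le_right _ _).trans (le_abs_self _))
      · refine le_max_of_le_right (le_min (by linarith [abs_nonneg (f x)]) (neg_abs_le _))
      · exact max_le (by linarith [abs_nonneg (f x)]) ((min_le_right _ _).trans (le_abs_self _))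
    have h2 := hB x
    rw [Real.norm_eq_abs] at h2 ⊢
    exact (abs_sub _ _).trans (by linarith)
  · filter_upwards [hv2 n] with x hx
    rw [hx]
    exact le_max_of_le_right (norm_gradient_le (hgL n) x)
  · filter_upwards [ae_all_iff.2 hv1] with x hx
    simp only [hx]
    exact hlim x
  · filter_upwards [ae_all_iff.2 hv2] with x hx
    simp only [hx]
    refine tendsto_const_nhds.congr' ?_
    by_cases hfx : f x = 0
    · refine Eventually.of_forall fun n => ?_
      have hx' : x ∉ tsupport (g n) := fun h => ?_
      · beta_reduce
        rw [if_pos hfx, gradient_of_notMem_tsupport hx']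
      have := hgs n h
      simp only [mem_ofPred_eq, hfx, abs_zero] at this
      exact (hδ n).not_ge this
    · -- near `x` the truncation differs from `f` by a constant
      filter_upwards [hδ0.eventually_lt_const (abs_pos.2 hfx)] with n hn
      rw [if_neg hfx]
      have h1 : ∃ a : ℝ, g n =ᶠ[𝓝 x] fun y => f y - a := by
        rcases lt_or_gt_of_ne hfx with h | h
        · rw [abs_of_neg h] at hn
          refine ⟨-δ n, ?_⟩
          filter_upwards [hf.continuous.continuousAt.eventually_lt_const
            (show f x < -δ n by linarith)] with y hy
          simp only [g]
          rw [max_eq_left ((min_le_right _ _).trans hy.le)]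
        · rw [abs_of_pos h] at hn
          refine ⟨δ n, ?_⟩
          filter_upwards [hf.continuous.continuousAt.eventually_const_lt hn] with y hy
          simp only [g]
          rw [min_eq_left hy.le, max_eq_right (by linarith [hδ n])]
      obtain ⟨a, ha⟩ := h1
      beta_reduce
      rw [ha.gradient_eq, gradient, gradient, fderiv_sub_const]

end LipschitzH10
end HeatFEM

namespace HeatFEM

/-! ### Finite element functions are in `H¹₀` -/

section FiniteElementH10

/-- A continuous function on a normed space that is `L`-Lipschitz on each set of a finite closed
cover is `L`-Lipschitz: along a segment its slopes are frequently bounded by `L` from the right. -/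
theorem lipschitzWith_of_finite_closed_cover {E ι : Type*} [NormedAddCommGroup E] [NormedSpace ℝ E]
    [Finite ι] {f : E → ℝ} {L : NNReal} (hf : Continuous f) {A : ι → Set E}
    (hA : ∀ i, IsClosed (A i)) (hcov : ⋃ i, A i = univ) (hL : ∀ i, LipschitzOnWith L f (A i)) :
    LipschitzWith L f := by
  refine LipschitzWith.of_dist_le_mul fun y x => le_of_forall_pos_le_add fun η hη => ?_
  set γ : ℝ → E := fun t => AffineMap.lineMap x y t with hγ
  have hγc : Continuous γ := AffineMap.lineMap_continuous
  set D := dist y x with hD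
  have h := image_norm_le_of_liminf_right_slope_norm_lt_deriv_boundary (a := 0) (b := 1)
    (f := fun t => f (γ t) - f (γ 0)) (f' := fun _ => L * D) (B := fun t => (L * D + η) * t)
    (B' := fun _ => L * D + η) (by fun_prop) ?_ (by simp) (by fun_prop)
    (fun t _ => by simpa using ((hasDerivAt_id t).const_mul (L * D + η)).hasDerivWithinAt)
    (fun t _ _ => by linarith)
  · have h1 := h (right_mem_Icc.2 zero_le_one)
    simpa [hγ, Real.dist_eq] using h1
  · intro t ht c hc
    -- from the right, one set of the cover is met frequently
    obtain ⟨i, hi⟩ : ∃ i, ∃ᶠ z in 𝓝[>] t, γ z ∈ A i := by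
      by_contra! hcon
      obtain ⟨z, hz⟩ := (eventually_all.2 hcon).exists
      have : γ z ∈ ⋃ i, A i := hcov ▸ mem_univ _
      obtain ⟨i, hi⟩ := mem_iUnion.1 this
      exact hz i hi
    have hti : γ t ∈ A i := (hA i).mem_of_frequently_of_tendsto hi
      (hγc.continuousAt.tendsto.mono_left nhdsWithin_le_nhds)
    refine (hi.and_eventually self_mem_nhdsWithin).mono fun z hz => lt_of_le_of_lt ?_ hc
    have hzt : 0 < z - t := sub_pos.2 hz.2
    rw [slope_def_field, div_le_iff₀ hzt]
    have h1 : |f (γ z) - f (γ t)| ≤ L * (D * (z - t)) := by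
      have h2 := (hL i).dist_le_mul _ hz.1 _ hti
      have h3 : dist (γ z) (γ t) = (z - t) * D := by
        rw [hγ, dist_lineMap_lineMap, Real.dist_eq, abs_of_pos hzt, hD, dist_comm]
      rwa [h3, mul_comm (z - t), Real.dist_eq] at h2
    have h4 := abs_norm_sub_norm_le (f (γ z) - f (γ 0)) (f (γ t) - f (γ 0))
    simp only [Function.comp_apply]
    rw [sub_sub_sub_cancel_right, Real.norm_eq_abs (f (γ z) - f (γ t))] at h4
    linarith [le_abs_self (‖f (γ z) - f (γ 0)‖ - ‖f (γ t) - f (γ 0)‖)]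

variable {N : ℕ} {Ω : Set (Sp N)} {𝒯 : Geometry.SimplicialComplex ℝ (Sp N)} {K h : ℝ} {r : ℕ}

theorem IsPolyhedralDomain.isBounded (hΩ : IsPolyhedralDomain Ω) : Bornology.IsBounded Ω := by
  obtain ⟨F, -, hF⟩ := hΩ.closure_eq
  refine Bornology.IsBounded.subset ?_ subset_closure
  rw [hF]
  exact (Bornology.isBounded_biUnion_finset F).2 fun s _ => (isCompact_cell s).isBounded

/-- Polynomials are Lipschitz on cells. -/
theorem exists_lipschitzOnWith_of_mem_polyFun {p : Sp N → ℝ} (hp : p ∈ polyFun N r)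
    (s : Finset (Sp N)) : ∃ L, LipschitzOnWith L p (convexHull ℝ (s : Set (Sp N))) := by
  have hd := contDiff_of_mem_polyFun hp (n := 1)
  obtain ⟨C, hC⟩ := (isCompact_cell s).exists_bound_of_continuousOn
    (f := fderiv ℝ p) (hd.continuous_fderiv (by simp)).continuousOn
  refine ⟨C.toNNReal, (convex_convexHull ℝ _).lipschitzOnWith_of_nnnorm_fderiv_le
    (fun x _ => hd.contDiffAt.differentiableAt (by simp)) fun x hx => ?_⟩
  rw [← NNReal.coe_le_coe, coe_nnnorm]
  exact (hC x hx).trans (Real.le_coe_toNNReal C)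

theorem exists_lipschitzWith_of_mem_feFun (hT : IsQuasiUniformTriangulation Ω 𝒯 K h)
    (hΩ : IsPolyhedralDomain Ω) {f : Sp N → ℝ} (hf : f ∈ feFun Ω 𝒯 r) :
    ∃ L, LipschitzWith L f := by
  have := hT.finite_cells.to_subtype
  have h1 : ∀ s : cells 𝒯, ∃ L, LipschitzOnWith L f (convexHull ℝ (s.1 : Set (Sp N))) := fun s => by
    obtain ⟨p, hp, hpe⟩ := exists_polyFun_of_mem_feFun hf s.2
    obtain ⟨L, hL⟩ := exists_lipschitzOnWith_of_mem_polyFun hp s.1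
    exact ⟨L, fun x hx y hy => by rw [hpe hx, hpe hy]; exact hL hx hy⟩
  choose L hL using h1
  obtain ⟨M, hM⟩ := (finite_range L).bddAbove
  refine ⟨M, lipschitzWith_of_finite_closed_cover hf.1 (ι := Option (cells 𝒯))
    (A := fun i => i.elim Ωᶜ fun s => convexHull ℝ (s.1 : Set (Sp N))) ?_ ?_ ?_⟩
  · rintro (_ | s)
    · exact hΩ.isOpen.isClosed_compl
    · exact isClosed_cell s.1
  · refine eq_univ_of_forall fun x => ?_
    by_cases hx : x ∈ Ω
    · obtain ⟨s, hs, hxs⟩ := hT.exists_cell (subset_closure hx)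
      exact mem_iUnion.2 ⟨some ⟨s, hs⟩, hxs⟩
    · exact mem_iUnion.2 ⟨none, hx⟩
  · rintro (_ | s)
    · intro x hx y hy
      rw [hf.2.1 x hx, hf.2.1 y hy, edist_self]
      exact zero_le
    · exact (hL s).weaken (hM ⟨s, rfl⟩)

/-- Finite element functions are in `H¹₀(Ω)`. -/
theorem exists_Sh_of_mem_feFun (hT : IsQuasiUniformTriangulation Ω 𝒯 K h)
    (hΩ : IsPolyhedralDomain Ω) {f : Sp N → ℝ} (hf : f ∈ feFun Ω 𝒯 r) :
    ∃ u : Sh Ω 𝒯 r, H10.val (u : H10 Ω) =ᵐ[volume.restrict Ω] f ∧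
      H10.grad (u : H10 Ω) =ᵐ[volume.restrict Ω] gradient f := by
  obtain ⟨L, hL⟩ := exists_lipschitzWith_of_mem_feFun hT hΩ hf
  obtain ⟨v, h1, h2⟩ := hL.exists_H10 hΩ.isOpen hΩ.isBounded hf.2.1
  exact ⟨⟨v, f, hf, h1⟩, h1, h2⟩

theorem H10.val_injective (hΩ : IsOpen Ω) : Function.Injective (H10.val : H10 Ω → L2 Ω) := by
  intro u v huv
  refine Subtype.ext ((WithLp.equiv 2 _).injective (Prod.ext huv ?_))
  refine Lp.ext ?_
  refine (H10.hasWeakGradOn subset_rfl u).unique hΩ ?_ (Lp.memLp _) (Lp.memLp _)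
  rw [huv]
  exact H10.hasWeakGradOn subset_rfl v

/-- A finite element function is determined by its class in `L²(Ω)`. -/
theorem eq_of_mem_feFun_of_ae_eq (hΩ : IsPolyhedralDomain Ω) {f g : Sp N → ℝ}
    (hf : f ∈ feFun Ω 𝒯 r) (hg : g ∈ feFun Ω 𝒯 r) (h : f =ᵐ[volume.restrict Ω] g) : f = g := by
  funext x
  by_cases hx : x ∈ Ω
  · exact Measure.eqOn_open_of_ae_eq h hΩ.isOpen hf.1.continuousOn hg.1.continuousOn hx
  · rw [hf.2.1 x hx, hg.2.1 x hx]

/-- The continuous piecewise polynomial function that represents an element of `S_h`. -/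
noncomputable def Sh.rep (u : Sh Ω 𝒯 r) : Sp N → ℝ := u.2.choose

theorem Sh.rep_mem (u : Sh Ω 𝒯 r) : Sh.rep u ∈ feFun Ω 𝒯 r := u.2.choose_spec.1

theorem Sh.val_ae_eq_rep (u : Sh Ω 𝒯 r) :
    H10.val (u : H10 Ω) =ᵐ[volume.restrict Ω] Sh.rep u := u.2.choose_spec.2

theorem Sh.rep_eq (hΩ : IsPolyhedralDomain Ω) {u : Sh Ω 𝒯 r} {f : Sp N → ℝ} (hf : f ∈ feFun Ω 𝒯 r)
    (h : H10.val (u : H10 Ω) =ᵐ[volume.restrict Ω] f) : Sh.rep u = f :=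
  eq_of_mem_feFun_of_ae_eq hΩ (Sh.rep_mem u) hf ((Sh.val_ae_eq_rep u).symm.trans h)

theorem Sh.grad_ae_eq (hT : IsQuasiUniformTriangulation Ω 𝒯 K h) (hΩ : IsPolyhedralDomain Ω)
    (u : Sh Ω 𝒯 r) : H10.grad (u : H10 Ω) =ᵐ[volume.restrict Ω] gradient (Sh.rep u) := by
  obtain ⟨v, h1, h2⟩ := exists_Sh_of_mem_feFun hT hΩ (Sh.rep_mem u)
  have : v = u := Subtype.ext (H10.val_injective hΩ.isOpen (Lp.ext
    (h1.trans (Sh.val_ae_eq_rep u).symm)))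
  rwa [this] at h2

/-- The representatives of the elements of `S_h`, as a linear equivalence. -/
noncomputable def Sh.equivFeFun (hT : IsQuasiUniformTriangulation Ω 𝒯 K h)
    (hΩ : IsPolyhedralDomain Ω) : Sh Ω 𝒯 r ≃ₗ[ℝ] feFun Ω 𝒯 r where
  toFun u := ⟨Sh.rep u, (Sh.rep_mem u)⟩
  map_add' u v := Subtype.ext <| Sh.rep_eq hΩ
      (Submodule.add_mem _ (Sh.rep_mem u) (Sh.rep_mem v)) <| by
    rw [Submodule.coe_add, map_add]
    exact (Lp.coeFn_add _ _).trans ((Sh.val_ae_eq_rep u).add (Sh.val_ae_eq_rep v))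
  map_smul' c u := Subtype.ext <| Sh.rep_eq hΩ (Submodule.smul_mem _ c (Sh.rep_mem u)) <| by
    rw [Submodule.coe_smul, map_smul]
    exact (Lp.coeFn_smul _ _).trans ((Sh.val_ae_eq_rep u).const_smul c)
  invFun f := (exists_Sh_of_mem_feFun hT hΩ f.2).choose
  left_inv u := Subtype.ext <| H10.val_injective hΩ.isOpen <| Lp.ext <|
    (exists_Sh_of_mem_feFun hT hΩ (Sh.rep_mem u)).choose_spec.1.trans (Sh.val_ae_eq_rep u).symm
  right_inv f := Subtype.ext <| Sh.rep_eq hΩ f.2 (exists_Sh_of_mem_feFun hT hΩ f.2).choose_spec.1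

theorem finiteDimensional_feFun (hT : IsQuasiUniformTriangulation Ω 𝒯 K h) (hr : 1 ≤ r) :
    FiniteDimensional ℝ (feFun Ω 𝒯 r) := by
  have := (finite_nodes (r := r) hT).to_subtype
  let ev : feFun Ω 𝒯 r →ₗ[ℝ] (nodes Ω 𝒯 r → ℝ) :=
    { toFun := fun f z => f.1 z.1, map_add' := fun _ _ => rfl, map_smul' := fun _ _ => rfl }
  refine FiniteDimensional.of_injective ev ((injective_iff_map_eq_zero ev).2 fun f hf => ?_)
  have hf' : ∀ z ∈ nodes Ω 𝒯 r, f.1 z = 0 := fun z hz => congrFun hf ⟨z, hz⟩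
  refine Subtype.ext (funext fun x => ?_)
  by_cases hx : x ∈ Ω
  · obtain ⟨s, hs, hxs⟩ := hT.exists_cell (subset_closure hx)
    rw [eq_cellInterp_of_mem_feFun hr f.2 hs hxs]
    refine Finset.sum_eq_zero fun m hm => ?_
    by_cases hz : lagNode s r m ∈ Ω
    · rw [hf' _ (mem_nodes_iff.2 ⟨hz, s, hs, m, hm, rfl⟩), zero_mul]
    · rw [f.2.2.1 _ hz, zero_mul]
  · exact f.2.2.1 x hx

theorem finiteDimensional_Sh (hT : IsQuasiUniformTriangulation Ω 𝒯 K h)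
    (hΩ : IsPolyhedralDomain Ω) (hr : 1 ≤ r) : FiniteDimensional ℝ (Sh Ω 𝒯 r) := by
  have := finiteDimensional_feFun (Ω := Ω) (r := r) hT hr
  exact (Sh.equivFeFun hT hΩ).symm.finiteDimensional

end FiniteElementH10
end HeatFEM

namespace HeatFEM

/-! ### Multiplication operators -/

section Multiplication

variable {α : Type*} [MeasurableSpace α] {μ : Measure α} {E : Type*} [NormedAddCommGroup E]
  [InnerProductSpace ℝ E] {w w' : α → ℝ}

/-- A measurable function with values in `[-1, 1]`. -/
structure IsWeight (w : α → ℝ) : Prop where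
  measurable : Measurable w
  abs_le_one : ∀ x, |w x| ≤ 1

theorem IsWeight.memLp_smul (hw : IsWeight w) {f : α → E} (hf : MemLp f 2 μ) :
    MemLp (fun x => w x • f x) 2 μ :=
  hf.of_le (hw.measurable.aestronglyMeasurable.smul hf.1) <| Eventually.of_forall fun x => by
    rw [norm_smul]
    exact mul_le_of_le_one_left (norm_nonneg _) (hw.abs_le_one x)

/-- Multiplication by a weight on square integrable functions. -/
noncomputable def mulOp (hw : IsWeight w) (E : Type*) [NormedAddCommGroup E]
    [InnerProductSpace ℝ E] (μ : Measure α) : Lp E 2 μ →L[ℝ] Lp E 2 μ :=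
  LinearMap.mkContinuous
    { toFun := fun f => (hw.memLp_smul (Lp.memLp f)).toLp _
      map_add' := fun f g => by
        rw [← MemLp.toLp_add]
        refine MemLp.toLp_congr _ _ ?_
        filter_upwards [Lp.coeFn_add f g] with x hx
        rw [hx]
        exact smul_add _ _ _
      map_smul' := fun c f => by
        rw [RingHom.id_apply, ← MemLp.toLp_const_smul]
        refine MemLp.toLp_congr _ _ ?_
        filter_upwards [Lp.coeFn_smul c f] with x hx
        rw [hx]
        exact smul_comm _ _ _ } 1 fun f => by
    rw [one_mul]
    refine Lp.norm_le_norm_of_ae_le ?_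
    filter_upwards [(hw.memLp_smul (Lp.memLp f)).coeFn_toLp] with x hx
    change ‖(hw.memLp_smul (Lp.memLp f)).toLp _ x‖ ≤ _
    rw [hx, norm_smul]
    exact mul_le_of_le_one_left (norm_nonneg _) (hw.abs_le_one x)

theorem coeFn_mulOp (hw : IsWeight w) (f : Lp E 2 μ) :
    mulOp hw E μ f =ᵐ[μ] fun x => w x • f x :=
  (hw.memLp_smul (Lp.memLp f)).coeFn_toLp

theorem norm_mulOp_le (hw : IsWeight w) (f : Lp E 2 μ) : ‖mulOp hw E μ f‖ ≤ ‖f‖ := by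
  refine Lp.norm_le_norm_of_ae_le ?_
  filter_upwards [coeFn_mulOp hw f] with x hx
  rw [hx, norm_smul]
  exact mul_le_of_le_one_left (norm_nonneg _) (hw.abs_le_one x)

theorem norm_mulOp_le_norm_mulOp (hw : IsWeight w) (hw' : IsWeight w')
    (h : ∀ x, |w x| ≤ |w' x|) (f : Lp E 2 μ) : ‖mulOp hw E μ f‖ ≤ ‖mulOp hw' E μ f‖ := by
  refine Lp.norm_le_norm_of_ae_le ?_
  filter_upwards [coeFn_mulOp hw f, coeFn_mulOp hw' f] with x hx hx'
  rw [hx, hx', norm_smul, norm_smul]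
  exact mul_le_mul_of_nonneg_right (h x) (norm_nonneg _)

theorem inner_mulOp (hw : IsWeight w) (f g : Lp E 2 μ) :
    inner ℝ (mulOp hw E μ f) g = inner ℝ f (mulOp hw E μ g) := by
  rw [L2.inner_def, L2.inner_def]
  refine integral_congr_ae ?_
  filter_upwards [coeFn_mulOp hw f, coeFn_mulOp hw g] with x hx hx'
  rw [hx, hx', real_inner_smul_left, real_inner_smul_right]

theorem norm_sq_eq_integral (f : Lp E 2 μ) : ‖f‖ ^ 2 = ∫ x, ‖f x‖ ^ 2 ∂μ := by
  rw [← real_inner_self_eq_norm_sq, L2.inner_def]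
  simp only [real_inner_self_eq_norm_sq]

end Multiplication

/-! ### Superapproximation -/

section Superapproximation

variable {N : ℕ} {Ω : Set (Sp N)} {𝒯 : Geometry.SimplicialComplex ℝ (Sp N)} {K h : ℝ} {r : ℕ}

theorem card_lagIdx_le {s : Finset (Sp N)} (hs : IsCell s) :
    (lagIdx s r).card ≤ (r + 1) ^ (N + 1) := by
  classical
  have h1 : (Fintype.piFinset fun _ : s => Finset.range (r + 1)).card = (r + 1) ^ (N + 1) := by
    simp [hs.1]
  rw [← h1]
  refine Finset.card_le_card_of_injOn (fun m v => m v) (fun m hm => ?_) fun m hm m' hm' heq => ?_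
  · refine Fintype.mem_piFinset.2 fun v => Finset.mem_range.2 (Nat.lt_succ_of_le ?_)
    rw [← (mem_lagIdx.1 hm).1]
    exact Finset.single_le_sum (f := m) (fun _ _ => Nat.zero_le _) v.2
  · funext v
    by_cases hv : v ∈ s
    · exact congrFun heq ⟨v, hv⟩
    · have h2 : ∀ {m}, m ∈ lagIdx s r → m v = 0 := fun hm =>
        by_contra fun h => hv ((mem_lagIdx.1 hm).2 v h)
      rw [h2 hm, h2 hm']

/-- The cellwise superapproximation estimate: the difference between the interpolant of `a p` and
`a(x) p` at a point `x` of the cell is small, because it is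
`∑_m (a(z_m) - a(x)) p(z_m) L_m`. -/
theorem exists_superapproximation_cell (N : ℕ) (hr : 1 ≤ r) (hK : 0 < K) :
    ∃ C, 0 ≤ C ∧ ∀ (s : Finset (Sp N)) (h : ℝ) (c : Sp N), IsCell s → 0 < h →
      Metric.closedBall c (K⁻¹ * h) ⊆ convexHull ℝ (s : Set (Sp N)) →
      convexHull ℝ (s : Set (Sp N)) ⊆ Metric.closedBall c (K * h) →
      Metric.diam (convexHull ℝ (s : Set (Sp N))) ≤ K * h →
      ∀ (a : Sp N → ℝ) (L : ℝ), 0 ≤ L → (∀ x y, |a x - a y| ≤ L * dist x y) →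
      ∀ p ∈ polyFun N r, ∀ x ∈ convexHull ℝ (s : Set (Sp N)),
      (cellInterp r (fun y => a y * p y) s x - a x * p x) ^ 2 *
          volume.real (Metric.closedBall c (K * h)) ≤
        (C * (L * h)) ^ 2 * ∫ y in Metric.closedBall c (K⁻¹ * h), p y ^ 2 ∧
      ‖fderiv ℝ (cellInterp r (fun y => a y * p y) s) x - a x • fderiv ℝ p x‖ ^ 2 *
          volume.real (Metric.closedBall c (K * h)) ≤
        (C * L) ^ 2 * ∫ y in Metric.closedBall c (K⁻¹ * h), p y ^ 2 := by
  obtain ⟨C₀, hC₀, hinv⟩ := polyFun_inverse N r hK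
  set n : ℝ := (r + 1) ^ (N + 1) * K * r ^ r with hn
  have hn0 : 0 ≤ n := by positivity
  set C : ℝ := n * (1 + C₀) with hC
  have hC1 : n ^ 2 * C₀ ≤ C ^ 2 := by
    rw [hC, mul_pow n]
    have : C₀ ≤ (1 + C₀) ^ 2 := by nlinarith
    exact mul_le_mul_of_nonneg_left this (sq_nonneg n)
  have hC2 : C₀ * (n ^ 2 * C₀) ≤ C ^ 2 := by
    rw [hC, mul_pow n]
    have : C₀ * C₀ ≤ (1 + C₀) ^ 2 := by nlinarith
    nlinarith [mul_le_mul_of_nonneg_left this (sq_nonneg n)]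
  refine ⟨C, by positivity, ?_⟩
  intro s h c hs hh hin hout hdiam a L hL ha p hp x hx
  set V := volume.real (Metric.closedBall c (K * h)) with hV
  set A := ∫ y in Metric.closedBall c (K⁻¹ * h), p y ^ 2 with hA
  have hA0 : 0 ≤ A := integral_nonneg fun y => sq_nonneg _
  have hV0 : 0 < V := ENNReal.toReal_pos
    (Metric.measure_closedBall_pos volume c (by positivity)).ne' measure_closedBall_lt_top.ne
  -- the polynomial whose value and gradient at `x` are to be estimated
  set q : Sp N → ℝ := fun y => cellInterp r (fun y => a y * p y) s y - a x * p y with hq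
  have hqP : q ∈ polyFun N r :=
    Submodule.sub_mem _ (cellInterp_mem_polyFun _ s) (polyFun_const_mul hp _)
  have hqsum : ∀ y, q y = ∑ m ∈ lagIdx s r, ((a (lagNode s r m) - a x) * p (lagNode s r m)) *
      lagPoly s r m y := by
    intro y
    rw [hq]
    beta_reduce
    rw [eq_sum_lagPoly hs hr hp y, cellInterp, Finset.mul_sum, ← Finset.sum_sub_distrib]
    exact Finset.sum_congr rfl fun m _ => by ring
  -- a bound for `p` on the cell, from the inverse inequality
  obtain ⟨S, hS0, hSA, hS⟩ : ∃ S, 0 ≤ S ∧ S ^ 2 * V = C₀ * A ∧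
      ∀ y ∈ convexHull ℝ (s : Set (Sp N)), |p y| ≤ S := by
    refine ⟨Real.sqrt (C₀ * A / V), Real.sqrt_nonneg _, ?_, fun y hy => Real.abs_le_sqrt ?_⟩
    · rw [Real.sq_sqrt (by positivity)]
      field_simp
    · rw [le_div_iff₀ hV0]
      exact (hinv c h hh p hp y (hout hy)).1
  -- every summand contains a difference of values of `a` at two points of the cell
  have hqb : ∀ y ∈ convexHull ℝ (s : Set (Sp N)), |q y| ≤ n * (L * h) * S := by
    intro y hy
    rw [hqsum]
    refine (Finset.abs_sum_le_sum_abs _ _).trans ?_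
    have hterm : ∀ m ∈ lagIdx s r, |((a (lagNode s r m) - a x) * p (lagNode s r m)) *
        lagPoly s r m y| ≤ (L * (K * h)) * S * (r : ℝ) ^ r := by
      intro m hm
      have hz := lagNode_mem_convexHull hs hr hm
      rw [abs_mul, abs_mul]
      have h1 : |a (lagNode s r m) - a x| ≤ L * (K * h) := (ha _ _).trans (by
        gcongr
        exact (Metric.dist_le_diam_of_mem (isCompact_cell s).isBounded hz hx).trans hdiam)
      have h2 := hS _ hz
      have h3 := abs_lagPoly_le hs hr hm hy
      gcongr
    refine (Finset.sum_le_card_nsmul _ _ _ hterm).trans ?_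
    rw [nsmul_eq_mul]
    have h4 : ((lagIdx s r).card : ℝ) ≤ (r + 1) ^ (N + 1) := by exact_mod_cast card_lagIdx_le hs
    calc ((lagIdx s r).card : ℝ) * ((L * (K * h)) * S * (r : ℝ) ^ r)
        ≤ (r + 1) ^ (N + 1) * ((L * (K * h)) * S * (r : ℝ) ^ r) := by gcongr
      _ = n * (L * h) * S := by rw [hn]; ring
  have hqb2 : ∀ y ∈ convexHull ℝ (s : Set (Sp N)),
      q y ^ 2 * V ≤ (L * h) ^ 2 * (n ^ 2 * C₀) * A := by
    intro y hy
    have h1 : q y ^ 2 ≤ (n * (L * h) * S) ^ 2 :=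
      sq_le_sq' (abs_le.1 (hqb y hy)).1 (abs_le.1 (hqb y hy)).2
    calc q y ^ 2 * V ≤ (n * (L * h) * S) ^ 2 * V := by gcongr
      _ = (n * (L * h)) ^ 2 * (S ^ 2 * V) := by ring
      _ = _ := by rw [hSA]; ring
  constructor
  · calc q x ^ 2 * V ≤ (L * h) ^ 2 * (n ^ 2 * C₀) * A := hqb2 x hx
      _ ≤ (L * h) ^ 2 * C ^ 2 * A := by gcongr
      _ = _ := by ring
  · have hfd : fderiv ℝ q x = fderiv ℝ (cellInterp r (fun y => a y * p y) s) x -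
        a x • fderiv ℝ p x := by
      have h1 : DifferentiableAt ℝ (cellInterp r (fun y => a y * p y) s) x :=
        (contDiff_of_mem_polyFun (cellInterp_mem_polyFun _ s) (n := 1)).contDiffAt.differentiableAt
          (by simp)
      have h2 : DifferentiableAt ℝ p x :=
        (contDiff_of_mem_polyFun hp (n := 1)).contDiffAt.differentiableAt (by simp)
      rw [hq, fderiv_fun_sub h1 (h2.const_mul _), fderiv_const_mul h2]
    rw [← hfd]
    -- the inverse inequality for `q` reduces the gradient to the values
    have h1 := (hinv c h hh q hqP x (hout hx)).2
    have h2 : (∫ y in Metric.closedBall c (K⁻¹ * h), q y ^ 2) ≤ (L * h) ^ 2 * (n ^ 2 * C₀) * A := by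
      have hfin : volume (Metric.closedBall c (K⁻¹ * h)) ≠ ⊤ := measure_closedBall_lt_top.ne
      have h3 : (∫ y in Metric.closedBall c (K⁻¹ * h), q y ^ 2) ≤
          ∫ y in Metric.closedBall c (K⁻¹ * h), (L * h) ^ 2 * (n ^ 2 * C₀) * A / V := by
        refine setIntegral_mono_on ?_ (integrableOn_const hfin) measurableSet_closedBall fun y hy =>
          ?_
        · exact ((continuous_of_mem_polyFun hqP).pow 2).continuousOn.integrableOn_compact
            (isCompact_closedBall _ _)
        · rw [le_div_iff₀ hV0]
          exact hqb2 y (hin hy)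
      refine h3.trans ?_
      rw [setIntegral_const, smul_eq_mul, mul_div_assoc', div_le_iff₀ hV0, mul_comm]
      have h4 : volume.real (Metric.closedBall c (K⁻¹ * h)) ≤ V :=
        measureReal_mono (hin.trans hout) measure_closedBall_lt_top.ne
      gcongr
    have h5 : h ^ 2 * (‖fderiv ℝ q x‖ ^ 2 * V) ≤ h ^ 2 * (C * L) ^ 2 * A :=
      calc h ^ 2 * (‖fderiv ℝ q x‖ ^ 2 * V) = h ^ 2 * ‖fderiv ℝ q x‖ ^ 2 * V := by ring
        _ ≤ C₀ * ∫ y in Metric.closedBall c (K⁻¹ * h), q y ^ 2 := h1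
        _ ≤ C₀ * ((L * h) ^ 2 * (n ^ 2 * C₀) * A) := by gcongr
        _ = (L * h) ^ 2 * (C₀ * (n ^ 2 * C₀)) * A := by ring
        _ ≤ (L * h) ^ 2 * C ^ 2 * A := by gcongr
        _ = _ := by ring
    rw [mul_assoc] at h5
    exact le_of_mul_le_mul_left h5 (by positivity)

theorem ae_eq_interior_cell (s : Finset (Sp N)) :
    interior (convexHull ℝ (s : Set (Sp N))) =ᵐ[volume] convexHull ℝ (s : Set (Sp N)) :=
  interior_ae_eq_of_null_frontier ((convex_convexHull ℝ _).addHaar_frontier volume)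

/-- Distinct cells have disjoint interiors. -/
theorem disjoint_interior_cells {s t : Finset (Sp N)} (hs : s ∈ cells 𝒯) (ht : t ∈ cells 𝒯)
    (hst : s ≠ t) : Disjoint (interior (convexHull ℝ (s : Set (Sp N))))
      (interior (convexHull ℝ (t : Set (Sp N)))) := by
  classical
  have hsc := isCell_of_mem_cells hs
  rw [Set.disjoint_iff_inter_eq_empty]
  by_contra hne
  obtain ⟨v, hvs, hvt⟩ : ∃ v ∈ s, v ∉ t := by
    by_contra! hcon
    exact hst (Finset.eq_of_subset_of_card_le hcon (by rw [hs.2, ht.2]))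
  have h0 := eq_zero_of_mem_polyFun (bary_mem_polyFun s v) (isOpen_interior.inter isOpen_interior)
    (nonempty_iff_ne_empty.2 hne) fun x hx =>
      (bary_eq_of_mem_subface hsc (isCell_of_mem_cells ht) Finset.inter_subset_left
        Finset.inter_subset_right (inter_cells_subset hs ht (interior_subset hx.1)
          (interior_subset hx.2)) v).2 fun h => hvt (Finset.mem_inter.1 h).2
  have h1 := bary_combination hsc (w := fun u => if u = v then 1 else 0) (by simp [hvs]) hvs
  rw [h0] at h1
  simp at h1

/-- The interiors of the cells cover `Ω` up to a null set. -/
theorem ae_eq_iUnion_interior_cells (hT : IsQuasiUniformTriangulation Ω 𝒯 K h)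
    (hΩ : IsPolyhedralDomain Ω) :
    (⋃ s ∈ hT.finite_cells.toFinset, interior (convexHull ℝ (s : Set (Sp N)))) =ᵐ[volume] Ω := by
  have h1 : (⋃ s ∈ hT.finite_cells.toFinset, interior (convexHull ℝ (s : Set (Sp N)))) ⊆ Ω :=
    iUnion₂_subset fun s hs => hT.interior_cell_subset hΩ (hT.finite_cells.mem_toFinset.1 hs)
  refine h1.eventuallyLE.antisymm ?_
  rw [ae_le_set]
  refine measure_mono_null (t := ⋃ s ∈ cells 𝒯, frontier (convexHull ℝ (s : Set (Sp N)))) ?_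
    ((measure_biUnion_null_iff hT.finite_cells.countable).2 fun s _ =>
      (convex_convexHull ℝ _).addHaar_frontier volume)
  rintro x ⟨hx, hxn⟩
  obtain ⟨s, hs, hxs⟩ := hT.exists_cell (subset_closure hx)
  refine mem_iUnion₂.2 ⟨s, hs, subset_closure hxs, fun hxi => hxn ?_⟩
  exact mem_iUnion₂.2 ⟨s, hT.finite_cells.mem_toFinset.2 hs, hxi⟩

/-- Summation of cellwise estimates. -/
theorem integral_le_of_cells (hT : IsQuasiUniformTriangulation Ω 𝒯 K h)
    (hΩ : IsPolyhedralDomain Ω) (hK : 0 < K) (hh : 0 < h) {F G : Sp N → ℝ} (hF : IntegrableOn F Ω)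
    (hG : IntegrableOn G Ω) (hG0 : ∀ x, 0 ≤ G x) {κ : ℝ} (hκ : 0 ≤ κ)
    (hcell : ∀ s ∈ cells 𝒯, ∀ c, Metric.closedBall c (K⁻¹ * h) ⊆ convexHull ℝ (s : Set (Sp N)) →
      convexHull ℝ (s : Set (Sp N)) ⊆ Metric.closedBall c (K * h) →
      ∀ x ∈ interior (convexHull ℝ (s : Set (Sp N))),
        F x * volume.real (Metric.closedBall c (K * h)) ≤
          κ * ∫ y in Metric.closedBall c (K⁻¹ * h), G y) :
    ∫ x in Ω, F x ≤ κ * ∫ x in Ω, G x := by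
  have hsub : ∀ s ∈ hT.finite_cells.toFinset, interior (convexHull ℝ (s : Set (Sp N))) ⊆ Ω :=
    fun s hs => hT.interior_cell_subset hΩ (hT.finite_cells.mem_toFinset.1 hs)
  have hsum : ∀ {f : Sp N → ℝ}, IntegrableOn f Ω → ∫ x in Ω, f x =
      ∑ s ∈ hT.finite_cells.toFinset, ∫ x in interior (convexHull ℝ (s : Set (Sp N))), f x := by
    intro f hf
    rw [← setIntegral_congr_set (ae_eq_iUnion_interior_cells hT hΩ)]
    refine integral_biUnion_finset _ (fun s _ => isOpen_interior.measurableSet) ?_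
      fun s hs => hf.mono_set (hsub s hs)
    intro s hs t ht hst
    exact disjoint_interior_cells (hT.finite_cells.mem_toFinset.1 hs)
      (hT.finite_cells.mem_toFinset.1 ht) hst
  rw [hsum hF, hsum hG, Finset.mul_sum]
  refine Finset.sum_le_sum fun s hs => ?_
  have hs' := hT.finite_cells.mem_toFinset.1 hs
  obtain ⟨c, hc⟩ := hT.ball_subset s hs'
  have hout : convexHull ℝ (s : Set (Sp N)) ⊆ Metric.closedBall c (K * h) := fun x hx =>
    Metric.mem_closedBall.2 ((Metric.dist_le_diam_of_mem (isCompact_cell s).isBounded hx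
      (hc (Metric.mem_closedBall_self (by positivity)))).trans (hT.diam_le s hs'))
  set V := volume.real (Metric.closedBall c (K * h)) with hV
  set A := ∫ y in Metric.closedBall c (K⁻¹ * h), G y with hA
  have hA0 : 0 ≤ A := integral_nonneg hG0
  have hV0 : 0 < V := ENNReal.toReal_pos
    (Metric.measure_closedBall_pos volume c (by positivity)).ne' measure_closedBall_lt_top.ne
  have hfin : volume (interior (convexHull ℝ (s : Set (Sp N)))) ≠ ⊤ :=
    ((isCompact_cell s).isBounded.subset interior_subset).measure_lt_top.ne
  calc ∫ x in interior (convexHull ℝ (s : Set (Sp N))), F x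
      ≤ ∫ x in interior (convexHull ℝ (s : Set (Sp N))), κ * A / V := by
        refine setIntegral_mono_on (hF.mono_set (hsub s hs)) (integrableOn_const hfin)
          isOpen_interior.measurableSet fun x hx => ?_
        rw [le_div_iff₀ hV0]
        exact hcell s hs' c hc hout x hx
    _ ≤ κ * A := by
        rw [setIntegral_const, smul_eq_mul, mul_div_assoc', div_le_iff₀ hV0, mul_comm]
        have h4 : volume.real (interior (convexHull ℝ (s : Set (Sp N)))) ≤ V :=
          measureReal_mono (interior_subset.trans hout) measure_closedBall_lt_top.ne
        gcongr
    _ ≤ _ := by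
        gcongr
        refine setIntegral_mono_set (hG.mono_set (hsub s hs)) (ae_of_all _ hG0) ?_
        exact hc.eventuallyLE.trans (ae_eq_interior_cell s).symm.le

end Superapproximation
end HeatFEM

namespace HeatFEM

/-! ### Cutoffs of finite element functions -/

section DiscreteCutoff

variable {N : ℕ} {Ω : Set (Sp N)} {𝒯 : Geometry.SimplicialComplex ℝ (Sp N)} {K h : ℝ} {r : ℕ}

/-- A shortcut: the norm of `S_h` is that of `H¹₀(Ω)`. -/
noncomputable scoped instance : NormedAddCommGroup (Sh Ω 𝒯 r) := Submodule.normedAddCommGroup _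

/-- A shortcut, as for the norm. -/
noncomputable scoped instance : NormedSpace ℝ (Sh Ω 𝒯 r) := Submodule.normedSpace _

/-- The inclusion `S_h → L²(Ω)`. -/
noncomputable def Sh.valL : Sh Ω 𝒯 r →L[ℝ] L2 Ω := H10.val.comp (Sh Ω 𝒯 r).subtypeL

/-- The gradient `S_h → L²(Ω)^N`. -/
noncomputable def Sh.gradL : Sh Ω 𝒯 r →L[ℝ] L2Vec Ω := H10.grad.comp (Sh Ω 𝒯 r).subtypeL

theorem cellInterp_add (f g : Sp N → ℝ) (s : Finset (Sp N)) (x : Sp N) :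
    cellInterp r (fun y => f y + g y) s x = cellInterp r f s x + cellInterp r g s x := by
  simp only [cellInterp, add_mul, Finset.sum_add_distrib]

theorem cellInterp_const_mul (c : ℝ) (f : Sp N → ℝ) (s : Finset (Sp N)) (x : Sp N) :
    cellInterp r (fun y => c * f y) s x = c * cellInterp r f s x := by
  simp only [cellInterp, Finset.mul_sum, mul_assoc]

theorem interp_add (f g : Sp N → ℝ) :
    interp 𝒯 r (fun y => f y + g y) = interp 𝒯 r f + interp 𝒯 r g := by
  funext x
  simp only [interp, Pi.add_apply]
  split_ifs
  · exact cellInterp_add _ _ _ _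
  · rw [add_zero]

theorem interp_const_mul (c : ℝ) (f : Sp N → ℝ) :
    interp 𝒯 r (fun y => c * f y) = c • interp 𝒯 r f := by
  funext x
  simp only [interp, Pi.smul_apply, smul_eq_mul]
  split_ifs
  · exact cellInterp_const_mul _ _ _ _
  · rw [mul_zero]

/-- The operator `χ ↦ interp (a χ)` on finite element functions. -/
noncomputable def interpMul (hT : IsQuasiUniformTriangulation Ω 𝒯 K h) (hΩ : IsPolyhedralDomain Ω)
    (hr : 1 ≤ r) (a : Sp N → ℝ) : feFun Ω 𝒯 r →ₗ[ℝ] feFun Ω 𝒯 r where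
  toFun f := ⟨interp 𝒯 r fun y => a y * f.1 y,
    interp_mem_feFun hT hΩ hr fun x hx => by rw [f.2.2.1 x hx, mul_zero]⟩
  map_add' f g := Subtype.ext <| by
    simp only [Submodule.coe_add, Pi.add_apply, mul_add]
    exact interp_add _ _
  map_smul' c f := Subtype.ext <| by
    simp only [Submodule.coe_smul, Pi.smul_apply, smul_eq_mul, mul_left_comm _ c]
    exact interp_const_mul _ _

/-- Interpolated multiplication `χ ↦ interp (a χ)` on `S_h`. -/
noncomputable def cutoffOp (hT : IsQuasiUniformTriangulation Ω 𝒯 K h) (hΩ : IsPolyhedralDomain Ω)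
    (hr : 1 ≤ r) (a : Sp N → ℝ) : Sh Ω 𝒯 r →L[ℝ] Sh Ω 𝒯 r :=
  haveI := finiteDimensional_Sh (r := r) hT hΩ hr
  LinearMap.toContinuousLinearMap ((Sh.equivFeFun hT hΩ).symm.toLinearMap ∘ₗ
    interpMul hT hΩ hr a ∘ₗ (Sh.equivFeFun hT hΩ).toLinearMap)

theorem rep_cutoffOp (hT : IsQuasiUniformTriangulation Ω 𝒯 K h) (hΩ : IsPolyhedralDomain Ω)
    (hr : 1 ≤ r) (a : Sp N → ℝ) (u : Sh Ω 𝒯 r) :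
    Sh.rep (cutoffOp hT hΩ hr a u) = interp 𝒯 r fun y => a y * Sh.rep u y :=
  congrArg Subtype.val ((Sh.equivFeFun hT hΩ).apply_symm_apply
    (interpMul hT hΩ hr a (Sh.equivFeFun hT hΩ u)))

theorem cellInterp_eq_zero (hr : 1 ≤ r) {s : Finset (Sp N)} (hs : IsCell s) {g : Sp N → ℝ}
    (hg : ∀ x ∈ convexHull ℝ (s : Set (Sp N)), g x = 0) : cellInterp r g s = 0 := by
  funext x
  exact Finset.sum_eq_zero fun m hm => by rw [hg _ (lagNode_mem_convexHull hs hr hm), zero_mul]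

theorem ae_mem_interior_cell (hT : IsQuasiUniformTriangulation Ω 𝒯 K h)
    (hΩ : IsPolyhedralDomain Ω) : ∀ᵐ x ∂volume.restrict Ω,
      ∃ s ∈ cells 𝒯, x ∈ interior (convexHull ℝ (s : Set (Sp N))) := by
  rw [ae_restrict_iff' hΩ.isOpen.measurableSet]
  filter_upwards [(ae_eq_iUnion_interior_cells hT hΩ).mem_iff] with x hx hxΩ
  obtain ⟨s, hs, hxs⟩ := mem_iUnion₂.1 (hx.2 hxΩ)
  exact ⟨s, hT.finite_cells.mem_toFinset.1 hs, hxs⟩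

set_option maxHeartbeats 1000000 in
/-- Interpolated multiplication by the square of a Lipschitz cutoff function is a discrete cutoff,
with a constant that depends only on the degree and on the quasi-uniformity. -/
theorem exists_isDiscreteCutoff (N : ℕ) (hr : 1 ≤ r) (hK : 0 < K) :
    ∃ C, 0 ≤ C ∧ ∀ (Ω : Set (Sp N)) (𝒯 : Geometry.SimplicialComplex ℝ (Sp N)) (h : ℝ)
      (hΩ : IsPolyhedralDomain Ω) (hT : IsQuasiUniformTriangulation Ω 𝒯 K h), 0 < h →
      ∀ (ζ w : Sp N → ℝ) (hζ : IsWeight ζ) (hw : IsWeight w) (δ : ℝ), 0 < δ →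
      (∀ x y, |ζ x - ζ y| ≤ δ⁻¹ * dist x y) → (∀ x, |ζ x| ≤ |w x|) →
      (∀ s ∈ cells 𝒯, (∀ x ∈ convexHull ℝ (s : Set (Sp N)), ζ x = 0) ∨
        ∀ x ∈ convexHull ℝ (s : Set (Sp N)), w x = 1) →
      IsDiscreteCutoff (X := Sh Ω 𝒯 r) Sh.valL Sh.gradL (cutoffOp hT hΩ hr fun x => ζ x ^ 2)
        (mulOp hζ ℝ (volume.restrict Ω)) (mulOp hw ℝ (volume.restrict Ω))
        (mulOp hζ (Sp N) (volume.restrict Ω)) (mulOp hw (Sp N) (volume.restrict Ω)) C h δ := by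
  obtain ⟨C, hC, hsup⟩ := exists_superapproximation_cell N hr hK
  refine ⟨C * 2, by positivity, ?_⟩
  intro Ω 𝒯 h hΩ hT hh ζ w hζ hw δ hδ hζL hζw hcell
  set a : Sp N → ℝ := fun x => ζ x ^ 2 with ha
  have haL : ∀ x y, |a x - a y| ≤ (2 * δ⁻¹) * dist x y := fun x y => by
    have h1 : a x - a y = (ζ x - ζ y) * (ζ x + ζ y) := by simp only [ha]; ring
    have h2 : |ζ x + ζ y| ≤ 2 :=
      (abs_add_le _ _).trans (by linarith [hζ.abs_le_one x, hζ.abs_le_one y])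
    rw [h1, abs_mul]
    calc |ζ x - ζ y| * |ζ x + ζ y| ≤ (δ⁻¹ * dist x y) * 2 := by gcongr; exact hζL x y
      _ = _ := by ring
  have hδ' : 0 < δ⁻¹ := inv_pos.2 hδ
  -- the pointwise error and its gradient, for the finite element function `f`
  let d₀ : (Sp N → ℝ) → Sp N → ℝ := fun f x => interp 𝒯 r (fun y => a y * f y) x - a x * f x
  let d₁ : (Sp N → ℝ) → Sp N → Sp N := fun f x =>
    gradient (interp 𝒯 r (fun y => a y * f y)) x - a x • gradient f x
  have hd₀ : ∀ u : Sh Ω 𝒯 r, (Sh.valL (cutoffOp hT hΩ hr a u) -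
      mulOp hζ ℝ (volume.restrict Ω) (mulOp hζ ℝ (volume.restrict Ω) (Sh.valL u)) : L2 Ω)
      =ᵐ[volume.restrict Ω] d₀ (Sh.rep u) := by
    intro u
    filter_upwards [Lp.coeFn_sub (Sh.valL (cutoffOp hT hΩ hr a u)) (mulOp hζ ℝ (volume.restrict Ω)
      (mulOp hζ ℝ (volume.restrict Ω) (Sh.valL u))), Sh.val_ae_eq_rep (cutoffOp hT hΩ hr a u),
      coeFn_mulOp hζ (mulOp hζ ℝ (volume.restrict Ω) (Sh.valL u)), coeFn_mulOp hζ (Sh.valL u),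
      Sh.val_ae_eq_rep u] with x h1 h2 h3 h4 h5
    have h2' : Sh.valL (cutoffOp hT hΩ hr a u) x = _ := h2
    have h5' : Sh.valL u x = _ := h5
    rw [h1, Pi.sub_apply, h3, h4, h5', h2', rep_cutoffOp]
    simp only [d₀, ha, smul_eq_mul]
    ring
  have hd₁ : ∀ u : Sh Ω 𝒯 r, (Sh.gradL (cutoffOp hT hΩ hr a u) -
      mulOp hζ (Sp N) (volume.restrict Ω) (mulOp hζ (Sp N) (volume.restrict Ω) (Sh.gradL u)) :
        L2Vec Ω) =ᵐ[volume.restrict Ω] d₁ (Sh.rep u) := by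
    intro u
    filter_upwards [Lp.coeFn_sub (Sh.gradL (cutoffOp hT hΩ hr a u))
      (mulOp hζ (Sp N) (volume.restrict Ω) (mulOp hζ (Sp N) (volume.restrict Ω) (Sh.gradL u))),
      Sh.grad_ae_eq hT hΩ (cutoffOp hT hΩ hr a u),
      coeFn_mulOp hζ (mulOp hζ (Sp N) (volume.restrict Ω) (Sh.gradL u)),
      coeFn_mulOp hζ (Sh.gradL u), Sh.grad_ae_eq hT hΩ u] with x h1 h2 h3 h4 h5
    have h2' : Sh.gradL (cutoffOp hT hΩ hr a u) x = _ := h2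
    have h5' : Sh.gradL u x = _ := h5
    rw [h1, Pi.sub_apply, h3, h4, h5', h2', rep_cutoffOp]
    simp only [d₁, ha, smul_smul, pow_two]
  have hf : ∀ u : Sh Ω 𝒯 r, (mulOp hw ℝ (volume.restrict Ω) (Sh.valL u)) =ᵐ[volume.restrict Ω]
      fun x => w x * Sh.rep u x := by
    intro u
    filter_upwards [coeFn_mulOp hw (Sh.valL u), Sh.val_ae_eq_rep u] with x h1 h2
    have h2' : Sh.valL u x = _ := h2
    rw [h1, h2', smul_eq_mul]
  -- in the interior of a cell all functions are polynomials
  have hint : ∀ (u : Sh Ω 𝒯 r), ∀ s ∈ cells 𝒯, ∃ p ∈ polyFun N r,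
      EqOn (Sh.rep u) p (convexHull ℝ (s : Set (Sp N))) ∧
      ∀ x ∈ interior (convexHull ℝ (s : Set (Sp N))),
        d₀ (Sh.rep u) x = cellInterp r (fun y => a y * p y) s x - a x * p x ∧
        ‖d₁ (Sh.rep u) x‖ =
          ‖fderiv ℝ (cellInterp r (fun y => a y * p y) s) x - a x • fderiv ℝ p x‖ := by
    intro u s hs
    obtain ⟨p, hp, hpe⟩ := exists_polyFun_of_mem_feFun (Sh.rep_mem u) hs
    have hsc := isCell_of_mem_cells hs
    have h1 : ∀ x ∈ convexHull ℝ (s : Set (Sp N)), interp 𝒯 r (fun y => a y * Sh.rep u y) x =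
        cellInterp r (fun y => a y * p y) s x := fun x hx => by
      rw [interp_eq hs _ hx]
      exact Finset.sum_congr rfl fun m hm => by
        simp only [hpe (lagNode_mem_convexHull hsc hr hm)]
    refine ⟨p, hp, hpe, fun x hx => ⟨?_, ?_⟩⟩
    · simp only [d₀]
      rw [h1 x (interior_subset hx), hpe (interior_subset hx)]
    · have hnhds := mem_interior_iff_mem_nhds.1 hx
      have h2 : interp 𝒯 r (fun y => a y * Sh.rep u y) =ᶠ[𝓝 x]
          cellInterp r (fun y => a y * p y) s := by filter_upwards [hnhds] with y hy using h1 y hy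
      have h3 : Sh.rep u =ᶠ[𝓝 x] p := by filter_upwards [hnhds] with y hy using hpe hy
      simp only [d₁]
      rw [h2.gradient_eq, h3.gradient_eq, gradient, gradient, ← map_smul, ← map_sub,
        LinearIsometryEquiv.norm_map]
  -- where the cutoff function vanishes on a cell, there is no error on this cell
  have hzero : ∀ (u : Sh Ω 𝒯 r), ∀ s ∈ cells 𝒯, (∀ x ∈ convexHull ℝ (s : Set (Sp N)), ζ x = 0) →
      ∀ x ∈ interior (convexHull ℝ (s : Set (Sp N))),
        d₀ (Sh.rep u) x = 0 ∧ d₁ (Sh.rep u) x = 0 := by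
    intro u s hs h0 x hx
    obtain ⟨p, -, -, h1⟩ := hint u s hs
    have h2 := cellInterp_eq_zero hr (isCell_of_mem_cells hs) (g := fun y => a y * p y)
      fun y hy => by simp [ha, h0 y hy]
    have h3 : a x = 0 := by simp [ha, h0 x (interior_subset hx)]
    refine ⟨?_, ?_⟩
    · rw [(h1 x hx).1, h2, h3]; simp
    · rw [← norm_eq_zero, (h1 x hx).2, h2, h3]; simp
  -- on the other cells the weight is `1`, and the cellwise superapproximation estimate applies
  have hmain : ∀ (u : Sh Ω 𝒯 r), ∀ s ∈ cells 𝒯, ∀ c,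
      Metric.closedBall c (K⁻¹ * h) ⊆ convexHull ℝ (s : Set (Sp N)) →
      convexHull ℝ (s : Set (Sp N)) ⊆ Metric.closedBall c (K * h) →
      ∀ x ∈ interior (convexHull ℝ (s : Set (Sp N))),
        d₀ (Sh.rep u) x ^ 2 * volume.real (Metric.closedBall c (K * h)) ≤
          (C * 2 * (h / δ)) ^ 2 * ∫ y in Metric.closedBall c (K⁻¹ * h), (w y * Sh.rep u y) ^ 2 ∧
        ‖d₁ (Sh.rep u) x‖ ^ 2 * volume.real (Metric.closedBall c (K * h)) ≤
          (C * 2 * δ⁻¹) ^ 2 * ∫ y in Metric.closedBall c (K⁻¹ * h), (w y * Sh.rep u y) ^ 2 := by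
    intro u s hs c hin hout x hx
    have hpos : 0 ≤ ∫ y in Metric.closedBall c (K⁻¹ * h), (w y * Sh.rep u y) ^ 2 :=
      integral_nonneg fun y => sq_nonneg _
    rcases hcell s hs with h0 | h1
    · obtain ⟨e0, e1⟩ := hzero u s hs h0 x hx
      rw [e0, e1]
      constructor
      · rw [zero_pow two_ne_zero, zero_mul]; positivity
      · rw [norm_zero, zero_pow two_ne_zero, zero_mul]; positivity
    · obtain ⟨p, hp, hpe, hpx⟩ := hint u s hs
      have h2 : ∫ y in Metric.closedBall c (K⁻¹ * h), (w y * Sh.rep u y) ^ 2 =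
          ∫ y in Metric.closedBall c (K⁻¹ * h), p y ^ 2 :=
        setIntegral_congr_fun measurableSet_closedBall fun y hy => by
          simp only [h1 y (hin hy), one_mul, hpe (hin hy)]
      obtain ⟨e0, e1⟩ := hsup s h c (isCell_of_mem_cells hs) hh hin hout (hT.diam_le s hs) a
        (2 * δ⁻¹) (by positivity) haL p hp x (interior_subset hx)
      rw [(hpx x hx).1, (hpx x hx).2, h2]
      refine ⟨e0.trans (le_of_eq ?_), e1.trans (le_of_eq ?_)⟩
      · rw [div_eq_mul_inv]; ring
      · ring
  -- the error vanishes outside the cells on which the weight is `1`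
  have hw_one : ∀ (u : Sh Ω 𝒯 r), ∀ᵐ x ∂volume.restrict Ω,
      w x * d₀ (Sh.rep u) x = d₀ (Sh.rep u) x ∧ w x • d₁ (Sh.rep u) x = d₁ (Sh.rep u) x := by
    intro u
    filter_upwards [ae_mem_interior_cell hT hΩ] with x ⟨s, hs, hx⟩
    rcases hcell s hs with h0 | h1
    · obtain ⟨e0, e1⟩ := hzero u s hs h0 x hx
      rw [e0, e1, mul_zero, smul_zero]
      exact ⟨rfl, rfl⟩
    · rw [h1 x (interior_subset hx), one_mul, one_smul]
      exact ⟨rfl, rfl⟩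
  have hsqle : ∀ {x y c : ℝ}, 0 ≤ x → 0 ≤ y → 0 ≤ c → x ^ 2 ≤ c ^ 2 * y ^ 2 → x ≤ c * y :=
    fun hx hy hc hxy => le_of_sq_le_sq (by rwa [mul_pow]) (by positivity)
  have hwf : ∀ u : Sh Ω 𝒯 r, IntegrableOn (fun x => (w x * Sh.rep u x) ^ 2) Ω := fun u =>
    ((Lp.memLp (mulOp hw ℝ (volume.restrict Ω) (Sh.valL u))).ae_eq (hf u)).integrable_sq
  have hnorm : ∀ u : Sh Ω 𝒯 r, ‖mulOp hw ℝ (volume.restrict Ω) (Sh.valL u)‖ ^ 2 =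
      ∫ x in Ω, (w x * Sh.rep u x) ^ 2 := fun u => by
    rw [norm_sq_eq_integral]
    refine integral_congr_ae ?_
    filter_upwards [hf u] with x hx
    rw [hx, Real.norm_eq_abs, sq_abs]
  refine ⟨inner_mulOp hζ, inner_mulOp hζ, inner_mulOp hw, inner_mulOp hw, norm_mulOp_le hζ,
    norm_mulOp_le hζ, norm_mulOp_le_norm_mulOp hζ hw hζw, norm_mulOp_le_norm_mulOp hζ hw hζw,
    fun u => ?_, fun u => ?_, fun u => ?_, fun u => ?_⟩
  · refine Lp.ext ?_
    filter_upwards [coeFn_mulOp hw (Sh.valL (cutoffOp hT hΩ hr a u) - mulOp hζ ℝ (volume.restrict Ω)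
      (mulOp hζ ℝ (volume.restrict Ω) (Sh.valL u))), hd₀ u, hw_one u] with x h1 h2 h3
    rw [h1, h2]
    exact h3.1
  · refine Lp.ext ?_
    filter_upwards [coeFn_mulOp hw (Sh.gradL (cutoffOp hT hΩ hr a u) -
      mulOp hζ (Sp N) (volume.restrict Ω) (mulOp hζ (Sp N) (volume.restrict Ω) (Sh.gradL u))),
      hd₁ u, hw_one u] with x h1 h2 h3
    rw [h1, h2]
    exact h3.2
  · refine hsqle (norm_nonneg _) (norm_nonneg _) (by positivity) ?_
    rw [hnorm, norm_sq_eq_integral]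
    have h1 : ∀ᵐ x ∂volume.restrict Ω, ‖(Sh.valL (cutoffOp hT hΩ hr a u) -
        mulOp hζ ℝ (volume.restrict Ω) (mulOp hζ ℝ (volume.restrict Ω) (Sh.valL u)) : L2 Ω) x‖ ^ 2 =
        d₀ (Sh.rep u) x ^ 2 := by
      filter_upwards [hd₀ u] with x hx
      rw [hx, Real.norm_eq_abs, sq_abs]
    rw [integral_congr_ae h1]
    exact integral_le_of_cells hT hΩ hK hh ((Lp.memLp _).ae_eq (hd₀ u)).integrable_sq (hwf u)
      (fun _ => sq_nonneg _) (sq_nonneg _) fun s hs c hin hout x hx =>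
        (hmain u s hs c hin hout x hx).1
  · refine hsqle (norm_nonneg _) (norm_nonneg _) (by positivity) ?_
    rw [hnorm, norm_sq_eq_integral]
    have h1 : ∀ᵐ x ∂volume.restrict Ω, ‖(Sh.gradL (cutoffOp hT hΩ hr a u) -
        mulOp hζ (Sp N) (volume.restrict Ω) (mulOp hζ (Sp N) (volume.restrict Ω) (Sh.gradL u)) :
          L2Vec Ω) x‖ ^ 2 = ‖d₁ (Sh.rep u) x‖ ^ 2 := by
      filter_upwards [hd₁ u] with x hx
      rw [hx]
    rw [integral_congr_ae h1]
    exact integral_le_of_cells hT hΩ hK hh ((Lp.memLp _).ae_eq (hd₁ u)).norm.integrable_sq (hwf u)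
      (fun _ => sq_nonneg _) (sq_nonneg _) fun s hs c hin hout x hx =>
        (hmain u s hs c hin hout x hx).2

end DiscreteCutoff
end HeatFEM

namespace HeatFEM

/-! ### The Clément operator -/

section Clement

variable {N : ℕ} {Ω : Set (Sp N)} {𝒯 : Geometry.SimplicialComplex ℝ (Sp N)} {K h : ℝ} {r : ℕ}

theorem isWeight_indicator {α : Type*} [MeasurableSpace α] {D : Set α} (hD : MeasurableSet D) :
    IsWeight (D.indicator fun _ => (1 : ℝ)) where
  measurable := measurable_const.indicator hD
  abs_le_one x := by
    by_cases hx : x ∈ D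
    · simp [hx]
    · simp [hx]

theorem measurableSet_patch (hT : IsQuasiUniformTriangulation Ω 𝒯 K h) (z : Sp N) :
    MeasurableSet (patch 𝒯 z) :=
  (hT.finite_cells.subset fun _ hs => hs.1).measurableSet_biUnion fun s _ =>
    (isClosed_cell s).measurableSet

/-- The defining property of the local projection. -/
def IsLocalProj (Ω : Set (Sp N)) (𝒯 : Geometry.SimplicialComplex ℝ (Sp N)) (r : ℕ) (z : Sp N)
    (v p : Sp N → ℝ) : Prop :=
  p ∈ feFun Ω 𝒯 r ∧ ∀ χ ∈ feFun Ω 𝒯 r, ∫ x in patch 𝒯 z ∩ Ω, (v x - p x) * χ x = 0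

/-- Multiplication by the characteristic function of the patch. -/
noncomputable def patchOp (hT : IsQuasiUniformTriangulation Ω 𝒯 K h) (z : Sp N) :
    L2 Ω →L[ℝ] L2 Ω :=
  mulOp (isWeight_indicator (measurableSet_patch hT z)) ℝ (volume.restrict Ω)

theorem inner_patchOp (hT : IsQuasiUniformTriangulation Ω 𝒯 K h) (z : Sp N)
    (v w : L2 Ω) : inner ℝ v (patchOp hT z w) = ∫ x in patch 𝒯 z ∩ Ω, v x * w x := by
  rw [← Measure.restrict_restrict (measurableSet_patch hT z),
    ← integral_indicator (measurableSet_patch hT z), L2.inner_def]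
  refine integral_congr_ae ?_
  filter_upwards [coeFn_mulOp (isWeight_indicator (measurableSet_patch hT z)) w] with x hx
  rw [patchOp, hx]
  by_cases hxp : x ∈ patch 𝒯 z
  · simp [hxp, mul_comm]
  · simp [hxp]

theorem isLocalProj_iff (hT : IsQuasiUniformTriangulation Ω 𝒯 K h) (hΩ : IsPolyhedralDomain Ω)
    {z : Sp N} {v : L2 Ω} {u : Sh Ω 𝒯 r} : IsLocalProj Ω 𝒯 r z v (Sh.rep u) ↔
      ∀ χ : Sh Ω 𝒯 r, inner ℝ (v - Sh.valL u) (patchOp hT z (Sh.valL χ)) = 0 := by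
  have key : ∀ χ : Sh Ω 𝒯 r, inner ℝ (v - Sh.valL u) (patchOp hT z (Sh.valL χ)) =
      ∫ x in patch 𝒯 z ∩ Ω, (v x - Sh.rep u x) * Sh.rep χ x := by
    intro χ
    rw [inner_patchOp]
    refine integral_congr_ae (ae_restrict_of_ae_restrict_of_subset inter_subset_right ?_)
    filter_upwards [Lp.coeFn_sub v (Sh.valL u), Sh.val_ae_eq_rep u, Sh.val_ae_eq_rep χ]
      with x h1 h2 h3
    have h2' : Sh.valL u x = _ := h2
    have h3' : Sh.valL χ x = _ := h3
    rw [h1, Pi.sub_apply, h2', h3']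
  refine ⟨fun h χ => by rw [key]; exact h.2 _ (Sh.rep_mem χ), fun h =>
    ⟨Sh.rep_mem u, fun χ hχ => ?_⟩⟩
  obtain ⟨w, hw, -⟩ := exists_Sh_of_mem_feFun hT hΩ hχ
  rw [← Sh.rep_eq hΩ hχ hw, ← key]
  exact h w

/-- The finite element functions cut off outside the patch. -/
noncomputable def patchSpace (hT : IsQuasiUniformTriangulation Ω 𝒯 K h) (r : ℕ) (z : Sp N) :
    Submodule ℝ (L2 Ω) :=
  LinearMap.range ((patchOp hT z).toLinearMap ∘ₗ (Sh.valL (Ω := Ω) (𝒯 := 𝒯) (r := r)).toLinearMap)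

theorem finiteDimensional_patchSpace (hT : IsQuasiUniformTriangulation Ω 𝒯 K h)
    (hΩ : IsPolyhedralDomain Ω) (hr : 1 ≤ r) (z : Sp N) :
    FiniteDimensional ℝ (patchSpace (Ω := Ω) hT r z) := by
  have := finiteDimensional_Sh (r := r) hT hΩ hr
  exact LinearMap.finiteDimensional_range _

theorem localProj_spec (hT : IsQuasiUniformTriangulation Ω 𝒯 K h) (hΩ : IsPolyhedralDomain Ω)
    (hr : 1 ≤ r) (z : Sp N) (v : L2 Ω) : IsLocalProj Ω 𝒯 r z v (localProj Ω 𝒯 r z v) := by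
  refine Classical.epsilon_spec (p := fun p => IsLocalProj Ω 𝒯 r z v p) ?_
  have := finiteDimensional_patchSpace (r := r) hT hΩ hr z
  obtain ⟨u, hu⟩ : (patchSpace (Ω := Ω) hT r z).starProjection v ∈ patchSpace hT r z :=
    Submodule.starProjection_apply_mem _ _
  refine ⟨Sh.rep u, (isLocalProj_iff hT hΩ).2 fun χ => ?_⟩
  have h1 := (patchSpace (Ω := Ω) hT r z).starProjection_inner_eq_zero v (patchOp hT z (Sh.valL χ))
    ⟨χ, rfl⟩
  rw [← hu] at h1
  have h2 : inner ℝ (patchOp hT z (Sh.valL u)) (patchOp hT z (Sh.valL χ)) =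
      inner ℝ (Sh.valL u) (patchOp hT z (Sh.valL χ)) := by
    rw [inner_patchOp, inner_patchOp]
    refine setIntegral_congr_ae ((measurableSet_patch hT z).inter hΩ.isOpen.measurableSet) ?_
    have := coeFn_mulOp (isWeight_indicator (measurableSet_patch hT z)) (Sh.valL u)
    rw [EventuallyEq, ae_restrict_iff' hΩ.isOpen.measurableSet] at this
    filter_upwards [this] with x hx hxp
    rw [patchOp, hx hxp.2, indicator_of_mem hxp.1, one_smul]
  rw [inner_sub_left] at h1 ⊢
  rw [← h2]
  exact h1

/-- The value of a local projection at its node is determined by the function. -/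
theorem IsLocalProj.eq_at (hT : IsQuasiUniformTriangulation Ω 𝒯 K h) (hΩ : IsPolyhedralDomain Ω)
    {z : Sp N} (hz : z ∈ Ω) {v : L2 Ω} {p q : Sp N → ℝ} (hp : IsLocalProj Ω 𝒯 r z v p)
    (hq : IsLocalProj Ω 𝒯 r z v q) : p z = q z := by
  obtain ⟨up, hup, -⟩ := exists_Sh_of_mem_feFun hT hΩ hp.1
  obtain ⟨uq, huq, -⟩ := exists_Sh_of_mem_feFun hT hΩ hq.1
  obtain rfl := Sh.rep_eq hΩ hp.1 hup
  obtain rfl := Sh.rep_eq hΩ hq.1 huq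
  have h1 := (isLocalProj_iff hT hΩ).1 hp (up - uq)
  have h2 := (isLocalProj_iff hT hΩ).1 hq (up - uq)
  have h3 : inner ℝ (Sh.valL (up - uq)) (patchOp hT z (Sh.valL (up - uq))) = 0 := by
    have h4 : Sh.valL (up - uq) = (v - Sh.valL uq) - (v - Sh.valL up) := by rw [map_sub]; abel
    nth_rewrite 1 [h4]
    rw [inner_sub_left, h1, h2, sub_zero]
  set f : Sp N → ℝ := Sh.rep up - Sh.rep uq with hf
  have hfm : f ∈ feFun Ω 𝒯 r := Submodule.sub_mem _ hp.1 hq.1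
  have hfr : Sh.rep (up - uq) = f := Sh.rep_eq hΩ hfm (by
    rw [Submodule.coe_sub, map_sub]
    exact (Lp.coeFn_sub _ _).trans (hup.sub huq))
  -- the difference vanishes on the interior of a cell that contains `z`
  obtain ⟨s, hs, hzs⟩ := hT.exists_cell (subset_closure hz)
  have hsp : interior (convexHull ℝ (s : Set (Sp N))) ⊆ patch 𝒯 z ∩ Ω := fun x hx =>
    ⟨mem_iUnion₂.2 ⟨s, ⟨hs, hzs⟩, interior_subset hx⟩, hT.interior_cell_subset hΩ hs hx⟩
  rw [inner_patchOp] at h3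
  have h5 : ∫ x in patch 𝒯 z ∩ Ω, f x * f x = 0 := by
    rw [← h3]
    refine integral_congr_ae (ae_restrict_of_ae_restrict_of_subset inter_subset_right ?_)
    filter_upwards [Sh.val_ae_eq_rep (up - uq)] with x h6
    have h6' : Sh.valL (up - uq) x = _ := h6
    rw [h6', hfr]
  have hfi : IntegrableOn (fun x => f x * f x) (patch 𝒯 z ∩ Ω) :=
    ((hfm.1.mul hfm.1).continuousOn.integrableOn_compact hΩ.isBounded.isCompact_closure).mono_set
      (inter_subset_right.trans subset_closure)
  have h6 := (integral_eq_zero_iff_of_nonneg (fun x => mul_self_nonneg (f x)) hfi).1 h5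
  have h7 : f =ᵐ[volume.restrict (interior (convexHull ℝ (s : Set (Sp N))))] 0 := by
    filter_upwards [ae_restrict_of_ae_restrict_of_subset hsp h6] with x hx
    exact mul_self_eq_zero.1 hx
  have h8 := Measure.eqOn_open_of_ae_eq h7 isOpen_interior hfm.1.continuousOn continuousOn_const
  have hne : (interior (convexHull ℝ (s : Set (Sp N)))).Nonempty := by
    have hsc := isCell_of_mem_cells hs
    have h9 := (cellBasis s hsc).tot
    have h10 : range (cellBasis s hsc) = (s : Set (Sp N)) := Subtype.range_coe
    rw [h10] at h9
    exact interior_convexHull_nonempty_iff_affineSpan_eq_top.2 h9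
  have h9 : z ∈ closure (interior (convexHull ℝ (s : Set (Sp N)))) := by
    rw [(convex_convexHull ℝ _).closure_interior_eq_closure_of_nonempty_interior hne]
    exact subset_closure hzs
  have h10 : f z = 0 := closure_minimal (fun x hx => h8 hx)
    (isClosed_singleton.preimage hfm.1) h9
  exact sub_eq_zero.1 h10

/-- The value at `z` of the local projection at `z`, as a continuous linear functional. It factors
through the orthogonal projection onto the finite element functions on the patch. -/
theorem exists_localProj_clm (hT : IsQuasiUniformTriangulation Ω 𝒯 K h)
    (hΩ : IsPolyhedralDomain Ω) (hr : 1 ≤ r) {z : Sp N} (hz : z ∈ Ω) :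
    ∃ ℓ : L2 Ω →L[ℝ] ℝ, ∀ v : L2 Ω, ℓ v = localProj Ω 𝒯 r z v z := by
  have hspec := localProj_spec (r := r) hT hΩ hr z
  have hadd : ∀ v w : L2 Ω, IsLocalProj Ω 𝒯 r z (v + w : L2 Ω)
      (localProj Ω 𝒯 r z v + localProj Ω 𝒯 r z w) := by
    intro v w
    obtain ⟨a, ha, -⟩ := exists_Sh_of_mem_feFun hT hΩ (hspec v).1
    obtain ⟨b, hb, -⟩ := exists_Sh_of_mem_feFun hT hΩ (hspec w).1
    have h1 := hspec v
    have h2 := hspec w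
    rw [← Sh.rep_eq hΩ (hspec v).1 ha, isLocalProj_iff hT hΩ] at h1
    rw [← Sh.rep_eq hΩ (hspec w).1 hb, isLocalProj_iff hT hΩ] at h2
    have h3 : Sh.rep (a + b) = localProj Ω 𝒯 r z v + localProj Ω 𝒯 r z w :=
      Sh.rep_eq hΩ (Submodule.add_mem _ (hspec v).1 (hspec w).1) (by
        rw [Submodule.coe_add, map_add]
        exact (Lp.coeFn_add _ _).trans (ha.add hb))
    rw [← h3, isLocalProj_iff hT hΩ]
    intro χ
    rw [map_add, add_sub_add_comm, inner_add_left, h1, h2, add_zero]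
  have hsmul : ∀ (c : ℝ) (v : L2 Ω), IsLocalProj Ω 𝒯 r z (c • v : L2 Ω)
      (c • localProj Ω 𝒯 r z v) := by
    intro c v
    obtain ⟨a, ha, -⟩ := exists_Sh_of_mem_feFun hT hΩ (hspec v).1
    have h1 := hspec v
    rw [← Sh.rep_eq hΩ (hspec v).1 ha, isLocalProj_iff hT hΩ] at h1
    have h3 : Sh.rep (c • a) = c • localProj Ω 𝒯 r z v :=
      Sh.rep_eq hΩ (Submodule.smul_mem _ c (hspec v).1) (by
        rw [Submodule.coe_smul, map_smul]
        exact (Lp.coeFn_smul _ _).trans (ha.const_smul c))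
    rw [← h3, isLocalProj_iff hT hΩ]
    intro χ
    rw [map_smul, ← smul_sub, inner_smul_left, h1, mul_zero]
  -- `localProj` is a choice among the functions with the same restriction to the patch; only its
  -- values on the patch, in particular that at the node `z`, are linear in `v`
  let ℓ₀ : L2 Ω →ₗ[ℝ] ℝ :=
    { toFun := fun v => localProj Ω 𝒯 r z v z
      map_add' := fun v w => (hspec (v + w)).eq_at hT hΩ hz (hadd v w)
      map_smul' := fun c v => (hspec (c • v)).eq_at hT hΩ hz (hsmul c v) }
  -- `ℓ₀` factors through the orthogonal projection onto a finite dimensional space, on which it is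
  -- continuous
  have := finiteDimensional_patchSpace (r := r) hT hΩ hr z
  refine ⟨(LinearMap.toContinuousLinearMap (ℓ₀.domRestrict (patchSpace hT r z))).comp
    (patchSpace (Ω := Ω) hT r z).orthogonalProjectionOnto, fun v => ?_⟩
  set P : L2 Ω := (patchSpace (Ω := Ω) hT r z).starProjection v with hP
  change localProj Ω 𝒯 r z P z = _
  refine (hspec P).eq_at hT hΩ hz ?_
  obtain ⟨a, ha, -⟩ := exists_Sh_of_mem_feFun hT hΩ (hspec v).1
  have h1 := hspec v
  rw [← Sh.rep_eq hΩ (hspec v).1 ha, isLocalProj_iff hT hΩ] at h1 ⊢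
  intro χ
  have h2 := (patchSpace (Ω := Ω) hT r z).starProjection_inner_eq_zero v (patchOp hT z (Sh.valL χ))
    ⟨χ, rfl⟩
  have h3 : P - Sh.valL a = (v - Sh.valL a) - (v - P) := by abel
  rw [h3, inner_sub_left, h1, zero_sub, neg_eq_zero]
  exact h2

/-- The Clément operator is a continuous linear map into `S_h`, and it is local. -/
theorem exists_Ih_clm (hT : IsQuasiUniformTriangulation Ω 𝒯 K h) (hΩ : IsPolyhedralDomain Ω)
    (hr : 1 ≤ r) : ∃ I : L2 Ω →L[ℝ] Sh Ω 𝒯 r, (∀ v, Sh.valL (I v) = Ih Ω 𝒯 r v) ∧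
      ∀ v x, (∀ᵐ y ∂volume.restrict (Ω ∩ Metric.closedBall x (2 * (K * h))), v y = 0) →
        Sh.rep (I v) x = 0 := by
  classical
  have hfin := finite_nodes (Ω := Ω) (r := r) hT
  choose ℓ hℓ using fun z : nodes Ω 𝒯 r => exists_localProj_clm (r := r) hT hΩ hr z.2.1
  have := hfin.fintype
  let Φ : nodes Ω 𝒯 r → Sh Ω 𝒯 r := fun z =>
    (Sh.equivFeFun hT hΩ).symm ⟨_, (nodalBasis_spec hT hΩ hr z.2).1⟩
  have hΦ : ∀ z, Sh.rep (Φ z) = nodalBasis Ω 𝒯 r z := fun z =>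
    congrArg Subtype.val ((Sh.equivFeFun hT hΩ).apply_symm_apply _)
  let I : L2 Ω →L[ℝ] Sh Ω 𝒯 r := ∑ z, (ℓ z).smulRight (Φ z)
  have hrep : ∀ v, Sh.rep (I v) = fun x =>
      ∑ᶠ z ∈ nodes Ω 𝒯 r, localProj Ω 𝒯 r z v z * nodalBasis Ω 𝒯 r z x := by
    intro v
    have h1 : (Sh.equivFeFun hT hΩ (I v)) = ∑ z, ℓ z v • Sh.equivFeFun hT hΩ (Φ z) := by
      simp only [I, sum_apply, ContinuousLinearMap.smulRight_apply, map_sum,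
        map_smul]
    have h2 : Sh.rep (I v) = ∑ z, ℓ z v • Sh.rep (Φ z) := by
      have := congrArg Subtype.val h1
      rw [Submodule.coe_sum] at this
      exact this
    rw [h2]
    funext x
    rw [Finset.sum_apply, ← finsum_set_coe_eq_finsum_mem, finsum_eq_sum_of_fintype]
    refine Finset.sum_congr rfl fun z _ => ?_
    rw [hΦ, Pi.smul_apply, smul_eq_mul, hℓ]
  refine ⟨I, fun v => ?_, fun v x hv => ?_⟩
  · have hm : MemLp (Sh.rep (I v)) 2 (volume.restrict Ω) :=
      (Lp.memLp (Sh.valL (I v))).ae_eq (Sh.val_ae_eq_rep (I v))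
    rw [hrep] at hm
    rw [Ih, toL2, dif_pos hm]
    refine Lp.ext (EventuallyEq.trans ?_ hm.coeFn_toLp.symm)
    rw [← hrep]
    exact Sh.val_ae_eq_rep (I v)
  · by_cases hx : x ∈ Ω
    swap
    · exact (Sh.rep_mem (I v)).2.1 x hx
    obtain ⟨s, hs, hxs⟩ := hT.exists_cell (subset_closure hx)
    rw [hrep]
    -- the basis function of `z` vanishes at `x` unless `z` is in the cell of `x`, and then the
    -- patch of `z` is within the distance `2 K h` of `x`
    refine finsum_mem_eq_zero_of_forall_eq_zero fun z hz => ?_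
    by_cases hzs : z ∈ convexHull ℝ (s : Set (Sp N))
    · have hsub : patch 𝒯 z ∩ Ω ⊆ Ω ∩ Metric.closedBall x (2 * (K * h)) := by
        rintro y ⟨hy, hyΩ⟩
        obtain ⟨t, ⟨ht, hzt⟩, hyt⟩ := mem_iUnion₂.1 hy
        refine ⟨hyΩ, Metric.mem_closedBall.2 ((dist_triangle y z x).trans ?_)⟩
        have h1 := (Metric.dist_le_diam_of_mem (isCompact_cell t).isBounded hyt hzt).trans
          (hT.diam_le t ht)
        have h2 := (Metric.dist_le_diam_of_mem (isCompact_cell s).isBounded hzs hxs).trans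
          (hT.diam_le s hs)
        linarith
      have h0 : IsLocalProj Ω 𝒯 r z v 0 := by
        refine ⟨Submodule.zero_mem _, fun χ _ => integral_eq_zero_of_ae ?_⟩
        filter_upwards [ae_restrict_of_ae_restrict_of_subset hsub hv] with y hy
        simp [hy]
      rw [(localProj_spec hT hΩ hr z v).eq_at hT hΩ hz.1 h0, Pi.zero_apply, zero_mul]
    · rw [nodalBasis_eq_zero hT hΩ hr hz hs hzs hxs, mul_zero]

end Clement
end HeatFEM

namespace HeatFEM

/-! ### Measurable selection of weak gradients -/

section Graph

section Selection

variable {X Y : Type*} [NormedAddCommGroup X] [CompleteSpace X] [SecondCountableTopology X]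
  [NormedAddCommGroup Y] [CompleteSpace Y] [SecondCountableTopology Y]

/-- The function of which a closed set is the graph is Borel measurable, with a Borel domain: the
first projection is an injective continuous map on a Polish space. -/
theorem exists_measurable_of_isClosed_graph [MeasurableSpace X] [BorelSpace X]
    [MeasurableSpace Y] [BorelSpace Y] {Γ : Set (X × Y)} (hΓ : IsClosed Γ)
    (hinj : InjOn Prod.fst Γ) :
    ∃ g : X → Y, Measurable g ∧ MeasurableSet (Prod.fst '' Γ) ∧ ∀ z ∈ Γ, g z.1 = z.2 := by
  have : PolishSpace Γ := hΓ.polishSpace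
  have h1 : Continuous fun z : Γ => z.1.1 := continuous_fst.comp continuous_subtype_val
  have h2 : Function.Injective fun z : Γ => z.1.1 := fun a b h => Subtype.ext (hinj a.2 b.2 h)
  have h3 := h1.measurableEmbedding h2
  obtain ⟨g, hg, hg'⟩ := h3.exists_measurable_extend (g := fun z : Γ => z.1.2)
    (continuous_snd.comp continuous_subtype_val).measurable fun _ => ⟨0⟩
  refine ⟨g, hg, ?_, fun z hz => congrFun hg' ⟨z, hz⟩⟩
  have h4 := h3.measurableSet_range
  have h5 : range (fun z : Γ => z.1.1) = Prod.fst '' Γ := by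
    ext x
    simp
  rwa [h5] at h4

/-- A curve in the domain of a closed operator `Γ` can be composed with `Γ` in a measurable way,
even if the bound `n` is not measurable. -/
theorem exists_aestronglyMeasurable_graph {Γ : Set (X × Y)} (hΓ : IsClosed Γ)
    (hinj : InjOn Prod.fst Γ) {μ : Measure ℝ} {u : ℝ → X} (hu : AEStronglyMeasurable u μ)
    {n : ℝ → ℝ≥0∞} (hn : ∫⁻ t, n t ^ 2 ∂μ ≠ ⊤)
    (h : ∀ᵐ t ∂μ, n t ≠ ⊤ → ∃ y, (u t, y) ∈ Γ ∧ ‖y‖ₑ ≤ n t) :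
    ∃ G : ℝ → Y, AEStronglyMeasurable G μ ∧ (∀ᵐ t ∂μ, (u t, G t) ∈ Γ) ∧
      ∫⁻ t, ‖G t‖ₑ ^ 2 ∂μ ≤ ∫⁻ t, n t ^ 2 ∂μ := by
  let _ : MeasurableSpace X := borel X
  let _ : MeasurableSpace Y := borel Y
  have : BorelSpace X := ⟨rfl⟩
  have : BorelSpace Y := ⟨rfl⟩
  obtain ⟨g, hg, hA, hgΓ⟩ := exists_measurable_of_isClosed_graph hΓ hinj
  have hG : AEStronglyMeasurable (fun t => g (u t)) μ :=
    (hg.comp_aemeasurable hu.aemeasurable).aestronglyMeasurable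
  -- the function that is `⊤` where `u` leaves the domain is measurable and bounded by `n`
  have key : ∀ᵐ t ∂μ, u t ∈ Prod.fst '' Γ := by
    have h1 : ∀ᵐ t ∂μ, (Prod.fst '' Γ)ᶜ.indicator (fun _ => (⊤ : ℝ≥0∞)) (u t) < ⊤ := by
      refine ae_lt_top' ((measurable_const.indicator hA.compl).comp_aemeasurable hu.aemeasurable)
        (ne_top_of_le_ne_top hn (lintegral_mono_ae ?_))
      filter_upwards [h] with t ht
      by_cases h2 : u t ∈ Prod.fst '' Γ
      · rw [indicator_of_notMem (by simpa using h2)]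
        exact zero_le
      · rw [indicator_of_mem h2]
        have h3 : n t = ⊤ := by
          by_contra h4
          obtain ⟨y, hy, -⟩ := ht h4
          exact h2 ⟨_, hy, rfl⟩
        simp [h3]
    filter_upwards [h1] with t ht
    by_contra h2
    rw [indicator_of_mem h2] at ht
    exact lt_irrefl _ ht
  refine ⟨_, hG, ?_, ?_⟩
  · filter_upwards [key] with t ht
    obtain ⟨z, hz, hzt⟩ := ht
    have : (u t, g (u t)) = z := by rw [← hzt, hgΓ z hz]
    rwa [this]
  · refine lintegral_mono_ae ?_
    filter_upwards [h] with t ht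
    by_cases h4 : n t = ⊤
    · simp [h4]
    · obtain ⟨y, hy, hyn⟩ := ht h4
      have h5 : g (u t) = y := hgΓ _ hy
      rw [h5]
      gcongr

end Selection

variable {X Y : Type*} [NormedAddCommGroup X] [NormedSpace ℝ X] [CompleteSpace X]
  [NormedAddCommGroup Y] [NormedSpace ℝ Y] [CompleteSpace Y]

/-- If a curve and its weak derivative are in the domain of a closed operator, then the operator
commutes with the derivative. -/
theorem weakDeriv_graph (Γ : Submodule ℝ (X × Y)) (hΓ : IsClosed (Γ : Set (X × Y)))
    (hinj : InjOn Prod.fst (Γ : Set (X × Y))) {a b : ℝ} {u u' : ℝ → X} {q q' : ℝ → Y}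
    (hu : IntegrableOn u (Ioo a b)) (hu' : IntegrableOn u' (Ioo a b))
    (hq : IntegrableOn q (Ioo a b)) (hq' : IntegrableOn q' (Ioo a b))
    (h : ∀ᵐ t ∂volume.restrict (Ioo a b), (u t, q t) ∈ Γ)
    (h' : ∀ᵐ t ∂volume.restrict (Ioo a b), (u' t, q' t) ∈ Γ)
    {θ : ℝ → ℝ} (hθ : ContDiff ℝ ∞ θ) (hθc : HasCompactSupport θ)
    (hd : ∫ t in Ioo a b, deriv θ t • u t = -∫ t in Ioo a b, θ t • u' t) :
    ∫ t in Ioo a b, deriv θ t • q t = -∫ t in Ioo a b, θ t • q' t := by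
  -- the integral of a curve in a closed subspace is in the subspace, by passing to the quotient
  have hmem : ∀ {F : ℝ → X × Y}, IntegrableOn F (Ioo a b) →
      (∀ᵐ t ∂volume.restrict (Ioo a b), F t ∈ Γ) → ∫ t in Ioo a b, F t ∈ Γ := by
    intro F hF hFΓ
    have : IsClosed (Γ : Set (X × Y)) := hΓ
    have h1 := Γ.mkQL.integral_comp_comm hF
    rw [integral_eq_zero_of_ae] at h1
    · exact (Submodule.Quotient.mk_eq_zero Γ).1 h1.symm
    · filter_upwards [hFΓ] with t ht
      exact (Submodule.Quotient.mk_eq_zero Γ).2 ht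
  have hi1 : IntegrableOn (fun t => deriv θ t • (u t, q t)) (Ioo a b) :=
    test_smul_integrable (hθ.continuous_deriv (by simp)) hθc.deriv (Integrable.prodMk hu hq)
  have hi2 : IntegrableOn (fun t => θ t • (u' t, q' t)) (Ioo a b) :=
    test_smul_integrable hθ.continuous hθc (Integrable.prodMk hu' hq')
  have h1 := hmem hi1 (h.mono fun t ht => Γ.smul_mem _ ht)
  have h2 := hmem hi2 (h'.mono fun t ht => Γ.smul_mem _ ht)
  have h3 := Γ.add_mem h1 h2
  have e1 : ∫ t in Ioo a b, deriv θ t • (u t, q t) =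
      (∫ t in Ioo a b, deriv θ t • u t, ∫ t in Ioo a b, deriv θ t • q t) := by
    simp only [Prod.smul_mk] at hi1 ⊢
    exact integral_pair hi1.fst hi1.snd
  have e2 : ∫ t in Ioo a b, θ t • (u' t, q' t) =
      (∫ t in Ioo a b, θ t • u' t, ∫ t in Ioo a b, θ t • q' t) := by
    simp only [Prod.smul_mk] at hi2 ⊢
    exact integral_pair hi2.fst hi2.snd
  rw [e1, e2] at h3
  have h4 : (0 : X × Y) = _ := hinj Γ.zero_mem h3 (by simp [hd])
  have h5 := congrArg Prod.snd h4
  exact eq_neg_of_add_eq_zero_left h5.symm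

end Graph

section WeakGraph

variable {N : ℕ} {Ω D : Set (Sp N)}

theorem IsTestFun.memLp_inner {ψ : Sp N → ℝ} (h : IsTestFun D ψ) (e : Sp N) :
    MemLp (fun x => inner ℝ e (gradient ψ x)) 2 (volume.restrict Ω) :=
  h.memLp_gradient.const_inner e

theorem IsTestFun.memLp_smul {ψ : Sp N → ℝ} (h : IsTestFun D ψ) (e : Sp N) :
    MemLp (fun x => ψ x • e) 2 (volume.restrict Ω) := by
  have h1 : Continuous fun x => ψ x • e := h.1.continuous.smul continuous_const
  exact (h1.memLp_of_hasCompactSupport h.2.1.smul_right).restrict _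

/-- The functional on `L² × L²` which vanishes on the pairs that satisfy the definition of a weak
gradient for the test function `ψ` and the direction `e`. -/
noncomputable def weakFunctional (Ω : Set (Sp N)) {ψ : Sp N → ℝ} (h : IsTestFun D ψ) (e : Sp N) :
    L2 Ω × L2Vec Ω →L[ℝ] ℝ :=
  (innerSL ℝ ((h.memLp_inner (Ω := Ω) e).toLp _)).comp (ContinuousLinearMap.fst ℝ _ _) +
    (innerSL ℝ ((h.memLp_smul (Ω := Ω) e).toLp _)).comp (ContinuousLinearMap.snd ℝ _ _)

/-- The graph of the weak gradient in `D`, as a subspace of `L²(Ω) × L²(Ω)^N`; the gradient is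
extended by zero outside `D`. -/
noncomputable def weakGraph (Ω : Set (Sp N)) (hD : MeasurableSet D) :
    Submodule ℝ (L2 Ω × L2Vec Ω) :=
  LinearMap.ker (((mulOp (isWeight_indicator hD) (Sp N) (volume.restrict Ω)).comp
      (ContinuousLinearMap.snd ℝ _ _) - ContinuousLinearMap.snd ℝ _ _ :
        L2 Ω × L2Vec Ω →L[ℝ] L2Vec Ω) : L2 Ω × L2Vec Ω →ₗ[ℝ] L2Vec Ω) ⊓
    ⨅ (ψ : {ψ : Sp N → ℝ // IsTestFun D ψ}) (e : Sp N),
      LinearMap.ker (weakFunctional Ω ψ.2 e : L2 Ω × L2Vec Ω →ₗ[ℝ] ℝ)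

theorem isClosed_weakGraph (hD : MeasurableSet D) :
    IsClosed (weakGraph Ω hD : Set (L2 Ω × L2Vec Ω)) := by
  rw [weakGraph, Submodule.coe_inf]
  refine IsClosed.inter (ContinuousLinearMap.isClosed_ker _) ?_
  simp only [Submodule.coe_iInf]
  exact isClosed_iInter fun ψ => isClosed_iInter fun e => ContinuousLinearMap.isClosed_ker _

/-- The linear conditions that define `weakGraph` say that the second component is a weak gradient
of the first one in `D`, and that it vanishes outside `D`. -/
theorem mem_weakGraph_iff (hD : MeasurableSet D) (hDΩ : D ⊆ Ω) {z : L2 Ω × L2Vec Ω} :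
    z ∈ weakGraph Ω hD ↔ mulOp (isWeight_indicator hD) (Sp N) _ z.2 = z.2 ∧
      HasWeakGradOn D z.1 z.2 := by
  have hz1 : MemLp z.1 2 (volume.restrict D) :=
    (Lp.memLp z.1).mono_measure (Measure.restrict_mono_set _ hDΩ)
  have hz2 : MemLp z.2 2 (volume.restrict D) :=
    (Lp.memLp z.2).mono_measure (Measure.restrict_mono_set _ hDΩ)
  have key : ∀ (ψ : Sp N → ℝ) (h : IsTestFun D ψ) (e : Sp N), weakFunctional Ω h e z =
      (∫ x in D, z.1 x * inner ℝ e (gradient ψ x)) + ∫ x in D, ψ x * inner ℝ e (z.2 x) := by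
    intro ψ h e
    have hout : ∀ x, x ∉ D → x ∉ tsupport ψ := fun x hx h' => hx (h.2.2 h')
    simp only [weakFunctional, add_apply, ContinuousLinearMap.comp_apply,
      ContinuousLinearMap.coe_fst', ContinuousLinearMap.coe_snd', innerSL_apply_apply, L2.inner_def]
    have e1 : ∫ x in D, z.1 x * inner ℝ e (gradient ψ x) =
        ∫ x in Ω, z.1 x * inner ℝ e (gradient ψ x) := by
      have h1 : ∀ x, x ∉ D → z.1 x * inner ℝ e (gradient ψ x) = 0 := fun x hx => by
        rw [gradient_of_notMem_tsupport (hout x hx), inner_zero_right, mul_zero]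
      rw [setIntegral_eq_integral_of_forall_compl_eq_zero h1,
        setIntegral_eq_integral_of_forall_compl_eq_zero fun x hx => h1 x fun h' => hx (hDΩ h')]
    have e2 : ∫ x in D, ψ x * inner ℝ e (z.2 x) = ∫ x in Ω, ψ x * inner ℝ e (z.2 x) := by
      have h1 : ∀ x, x ∉ D → ψ x * inner ℝ e (z.2 x) = 0 := fun x hx => by
        rw [image_eq_zero_of_notMem_tsupport (hout x hx), zero_mul]
      rw [setIntegral_eq_integral_of_forall_compl_eq_zero h1,
        setIntegral_eq_integral_of_forall_compl_eq_zero fun x hx => h1 x fun h' => hx (hDΩ h')]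
    rw [e1, e2]
    congr 1
    · refine integral_congr_ae ?_
      filter_upwards [(h.memLp_inner (Ω := Ω) e).coeFn_toLp] with x hx
      rw [hx]
      rfl
    · refine integral_congr_ae ?_
      filter_upwards [(h.memLp_smul (Ω := Ω) e).coeFn_toLp] with x hx
      rw [hx, real_inner_smul_left]
  simp only [weakGraph, Submodule.mem_inf, Submodule.mem_iInf, LinearMap.mem_ker,
    ContinuousLinearMap.coe_coe]
  refine and_congr ?_ ⟨fun h => ?_, fun h ψ e => ?_⟩
  · simp [sub_eq_zero]
  · refine hasWeakGradOn_of_inner hz1 hz2 fun ψ hψ e => ?_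
    have h1 := h ⟨ψ, hψ⟩ e
    rw [key ψ hψ] at h1
    exact eq_neg_of_add_eq_zero_left h1
  · rw [key]
    have h1 := congrArg (inner ℝ e) (h ψ ψ.2)
    rw [inner_neg_right, ← integral_inner, ← integral_inner] at h1
    · simp only [real_inner_smul_right] at h1
      rw [h1, neg_add_cancel]
    · exact memLp_one_iff_integrable.1 (hz2.smul ψ.2.memLp)
    · exact memLp_one_iff_integrable.1 (ψ.2.memLp_gradient.smul hz1)

theorem injOn_weakGraph (hDo : IsOpen D) (hDΩ : D ⊆ Ω) :
    InjOn Prod.fst (weakGraph Ω hDo.measurableSet : Set (L2 Ω × L2Vec Ω)) := by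
  rintro ⟨u, G⟩ hz ⟨u', G'⟩ hz' (rfl : u = u')
  obtain ⟨h1, h2⟩ := (mem_weakGraph_iff hDo.measurableSet hDΩ).1 hz
  obtain ⟨h1', h2'⟩ := (mem_weakGraph_iff hDo.measurableSet hDΩ).1 hz'
  have hm : ∀ H : L2Vec Ω, MemLp H 2 (volume.restrict D) := fun H =>
    (Lp.memLp H).mono_measure (Measure.restrict_mono_set _ hDΩ)
  have h3 := h2.unique hDo h2' (hm _) (hm _)
  simp only at h1 h1' h3
  rw [← h1, ← h1']
  congr 1
  refine Lp.ext ?_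
  rw [EventuallyEq, ae_restrict_iff' hDo.measurableSet] at h3
  filter_upwards [coeFn_mulOp (isWeight_indicator hDo.measurableSet) G,
    coeFn_mulOp (isWeight_indicator hDo.measurableSet) G', ae_restrict_of_ae h3] with x a b c
  rw [a, b]
  by_cases hx : x ∈ D
  · rw [c hx]
  · simp [hx]

theorem enorm_mulOp_indicator {E : Type*} [NormedAddCommGroup E] [InnerProductSpace ℝ E]
    (hD : MeasurableSet D) (hDΩ : D ⊆ Ω) (f : Lp E 2 (volume.restrict Ω)) :
    ‖mulOp (isWeight_indicator hD) E _ f‖ₑ = eLpNorm f 2 (volume.restrict D) := by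
  rw [Lp.enorm_def, eLpNorm_congr_ae (coeFn_mulOp _ f)]
  have h1 : (fun x => D.indicator (fun _ => (1 : ℝ)) x • f x) = D.indicator f := by
    funext x
    by_cases hx : x ∈ D <;> simp [hx]
  rw [h1, eLpNorm_indicator_eq_eLpNorm_restrict hD, Measure.restrict_restrict hD,
    inter_eq_left.2 hDΩ]

theorem H10.mem_weakGraph (hDo : IsOpen D) (hDΩ : D ⊆ Ω) (u : H10 Ω) :
    (H10.val u, mulOp (isWeight_indicator hDo.measurableSet) (Sp N) _ (H10.grad u)) ∈
      weakGraph Ω hDo.measurableSet := by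
  have h1 := coeFn_mulOp (isWeight_indicator hDo.measurableSet) (H10.grad u)
  refine (mem_weakGraph_iff _ hDΩ).2 ⟨Lp.ext ?_, ?_⟩
  · filter_upwards [h1, coeFn_mulOp (isWeight_indicator hDo.measurableSet)
      (mulOp (isWeight_indicator hDo.measurableSet) (Sp N) _ (H10.grad u))] with x a b
    rw [b, a]
    by_cases hx : x ∈ D <;> simp [hx]
  · refine (H10.hasWeakGradOn hDΩ u).congr (ae_eq_refl _) ?_
    have h2 := ae_restrict_of_ae_restrict_of_subset hDΩ h1
    filter_upwards [h2, ae_restrict_mem hDo.measurableSet] with x a b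
    simp only at a ⊢
    rw [a]
    simp [b]

theorem norm0_mono {S S' : Set (Sp N)} (h : S ⊆ S') (w : Sp N → ℝ) : norm0 S w ≤ norm0 S' w :=
  eLpNorm_mono_measure _ (Measure.restrict_mono_set _ h)

theorem norm1_mono {S S' : Set (Sp N)} (h : S ⊆ S') (w : Sp N → ℝ) : norm1 S w ≤ norm1 S' w := by
  refine le_iInf₂ fun G hG => ?_
  have hm := Measure.restrict_mono_set volume h
  refine (iInf₂_le G ⟨hG.1.mono_measure hm, hG.2.mono (interior_mono h)⟩).trans ?_
  refine ENNReal.rpow_le_rpow (add_le_add ?_ ?_) (by norm_num)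
  · exact pow_le_pow_left' (norm0_mono h w) 2
  · exact pow_le_pow_left' (eLpNorm_mono_measure _ hm) 2

theorem stNorm0_mono {Q Q' : Set (ℝ × Sp N)} (h : Q ⊆ Q') (v : ℝ → L2 Ω) :
    stNorm0 Q v ≤ stNorm0 Q' v :=
  ENNReal.rpow_le_rpow (lintegral_mono fun t =>
    pow_le_pow_left' (norm0_mono (fun _ hx => h hx) _) 2) (by norm_num)

theorem stNorm1_mono {Q Q' : Set (ℝ × Sp N)} (h : Q ⊆ Q') (v : ℝ → L2 Ω) :
    stNorm1 Q v ≤ stNorm1 Q' v :=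
  ENNReal.rpow_le_rpow (lintegral_mono fun t =>
    pow_le_pow_left' (norm1_mono (fun _ hx => h hx) _) 2) (by norm_num)

theorem rpow_half_sq (a : ℝ≥0∞) : (a ^ (1 / 2 : ℝ)) ^ 2 = a := by
  rw [← ENNReal.rpow_natCast, ← ENNReal.rpow_mul]
  norm_num

/-- The norm of a function of `H¹₀` in a subset of `Ω` is at most the one that is given by its
gradient. -/
theorem norm1_val_le {S : Set (Sp N)} (hS : S ⊆ Ω) (u : H10 Ω) :
    norm1 S (H10.val u) ^ 2 ≤
      norm0 S (H10.val u) ^ 2 + eLpNorm (H10.grad u) 2 (volume.restrict S) ^ 2 := by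
  rw [← rpow_half_sq (_ + _)]
  refine pow_le_pow_left' (iInf₂_le (H10.grad u : Sp N → Sp N) ⟨?_, ?_⟩) 2
  · exact (Lp.memLp _).mono_measure (Measure.restrict_mono_set _ hS)
  · exact H10.hasWeakGradOn (interior_subset.trans hS) u

/-- The weak gradient in an open set is controlled by the norm on every larger set. -/
theorem le_norm1_sq {S : Set (Sp N)} (hDo : IsOpen D) (hDS : D ⊆ S) {w : Sp N → ℝ}
    {G : Sp N → Sp N} (hG : HasWeakGradOn D w G) (hG2 : MemLp G 2 (volume.restrict D)) :
    norm0 D w ^ 2 + eLpNorm G 2 (volume.restrict D) ^ 2 ≤ norm1 S w ^ 2 := by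
  rw [← rpow_half_sq (_ + _)]
  refine pow_le_pow_left' (le_iInf₂ fun G' hG' => ?_) 2
  have hm := Measure.restrict_mono_set volume hDS
  have h1 := hG.unique hDo (hG'.2.mono (interior_maximal hDS hDo)) hG2 (hG'.1.mono_measure hm)
  rw [eLpNorm_congr_ae h1]
  refine ENNReal.rpow_le_rpow (add_le_add ?_ ?_) (by norm_num)
  · exact pow_le_pow_left' (norm0_mono hDS w) 2
  · exact pow_le_pow_left' (eLpNorm_mono_measure _ hm) 2

theorem le_norm1_of_mem_weakGraph {S : Set (Sp N)} (hDo : IsOpen D) (hDΩ : D ⊆ Ω) (hDS : D ⊆ S)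
    {z : L2 Ω × L2Vec Ω} (hz : z ∈ weakGraph Ω hDo.measurableSet) :
    ‖mulOp (isWeight_indicator hDo.measurableSet) ℝ _ z.1‖ₑ ^ 2 + ‖z.2‖ₑ ^ 2 ≤
      norm1 S z.1 ^ 2 := by
  obtain ⟨h1, h2⟩ := (mem_weakGraph_iff hDo.measurableSet hDΩ).1 hz
  rw [← h1, enorm_mulOp_indicator hDo.measurableSet hDΩ, enorm_mulOp_indicator hDo.measurableSet
    hDΩ]
  exact le_norm1_sq hDo hDS h2 ((Lp.memLp z.2).mono_measure (Measure.restrict_mono_set _ hDΩ))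

/-- A function with a finite norm on `S` is in the domain of the weak gradient on each open subset
`D` of `S`. The infimum in `norm1` need not be known to be attained, since weak gradients in `D` are
unique. -/
theorem exists_mem_weakGraph {S : Set (Sp N)} (hDo : IsOpen D) (hDΩ : D ⊆ Ω) (hDS : D ⊆ S)
    {u : L2 Ω} (hu : norm1 S u ≠ ⊤) :
    ∃ G, (u, G) ∈ weakGraph Ω hDo.measurableSet ∧ ‖G‖ₑ ≤ norm1 S u := by
  obtain ⟨G, hG⟩ : ∃ G : Sp N → Sp N, MemLp G 2 (volume.restrict S) ∧
      HasWeakGradOn (interior S) u G := by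
    by_contra! h
    refine hu ?_
    rw [norm1, iInf₂_eq_top]
    exact fun G hG => absurd hG.2 (h G hG.1)
  have hG2 : MemLp (D.indicator G) 2 (volume.restrict Ω) := by
    rw [memLp_indicator_iff_restrict hDo.measurableSet, Measure.restrict_restrict hDo.measurableSet]
    exact hG.1.mono_measure (Measure.restrict_mono_set _ (inter_subset_left.trans hDS))
  have hz : (u, hG2.toLp _) ∈ weakGraph Ω hDo.measurableSet := by
    refine (mem_weakGraph_iff _ hDΩ).2 ⟨Lp.ext ?_, ?_⟩
    · filter_upwards [hG2.coeFn_toLp, coeFn_mulOp (isWeight_indicator hDo.measurableSet)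
        (hG2.toLp _)] with x a b
      simp only
      rw [b, a]
      by_cases hx : x ∈ D <;> simp [hx]
    · refine (hG.2.mono (interior_maximal hDS hDo)).congr (ae_eq_refl _) ?_
      have h2 := ae_restrict_of_ae_restrict_of_subset hDΩ hG2.coeFn_toLp
      filter_upwards [h2, ae_restrict_mem hDo.measurableSet] with x a b
      rw [a, indicator_of_mem b]
  refine ⟨_, hz, ?_⟩
  have h1 := (le_add_left le_rfl).trans (le_norm1_of_mem_weakGraph hDo hDΩ hDS hz)
  exact (ENNReal.pow_right_strictMono two_ne_zero).le_iff_le.1 h1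

instance secondCountableTopology_L2 : SecondCountableTopology (L2 Ω) := by
  have : Fact ((2 : ℝ≥0∞) ≠ ⊤) := ⟨by norm_num⟩
  exact Lp.SecondCountableTopology

instance secondCountableTopology_L2Vec : SecondCountableTopology (L2Vec Ω) := by
  have : Fact ((2 : ℝ≥0∞) ≠ ⊤) := ⟨by norm_num⟩
  exact Lp.SecondCountableTopology

end WeakGraph
end HeatFEM

namespace HeatFEM

/-! ### The energy estimate for the error -/

section ErrorEstimate

theorem IsDiscreteCutoff.mono {X H G : Type*} [NormedAddCommGroup X] [NormedSpace ℝ X]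
    [NormedAddCommGroup H] [InnerProductSpace ℝ H] [NormedAddCommGroup G] [InnerProductSpace ℝ G]
    {v : X →L[ℝ] H} {g : X →L[ℝ] G} {M : X →L[ℝ] X} {m P : H →L[ℝ] H}
    {n R : G →L[ℝ] G} {c c' h δ : ℝ} (hM : IsDiscreteCutoff v g M m P n R c h δ) (hc : c ≤ c')
    (h0 : 0 ≤ h) (hδ : 0 < δ) : IsDiscreteCutoff v g M m P n R c' h δ :=
  { hM with
    est_v := fun χ => (hM.est_v χ).trans (by gcongr)
    est_g := fun χ => (hM.est_g χ).trans (by gcongr) }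

theorem IsPrimOn.memLp {X : Type*} [NormedAddCommGroup X] [NormedSpace ℝ X] {a b : ℝ} {u u' : ℝ → X}
    (hu : IsPrimOn a b u u') :
    MemLp u 2 (volume.restrict (Ioc a b)) := by
  obtain ⟨C, hC⟩ := hu.bounded
  refine MemLp.of_bound hu.aestronglyMeasurable C ?_
  filter_upwards [ae_restrict_mem measurableSet_Ioc] with t ht
  exact hC t (Ioc_subset_Icc_self ht)

theorem integral_norm_sq_le {H α : Type*} [NormedAddCommGroup H] [MeasurableSpace α] {μ : Measure α}
    {f k : α → H}
    (hf : MemLp f 2 μ) (hk : MemLp k 2 μ) :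
    ∫ t, ‖f t‖ ^ 2 ∂μ ≤ 2 * ∫ t, ‖f t - k t‖ ^ 2 ∂μ + 2 * ∫ t, ‖k t‖ ^ 2 ∂μ := by
  have h1 := (memLp_two_iff_integrable_sq_norm (hf.sub hk).1).1 (hf.sub hk)
  have h2 := (memLp_two_iff_integrable_sq_norm hk.1).1 hk
  have h1' : Integrable (fun t => ‖f t - k t‖ ^ 2) μ := h1
  rw [← integral_const_mul, ← integral_const_mul, ← integral_add (h1'.const_mul 2) (h2.const_mul 2)]
  refine integral_mono_of_nonneg (Eventually.of_forall fun t => by positivity)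
    ((h1'.const_mul 2).add (h2.const_mul 2)) (Eventually.of_forall fun t => ?_)
  have h3 : ‖f t‖ ≤ ‖f t - k t‖ + ‖k t‖ := by
    simpa using norm_add_le (f t - k t) (k t)
  simp only
  have h4 := pow_le_pow_left₀ (norm_nonneg _) h3 2
  linarith [add_sq_le (a := ‖f t - k t‖) (b := ‖k t‖)]

theorem integral_mul_norm_sq_sub_le {H α : Type*} [NormedAddCommGroup H] [MeasurableSpace α]
    {μ : Measure α} {f k : α → H}
    {a : α → ℝ} (hf : MemLp f 2 μ) (hk : MemLp k 2 μ) (ha : AEStronglyMeasurable a μ)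
    (ha0 : ∀ t, 0 ≤ a t) (ha1 : ∀ t, a t ≤ 1) :
    ∫ t, a t * ‖f t - k t‖ ^ 2 ∂μ ≤
      2 * ∫ t, a t * ‖f t‖ ^ 2 ∂μ + 2 * ∫ t, ‖k t‖ ^ 2 ∂μ := by
  have h1 := (memLp_two_iff_integrable_sq_norm hf.1).1 hf
  have h2 := (memLp_two_iff_integrable_sq_norm hk.1).1 hk
  have h1' : Integrable (fun t => a t * ‖f t‖ ^ 2) μ :=
    h1.bdd_mul (c := 1) ha (Eventually.of_forall fun t => by
      rw [Real.norm_eq_abs, abs_of_nonneg (ha0 t)]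
      exact ha1 t)
  rw [← integral_const_mul, ← integral_const_mul, ← integral_add (h1'.const_mul 2) (h2.const_mul 2)]
  refine integral_mono_of_nonneg (Eventually.of_forall fun t => mul_nonneg (ha0 t) (by positivity))
    ((h1'.const_mul 2).add (h2.const_mul 2)) (Eventually.of_forall fun t => ?_)
  have h3 : ‖f t - k t‖ ≤ ‖f t‖ + ‖k t‖ := norm_sub_le _ _
  have h4 : ‖f t - k t‖ ^ 2 ≤ 2 * ‖f t‖ ^ 2 + 2 * ‖k t‖ ^ 2 := by
    have h5 := pow_le_pow_left₀ (norm_nonneg _) h3 2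
    linarith [add_sq_le (a := ‖f t‖) (b := ‖k t‖)]
  have h5 := mul_le_mul_of_nonneg_left h4 (ha0 t)
  have h6 : a t * ‖k t‖ ^ 2 ≤ ‖k t‖ ^ 2 := mul_le_of_le_one_left (by positivity) (ha1 t)
  simp only
  linarith

variable {X H G : Type*} [NormedAddCommGroup X] [NormedSpace ℝ X] [CompleteSpace X]
  [NormedAddCommGroup H] [InnerProductSpace ℝ H] [CompleteSpace H]
  [NormedAddCommGroup G] [InnerProductSpace ℝ G] [CompleteSpace G]
  {v : X →L[ℝ] H} {g : X →L[ℝ] G} {c h δ t₀ t₁ : ℝ}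

/-- The energy estimate in terms of the error `v y - s`, where `s` is the interpolation error. -/
theorem energy_error {M₁ M₂ : X →L[ℝ] X} {m₁ m₂ P : H →L[ℝ] H} {n₁ n₂ R : G →L[ℝ] G}
    (hM₁ : IsDiscreteCutoff v g M₁ m₁ m₂ n₁ n₂ c h δ)
    (hM₂ : IsDiscreteCutoff v g M₂ m₂ P n₂ R c h δ)
    (hc : 0 ≤ c) (hδ : 0 < δ) (h0 : 0 ≤ h)
    (hh : h ≤ δ) (ht : t₀ < t₁) (hl : t₁ - t₀ ≤ c * δ ^ 2) (hl' : (t₁ - t₀)⁻¹ ≤ c * δ⁻¹ ^ 2)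
    {y y' : ℝ → X} (hy : IsPrimOn t₀ t₁ y y')
    (hy' : MemLp y' 2 (volume.restrict (Ioc t₀ t₁)))
    {s s' : ℝ → H} (hs : MemLp s 2 (volume.restrict (Ioc t₀ t₁)))
    (hs' : MemLp s' 2 (volume.restrict (Ioc t₀ t₁)))
    {z : ℝ → G} (hz : MemLp z 2 (volume.restrict (Ioc t₀ t₁)))
    {q q' : ℝ → G} (hq : IsPrimOn t₀ t₁ q q') (hq' : MemLp q' 2 (volume.restrict (Ioc t₀ t₁)))
    (hqz : ∀ᵐ t ∂(volume.restrict (Ioc t₀ t₁)), q t = R (z t))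
    {a₁ a₁' a₂ a₂' : ℝ → ℝ} (ha : IsPrimOn t₀ t₁ a₁ a₁') (hb : IsPrimOn t₀ t₁ a₂ a₂')
    (ha0 : ∀ t, 0 ≤ a₁ t) (hab : ∀ t, a₁ t ≤ a₂ t) (hb1 : ∀ t, a₂ t ≤ 1)
    (ha' : ∀ t, |a₁' t| ≤ c * δ⁻¹ ^ 2 * a₂ t) (hb' : ∀ t, |a₂' t| ≤ c * δ⁻¹ ^ 2)
    (hPM : ∀ χ ∈ range M₁ ∪ range M₂, P (v χ) = v χ)
    (hRM : ∀ χ ∈ range M₁ ∪ range M₂, R (g χ) = g χ)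
    (heq : ∀ᵐ t ∂(volume.restrict (Ioc t₀ t₁)), ∀ χ,
      inner ℝ (v (y' t) - s' t) (v χ) + inner ℝ (g (y t) - z t) (g χ) = 0)
    {ε : ℝ} (hε : 0 < ε) (hε1 : ε ≤ 1) :
    (∫ t in Ioc t₀ t₁, a₁ t * ‖m₁ (v (y' t) - s' t)‖ ^ 2) +
      δ⁻¹ ^ 2 * (∫ t in Ioc t₀ t₁, a₂ t * ‖n₂ (g (y t) - z t)‖ ^ 2) ≤
    1200 * (1 + c) ^ 5 * (h / δ + ε ^ 2) * ((∫ t in Ioc t₀ t₁, ‖P (v (y' t) - s' t)‖ ^ 2) +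
        δ⁻¹ ^ 2 * (∫ t in Ioc t₀ t₁, ‖R (g (y t) - z t)‖ ^ 2)) +
      1200 * (1 + c) ^ 5 * ε⁻¹ ^ 6 *
        (a₂ t₀ * (‖R (g (y t₀))‖ ^ 2 + δ⁻¹ ^ 2 * ‖P (v (y t₀))‖ ^ 2) +
        δ⁻¹ ^ 4 * (∫ t in Ioc t₀ t₁, ‖P (v (y t) - s t)‖ ^ 2) +
        δ⁻¹ ^ 4 * (∫ t in Ioc t₀ t₁, ‖P (s t)‖ ^ 2) + (∫ t in Ioc t₀ t₁, ‖P (s' t)‖ ^ 2) +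
        δ⁻¹ ^ 2 * (∫ t in Ioc t₀ t₁, ‖R (z t)‖ ^ 2) +
        δ ^ 2 * (∫ t in Ioc t₀ t₁, ‖q' t‖ ^ 2)) := by
  have heq' : ∀ᵐ t ∂(volume.restrict (Ioc t₀ t₁)), ∀ χ, χ ∈ range M₁ ∪ range M₂ →
      inner ℝ (v (y' t)) (v χ) + inner ℝ (g (y t)) (g χ) =
      inner ℝ (P (s' t)) (v χ) + inner ℝ (q t) (g χ) := by
    filter_upwards [heq, hqz] with t h1 h2 χ hχ
    have h3 := h1 χ
    rw [inner_sub_left, inner_sub_left] at h3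
    rw [h2, hM₂.symm_P, hM₂.symm_R, hPM χ hχ, hRM χ hχ]
    linarith
  have key := energy_combined hM₁ hM₂ hc hδ h0 hh ht hl hl' hy hy' (P.comp_memLp' hs') hq hq' ha hb
    ha0 hab hb1 ha' hb' heq' hε hε1
  have hvy' : MemLp (fun t => v (y' t)) 2 (volume.restrict (Ioc t₀ t₁)) := v.comp_memLp' hy'
  have hvy : MemLp (fun t => v (y t)) 2 (volume.restrict (Ioc t₀ t₁)) := v.comp_memLp' hy.memLp
  have hgy : MemLp (fun t => g (y t)) 2 (volume.restrict (Ioc t₀ t₁)) := g.comp_memLp' hy.memLp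
  have b1 := integral_norm_sq_le (P.comp_memLp' hvy') (P.comp_memLp' hs')
  have b2 := integral_norm_sq_le (P.comp_memLp' hvy) (P.comp_memLp' hs)
  have b3 := integral_norm_sq_le (R.comp_memLp' hgy) (R.comp_memLp' hz)
  have b4 := integral_mul_norm_sq_sub_le (m₁.comp_memLp' hvy') (m₁.comp_memLp' hs')
    ha.aestronglyMeasurable ha0 fun t => (hab t).trans (hb1 t)
  have b5 := integral_mul_norm_sq_sub_le (n₂.comp_memLp' hgy) (n₂.comp_memLp' hz)
    hb.aestronglyMeasurable (fun t => (ha0 t).trans (hab t)) hb1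
  have b6 : ∫ t in Ioc t₀ t₁, ‖m₁ (s' t)‖ ^ 2 ≤ ∫ t in Ioc t₀ t₁, ‖P (s' t)‖ ^ 2 := by
    have h1 := P.comp_memLp' hs'
    refine integral_mono_of_nonneg (Eventually.of_forall fun t => by positivity)
      ((memLp_two_iff_integrable_sq_norm h1.1).1 h1) (Eventually.of_forall fun t => ?_)
    exact pow_le_pow_left₀ (norm_nonneg _) ((hM₁.m_le _).trans (hM₂.m_le _)) 2
  have b7 : ∫ t in Ioc t₀ t₁, ‖n₂ (z t)‖ ^ 2 ≤ ∫ t in Ioc t₀ t₁, ‖R (z t)‖ ^ 2 := by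
    have h1 := R.comp_memLp' hz
    refine integral_mono_of_nonneg (Eventually.of_forall fun t => by positivity)
      ((memLp_two_iff_integrable_sq_norm h1.1).1 h1) (Eventually.of_forall fun t => ?_)
    exact pow_le_pow_left₀ (norm_nonneg _) (hM₂.n_le _) 2
  have b8 : ∫ t in Ioc t₀ t₁, ‖q t‖ ^ 2 = ∫ t in Ioc t₀ t₁, ‖R (z t)‖ ^ 2 :=
    integral_congr_ae (hqz.mono fun t h1 => by simp only [h1])
  rw [b8] at key
  simp only [← map_sub, Function.comp_def] at b1 b2 b3 b4 b5 key
  -- From here on, only the following real numbers and the inequalities between them matter.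
  have hA : 0 ≤ a₂ t₀ * (‖R (g (y t₀))‖ ^ 2 + δ⁻¹ ^ 2 * ‖P (v (y t₀))‖ ^ 2) :=
    mul_nonneg ((ha0 _).trans (hab _)) (by positivity)
  generalize a₂ t₀ * (‖R (g (y t₀))‖ ^ 2 + δ⁻¹ ^ 2 * ‖P (v (y t₀))‖ ^ 2) = A at *
  have nn : ∀ f : ℝ → H, 0 ≤ ∫ t in Ioc t₀ t₁, ‖f t‖ ^ 2 :=
    fun f => integral_nonneg fun t => by positivity
  have nn' : ∀ f : ℝ → G, 0 ≤ ∫ t in Ioc t₀ t₁, ‖f t‖ ^ 2 :=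
    fun f => integral_nonneg fun t => by positivity
  have n1 := nn fun t => P (v (y' t) - s' t)
  have n2 := nn fun t => P (s' t)
  have n3 := nn' fun t => R (g (y t) - z t)
  have n4 := nn' fun t => R (z t)
  have n5 := nn fun t => P (v (y t) - s t)
  have n6 := nn fun t => P (s t)
  have n7 := nn' q'
  clear nn nn' heq heq' hqz
  generalize (∫ t in Ioc t₀ t₁, ‖P (v (y' t) - s' t)‖ ^ 2) = I1 at *
  generalize (∫ t in Ioc t₀ t₁, ‖P (s' t)‖ ^ 2) = I2 at *
  generalize (∫ t in Ioc t₀ t₁, ‖R (g (y t) - z t)‖ ^ 2) = I3 at *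
  generalize (∫ t in Ioc t₀ t₁, ‖R (z t)‖ ^ 2) = I4 at *
  generalize (∫ t in Ioc t₀ t₁, ‖P (v (y t) - s t)‖ ^ 2) = I5 at *
  generalize (∫ t in Ioc t₀ t₁, ‖P (s t)‖ ^ 2) = I6 at *
  generalize (∫ t in Ioc t₀ t₁, ‖q' t‖ ^ 2) = I7 at *
  generalize (∫ t in Ioc t₀ t₁, ‖P (v (y' t))‖ ^ 2) = I8 at *
  generalize (∫ t in Ioc t₀ t₁, ‖P (v (y t))‖ ^ 2) = I9 at *
  generalize (∫ t in Ioc t₀ t₁, ‖R (g (y t))‖ ^ 2) = I10 at *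
  generalize (∫ t in Ioc t₀ t₁, a₁ t * ‖m₁ (v (y' t))‖ ^ 2) = J1 at *
  generalize (∫ t in Ioc t₀ t₁, a₁ t * ‖m₁ (v (y' t) - s' t)‖ ^ 2) = J2 at *
  generalize (∫ t in Ioc t₀ t₁, a₂ t * ‖n₂ (g (y t))‖ ^ 2) = J3 at *
  generalize (∫ t in Ioc t₀ t₁, a₂ t * ‖n₂ (g (y t) - z t)‖ ^ 2) = J4 at *
  generalize (∫ t in Ioc t₀ t₁, ‖m₁ (s' t)‖ ^ 2) = I11 at *
  generalize (∫ t in Ioc t₀ t₁, ‖n₂ (z t)‖ ^ 2) = I12 at *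
  set k := 100 * (1 + c) ^ 5 with hk
  have hk1 : 1 ≤ k := by
    have : 1 ≤ (1 + c) ^ 5 := one_le_pow₀ (by linarith)
    linarith
  have hck : c ≤ k := by
    have : 1 + c ≤ (1 + c) ^ 5 := le_self_pow₀ (by linarith) (by norm_num)
    have h2 : 0 ≤ (1 + c) ^ 5 := by positivity
    linarith
  have hk2 : 1200 * (1 + c) ^ 5 = 12 * k := by rw [hk]; ring
  rw [hk2]
  clear_value k
  have hhδ : h / δ ≤ 1 := (div_le_one hδ).2 hh
  have hhδ0 : 0 ≤ h / δ := by positivity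
  set x := h / δ
  set D := δ⁻¹ ^ 2 with hD
  have hD0 : 0 ≤ D := by positivity
  have hD4 : δ⁻¹ ^ 4 = D ^ 2 := by rw [hD]; ring
  rw [hD4] at key ⊢
  have he6 : 1 ≤ ε⁻¹ ^ 6 := one_le_pow₀ ((one_le_inv₀ hε).2 hε1)
  have he2 : ε ^ 2 ≤ 1 := pow_le_one₀ hε.le hε1
  have hδ2 : 0 ≤ δ ^ 2 := by positivity
  set e6 := ε⁻¹ ^ 6
  have he20 : 0 ≤ ε ^ 2 := by positivity
  set e2 := ε ^ 2
  set dd := δ ^ 2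
  clear_value e6 e2 D x dd
  have r1 : J2 + D * J4 ≤ 2 * (J1 + D * J3) + 2 * (I2 + D * I4) := by
    have := mul_le_mul_of_nonneg_left b5 hD0
    have := mul_le_mul_of_nonneg_left b7 hD0
    linarith
  have hB : 0 ≤ I2 + D * I4 := by positivity
  have r2 : I8 + D * I10 ≤ 2 * (I1 + D * I3) + 2 * (I2 + D * I4) := by
    have := mul_le_mul_of_nonneg_left b3 hD0
    linarith
  have r3 : D ^ 2 * I9 ≤ 2 * (D ^ 2 * I5) + 2 * (D ^ 2 * I6) := by
    have := mul_le_mul_of_nonneg_left b2 (sq_nonneg D)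
    linarith
  have hx : c * x + k * e2 ≤ k * (x + e2) := by linarith only [mul_le_mul_of_nonneg_right hck hhδ0]
  have r4 : (c * x + k * e2) * (I8 + D * I10) ≤
      k * (x + e2) * (2 * (I1 + D * I3) + 2 * (I2 + D * I4)) :=
    (mul_le_mul_of_nonneg_left r2 (by positivity)).trans
      (mul_le_mul_of_nonneg_right hx (by positivity))
  have r5 : k * (x + e2) * (I2 + D * I4) ≤ 2 * (k * e6 * (I2 + D * I4)) := by
    have h1 : x + e2 ≤ 2 * e6 := by linarith
    have h2 := mul_le_mul_of_nonneg_left h1 (by positivity : 0 ≤ k * (I2 + D * I4))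
    linarith
  have r6 : I2 + D * I4 ≤ k * e6 * (I2 + D * I4) :=
    le_mul_of_one_le_left hB (one_le_mul_of_one_le_of_one_le hk1 he6)
  have r7 : k * e6 * (D ^ 2 * I9) ≤ k * e6 * (2 * (D ^ 2 * I5) + 2 * (D ^ 2 * I6)) :=
    mul_le_mul_of_nonneg_left r3 (by positivity)
  have p1 : 0 ≤ k * (x + e2) * (I1 + D * I3) := by positivity
  have p2 : 0 ≤ k * e6 * A := by positivity
  have p3 : 0 ≤ k * e6 * (D ^ 2 * I5) := by positivity
  have p4 : 0 ≤ k * e6 * (D ^ 2 * I6) := by positivity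
  have p5 : 0 ≤ k * e6 * (dd * I7) := by positivity
  have p6 : 0 ≤ k * e6 * (I2 + D * I4) := by positivity
  linarith

/-- From an estimate of squares to an estimate. -/
theorem le_sq_of_energy {k x ε L α₁ α₂ β₁ β₂ β₃ β₄ β₅ β₆ β₇ : ℝ} (hk : 1 ≤ k) (hx : 0 ≤ x)
    (hε : 0 < ε)
    (h1 : 0 ≤ α₁) (h2 : 0 ≤ α₂) (g1 : 0 ≤ β₁) (g2 : 0 ≤ β₂) (g3 : 0 ≤ β₃) (g4 : 0 ≤ β₄)
    (g5 : 0 ≤ β₅) (g6 : 0 ≤ β₆) (g7 : 0 ≤ β₇)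
    (hL : L ≤ k * (x + ε ^ 2) * (α₁ ^ 2 + α₂ ^ 2) + k * ε⁻¹ ^ 6 *
      (β₁ ^ 2 + β₂ ^ 2 + β₃ ^ 2 + β₄ ^ 2 + β₅ ^ 2 + β₆ ^ 2 + β₇ ^ 2)) :
    L ≤ (k * (√x + ε) * (α₁ + α₂) + k * ε⁻¹ ^ 3 * (β₁ + β₂ + β₃ + β₄ + β₅ + β₆ + β₇)) ^ 2 := by
  have sq2 : ∀ {a b A B : ℝ}, 0 ≤ a → 0 ≤ b → A ≤ a ^ 2 → B ≤ b ^ 2 → A + B ≤ (a + b) ^ 2 := by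
    intro a b A B ha hb hA hB
    linarith [mul_nonneg ha hb]
  have hk0 : 0 ≤ k := by linarith
  have hkk : k ≤ k ^ 2 := le_self_pow₀ hk two_ne_zero
  have e1 : x + ε ^ 2 ≤ (√x + ε) ^ 2 :=
    sq2 (Real.sqrt_nonneg _) hε.le (Real.sq_sqrt hx).ge le_rfl
  have e2 : α₁ ^ 2 + α₂ ^ 2 ≤ (α₁ + α₂) ^ 2 := sq2 h1 h2 le_rfl le_rfl
  have e3 : β₁ ^ 2 + β₂ ^ 2 + β₃ ^ 2 + β₄ ^ 2 + β₅ ^ 2 + β₆ ^ 2 + β₇ ^ 2 ≤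
      (β₁ + β₂ + β₃ + β₄ + β₅ + β₆ + β₇) ^ 2 := by
    refine sq2 (by positivity) g7 (sq2 (by positivity) g6 (sq2 (by positivity) g5
      (sq2 (by positivity) g4 (sq2 (by positivity) g3 (sq2 g1 g2 le_rfl le_rfl) le_rfl) le_rfl)
      le_rfl) le_rfl) le_rfl
  refine hL.trans (sq2 (by positivity) (by positivity) ?_ ?_)
  · rw [mul_pow, mul_pow]
    gcongr
  · rw [mul_pow, mul_pow, ← pow_mul]
    gcongr

end ErrorEstimate
end HeatFEM

namespace HeatFEM

/-! ### Cutoff functions in space -/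

/-- The operators `P` and `R` of a discrete cutoff fix the range of `M`. -/
theorem IsDiscreteCutoff.fix {X H G : Type*} [NormedAddCommGroup X] [NormedSpace ℝ X]
    [NormedAddCommGroup H] [InnerProductSpace ℝ H] [NormedAddCommGroup G] [InnerProductSpace ℝ G]
    {v : X →L[ℝ] H} {g : X →L[ℝ] G} {M : X →L[ℝ] X} {m P : H →L[ℝ] H}
    {n R : G →L[ℝ] G} {c h δ : ℝ} (hM : IsDiscreteCutoff v g M m P n R c h δ)
    (hP : ∀ a, P (m a) = m a) (hR : ∀ a, R (n a) = n a) (χ : X) :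
    P (v (M χ)) = v (M χ) ∧ R (g (M χ)) = g (M χ) := by
  have h1 := hM.loc_v χ
  have h2 := hM.loc_g χ
  rw [map_sub, hP] at h1
  rw [map_sub, hR] at h2
  exact ⟨sub_left_injective h1, sub_left_injective h2⟩

section Ramp

variable {N : ℕ} {Ω : Set (Sp N)} {𝒯 : Geometry.SimplicialComplex ℝ (Sp N)} {K h δ : ℝ} {r : ℕ}
  {ρ : Sp N → ℝ} {k : ℝ}

/-- The cutoff function that decreases from `1` to `0` between the level sets `(k - 1) δ` and `k δ`
of `ρ`. -/
noncomputable def ramp (ρ : Sp N → ℝ) (δ k : ℝ) (x : Sp N) : ℝ := max 0 (min 1 (k - ρ x / δ))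

theorem ramp_nonneg (x : Sp N) : 0 ≤ ramp ρ δ k x := le_max_left _ _

theorem ramp_le_one (x : Sp N) : ramp ρ δ k x ≤ 1 := max_le zero_le_one (min_le_left _ _)

theorem ramp_eq_one (hδ : 0 < δ) {x : Sp N} (hx : ρ x ≤ (k - 1) * δ) : ramp ρ δ k x = 1 := by
  have h1 : ρ x / δ ≤ k - 1 := (div_le_iff₀ hδ).2 hx
  rw [ramp, min_eq_left (by linarith), max_eq_right zero_le_one]

theorem ramp_eq_zero (hδ : 0 < δ) {x : Sp N} (hx : k * δ ≤ ρ x) : ramp ρ δ k x = 0 := by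
  have h1 : k ≤ ρ x / δ := (le_div_iff₀ hδ).2 hx
  rw [ramp, max_eq_left]
  exact (min_le_right _ _).trans (by linarith)

theorem ramp_le_ramp {k' : ℝ} (hk : k ≤ k') (x : Sp N) : ramp ρ δ k x ≤ ramp ρ δ k' x :=
  max_le_max_left _ (min_le_min_left _ (by linarith))

theorem continuous_of_abs_sub_le (hρ : ∀ x y, |ρ x - ρ y| ≤ dist x y) : Continuous ρ :=
  (LipschitzWith.of_dist_le_mul (K := 1) fun x y => by
    rw [Real.dist_eq, NNReal.coe_one, one_mul]
    exact hρ x y).continuous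

theorem abs_ramp_sub_le (hρ : ∀ x y, |ρ x - ρ y| ≤ dist x y) (hδ : 0 < δ) (x y : Sp N) :
    |ramp ρ δ k x - ramp ρ δ k y| ≤ δ⁻¹ * dist x y := by
  have h1 : |ramp ρ δ k x - ramp ρ δ k y| ≤ |(k - ρ x / δ) - (k - ρ y / δ)| := by
    refine (abs_max_sub_max_le_max _ _ _ _).trans ?_
    rw [sub_self, abs_zero, max_eq_right (abs_nonneg _)]
    refine (abs_min_sub_min_le_max _ _ _ _).trans ?_
    rw [sub_self, abs_zero, max_eq_right (abs_nonneg _)]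
  have h2 : (k - ρ x / δ) - (k - ρ y / δ) = δ⁻¹ * (ρ y - ρ x) := by
    field_simp
    ring
  rw [h2, abs_mul, abs_of_pos (inv_pos.2 hδ), abs_sub_comm (ρ y)] at h1
  exact h1.trans (mul_le_mul_of_nonneg_left (hρ x y) (inv_pos.2 hδ).le)

theorem isWeight_ramp (hρ : ∀ x y, |ρ x - ρ y| ≤ dist x y) (δ k : ℝ) : IsWeight (ramp ρ δ k) where
  measurable := by
    have := continuous_of_abs_sub_le hρ
    unfold ramp
    fun_prop
  abs_le_one x := by
    rw [abs_of_nonneg (ramp_nonneg x)]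
    exact ramp_le_one x

theorem mulOp_congr {α E : Type*} [NormedAddCommGroup E] [InnerProductSpace ℝ E]
    [MeasurableSpace α] {μ : Measure α} {w w' : α → ℝ} (hw : IsWeight w) (hw' : IsWeight w')
    (h : w =ᵐ[μ] w') : mulOp hw E μ = mulOp hw' E μ := by
  refine ContinuousLinearMap.ext fun f => Lp.ext ?_
  filter_upwards [coeFn_mulOp hw f, coeFn_mulOp hw' f, h] with x h1 h2 h3
  rw [h1, h2, h3]

theorem mulOp_mulOp_of_eq_one {α E : Type*} [NormedAddCommGroup E] [InnerProductSpace ℝ E]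
    [MeasurableSpace α] {μ : Measure α} {w ζ : α → ℝ} (hw : IsWeight w) (hζ : IsWeight ζ)
    (h : ∀ x, ζ x = 0 ∨ w x = 1) (f : Lp E 2 μ) :
    mulOp hw E μ (mulOp hζ E μ f) = mulOp hζ E μ f := by
  refine Lp.ext ?_
  filter_upwards [coeFn_mulOp hw (mulOp hζ E μ f), coeFn_mulOp hζ f] with x h1 h2
  rw [h1, h2]
  rcases h x with h3 | h3 <;> simp [h3]

theorem isOpen_sublevel (hρ : ∀ x y, |ρ x - ρ y| ≤ dist x y) (hΩ : IsOpen Ω) (a : ℝ) :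
    IsOpen (Ω ∩ {x | ρ x < a}) :=
  hΩ.inter (isOpen_lt (continuous_of_abs_sub_le hρ) continuous_const)

/-- A function that varies by at most `δ` on a cell satisfies the alternative that is required for
discrete cutoffs. -/
theorem cell_alternative (hT : IsQuasiUniformTriangulation Ω 𝒯 K h)
    (hρ : ∀ x y, |ρ x - ρ y| ≤ dist x y) (hKh : K * h ≤ δ) {s : Finset (Sp N)} (hs : s ∈ cells 𝒯)
    (a : ℝ) : (∀ x ∈ convexHull ℝ (s : Set (Sp N)), a ≤ ρ x) ∨
      ∀ x ∈ convexHull ℝ (s : Set (Sp N)), ρ x < a + δ := by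
  by_cases h : ∀ x ∈ convexHull ℝ (s : Set (Sp N)), a ≤ ρ x
  · exact Or.inl h
  · right
    push Not at h
    obtain ⟨x, hx, hxa⟩ := h
    intro y hy
    have h1 := (Metric.dist_le_diam_of_mem (isCompact_cell s).isBounded hy hx).trans
      (hT.diam_le s hs)
    have h2 := (abs_le.1 (hρ y x)).2
    linarith

/-- Two nested discrete cutoffs for the sublevel sets of a `1`-Lipschitz function. The ramps end at
the levels `δ` and `3 δ`. Since `ρ` varies by at most `δ` on a cell, the first cutoff acts where the
second ramp is `1`, and the second one acts where `ρ < 4 δ`. -/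
theorem exists_nested_cutoffs (N : ℕ) (hr : 1 ≤ r) (hK : 0 < K) :
    ∃ C, 0 ≤ C ∧ ∀ (Ω : Set (Sp N)) (𝒯 : Geometry.SimplicialComplex ℝ (Sp N)) (h : ℝ)
      (hΩ : IsPolyhedralDomain Ω), IsQuasiUniformTriangulation Ω 𝒯 K h → 0 < h →
      ∀ (ρ : Sp N → ℝ) (hρ : ∀ x y, |ρ x - ρ y| ≤ dist x y) (δ : ℝ), 0 < δ → K * h ≤ δ →
      ∃ M₁ M₂ : Sh Ω 𝒯 r →L[ℝ] Sh Ω 𝒯 r,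
        IsDiscreteCutoff (X := Sh Ω 𝒯 r) Sh.valL Sh.gradL M₁
          (mulOp (isWeight_ramp hρ δ 1) ℝ _) (mulOp (isWeight_ramp hρ δ 3) ℝ _)
          (mulOp (isWeight_ramp hρ δ 1) (Sp N) _) (mulOp (isWeight_ramp hρ δ 3) (Sp N) _) C h δ ∧
        IsDiscreteCutoff (X := Sh Ω 𝒯 r) Sh.valL Sh.gradL M₂
          (mulOp (isWeight_ramp hρ δ 3) ℝ _)
          (mulOp (isWeight_indicator (isOpen_sublevel hρ hΩ.isOpen (4 * δ)).measurableSet) ℝ _)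
          (mulOp (isWeight_ramp hρ δ 3) (Sp N) _)
          (mulOp (isWeight_indicator (isOpen_sublevel hρ hΩ.isOpen (4 * δ)).measurableSet)
            (Sp N) _) C h δ ∧
        ∀ χ ∈ range M₁ ∪ range M₂,
          mulOp (isWeight_indicator (isOpen_sublevel hρ hΩ.isOpen (4 * δ)).measurableSet) ℝ _
            (Sh.valL χ) = Sh.valL χ ∧
          mulOp (isWeight_indicator (isOpen_sublevel hρ hΩ.isOpen (4 * δ)).measurableSet) (Sp N) _
            (Sh.gradL χ) = Sh.gradL χ := by
  obtain ⟨C, hC, H⟩ := exists_isDiscreteCutoff (r := r) N hr hK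
  refine ⟨C, hC, fun Ω 𝒯 h hΩ hT hh ρ hρ δ hδ hKh => ?_⟩
  have hD : MeasurableSet {x | ρ x < 4 * δ} :=
    (isOpen_lt (continuous_of_abs_sub_le hρ) continuous_const).measurableSet
  have hDΩ := (isOpen_sublevel hρ hΩ.isOpen (4 * δ)).measurableSet
  set w : Sp N → ℝ := {x | ρ x < 4 * δ}.indicator fun _ => 1 with hwdef
  have hw : IsWeight w := isWeight_indicator hD
  have hw1 : ∀ x, ρ x < 4 * δ → w x = 1 := fun x hx =>
    indicator_of_mem (s := {x | ρ x < 4 * δ}) hx _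
  have hae : w =ᵐ[volume.restrict Ω] (Ω ∩ {x | ρ x < 4 * δ}).indicator fun _ => 1 := by
    filter_upwards [ae_restrict_mem hΩ.isOpen.measurableSet] with x hx
    by_cases h1 : ρ x < 4 * δ
    · rw [hw1 x h1, indicator_of_mem (show x ∈ Ω ∩ {x | ρ x < 4 * δ} from ⟨hx, h1⟩)]
    · rw [hwdef, indicator_of_notMem (by simpa using h1), indicator_of_notMem fun h2 => h1 h2.2]
  have hwle : ∀ k, k ≤ 4 → ∀ x, |ramp ρ δ k x| ≤ |w x| := by
    intro k hk x
    by_cases h1 : ρ x < 4 * δ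
    · rw [hw1 x h1, abs_one]
      exact (isWeight_ramp hρ δ k).abs_le_one x
    · rw [ramp_eq_zero hδ, abs_zero]
      · exact abs_nonneg _
      · push Not at h1
        exact (mul_le_mul_of_nonneg_right hk hδ.le).trans h1
  have hrw : ∀ k, k ≤ 4 → ∀ x, ramp ρ δ k x = 0 ∨ w x = 1 := by
    intro k hk x
    by_cases h1 : ρ x < 4 * δ
    · exact Or.inr (hw1 x h1)
    · push Not at h1
      exact Or.inl (ramp_eq_zero hδ ((mul_le_mul_of_nonneg_right hk hδ.le).trans h1))
  have hcw : ∀ k, k ≤ 3 → ∀ s ∈ cells 𝒯, (∀ x ∈ convexHull ℝ (s : Set (Sp N)), ramp ρ δ k x = 0) ∨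
      ∀ x ∈ convexHull ℝ (s : Set (Sp N)), w x = 1 := by
    intro k hk s hs
    refine (cell_alternative hT hρ hKh hs (3 * δ)).imp (fun h1 x hx => ramp_eq_zero hδ ?_)
      fun h1 x hx => hw1 x ?_
    · exact (mul_le_mul_of_nonneg_right hk hδ.le).trans (h1 x hx)
    · linarith [h1 x hx]
  have c12 := H Ω 𝒯 h hΩ hT hh (ramp ρ δ 1) (ramp ρ δ 3) (isWeight_ramp hρ δ 1)
    (isWeight_ramp hρ δ 3) δ hδ (abs_ramp_sub_le hρ hδ) (fun x => by
      rw [abs_of_nonneg (ramp_nonneg x), abs_of_nonneg (ramp_nonneg x)]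
      exact ramp_le_ramp (by norm_num) x) fun s hs => by
        refine (cell_alternative hT hρ hKh hs δ).imp (fun h1 x hx => ramp_eq_zero hδ ?_)
          fun h1 x hx => ramp_eq_one hδ ?_
        · linarith [h1 x hx]
        · linarith [h1 x hx]
  have c1w := H Ω 𝒯 h hΩ hT hh (ramp ρ δ 1) w (isWeight_ramp hρ δ 1) hw δ hδ
    (abs_ramp_sub_le hρ hδ) (hwle 1 (by norm_num)) (hcw 1 (by norm_num))
  have c2w := H Ω 𝒯 h hΩ hT hh (ramp ρ δ 3) w (isWeight_ramp hρ δ 3) hw δ hδ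
    (abs_ramp_sub_le hρ hδ) (hwle 3 (by norm_num)) (hcw 3 (by norm_num))
  have e1 : mulOp hw ℝ (volume.restrict Ω) = mulOp (isWeight_indicator hDΩ) ℝ (volume.restrict Ω) :=
    mulOp_congr _ _ hae
  have e2 : mulOp hw (Sp N) (volume.restrict Ω) =
      mulOp (isWeight_indicator hDΩ) (Sp N) (volume.restrict Ω) := mulOp_congr _ _ hae
  have c2w' := c2w
  rw [e1, e2] at c2w
  refine ⟨cutoffOp hT hΩ hr fun x => ramp ρ δ 1 x ^ 2, cutoffOp hT hΩ hr fun x => ramp ρ δ 3 x ^ 2,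
    c12, c2w, ?_⟩
  rw [← e1, ← e2]
  have f1 := fun f => mulOp_mulOp_of_eq_one (E := ℝ) (μ := volume.restrict Ω) hw
    (isWeight_ramp hρ δ 1) (hrw 1 (by norm_num)) f
  have f2 := fun f => mulOp_mulOp_of_eq_one (E := Sp N) (μ := volume.restrict Ω) hw
    (isWeight_ramp hρ δ 1) (hrw 1 (by norm_num)) f
  have f3 := fun f => mulOp_mulOp_of_eq_one (E := ℝ) (μ := volume.restrict Ω) hw
    (isWeight_ramp hρ δ 3) (hrw 3 (by norm_num)) f
  have f4 := fun f => mulOp_mulOp_of_eq_one (E := Sp N) (μ := volume.restrict Ω) hw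
    (isWeight_ramp hρ δ 3) (hrw 3 (by norm_num)) f
  rintro χ (⟨χ, rfl⟩ | ⟨χ, rfl⟩)
  · exact c1w.fix f1 f2 χ
  · exact c2w'.fix f3 f4 χ

end Ramp
end HeatFEM

namespace HeatFEM

/-! ### Space-time norms on cylinders -/

section SpaceTime

variable {N : ℕ} {Ω D : Set (Sp N)} {T a b : ℝ}

/-- A shortcut: the norm of `H¹₀(Ω)` is that of `L²(Ω) × L²(Ω)^N`. -/
noncomputable scoped instance : NormedAddCommGroup (H10 Ω) := Submodule.normedAddCommGroup _

/-- A shortcut, as for the norm. -/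
noncomputable scoped instance : NormedSpace ℝ (H10 Ω) := Submodule.normedSpace _

instance completeSpace_H10 : CompleteSpace (H10 Ω) :=
  (Submodule.isClosed_topologicalClosure _).completeSpace_coe

theorem restrict_Ioc_le (ha : 0 ≤ a) (hb : b ≤ T) :
    (volume : Measure ℝ).restrict (Ioc a b) ≤ volume.restrict (Ioo 0 T) := by
  rw [← restrict_Ioo_eq_restrict_Ioc]
  exact Measure.restrict_mono_set _ (Ioo_subset_Ioo ha hb)

theorem MemL2Time.memLp_Ioc {X : Type*} [NormedAddCommGroup X] {u : ℝ → X}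
    (hu : MemL2Time T u) (ha : 0 ≤ a) (hb : b ≤ T) : MemLp u 2 (volume.restrict (Ioc a b)) :=
  MemLp.mono_measure (restrict_Ioc_le ha hb) hu

theorem ae_Ioc_of_ae {p : ℝ → Prop} (h : ∀ᵐ t ∂volume.restrict (Ioo 0 T), p t) (ha : 0 ≤ a)
    (hb : b ≤ T) : ∀ᵐ t ∂volume.restrict (Ioc a b), p t :=
  ae_mono (restrict_Ioc_le ha hb) h

theorem integral_norm_sq_le_of_lintegral {α E : Type*} [NormedAddCommGroup E] [MeasurableSpace α]
    {μ : Measure α} {f : α → E} (hf : MemLp f 2 μ) {B : ℝ}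
    (h : ∫⁻ t, ‖f t‖ₑ ^ 2 ∂μ ≤ ENNReal.ofReal B ^ 2) : ∫ t, ‖f t‖ ^ 2 ∂μ ≤ B ^ 2 := by
  have h0 : AEStronglyMeasurable (fun t => ‖f t‖ ^ 2) μ := hf.1.norm.pow 2
  rw [integral_eq_lintegral_of_nonneg_ae (Eventually.of_forall fun t => by positivity) h0]
  have h1 : ∀ t, ENNReal.ofReal (‖f t‖ ^ 2) = ‖f t‖ₑ ^ 2 := fun t => by
    rw [ENNReal.ofReal_pow (norm_nonneg _), ofReal_norm]
  simp only [h1]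
  refine ENNReal.toReal_le_of_le_ofReal (sq_nonneg B) (h.trans ?_)
  rcases le_total 0 B with hB | hB
  · rw [ENNReal.ofReal_pow hB]
  · simp [ENNReal.ofReal_of_nonpos hB]

theorem lintegral_sq_le_of_rpow_le {μ : Measure ℝ} {n : ℝ → ℝ≥0∞} {B : ℝ≥0∞}
    (h : (∫⁻ t, n t ^ 2 ∂μ) ^ (1 / 2 : ℝ) ≤ B) : ∫⁻ t, n t ^ 2 ∂μ ≤ B ^ 2 := by
  rw [← rpow_half_sq (∫⁻ t, n t ^ 2 ∂μ)]
  exact pow_le_pow_left' h 2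

theorem lintegral_le_of_stNorm0 {Q : Set (ℝ × Sp N)} {v : ℝ → L2 Ω} {B : ℝ≥0∞}
    (hB : stNorm0 Q v ≤ B) {p : ℝ → ℝ≥0∞}
    (hp : ∀ᵐ t ∂volume.restrict (Ioo a b), p t ≤ norm0 (slice Q t) (v t) ^ 2) :
    ∫⁻ t in Ioc a b, p t ≤ B ^ 2 := by
  rw [← restrict_Ioo_eq_restrict_Ioc]
  exact (lintegral_mono_ae hp).trans ((lintegral_mono' Measure.restrict_le_self le_rfl).trans
    (lintegral_sq_le_of_rpow_le hB))

theorem lintegral_le_of_stNorm1 {Q : Set (ℝ × Sp N)} {v : ℝ → L2 Ω} {B : ℝ≥0∞}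
    (hB : stNorm1 Q v ≤ B) {p : ℝ → ℝ≥0∞}
    (hp : ∀ᵐ t ∂volume.restrict (Ioo a b), p t ≤ norm1 (slice Q t) (v t) ^ 2) :
    ∫⁻ t in Ioc a b, p t ≤ B ^ 2 := by
  rw [← restrict_Ioo_eq_restrict_Ioc]
  exact (lintegral_mono_ae hp).trans ((lintegral_mono' Measure.restrict_le_self le_rfl).trans
    (lintegral_sq_le_of_rpow_le hB))

/-- The norm over a space-time cylinder in `Q` of a function is controlled by its norm on `Q`. -/
theorem integral_mulOp_le_of_stNorm0 {Q : Set (ℝ × Sp N)} (hD : MeasurableSet D) (hDΩ : D ⊆ Ω)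
    (hDQ : ∀ t ∈ Ioo a b, D ⊆ slice Q t) {v : ℝ → L2 Ω}
    (hv : MemLp v 2 (volume.restrict (Ioc a b))) {B : ℝ}
    (hB : stNorm0 Q v ≤ ENNReal.ofReal B) :
    ∫ t in Ioc a b, ‖mulOp (isWeight_indicator hD) ℝ _ (v t)‖ ^ 2 ≤ B ^ 2 := by
  refine integral_norm_sq_le_of_lintegral
    ((mulOp (isWeight_indicator hD) ℝ (volume.restrict Ω)).comp_memLp' hv)
    (lintegral_le_of_stNorm0 hB ?_)
  filter_upwards [ae_restrict_mem measurableSet_Ioo] with t ht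
  rw [Function.comp_apply, enorm_mulOp_indicator hD hDΩ]
  exact pow_le_pow_left' (norm0_mono (hDQ t ht) _) 2

/-- The gradient of a function in `H¹₀` over a space-time cylinder in `Q`. -/
theorem integral_mulOp_grad_le_of_stNorm1 {Q : Set (ℝ × Sp N)} (hDo : IsOpen D) (hDΩ : D ⊆ Ω)
    (hDQ : ∀ t ∈ Ioo a b, D ⊆ slice Q t) {u : ℝ → H10 Ω}
    (hu : MemLp u 2 (volume.restrict (Ioc a b))) {B : ℝ}
    (hB : stNorm1 Q (fun t => H10.val (u t)) ≤ ENNReal.ofReal B) :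
    ∫ t in Ioc a b, ‖mulOp (isWeight_indicator hDo.measurableSet) (Sp N) _ (H10.grad (u t))‖ ^ 2 ≤
      B ^ 2 := by
  have h1 : MemLp (fun t => H10.grad (u t)) 2 (volume.restrict (Ioc a b)) :=
    H10.grad.comp_memLp' hu
  have h2 : MemLp (fun t => mulOp (isWeight_indicator hDo.measurableSet) (Sp N) _ (H10.grad (u t)))
      2 (volume.restrict (Ioc a b)) := ContinuousLinearMap.comp_memLp' _ h1
  refine integral_norm_sq_le_of_lintegral h2 (lintegral_le_of_stNorm1 hB ?_)
  filter_upwards [ae_restrict_mem measurableSet_Ioo] with t ht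
  have h3 := le_norm1_of_mem_weakGraph hDo hDΩ (hDQ t ht) (H10.mem_weakGraph hDo hDΩ (u t))
  exact (le_add_left le_rfl).trans h3

/-- If `∂ₜu` has a square integrable spatial gradient on a space-time cylinder, then the
gradient of `u` is absolutely continuous in time there. The weak gradient of `∂ₜu` is selected
measurably as a value of a closed operator, and a closed operator commutes with the derivative. -/
theorem exists_isPrimOn_grad {Q : Set (ℝ × Sp N)} (hDo : IsOpen D) (hDΩ : D ⊆ Ω)
    (ha : 0 ≤ a) (hab : a < b) (hb : b ≤ T)
    (hDQ : ∀ t ∈ Ioo a b, D ⊆ slice Q t) {u : ℝ → H10 Ω} (hu : MemL2Time T u) {u' : ℝ → L2 Ω}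
    (hu' : IsTimeDeriv T (fun t => H10.val (u t)) u') {B : ℝ}
    (hB : stNorm1 Q u' ≤ ENNReal.ofReal B) :
    ∃ q q' : ℝ → L2Vec Ω, IsPrimOn a b q q' ∧ MemLp q' 2 (volume.restrict (Ioc a b)) ∧
      (∀ᵐ t ∂volume.restrict (Ioc a b),
        q t = mulOp (isWeight_indicator hDo.measurableSet) (Sp N) _ (H10.grad (u t))) ∧
      ∫ t in Ioc a b, ‖q' t‖ ^ 2 ≤ B ^ 2 := by
  have hsub : Ioo a b ⊆ Ioo 0 T := Ioo_subset_Ioo ha hb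
  have hm := Measure.restrict_mono_set (volume : Measure ℝ) hsub
  have hn : ∫⁻ t in Ioc a b, norm1 (slice Q t) (u' t) ^ 2 ≤ ENNReal.ofReal B ^ 2 :=
    lintegral_le_of_stNorm1 hB (Eventually.of_forall fun _ => le_rfl)
  have hm' := hu'.1.memLp_Ioc ha hb
  obtain ⟨G, hG, hGΓ, hGn⟩ := exists_aestronglyMeasurable_graph
    (isClosed_weakGraph hDo.measurableSet) (injOn_weakGraph hDo hDΩ) hm'.1
    (ne_top_of_le_ne_top (by simp) hn) (by
      rw [← restrict_Ioo_eq_restrict_Ioc]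
      filter_upwards [ae_restrict_mem measurableSet_Ioo] with t ht ht'
      exact exists_mem_weakGraph hDo hDΩ (hDQ t ht) ht')
  have hG2 : MemLp G 2 (volume.restrict (Ioc a b)) := by
    refine ⟨hG, ?_⟩
    rw [eLpNorm_lt_top_iff_lintegral_rpow_enorm_lt_top (by norm_num) (by norm_num)]
    have : ∀ t, ‖G t‖ₑ ^ (2 : ℝ≥0∞).toReal = ‖G t‖ₑ ^ 2 := fun t => by
      rw [ENNReal.toReal_ofNat, ← ENNReal.rpow_natCast, Nat.cast_ofNat]
    simp only [this]
    exact (hGn.trans hn).trans_lt (by simp)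
  set L : H10 Ω →L[ℝ] L2Vec Ω :=
    (mulOp (isWeight_indicator hDo.measurableSet) (Sp N) (volume.restrict Ω)).comp H10.grad
  rw [← restrict_Ioo_eq_restrict_Ioc] at hG2 hGΓ
  have hval : MemL2Time T fun t => H10.val (u t) := hu.clm H10.val
  have hgr : MemL2Time T fun t => L (u t) := hu.clm L
  obtain ⟨q, hq, hqae⟩ := exists_isPrimOn_of_weakDeriv hab
    (hgr.integrableOn.mono_set hsub) (hG2.integrable one_le_two) fun θ h1 h2 h3 => by
      refine weakDeriv_graph (weakGraph Ω hDo.measurableSet) (isClosed_weakGraph _)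
        (injOn_weakGraph hDo hDΩ) (hval.integrableOn.mono_set hsub)
        (hu'.1.integrableOn.mono_set hsub) (hgr.integrableOn.mono_set hsub)
        (hG2.integrable one_le_two)
        (Eventually.of_forall fun t => H10.mem_weakGraph hDo hDΩ (u t)) hGΓ h1 h2 ?_
      have h4 := hu'.2 θ h1 h2 (h3.trans hsub)
      have h5 : ∀ t, t ∉ Ioo a b → t ∉ tsupport θ := fun t ht h => ht (h3 h)
      have h6 : ∀ t, t ∉ Ioo a b → θ t • u' t = 0 := fun t ht => by
        rw [image_eq_zero_of_notMem_tsupport (h5 t ht), zero_smul]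
      have h7 : ∀ t, t ∉ Ioo a b → deriv θ t • H10.val (u t) = 0 := fun t ht => by
        rw [image_eq_zero_of_notMem_tsupport fun h => h5 t ht (tsupport_deriv_subset h),
          zero_smul]
      rw [setIntegral_eq_integral_of_forall_compl_eq_zero h6,
        setIntegral_eq_integral_of_forall_compl_eq_zero h7]
      rwa [setIntegral_eq_integral_of_forall_compl_eq_zero fun t ht => h6 t fun h => ht (hsub h),
        setIntegral_eq_integral_of_forall_compl_eq_zero fun t ht => h7 t fun h => ht (hsub h)] at h4
  rw [restrict_Ioo_eq_restrict_Ioc] at hG2 hqae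
  exact ⟨q, G, hq, hG2, hqae, integral_norm_sq_le_of_lintegral hG2 (hGn.trans hn)⟩

end SpaceTime
end HeatFEM

namespace HeatFEM

/-! ### The local estimate for cutoffs in space and time -/

section Core

variable {N : ℕ} {Ω : Set (Sp N)} {𝒯 : Geometry.SimplicialComplex ℝ (Sp N)} {K h δ T : ℝ} {r : ℕ}

/-- `φ_h` is a semidiscrete approximation of `φ`: the error satisfies the Galerkin orthogonality
relation. -/
structure IsGalerkinPair (T : ℝ) (φ : ℝ → H10 Ω) (φh : ℝ → Sh Ω 𝒯 r) : Prop where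
  memL2 : MemL2Time T φ
  memH1 : MemH1Time T fun t => H10.val (φ t)
  memH1_h : MemH1Time T φh
  galerkin : ∀ᵐ t ∂volume.restrict (Ioo 0 T), ∀ χ : Sh Ω 𝒯 r,
    inner ℝ (timeDeriv T (fun s => H10.val (φ s - (φh s : H10 Ω))) t) (H10.val (χ : H10 Ω)) +
      inner ℝ (H10.grad (φ t - (φh t : H10 Ω))) (H10.grad (χ : H10 Ω)) = 0

theorem lintegral_enorm_sq_le_ofReal {E : Type*} [NormedAddCommGroup E] {t₀ s t₁ : ℝ} {f : ℝ → E}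
    (hf : MemLp f 2 (volume.restrict (Ioc t₀ t₁))) (hs : t₀ ≤ s) {a : ℝ → ℝ}
    (ha : AEStronglyMeasurable a (volume.restrict (Ioc t₀ t₁))) (ha0 : ∀ t, 0 ≤ a t)
    (ha1 : ∀ t, a t ≤ 1) (has : ∀ t ∈ Ioc s t₁, a t = 1) :
    ∫⁻ t in Ioc s t₁, ‖f t‖ₑ ^ 2 ≤ ENNReal.ofReal (∫ t in Ioc t₀ t₁, a t * ‖f t‖ ^ 2) := by
  have h1 : Integrable (fun t => a t * ‖f t‖ ^ 2) (volume.restrict (Ioc t₀ t₁)) :=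
    ((memLp_two_iff_integrable_sq_norm hf.1).1 hf).bdd_mul (c := 1) ha
      (Eventually.of_forall fun t => by
        rw [Real.norm_eq_abs, abs_of_nonneg (ha0 t)]
        exact ha1 t)
  rw [ofReal_integral_eq_lintegral_ofReal h1
    (Eventually.of_forall fun t => mul_nonneg (ha0 t) (by positivity))]
  have h2 : ∫⁻ t in Ioc s t₁, ‖f t‖ₑ ^ 2 =
      ∫⁻ t in Ioc s t₁, ENNReal.ofReal (a t * ‖f t‖ ^ 2) :=
    setLIntegral_congr_fun measurableSet_Ioc fun t ht => by
      rw [has t ht, one_mul, ENNReal.ofReal_pow (norm_nonneg _), ofReal_norm]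
  rw [h2]
  exact lintegral_mono_set (Ioc_subset_Ioc_left hs)

/-- The Clément interpolant of a function that vanishes near a set vanishes there with its
gradient. -/
theorem mulOp_Ih_eq_zero (hT : IsQuasiUniformTriangulation Ω 𝒯 K h) (hΩ : IsPolyhedralDomain Ω)
    {D : Set (Sp N)} (hDo : IsOpen D) {u : Sh Ω 𝒯 r} (hu : ∀ x ∈ D, Sh.rep u x = 0) :
    mulOp (isWeight_indicator hDo.measurableSet) ℝ _ (Sh.valL u) = 0 ∧
      mulOp (isWeight_indicator hDo.measurableSet) (Sp N) _ (Sh.gradL u) = 0 := by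
  constructor
  · refine Lp.ext ?_
    filter_upwards [coeFn_mulOp (isWeight_indicator hDo.measurableSet) (Sh.valL u),
      Sh.val_ae_eq_rep u, Lp.coeFn_zero ℝ 2 (volume.restrict Ω)] with x h1 h2 h3
    have h2' : Sh.valL u x = _ := h2
    rw [h1, h2', h3, Pi.zero_apply]
    by_cases hx : x ∈ D
    · rw [hu x hx, smul_zero]
    · rw [indicator_of_notMem hx, zero_smul]
  · refine Lp.ext ?_
    filter_upwards [coeFn_mulOp (isWeight_indicator hDo.measurableSet) (Sh.gradL u),
      Sh.grad_ae_eq hT hΩ u, Lp.coeFn_zero (Sp N) 2 (volume.restrict Ω)] with x h1 h2 h3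
    have h2' : Sh.gradL u x = _ := h2
    rw [h1, h2', h3, Pi.zero_apply]
    by_cases hx : x ∈ D
    · have h4 : Sh.rep u =ᶠ[𝓝 x] fun _ => 0 :=
        Filter.eventually_of_mem (hDo.mem_nhds hx) hu
      have h5 : gradient (Sh.rep u) x = 0 := by
        rw [gradient, h4.fderiv_eq, fderiv_const_apply, map_zero]
      rw [h5, smul_zero]
    · rw [indicator_of_notMem hx, zero_smul]

/-- The initial value of the finite element function `I_h φ - φ_h`, when `φ(0)` vanishes near the
set under consideration. -/
theorem norm_initial_le (hT : IsQuasiUniformTriangulation Ω 𝒯 K h) (hΩ : IsPolyhedralDomain Ω)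
    {D S : Set (Sp N)} (hDo : IsOpen D) (hDΩ : D ⊆ Ω) (hDS : D ⊆ S) {u w : Sh Ω 𝒯 r}
    (hu : ∀ x ∈ D, Sh.rep u x = 0) {β₁ β₂ : ℝ} (h1 : 0 ≤ β₁) (h2 : 0 ≤ β₂)
    (hβ₁ : norm1 S (H10.val (w : H10 Ω)) ≤ ENNReal.ofReal β₁)
    (hβ₂ : norm0 S (H10.val (w : H10 Ω)) ≤ ENNReal.ofReal β₂) :
    ‖mulOp (isWeight_indicator hDo.measurableSet) (Sp N) _ (Sh.gradL (u - w))‖ ≤ β₁ ∧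
      ‖mulOp (isWeight_indicator hDo.measurableSet) ℝ _ (Sh.valL (u - w))‖ ≤ β₂ := by
  obtain ⟨e1, e2⟩ := mulOp_Ih_eq_zero hT hΩ hDo hu
  rw [map_sub, map_sub, map_sub, map_sub, e1, e2, zero_sub, zero_sub, norm_neg, norm_neg]
  constructor
  · have h3 := le_norm1_of_mem_weakGraph hDo hDΩ hDS (H10.mem_weakGraph hDo hDΩ (w : H10 Ω))
    have h4 := (le_add_left le_rfl).trans h3
    have h5 := ((ENNReal.pow_right_strictMono two_ne_zero).le_iff_le.1 h4).trans hβ₁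
    rw [← ofReal_norm] at h5
    exact (ENNReal.ofReal_le_ofReal_iff h1).1 h5
  · have h5 : ‖mulOp (isWeight_indicator hDo.measurableSet) ℝ _ (Sh.valL w)‖ₑ ≤
        ENNReal.ofReal β₂ := by
      rw [enorm_mulOp_indicator hDo.measurableSet hDΩ]
      exact (norm0_mono hDS _).trans hβ₂
    rw [← ofReal_norm] at h5
    exact (ENNReal.ofReal_le_ofReal_iff h2).1 h5

theorem eLpNorm_sublevel_le {E : Type*} [NormedAddCommGroup E] [InnerProductSpace ℝ E]
    (hΩ : IsOpen Ω) {ρ : Sp N → ℝ} (hρ : ∀ x y, |ρ x - ρ y| ≤ dist x y) (hδ : 0 < δ)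
    (f : Lp E 2 (volume.restrict Ω)) {k : ℝ} (hk : 1 ≤ k) :
    eLpNorm f 2 (volume.restrict (Ω ∩ {x | ρ x ≤ 0})) ≤ ‖mulOp (isWeight_ramp hρ δ k) E _ f‖ₑ := by
  have hm : MeasurableSet (Ω ∩ {x | ρ x ≤ 0}) := hΩ.measurableSet.inter
    (isClosed_le (continuous_of_abs_sub_le hρ) continuous_const).measurableSet
  rw [← enorm_mulOp_indicator hm inter_subset_left, ← ofReal_norm, ← ofReal_norm]
  refine ENNReal.ofReal_le_ofReal (norm_mulOp_le_norm_mulOp _ _ (fun x => ?_) f)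
  by_cases hx : x ∈ Ω ∩ {x | ρ x ≤ 0}
  · rw [indicator_of_mem hx, ramp_eq_one hδ]
    exact hx.2.trans (mul_nonneg (by linarith) hδ.le)
  · rw [indicator_of_notMem hx, abs_zero]
    exact abs_nonneg _

end Core
end HeatFEM

namespace HeatFEM

/-! ### The discrete part of the error -/

section DiscretePart

variable {V X H : Type*} [NormedAddCommGroup V] [NormedSpace ℝ V] [CompleteSpace V]
  [NormedAddCommGroup X] [NormedSpace ℝ X]
  [NormedAddCommGroup H] [NormedSpace ℝ H] [CompleteSpace H]
  {val : V →L[ℝ] H} (ι : X →L[ℝ] V) (I : H →L[ℝ] X) {T : ℝ} {φ : ℝ → V} {φh : ℝ → X}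

theorem isTimeDeriv_err [CompleteSpace X] (hφ : MemL2Time T φ)
    (hφ' : MemH1Time T fun t => val (φ t))
    (hφh : MemH1Time T φh) : IsTimeDeriv T (fun t => val (φ t - ι (φh t))) fun t =>
      timeDeriv T (fun t => val (φ t)) t - val (ι (timeDeriv T φh t)) := by
  have h1 := hφ'.isTimeDeriv.sub (hφ.clm val) (hφh.1.clm (val.comp ι))
    (IsTimeDeriv.clm (val.comp ι) hφh.1 hφh.isTimeDeriv)
  simp only [map_sub]
  exact h1

theorem isTimeDeriv_interpErr (hφ : MemL2Time T φ) (hφ' : MemH1Time T fun t => val (φ t)) :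
    IsTimeDeriv T (fun t => val (ι (I (val (φ t))) - φ t)) fun t =>
      val (ι (I (timeDeriv T (fun t => val (φ t)) t))) - timeDeriv T (fun t => val (φ t)) t := by
  have hL := hφ.clm val
  have h1 := IsTimeDeriv.sub (hL.clm ((val.comp ι).comp I)) hL
    (IsTimeDeriv.clm ((val.comp ι).comp I) hL hφ'.isTimeDeriv) hφ'.isTimeDeriv
  simp only [map_sub]
  exact h1

/-- The discrete function `y = I φ - φ_h`, represented as a primitive of its derivative. It is the
sum of the error `φ - φ_h` and the interpolation error `I φ - φ`. -/
theorem exists_discretePart [CompleteSpace X] (hT : 0 < T) (hφ : MemL2Time T φ)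
    (hφ' : MemH1Time T fun t => val (φ t)) (hφh : MemH1Time T φh) :
    ∃ y y' : ℝ → X, IsPrimOn 0 T y y' ∧ MemL2Time T y' ∧
      y 0 = I (initialValue T fun t => val (φ t)) - initialValue T φh ∧
      (∀ᵐ t ∂volume.restrict (Ioo 0 T), ι (y t) - (ι (I (val (φ t))) - φ t) = φ t - ι (φh t)) ∧
      ∀ᵐ t ∂volume.restrict (Ioo 0 T),
        val (ι (y' t)) - timeDeriv T (fun t => val (ι (I (val (φ t))) - φ t)) t =
          timeDeriv T (fun t => val (φ t - ι (φh t))) t := by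
  have hL := hφ.clm val
  obtain ⟨f, hf, hfae⟩ := hφ'.isTimeDeriv.exists_isPrimOn hT hL
  obtain ⟨g, hg, hgae⟩ := hφh.isTimeDeriv.exists_isPrimOn hT hφh.1
  refine ⟨fun t => I (f t) - g t,
    fun t => I (timeDeriv T (fun t => val (φ t)) t) - timeDeriv T φh t,
    (hf.clm I).sub hg, ?_, ?_, ?_, ?_⟩
  · exact MemLp.sub (hφ'.isTimeDeriv.1.clm I) hφh.isTimeDeriv.1
  · rw [initialValue_eq hT hf.continuousOn hfae, initialValue_eq hT hg.continuousOn hgae]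
  · filter_upwards [hfae, hgae] with t h1 h2
    rw [h1, h2, map_sub]
    abel
  · filter_upwards [(isTimeDeriv_interpErr ι I hφ hφ').timeDeriv_ae,
      (isTimeDeriv_err ι hφ hφ' hφh).timeDeriv_ae] with t h3 h4
    rw [h3, h4, map_sub, map_sub]
    abel

end DiscretePart

section EnergyBound

variable {X H G : Type*} [NormedAddCommGroup X] [NormedSpace ℝ X] [CompleteSpace X]
  [NormedAddCommGroup H] [InnerProductSpace ℝ H] [CompleteSpace H]
  [NormedAddCommGroup G] [InnerProductSpace ℝ G] [CompleteSpace G]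
  {v : X →L[ℝ] H} {g : X →L[ℝ] G} {c h δ t₀ t₁ : ℝ}

/-- The energy estimate for the error `e` with time derivative `e'` and gradient `w`. Here `s` is
the interpolation error with time derivative `s'` and gradient `z`. The numbers `α` and `β` bound
the norms of the error and of the data. -/
theorem energy_bound {M₁ M₂ : X →L[ℝ] X} {m₁ m₂ P : H →L[ℝ] H} {n₁ n₂ R : G →L[ℝ] G}
    (hM₁ : IsDiscreteCutoff v g M₁ m₁ m₂ n₁ n₂ c h δ)
    (hM₂ : IsDiscreteCutoff v g M₂ m₂ P n₂ R c h δ)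
    (hc : 0 ≤ c) (hδ : 0 < δ) (h0 : 0 ≤ h)
    (hh : h ≤ δ) (ht : t₀ < t₁) (hl : t₁ - t₀ ≤ c * δ ^ 2) (hl' : (t₁ - t₀)⁻¹ ≤ c * δ⁻¹ ^ 2)
    {y y' : ℝ → X} (hy : IsPrimOn t₀ t₁ y y')
    (hy' : MemLp y' 2 (volume.restrict (Ioc t₀ t₁)))
    {s s' : ℝ → H} (hs : MemLp s 2 (volume.restrict (Ioc t₀ t₁)))
    (hs' : MemLp s' 2 (volume.restrict (Ioc t₀ t₁)))
    {z : ℝ → G} (hz : MemLp z 2 (volume.restrict (Ioc t₀ t₁)))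
    {e e' : ℝ → H} {w : ℝ → G} (he : ∀ᵐ t ∂(volume.restrict (Ioc t₀ t₁)), v (y t) - s t = e t)
    (he' : ∀ᵐ t ∂(volume.restrict (Ioc t₀ t₁)), v (y' t) - s' t = e' t)
    (hw : ∀ᵐ t ∂(volume.restrict (Ioc t₀ t₁)), g (y t) - z t = w t)
    {q q' : ℝ → G} (hq : IsPrimOn t₀ t₁ q q') (hq' : MemLp q' 2 (volume.restrict (Ioc t₀ t₁)))
    (hqz : ∀ᵐ t ∂(volume.restrict (Ioc t₀ t₁)), q t = R (z t))
    {a₁ a₁' a₂ a₂' : ℝ → ℝ} (ha : IsPrimOn t₀ t₁ a₁ a₁') (hb : IsPrimOn t₀ t₁ a₂ a₂')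
    (ha0 : ∀ t, 0 ≤ a₁ t) (hab : ∀ t, a₁ t ≤ a₂ t) (hb1 : ∀ t, a₂ t ≤ 1)
    (ha' : ∀ t, |a₁' t| ≤ c * δ⁻¹ ^ 2 * a₂ t) (hb' : ∀ t, |a₂' t| ≤ c * δ⁻¹ ^ 2)
    (hPM : ∀ χ ∈ range M₁ ∪ range M₂, P (v χ) = v χ ∧ R (g χ) = g χ)
    (heq : ∀ᵐ t ∂(volume.restrict (Ioc t₀ t₁)), ∀ χ,
      inner ℝ (e' t) (v χ) + inner ℝ (w t) (g χ) = 0)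
    {ε : ℝ} (hε : 0 < ε) (hε1 : ε ≤ 1) {α₁ α₂ β₁ β₂ β₃ β₄ β₅ β₆ β₇ : ℝ}
    (hα₁0 : 0 ≤ α₁) (hα₂0 : 0 ≤ α₂) (hβ₁0 : 0 ≤ β₁) (hβ₂0 : 0 ≤ β₂) (hβ₃0 : 0 ≤ β₃) (hβ₄0 : 0 ≤ β₄)
    (hβ₅0 : 0 ≤ β₅) (hβ₆0 : 0 ≤ β₆) (hβ₇0 : 0 ≤ β₇)
    (hα₁ : ∫ t in Ioc t₀ t₁, ‖P (e' t)‖ ^ 2 ≤ α₁ ^ 2)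
    (hα₂ : ∫ t in Ioc t₀ t₁, ‖R (w t)‖ ^ 2 ≤ α₂ ^ 2)
    (hβ₁₂ : a₂ t₀ ≠ 0 → ‖R (g (y t₀))‖ ≤ β₁ ∧ ‖P (v (y t₀))‖ ≤ β₂)
    (hβ₃ : ∫ t in Ioc t₀ t₁, ‖P (e t)‖ ^ 2 ≤ β₃ ^ 2)
    (hβ₄ : ∫ t in Ioc t₀ t₁, ‖P (s t)‖ ^ 2 ≤ β₄ ^ 2)
    (hβ₅ : ∫ t in Ioc t₀ t₁, ‖P (s' t)‖ ^ 2 ≤ β₅ ^ 2)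
    (hβ₆ : ∫ t in Ioc t₀ t₁, ‖R (z t)‖ ^ 2 ≤ β₆ ^ 2)
    (hβ₇ : ∫ t in Ioc t₀ t₁, ‖q' t‖ ^ 2 ≤ β₇ ^ 2) {B : ℝ}
    (hB : B = 1200 * (1 + c) ^ 5 * (√(h / δ) + ε) * (α₁ + δ⁻¹ * α₂) +
      1200 * (1 + c) ^ 5 * ε⁻¹ ^ 3 * (β₁ + δ⁻¹ * β₂ +
        δ⁻¹ ^ 2 * β₃ + δ⁻¹ ^ 2 * β₄ + β₅ + δ⁻¹ * β₆ + δ * β₇)) :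
    ∫ t in Ioc t₀ t₁, a₁ t * ‖m₁ (e' t)‖ ^ 2 ≤ B ^ 2 ∧
      ∫ t in Ioc t₀ t₁, a₂ t * ‖n₂ (w t)‖ ^ 2 ≤ (δ * B) ^ 2 := by
  have heq' : ∀ᵐ t ∂(volume.restrict (Ioc t₀ t₁)), ∀ χ,
      inner ℝ (v (y' t) - s' t) (v χ) + inner ℝ (g (y t) - z t) (g χ) = 0 := by
    filter_upwards [heq, he', hw] with t h1 h2 h3 χ
    rw [h2, h3]
    exact h1 χ
  have key := energy_error hM₁ hM₂ hc hδ h0 hh ht hl hl' hy hy' hs hs' hz hq hq' hqz ha hb ha0 hab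
    hb1 ha' hb' (fun χ hχ => (hPM χ hχ).1) (fun χ hχ => (hPM χ hχ).2) heq' hε hε1
  have c1 : ∫ t in Ioc t₀ t₁, ‖P (v (y' t) - s' t)‖ ^ 2 = ∫ t in Ioc t₀ t₁, ‖P (e' t)‖ ^ 2 :=
    integral_congr_ae (he'.mono fun t h1 => by simp only [h1])
  have c2 : ∫ t in Ioc t₀ t₁, ‖R (g (y t) - z t)‖ ^ 2 = ∫ t in Ioc t₀ t₁, ‖R (w t)‖ ^ 2 :=
    integral_congr_ae (hw.mono fun t h1 => by simp only [h1])
  have c3 : ∫ t in Ioc t₀ t₁, ‖P (v (y t) - s t)‖ ^ 2 = ∫ t in Ioc t₀ t₁, ‖P (e t)‖ ^ 2 :=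
    integral_congr_ae (he.mono fun t h1 => by simp only [h1])
  have c4 : ∫ t in Ioc t₀ t₁, a₁ t * ‖m₁ (v (y' t) - s' t)‖ ^ 2 =
      ∫ t in Ioc t₀ t₁, a₁ t * ‖m₁ (e' t)‖ ^ 2 :=
    integral_congr_ae (he'.mono fun t h1 => by simp only [h1])
  have c5 : ∫ t in Ioc t₀ t₁, a₂ t * ‖n₂ (g (y t) - z t)‖ ^ 2 =
      ∫ t in Ioc t₀ t₁, a₂ t * ‖n₂ (w t)‖ ^ 2 :=
    integral_congr_ae (hw.mono fun t h1 => by simp only [h1])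
  rw [c1, c2, c3, c4, c5] at key
  have x0 : a₂ t₀ * (‖R (g (y t₀))‖ ^ 2 + δ⁻¹ ^ 2 * ‖P (v (y t₀))‖ ^ 2) ≤
      β₁ ^ 2 + (δ⁻¹ * β₂) ^ 2 := by
    by_cases h1 : a₂ t₀ = 0
    · rw [h1, zero_mul]
      positivity
    · obtain ⟨h2, h3⟩ := hβ₁₂ h1
      refine (mul_le_of_le_one_left (by positivity) (hb1 t₀)).trans ?_
      rw [mul_pow]
      gcongr
  have hk : 1 ≤ 1200 * (1 + c) ^ 5 := by
    have : 1 ≤ (1 + c) ^ 5 := one_le_pow₀ (by linarith)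
    linarith
  have hδ' : 0 < δ⁻¹ := inv_pos.2 hδ
  have hJ1 : 0 ≤ ∫ t in Ioc t₀ t₁, a₁ t * ‖m₁ (e' t)‖ ^ 2 :=
    integral_nonneg fun t => mul_nonneg (ha0 t) (by positivity)
  have hJ2 : 0 ≤ ∫ t in Ioc t₀ t₁, a₂ t * ‖n₂ (w t)‖ ^ 2 :=
    integral_nonneg fun t => mul_nonneg ((ha0 t).trans (hab t)) (by positivity)
  have hBsq := le_sq_of_energy (L := (∫ t in Ioc t₀ t₁, a₁ t * ‖m₁ (e' t)‖ ^ 2) +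
      δ⁻¹ ^ 2 * (∫ t in Ioc t₀ t₁, a₂ t * ‖n₂ (w t)‖ ^ 2)) hk (x := h / δ) (by positivity) hε
    (α₁ := α₁) (α₂ := δ⁻¹ * α₂) (β₁ := β₁) (β₂ := δ⁻¹ * β₂) (β₃ := δ⁻¹ ^ 2 * β₃)
    (β₄ := δ⁻¹ ^ 2 * β₄) (β₅ := β₅) (β₆ := δ⁻¹ * β₆) (β₇ := δ * β₇)
    hα₁0 (by positivity) hβ₁0 (by positivity) (by positivity) (by positivity) hβ₅0 (by positivity)
    (by positivity) (key.trans (by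
      have e1 : (δ⁻¹ * α₂) ^ 2 = δ⁻¹ ^ 2 * α₂ ^ 2 := by ring
      have e2 : ∀ b : ℝ, (δ⁻¹ ^ 2 * b) ^ 2 = δ⁻¹ ^ 4 * b ^ 2 := fun b => by ring
      have e3 : (δ⁻¹ * β₆) ^ 2 = δ⁻¹ ^ 2 * β₆ ^ 2 := by ring
      have e4 : (δ * β₇) ^ 2 = δ ^ 2 * β₇ ^ 2 := by ring
      rw [e1, e2, e2, e3, e4]
      gcongr))
  rw [← hB] at hBsq
  constructor
  · have : 0 ≤ δ⁻¹ ^ 2 * ∫ t in Ioc t₀ t₁, a₂ t * ‖n₂ (w t)‖ ^ 2 := by positivity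
    linarith
  · have h1 : δ⁻¹ ^ 2 * (∫ t in Ioc t₀ t₁, a₂ t * ‖n₂ (w t)‖ ^ 2) ≤ B ^ 2 := by linarith
    have h2 := mul_le_mul_of_nonneg_left h1 (sq_nonneg δ)
    rw [← mul_assoc, ← mul_pow, mul_inv_cancel₀ hδ.ne', one_pow, one_mul, ← mul_pow] at h2
    exact h2

end EnergyBound
end HeatFEM

namespace HeatFEM

/-! ### The estimate on sublevel sets -/

section SublevelEstimate

set_option maxHeartbeats 1600000 in
/-- The estimate on a sublevel set of a `1`-Lipschitz function `ρ`, with cutoff functions `a₁`, `a₂`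
in time. The real numbers `α` and `β` bound the norms that occur in the estimate. -/
theorem exists_sublevel_estimate (N : ℕ) {r : ℕ} (hr : 1 ≤ r) {K : ℝ} (hK : 0 < K) :
    ∃ C, 1 ≤ C ∧ ∀ (Ω : Set (Sp N)) (𝒯 : Geometry.SimplicialComplex ℝ (Sp N)) (h T : ℝ),
      IsPolyhedralDomain Ω → IsQuasiUniformTriangulation Ω 𝒯 K h → 0 < h → 0 < T →
      ∀ (φ : ℝ → H10 Ω) (φh : ℝ → Sh Ω 𝒯 r), IsGalerkinPair T φ φh →
      ∀ (e η : ℝ → L2 Ω), e = (fun t => H10.val (φ t - (φh t : H10 Ω))) →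
        η = (fun t => Ih Ω 𝒯 r (H10.val (φ t)) - H10.val (φ t)) →
      ∀ (ρ : Sp N → ℝ), (∀ x y, |ρ x - ρ y| ≤ dist x y) → ∀ δ, 0 < δ → K * h ≤ δ → h ≤ δ →
      ∀ t₀ s t₁, 0 ≤ t₀ → t₀ ≤ s → t₀ < t₁ → t₁ ≤ T → t₁ - t₀ ≤ 256 * δ ^ 2 →
        (t₁ - t₀)⁻¹ ≤ 256 * δ⁻¹ ^ 2 →
      ∀ a₁ a₁' a₂ a₂' : ℝ → ℝ, IsPrimOn t₀ t₁ a₁ a₁' → IsPrimOn t₀ t₁ a₂ a₂' → (∀ t, 0 ≤ a₁ t) →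
        (∀ t, a₁ t ≤ a₂ t) → (∀ t, a₂ t ≤ 1) → (∀ t, |a₁' t| ≤ 256 * δ⁻¹ ^ 2 * a₂ t) →
        (∀ t, |a₂' t| ≤ 256 * δ⁻¹ ^ 2) → (∀ t ∈ Ioc s t₁, a₁ t = 1) →
      ∀ (Q : Set (ℝ × Sp N)) (S : Set (Sp N)),
        (∀ t ∈ Ioo t₀ t₁, Ω ∩ {x | ρ x < 4 * δ} ⊆ slice Q t) →
        (a₂ t₀ = 0 ∨ t₀ = 0 ∧ Ω ∩ {x | ρ x < 4 * δ} ⊆ S ∧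
          ∀ᵐ x ∂volume.restrict (Ω ∩ {x | ρ x < 6 * δ}),
            initialValue T (fun t => H10.val (φ t)) x = 0) →
      ∀ ε, 0 < ε → ε ≤ 1 → ∀ α₁ α₂ β₁ β₂ β₃ β₄ β₅ β₆ β₇ : ℝ, 0 ≤ α₁ → 0 ≤ α₂ → 0 ≤ β₁ → 0 ≤ β₂ →
        0 ≤ β₃ → 0 ≤ β₄ → 0 ≤ β₅ → 0 ≤ β₆ → 0 ≤ β₇ →
      stNorm0 Q (timeDeriv T e) ≤ ENNReal.ofReal α₁ →
      stNorm1 Q e ≤ ENNReal.ofReal α₂ →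
      norm1 S (H10.val ((initialValue T φh : Sh Ω 𝒯 r) : H10 Ω)) ≤ ENNReal.ofReal β₁ →
      norm0 S (H10.val ((initialValue T φh : Sh Ω 𝒯 r) : H10 Ω)) ≤ ENNReal.ofReal β₂ →
      stNorm0 Q e ≤ ENNReal.ofReal β₃ →
      stNorm0 Q η ≤ ENNReal.ofReal β₄ →
      stNorm0 Q (timeDeriv T η) ≤ ENNReal.ofReal β₅ →
      stNorm1 Q η ≤ ENNReal.ofReal β₆ →
      stNorm1 Q (timeDeriv T η) ≤ ENNReal.ofReal β₇ →
      ∀ B, B = C * (√(h / δ) + ε) * (α₁ + δ⁻¹ * α₂) + C * ε⁻¹ ^ 3 * (β₁ + δ⁻¹ * β₂ +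
        δ⁻¹ ^ 2 * β₃ + δ⁻¹ ^ 2 * β₄ + β₅ + δ⁻¹ * β₆ + δ * β₇) →
      ∫⁻ t in Ioc s t₁, norm0 (Ω ∩ {x | ρ x ≤ 0}) (timeDeriv T e t : L2 Ω) ^ 2 ≤
        ENNReal.ofReal (B ^ 2) ∧
      ∫⁻ t in Ioc s t₁, eLpNorm (H10.grad (φ t - (φh t : H10 Ω))) 2
        (volume.restrict (Ω ∩ {x | ρ x ≤ 0})) ^ 2 ≤ ENNReal.ofReal ((δ * B) ^ 2) := by
  obtain ⟨C₀, hC₀, hcut⟩ := exists_nested_cutoffs (r := r) N hr hK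
  obtain ⟨c, hcC, hc256⟩ : ∃ c, C₀ ≤ c ∧ 256 ≤ c := ⟨max C₀ 256, le_max_left _ _, le_max_right _ _⟩
  have hc0 : 0 ≤ c := hC₀.trans hcC
  have hC1 : 1 ≤ 1200 * (1 + c) ^ 5 := by
    have : 1 ≤ (1 + c) ^ 5 := one_le_pow₀ (by linarith)
    linarith
  refine ⟨1200 * (1 + c) ^ 5, hC1, ?_⟩
  intro Ω 𝒯 h T hΩ hT hh hT0 φ φh hφ e η he hη ρ hρ δ hδ hKδ hhδ t₀ s t₁ ht0 hts ht htT hl hl'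
    a₁ a₁' a₂ a₂' ha hb ha0 hab hb1 ha' hb' has Q S hDQ hinit ε hε hε1 α₁ α₂ β₁ β₂ β₃ β₄ β₅ β₆ β₇
    hα₁0 hα₂0 hβ₁0 hβ₂0 hβ₃0 hβ₄0 hβ₅0 hβ₆0 hβ₇0 hα₁ hα₂ hβ₁ hβ₂ hβ₃ hβ₄ hβ₅ hβ₆ hβ₇ B hB
  obtain ⟨M₁, M₂, hM₁, hM₂, hfix⟩ := hcut Ω 𝒯 h hΩ hT hh ρ hρ δ hδ hKδ
  obtain ⟨I, hI, hIloc⟩ := exists_Ih_clm (r := r) hT hΩ hr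
  have hfd := finiteDimensional_Sh (r := r) hT hΩ hr
  have hcs : CompleteSpace (Sh Ω 𝒯 r) := FiniteDimensional.complete ℝ _
  have hDo := isOpen_sublevel hρ hΩ.isOpen (4 * δ)
  have hDΩ : Ω ∩ {x | ρ x < 4 * δ} ⊆ Ω := inter_subset_left
  obtain ⟨hφ1, hφ2, hφ3, hφ4⟩ := hφ
  -- the error, the interpolation error and the discrete part as functions with values in `H¹₀`
  obtain ⟨w, hw⟩ : ∃ w : ℝ → H10 Ω, w = fun t => φ t - (Sh Ω 𝒯 r).subtypeL (φh t) := ⟨_, rfl⟩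
  obtain ⟨u, hu⟩ : ∃ u : ℝ → H10 Ω,
    u = fun t => (Sh Ω 𝒯 r).subtypeL (I (H10.val (φ t))) - φ t := ⟨_, rfl⟩
  have hed := isTimeDeriv_err (val := H10.val) (Sh Ω 𝒯 r).subtypeL hφ1 hφ2 hφ3
  have hηd := isTimeDeriv_interpErr (val := H10.val) (Sh Ω 𝒯 r).subtypeL I hφ1 hφ2
  obtain ⟨y, y', hy, hy', hy0, hyw, hyw'⟩ :=
    exists_discretePart (val := H10.val) (Sh Ω 𝒯 r).subtypeL I hT0 hφ1 hφ2 hφ3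
  have hw2 : MemL2Time T w := by
    rw [hw]
    exact MemLp.sub hφ1 (hφ3.1.clm (Sh Ω 𝒯 r).subtypeL)
  have hu2 : MemL2Time T u := by
    rw [hu]
    exact MemLp.sub ((hφ1.clm H10.val).clm ((Sh Ω 𝒯 r).subtypeL.comp I)) hφ1
  have hew : e = fun t => H10.val (w t) := by rw [he, hw]; rfl
  have hηu : η = fun t => H10.val (u t) := by
    rw [hη, hu]
    funext t
    rw [map_sub, ← hI]
    rfl
  have hwt : ∀ t, φ t - (φh t : H10 Ω) = w t := fun t => by rw [hw]; rfl
  have he2 : MemL2Time T e := by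
    rw [hew]
    exact hw2.clm H10.val
  have hη2 : MemL2Time T η := by
    rw [hηu]
    exact hu2.clm H10.val
  have hed' : IsTimeDeriv T e (timeDeriv T e) := MemH1Time.isTimeDeriv ⟨he2, _, by
    rw [he]
    exact hed⟩
  have hηd' : IsTimeDeriv T η (timeDeriv T η) := MemH1Time.isTimeDeriv ⟨hη2, _, by
    rw [hηu, hu]
    exact hηd⟩
  have hηd'' : IsTimeDeriv T (fun t => H10.val (u t)) (timeDeriv T η) := by
    rw [← hηu]
    exact hηd'
  obtain ⟨q, q', hq, hq2, hqz, hqB⟩ :=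
    exists_isPrimOn_grad hDo hDΩ ht0 ht htT hDQ hu2 hηd'' hβ₇
  have hgu2 : MemL2Time T fun t => H10.grad (u t) := hu2.clm H10.grad
  have hgw2 : MemL2Time T fun t => H10.grad (w t) := hw2.clm H10.grad
  have hy1 : ∀ᵐ t ∂volume.restrict (Ioc t₀ t₁), Sh.valL (y t) - η t = e t := by
    filter_upwards [ae_Ioc_of_ae hyw ht0 htT] with t h1
    have h2 := congrArg H10.val h1
    rw [map_sub] at h2
    rw [hηu, hu, he]
    exact h2
  have hy2 : ∀ᵐ t ∂volume.restrict (Ioc t₀ t₁),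
      Sh.gradL (y t) - H10.grad (u t) = H10.grad (w t) := by
    filter_upwards [ae_Ioc_of_ae hyw ht0 htT] with t h1
    have h2 := congrArg H10.grad h1
    rw [map_sub] at h2
    rw [hu, hw]
    exact h2
  have hy3 : ∀ᵐ t ∂volume.restrict (Ioc t₀ t₁),
      Sh.valL (y' t) - timeDeriv T η t = timeDeriv T e t := by
    filter_upwards [ae_Ioc_of_ae hyw' ht0 htT] with t h1
    rw [hηu, hu, he]
    exact h1
  have heq : ∀ᵐ t ∂volume.restrict (Ioc t₀ t₁), ∀ χ : Sh Ω 𝒯 r,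
      inner ℝ (timeDeriv T e t) (Sh.valL χ) + inner ℝ (H10.grad (w t)) (Sh.gradL χ) = 0 := by
    filter_upwards [ae_Ioc_of_ae hφ4 ht0 htT] with t h3 χ
    rw [← hwt, he]
    exact h3 χ
  have hin : a₂ t₀ ≠ 0 →
      ‖mulOp (isWeight_indicator hDo.measurableSet) (Sp N) _ (Sh.gradL (y t₀))‖ ≤ β₁ ∧
      ‖mulOp (isWeight_indicator hDo.measurableSet) ℝ _ (Sh.valL (y t₀))‖ ≤ β₂ := by
    intro h0
    obtain ⟨rfl, hDS, h1⟩ := hinit.resolve_left h0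
    rw [hy0]
    refine norm_initial_le hT hΩ hDo hDΩ hDS (w := initialValue T φh)
      (u := I (initialValue T fun t => H10.val (φ t))) (fun x hx => hIloc _ x ?_)
      hβ₁0 hβ₂0 hβ₁ hβ₂
    have hsub : Ω ∩ Metric.closedBall x (2 * (K * h)) ⊆ Ω ∩ {x | ρ x < 6 * δ} := by
      intro z hz
      have h3 := (abs_le.1 (hρ z x)).2
      have h4 := Metric.mem_closedBall.1 hz.2
      have h5 : ρ x < 4 * δ := hx.2
      exact ⟨hz.1, show ρ z < 6 * δ by linarith⟩
    exact ae_restrict_of_ae_restrict_of_subset hsub h1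
  obtain ⟨b1, b2⟩ := energy_bound (X := Sh Ω 𝒯 r) (hM₁.mono hcC hh.le hδ) (hM₂.mono hcC hh.le hδ)
    hc0 hδ hh.le hhδ ht (hl.trans (by gcongr)) (hl'.trans (by gcongr)) (hy.mono ht0 htT)
    (hy'.memLp_Ioc ht0 htT) (hη2.memLp_Ioc ht0 htT) (hηd'.1.memLp_Ioc ht0 htT)
    (hgu2.memLp_Ioc ht0 htT) hy1 hy3 hy2 hq hq2 hqz ha hb ha0 hab hb1
    (fun t => (ha' t).trans
      (mul_le_mul_of_nonneg_right (by gcongr) ((ha0 t).trans (hab t))))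
    (fun t => (hb' t).trans (by gcongr)) hfix heq hε hε1 hα₁0 hα₂0 hβ₁0 hβ₂0 hβ₃0 hβ₄0 hβ₅0 hβ₆0
    hβ₇0
    (integral_mulOp_le_of_stNorm0 hDo.measurableSet hDΩ hDQ (hed'.1.memLp_Ioc ht0 htT) hα₁)
    (integral_mulOp_grad_le_of_stNorm1 hDo hDΩ hDQ (hw2.memLp_Ioc ht0 htT)
      (by rw [← hew]; exact hα₂)) hin
    (integral_mulOp_le_of_stNorm0 hDo.measurableSet hDΩ hDQ (he2.memLp_Ioc ht0 htT) hβ₃)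
    (integral_mulOp_le_of_stNorm0 hDo.measurableSet hDΩ hDQ (hη2.memLp_Ioc ht0 htT) hβ₄)
    (integral_mulOp_le_of_stNorm0 hDo.measurableSet hDΩ hDQ (hηd'.1.memLp_Ioc ht0 htT) hβ₅)
    (integral_mulOp_grad_le_of_stNorm1 hDo hDΩ hDQ (hu2.memLp_Ioc ht0 htT)
      (by rw [← hηu]; exact hβ₆)) hqB hB
  constructor
  · refine le_trans ?_ (ENNReal.ofReal_le_ofReal b1)
    refine le_trans (lintegral_mono fun t => pow_le_pow_left'
      (eLpNorm_sublevel_le hΩ.isOpen hρ hδ (timeDeriv T e t) le_rfl) 2)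
      (lintegral_enorm_sq_le_ofReal (ContinuousLinearMap.comp_memLp' _
        (hed'.1.memLp_Ioc ht0 htT)) hts ha.aestronglyMeasurable ha0
        (fun t => (hab t).trans (hb1 t)) has)
  · refine le_trans ?_ (ENNReal.ofReal_le_ofReal b2)
    simp only [hwt]
    refine le_trans (lintegral_mono fun t => pow_le_pow_left'
      (eLpNorm_sublevel_le hΩ.isOpen hρ hδ (H10.grad (w t)) (k := 3) (by norm_num)) 2)
      (lintegral_enorm_sq_le_ofReal (ContinuousLinearMap.comp_memLp' _
        (hgw2.memLp_Ioc ht0 htT)) hts hb.aestronglyMeasurable (fun t => (ha0 t).trans (hab t))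
        hb1 fun t htt => le_antisymm (hb1 t) ((has t htt).symm.le.trans (hab t)))

end SublevelEstimate
end HeatFEM

namespace HeatFEM

/-! ### The dyadic decomposition -/

section Dyadic

variable {N : ℕ} {Ω : Set (Sp N)} {x₀ : Sp N} {J j : ℤ}

theorem dy_pos (j : ℤ) : 0 < dy j := zpow_pos two_pos _

theorem dy_zero : dy 0 = 1 := by simp [dy]

theorem two_mul_dy_add_one (j : ℤ) : 2 * dy (j + 1) = dy j := by
  rw [dy, dy, neg_add, zpow_add₀ two_ne_zero, zpow_neg_one]
  ring

theorem dy_sub_one (j : ℤ) : dy (j - 1) = 2 * dy j := by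
  rw [← two_mul_dy_add_one (j - 1), sub_add_cancel]

theorem dy_anti {i j : ℤ} (h : i ≤ j) : dy j ≤ dy i :=
  zpow_le_zpow_right₀ one_le_two (neg_le_neg h)

theorem two_mul_dy_le_one (hj : 1 ≤ j) : 2 * dy j ≤ 1 := by
  rw [← dy_sub_one, ← dy_zero]
  exact dy_anti (by omega)

theorem mem_Qj_of_le {p : ℝ × Sp N} (hp : p ∈ cyl Ω) (hj : 1 ≤ j) (h1 : dy j ≤ pDist x₀ p)
    (h2 : pDist x₀ p ≤ 2 * dy j) : p ∈ Qj Ω x₀ J j := by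
  rw [Qj, if_pos hj]
  exact ⟨hp, h1, h2⟩

theorem mem_Qj_zero (hJ : dy J < 1) {p : ℝ × Sp N} (hp : p ∈ cyl Ω) (h1 : 1 < pDist x₀ p) :
    p ∈ Qj Ω x₀ J 0 := by
  rw [Qj, if_neg (by norm_num), if_pos rfl]
  refine ⟨hp, ?_⟩
  rintro (h2 | h2)
  · obtain ⟨i, hi, -, -, h3⟩ := mem_iUnion₂.1 h2
    linarith [two_mul_dy_le_one hi.1]
  · linarith [h2.2]

/-- The region of the index `0` is the one outside the unit parabolic ball. -/
theorem one_lt_pDist_of_mem_Qj_zero {p : ℝ × Sp N} (h : p ∈ Qj Ω x₀ J 0) :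
    p ∈ cyl Ω ∧ 1 < pDist x₀ p := by
  rw [Qj, if_neg (by norm_num), if_pos rfl] at h
  refine ⟨h.1, ?_⟩
  by_contra! h1
  have h2 : dy J < pDist x₀ p := by
    by_contra! h2
    exact h.2 (Or.inr ⟨h.1, h2⟩)
  have h0 : 0 < pDist x₀ p := (dy_pos J).trans h2
  -- the annulus that contains `p`
  obtain ⟨n, hn1, hn2⟩ := exists_mem_Ioc_zpow h0 (one_lt_two (α := ℝ))
  have h3 : dy (-n) < pDist x₀ p := by rwa [dy, neg_neg]
  have h4 : pDist x₀ p ≤ 2 * dy (-n) := by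
    rw [← dy_sub_one, dy]
    rwa [neg_sub, sub_neg_eq_add, add_comm]
  have h5 : 1 ≤ -n := by
    by_contra h6
    have := dy_anti (show -n ≤ 0 by omega)
    rw [dy_zero] at this
    linarith
  have h6 : -n ≤ J := by
    by_contra h6
    have := dy_anti (show J ≤ -n - 1 by omega)
    rw [dy_sub_one] at this
    linarith
  exact h.2 (Or.inl (mem_iUnion₂.2 ⟨-n, ⟨h5, h6⟩, h.1, h3.le, h4⟩))

theorem mem_Omj_of_le {x : Sp N} (hx : x ∈ Ω) (hj : 1 ≤ j) (h1 : dy j ≤ ‖x - x₀‖)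
    (h2 : ‖x - x₀‖ ≤ 2 * dy j) : x ∈ Omj Ω x₀ J j := by
  rw [Omj, if_pos hj]
  exact ⟨hx, h1, h2⟩

theorem mem_Omj_zero (hJ : dy J < 1) {x : Sp N} (hx : x ∈ Ω) (h1 : 1 < ‖x - x₀‖) :
    x ∈ Omj Ω x₀ J 0 := by
  rw [Omj, if_neg (by norm_num), if_pos rfl]
  refine ⟨hx, ?_⟩
  rintro (h2 | h2)
  · obtain ⟨i, hi, -, -, h3⟩ := mem_iUnion₂.1 h2
    linarith [two_mul_dy_le_one hi.1]
  · linarith [h2.2]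

theorem mem_Qj'_of_le (hJ : dy J < 1) (hj : 1 ≤ j) {p : ℝ × Sp N} (hp : p ∈ cyl Ω)
    (h1 : dy j / 2 ≤ pDist x₀ p) (h2 : pDist x₀ p ≤ 4 * dy j) : p ∈ Qj' Ω x₀ J j := by
  have e1 := two_mul_dy_add_one j
  rcases le_or_gt (pDist x₀ p) (dy j) with h3 | h3
  · exact Or.inr (mem_Qj_of_le hp (by omega) (by linarith) (by linarith))
  rcases le_or_gt (pDist x₀ p) (2 * dy j) with h4 | h4
  · exact Or.inl (Or.inr (mem_Qj_of_le hp hj h3.le h4))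
  refine Or.inl (Or.inl ?_)
  have e2 := dy_sub_one j
  rcases eq_or_lt_of_le hj with rfl | hj1
  · norm_num at e2 ⊢
    rw [dy_zero] at e2
    exact mem_Qj_zero hJ hp (by linarith)
  · exact mem_Qj_of_le hp (by omega) (by linarith) (by linarith)

theorem mem_Qj'_zero (hJ : dy J < 1) {p : ℝ × Sp N} (hp : p ∈ cyl Ω) (h1 : 1 / 2 ≤ pDist x₀ p) :
    p ∈ Qj' Ω x₀ J 0 := by
  have e1 := two_mul_dy_add_one 0
  rw [dy_zero] at e1
  rcases le_or_gt (pDist x₀ p) 1 with h3 | h3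
  · exact Or.inr (mem_Qj_of_le hp (by omega) (by linarith) (by linarith))
  · exact Or.inl (Or.inr (mem_Qj_zero hJ hp h3))

theorem mem_Omj'_of_le (hJ : dy J < 1) (hj : 1 ≤ j) {x : Sp N} (hx : x ∈ Ω)
    (h1 : dy j / 2 ≤ ‖x - x₀‖) (h2 : ‖x - x₀‖ ≤ 4 * dy j) : x ∈ Omj' Ω x₀ J j := by
  have e1 := two_mul_dy_add_one j
  rcases le_or_gt ‖x - x₀‖ (dy j) with h3 | h3
  · exact Or.inr (mem_Omj_of_le hx (by omega) (by linarith) (by linarith))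
  rcases le_or_gt ‖x - x₀‖ (2 * dy j) with h4 | h4
  · exact Or.inl (Or.inr (mem_Omj_of_le hx hj h3.le h4))
  refine Or.inl (Or.inl ?_)
  have e2 := dy_sub_one j
  rcases eq_or_lt_of_le hj with rfl | hj1
  · norm_num at e2 ⊢
    rw [dy_zero] at e2
    exact mem_Omj_zero hJ hx (by linarith)
  · exact mem_Omj_of_le hx (by omega) (by linarith) (by linarith)

theorem mem_Omj'_zero (hJ : dy J < 1) {x : Sp N} (hx : x ∈ Ω) (h1 : 1 / 2 ≤ ‖x - x₀‖) :
    x ∈ Omj' Ω x₀ J 0 := by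
  have e1 := two_mul_dy_add_one 0
  rw [dy_zero] at e1
  rcases le_or_gt ‖x - x₀‖ 1 with h3 | h3
  · exact Or.inr (mem_Omj_of_le hx (by omega) (by linarith) (by linarith))
  · exact Or.inl (Or.inr (mem_Omj_zero hJ hx h3))

theorem mem_Omj''_of_le (hJ : dy J < 1) (hj : 1 ≤ j) {x : Sp N} (hx : x ∈ Ω)
    (h1 : dy j / 4 ≤ ‖x - x₀‖) (h2 : ‖x - x₀‖ ≤ 4 * dy j) : x ∈ Omj'' Ω x₀ J j := by
  have e1 := two_mul_dy_add_one j
  have e2 := two_mul_dy_add_one (j + 1)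
  rw [add_assoc, one_add_one_eq_two] at e2
  rcases le_or_gt (dy j / 2) ‖x - x₀‖ with h3 | h3
  · exact Or.inl (Or.inr (mem_Omj'_of_le hJ hj hx h3 h2))
  · exact Or.inr (mem_Omj_of_le hx (by omega) (by linarith) (by linarith))

theorem mem_Omj''_zero (hJ : dy J < 1) {x : Sp N} (hx : x ∈ Ω) (h1 : 1 / 4 ≤ ‖x - x₀‖) :
    x ∈ Omj'' Ω x₀ J 0 := by
  have e1 := two_mul_dy_add_one 0
  have e2 := two_mul_dy_add_one (0 + 1)
  rw [add_assoc, one_add_one_eq_two] at e2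
  rw [dy_zero] at e1
  rcases le_or_gt (1 / 2) ‖x - x₀‖ with h3 | h3
  · exact Or.inl (Or.inr (mem_Omj'_zero hJ hx h3))
  · exact Or.inr (mem_Omj_of_le hx (by omega) (by linarith) (by linarith))

theorem Qj_subset_Qj' : Qj Ω x₀ J j ⊆ Qj' Ω x₀ J j := fun _ h => Or.inl (Or.inr h)

end Dyadic

section TimeRamp

/-- The cutoff function in time that increases linearly from `0` at `p` to `1` at `p + l`. -/
noncomputable def timeRamp (p l t : ℝ) : ℝ := max 0 (min 1 ((t - p) / l))

theorem timeRamp_nonneg (p l t : ℝ) : 0 ≤ timeRamp p l t := le_max_left _ _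

theorem timeRamp_le_one (p l t : ℝ) : timeRamp p l t ≤ 1 := max_le zero_le_one (min_le_left _ _)

theorem timeRamp_of_le {p l t : ℝ} (hl : 0 < l) (ht : t ≤ p) : timeRamp p l t = 0 :=
  max_eq_left ((min_le_right _ _).trans (div_nonpos_of_nonpos_of_nonneg (by linarith) hl.le))

theorem timeRamp_of_ge {p l t : ℝ} (hl : 0 < l) (ht : p + l ≤ t) : timeRamp p l t = 1 := by
  rw [timeRamp, min_eq_left ((one_le_div hl).2 (by linarith)), max_eq_right zero_le_one]

theorem timeRamp_anti {p p' l : ℝ} (hl : 0 < l) (hp : p ≤ p') (t : ℝ) :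
    timeRamp p' l t ≤ timeRamp p l t :=
  max_le_max_left _ (min_le_min_left _ (by gcongr))

theorem isPrimOn_timeRamp {p l a b : ℝ} (hl : 0 < l) (ha : a ≤ p) :
    IsPrimOn a b (timeRamp p l) ((Ioc p (p + l)).indicator fun _ => l⁻¹) := by
  refine ⟨(integrableOn_const (by simp)).indicator measurableSet_Ioc, fun t ht => ?_⟩
  rw [timeRamp_of_le hl ha, zero_add, setIntegral_indicator measurableSet_Ioc, Ioc_inter_Ioc,
    max_eq_right ha, setIntegral_const, smul_eq_mul, Real.volume_real_Ioc, timeRamp]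
  rcases le_total t p with h1 | h1
  · rw [max_eq_left, max_eq_right, zero_mul]
    · have := min_le_left t (p + l)
      linarith
    · exact (min_le_right _ _).trans (div_nonpos_of_nonpos_of_nonneg (by linarith) hl.le)
  · rcases le_total t (p + l) with h2 | h2
    · rw [min_eq_left h2, min_eq_right ((div_le_one hl).2 (by linarith)),
        max_eq_left (sub_nonneg.2 h1), max_eq_right (div_nonneg (sub_nonneg.2 h1) hl.le),
        div_eq_mul_inv]
    · rw [min_eq_right h2, min_eq_left ((one_le_div hl).2 (by linarith)), add_sub_cancel_left,
        max_eq_left hl.le, max_eq_right zero_le_one, mul_inv_cancel₀ hl.ne']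

end TimeRamp
end HeatFEM

namespace HeatFEM

/-! ### Covering the dyadic regions by cylinders -/

section Cover

variable {N : ℕ} {Ω : Set (Sp N)} {Q : Set (ℝ × Sp N)} {E₁ E₂ : Set (Sp N)} {s b B : ℝ}

theorem lintegral_eq_add_Ioc {F : ℝ → ℝ≥0∞} (hs : 0 ≤ s) (hsb : s ≤ b)
    (hF : ∀ t, t ∉ Ioc 0 b → F t = 0) :
    ∫⁻ t, F t = (∫⁻ t in Ioc 0 s, F t) + ∫⁻ t in Ioc s b, F t := by
  rw [← lintegral_union measurableSet_Ioc (Ioc_disjoint_Ioc_of_le le_rfl),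
    Ioc_union_Ioc_eq_Ioc hs hsb, ← lintegral_indicator measurableSet_Ioc]
  refine lintegral_congr fun t => ?_
  by_cases ht : t ∈ Ioc 0 b
  · rw [indicator_of_mem ht]
  · rw [indicator_of_notMem ht, hF t ht]

theorem norm0_empty (w : Sp N → ℝ) : norm0 ∅ w = 0 := by simp [norm0]

theorem norm1_val_empty (u : H10 Ω) : norm1 ∅ (H10.val u) = 0 := by
  have h1 := norm1_val_le (empty_subset Ω) u
  rw [norm0_empty, Measure.restrict_empty, eLpNorm_measure_zero] at h1
  simpa using h1

/-- A region that is covered by two cylinders, in consecutive time intervals. -/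
structure IsCoveredBy (Q : Set (ℝ × Sp N)) (E₁ E₂ : Set (Sp N)) (s b : ℝ) : Prop where
  nonneg : 0 ≤ s
  le : s ≤ b
  empty : ∀ t, t ∉ Ioc 0 b → slice Q t = ∅
  left : ∀ t ∈ Ioc 0 s, slice Q t ⊆ E₁
  right : ∀ t ∈ Ioc s b, slice Q t ⊆ E₂

theorem IsCoveredBy.stNorm0_le (h : IsCoveredBy Q E₁ E₂ s b) (hB : 0 ≤ B) {v : ℝ → L2 Ω}
    (h1 : ∫⁻ t in Ioc 0 s, norm0 E₁ (v t) ^ 2 ≤ ENNReal.ofReal (B ^ 2))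
    (h2 : ∫⁻ t in Ioc s b, norm0 E₂ (v t) ^ 2 ≤ ENNReal.ofReal (B ^ 2)) :
    stNorm0 Q v ≤ ENNReal.ofReal (2 * B) := by
  rw [← (ENNReal.pow_right_strictMono two_ne_zero).le_iff_le]
  rw [stNorm0, rpow_half_sq, lintegral_eq_add_Ioc h.nonneg h.le fun t ht => by
    rw [h.empty t ht, norm0_empty, zero_pow two_ne_zero]]
  calc (∫⁻ t in Ioc 0 s, norm0 (slice Q t) (v t) ^ 2) + ∫⁻ t in Ioc s b, norm0 (slice Q t) (v t) ^ 2
      ≤ ENNReal.ofReal (B ^ 2) + ENNReal.ofReal (B ^ 2) := by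
        refine add_le_add (le_trans (setLIntegral_mono' measurableSet_Ioc fun t ht => ?_) h1)
          (le_trans (setLIntegral_mono' measurableSet_Ioc fun t ht => ?_) h2)
        · exact pow_le_pow_left' (norm0_mono (h.left t ht) _) 2
        · exact pow_le_pow_left' (norm0_mono (h.right t ht) _) 2
    _ ≤ ENNReal.ofReal (2 * B) ^ 2 := by
        rw [← ENNReal.ofReal_add (by positivity) (by positivity), ← ENNReal.ofReal_pow
          (by positivity)]
        refine ENNReal.ofReal_le_ofReal ?_
        nlinarith [sq_nonneg B]

theorem aemeasurable_eLpNorm_grad {T a : ℝ} {E : Set (Sp N)} (hE : MeasurableSet E) (hEΩ : E ⊆ Ω)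
    {w : ℝ → H10 Ω} (hw : MemL2Time T w) (ha : 0 ≤ a) (hb : b ≤ T) :
    AEMeasurable (fun t => eLpNorm (H10.grad (w t)) 2 (volume.restrict E) ^ 2)
      (volume.restrict (Ioc a b)) := by
  have h1 : MemL2Time T fun t => H10.grad (w t) := hw.clm H10.grad
  have h2 : MemL2Time T fun t => mulOp (isWeight_indicator hE) (Sp N) (volume.restrict Ω)
      (H10.grad (w t)) := h1.clm _
  simp only [← enorm_mulOp_indicator hE hEΩ]
  exact (h2.memLp_Ioc ha hb).1.enorm.pow_const 2

theorem IsCoveredBy.stNorm1_le (h : IsCoveredBy Q E₁ E₂ s b) (hQ : ∀ t, slice Q t ⊆ Ω)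
    (hE₁ : MeasurableSet E₁) (hE₂ : MeasurableSet E₂) (hE₁Ω : E₁ ⊆ Ω) (hE₂Ω : E₂ ⊆ Ω) {T : ℝ}
    (hbT : b ≤ T) {A : ℝ} (hA : 0 ≤ A) (hB : 0 ≤ B) {w : ℝ → H10 Ω} (hw : MemL2Time T w)
    (h0 : stNorm0 Q (fun t => H10.val (w t)) ≤ ENNReal.ofReal A)
    (h1 : ∫⁻ t in Ioc 0 s, eLpNorm (H10.grad (w t)) 2 (volume.restrict E₁) ^ 2 ≤
      ENNReal.ofReal (B ^ 2))
    (h2 : ∫⁻ t in Ioc s b, eLpNorm (H10.grad (w t)) 2 (volume.restrict E₂) ^ 2 ≤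
      ENNReal.ofReal (B ^ 2)) :
    stNorm1 Q (fun t => H10.val (w t)) ≤ ENNReal.ofReal (A + 2 * B) := by
  have h0' := lintegral_sq_le_of_rpow_le h0
  rw [lintegral_eq_add_Ioc h.nonneg h.le fun t ht => by
    rw [h.empty t ht, norm0_empty, zero_pow two_ne_zero]] at h0'
  rw [← (ENNReal.pow_right_strictMono two_ne_zero).le_iff_le]
  rw [stNorm1, rpow_half_sq, lintegral_eq_add_Ioc h.nonneg h.le fun t ht => by
    rw [h.empty t ht, norm1_val_empty, zero_pow two_ne_zero]]
  have k1 : ∫⁻ t in Ioc 0 s, norm1 (slice Q t) (H10.val (w t)) ^ 2 ≤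
      (∫⁻ t in Ioc 0 s, norm0 (slice Q t) (H10.val (w t)) ^ 2) + ENNReal.ofReal (B ^ 2) := by
    refine le_trans ?_ (add_le_add_right h1 _)
    rw [← lintegral_add_right' _ (aemeasurable_eLpNorm_grad hE₁ hE₁Ω hw le_rfl (h.le.trans hbT))]
    refine setLIntegral_mono' measurableSet_Ioc fun t ht => (norm1_val_le (hQ t) _).trans ?_
    gcongr
    exact h.left t ht
  have k2 : ∫⁻ t in Ioc s b, norm1 (slice Q t) (H10.val (w t)) ^ 2 ≤
      (∫⁻ t in Ioc s b, norm0 (slice Q t) (H10.val (w t)) ^ 2) + ENNReal.ofReal (B ^ 2) := by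
    refine le_trans ?_ (add_le_add_right h2 _)
    rw [← lintegral_add_right' _ (aemeasurable_eLpNorm_grad hE₂ hE₂Ω hw h.nonneg hbT)]
    refine setLIntegral_mono' measurableSet_Ioc fun t ht => (norm1_val_le (hQ t) _).trans ?_
    gcongr
    exact h.right t ht
  refine (add_le_add k1 k2).trans ?_
  rw [add_add_add_comm]
  refine (add_le_add_left h0' _).trans ?_
  rw [← ENNReal.ofReal_add (by positivity) (by positivity), ← ENNReal.ofReal_pow hA,
    ← ENNReal.ofReal_pow (by positivity), ← ENNReal.ofReal_add (by positivity) (by positivity)]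
  refine ENNReal.ofReal_le_ofReal ?_
  nlinarith [sq_nonneg B, mul_nonneg hA hB]

variable {x₀ : Sp N} {J j : ℤ}

theorem Qj_subset_cyl : Qj Ω x₀ J j ⊆ cyl Ω := by
  intro p hp
  rw [Qj] at hp
  split_ifs at hp
  · exact hp.1
  · exact hp.1
  · exact absurd hp (notMem_empty p)

/-- The annular region of index `j ≥ 1`: for small times the points are in the spatial annulus. -/
theorem isCoveredBy_Qj (hj : 1 ≤ j) : IsCoveredBy (Qj Ω x₀ J j)
    (Ω ∩ {x | max (dy j - ‖x - x₀‖) (‖x - x₀‖ - 2 * dy j) ≤ 0})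
    (Ω ∩ {x | ‖x - x₀‖ - 2 * dy j ≤ 0}) (7 / 8 * dy j ^ 2) (4 * dy j ^ 2) := by
  have hd := dy_pos j
  have hm : ∀ {t x}, x ∈ slice (Qj Ω x₀ J j) t → ((0 < t ∧ t < 1) ∧ x ∈ Ω) ∧
      dy j ≤ max ‖x - x₀‖ √t ∧ ‖x - x₀‖ ≤ 2 * dy j ∧ √t ≤ 2 * dy j := by
    intro t x hx
    have h1 : (t, x) ∈ Qj Ω x₀ J j := hx
    rw [Qj, if_pos hj] at h1
    exact ⟨h1.1, h1.2.1, max_le_iff.1 h1.2.2⟩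
  refine ⟨by positivity, by nlinarith, fun t ht => ?_, fun t ht x hx => ?_, fun t ht x hx => ?_⟩
  · rw [eq_empty_iff_forall_notMem]
    intro x hx
    obtain ⟨⟨⟨h1, -⟩, -⟩, -, -, h2⟩ := hm hx
    refine ht ⟨h1, ?_⟩
    have h3 := (Real.sqrt_le_left (by positivity)).1 h2
    linarith
  · obtain ⟨⟨⟨h1, -⟩, h0⟩, h2, h3, h4⟩ := hm hx
    refine ⟨h0, show max (dy j - ‖x - x₀‖) (‖x - x₀‖ - 2 * dy j) ≤ 0 from
      max_le ?_ (by linarith)⟩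
    rcases le_max_iff.1 h2 with h5 | h5
    · linarith
    · have h6 := (Real.le_sqrt hd.le h1.le).1 h5
      have h7 := ht.2
      nlinarith [sq_pos_of_pos hd]
  · obtain ⟨⟨-, h0⟩, h2, h3, h4⟩ := hm hx
    exact ⟨h0, show ‖x - x₀‖ - 2 * dy j ≤ 0 by linarith⟩

/-- The region of index `0`. As the times are at most `1`, its points have distance more than `1`
from `x₀`, and a single cylinder suffices. -/
theorem isCoveredBy_Qj_zero : IsCoveredBy (Qj Ω x₀ J 0) (Ω ∩ {x | 1 - ‖x - x₀‖ ≤ 0})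
    (Ω ∩ {x | 1 - ‖x - x₀‖ ≤ 0}) 1 1 := by
  have hm : ∀ {t x}, x ∈ slice (Qj Ω x₀ J 0) t → ((0 < t ∧ t < 1) ∧ x ∈ Ω) ∧ 1 < ‖x - x₀‖ := by
    intro t x hx
    obtain ⟨⟨h1, h2⟩, h3⟩ := one_lt_pDist_of_mem_Qj_zero hx
    refine ⟨⟨h1, h2⟩, (lt_max_iff.1 h3).resolve_right ?_⟩
    rw [not_lt, Real.sqrt_le_one]
    exact h1.2.le
  refine ⟨zero_le_one, le_rfl, fun t ht => ?_, fun t ht x hx => ?_, fun t ht x hx => ?_⟩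
  · rw [eq_empty_iff_forall_notMem]
    intro x hx
    obtain ⟨⟨⟨h1, h2⟩, -⟩, -⟩ := hm hx
    exact ht ⟨h1, h2.le⟩
  · obtain ⟨⟨-, h0⟩, h1⟩ := hm hx
    exact ⟨h0, show 1 - ‖x - x₀‖ ≤ 0 by linarith⟩
  · obtain ⟨⟨-, h0⟩, h1⟩ := hm hx
    exact ⟨h0, show 1 - ‖x - x₀‖ ≤ 0 by linarith⟩

end Cover
end HeatFEM

namespace HeatFEM

/-! ### The local energy estimate on the dyadic regions -/

section Local

variable {N : ℕ}

theorem abs_sub_norm_sub_le (c : ℝ) (x₀ x y : Sp N) :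
    |(c - ‖x - x₀‖) - (c - ‖y - x₀‖)| ≤ dist x y := by
  rw [dist_eq_norm, sub_sub_sub_cancel_left]
  refine (abs_norm_sub_norm_le _ _).trans ?_
  rw [sub_sub_sub_cancel_right, norm_sub_rev]

theorem abs_norm_sub_sub_le (c : ℝ) (x₀ x y : Sp N) :
    |(‖x - x₀‖ - c) - (‖y - x₀‖ - c)| ≤ dist x y := by
  rw [dist_eq_norm, sub_sub_sub_cancel_right]
  refine (abs_norm_sub_norm_le _ _).trans ?_
  rw [sub_sub_sub_cancel_right]

theorem measurableSet_inter_sublevel {Ω : Set (Sp N)} (hΩ : IsOpen Ω) {ρ : Sp N → ℝ}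
    (hρ : ∀ x y, |ρ x - ρ y| ≤ dist x y) : MeasurableSet (Ω ∩ {x | ρ x ≤ 0}) :=
  hΩ.measurableSet.inter
    (isClosed_le (continuous_of_abs_sub_le hρ) continuous_const).measurableSet

/-- The energy estimate on a dyadic region, in terms of bounds for the norms on the enlarged
region. A region of index `j ≥ 1` is covered by two cylinders: for `t ≤ 7/8 d_j²` it lies over the
annulus, where the initial value of `φ` vanishes nearby; for later times it lies over a ball, and
a cutoff in time, supported in `t > d_j² / 2`, removes the initial value. -/
theorem exists_dyadic_estimate (N : ℕ) {r : ℕ} (hr : 1 ≤ r) {K : ℝ} (hK : 0 < K) :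
    ∃ C, 1 ≤ C ∧ ∀ (Ω : Set (Sp N)) (𝒯 : Geometry.SimplicialComplex ℝ (Sp N)) (h T : ℝ),
      IsPolyhedralDomain Ω → IsQuasiUniformTriangulation Ω 𝒯 K h → 0 < h → 1 ≤ T →
      ∀ (φ : ℝ → H10 Ω) (φh : ℝ → Sh Ω 𝒯 r), IsGalerkinPair T φ φh →
      ∀ (e η : ℝ → L2 Ω), e = (fun t => H10.val (φ t - (φh t : H10 Ω))) →
        η = (fun t => Ih Ω 𝒯 r (H10.val (φ t)) - H10.val (φ t)) →
      ∀ (x₀ : Sp N) (J j : ℤ), dy J < 1 → 0 ≤ j → K * h ≤ dy j / 8 → h ≤ dy j / 8 →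
        (∀ᵐ x ∂volume.restrict (Omj'' Ω x₀ J j),
          initialValue T (fun t => H10.val (φ t)) x = 0) →
      ∀ ε, 0 < ε → ε ≤ 1 → ∀ α₁ α₂ β₁ β₂ β₃ β₄ β₅ β₆ β₇ : ℝ, 0 ≤ α₁ → 0 ≤ α₂ → 0 ≤ β₁ → 0 ≤ β₂ →
        0 ≤ β₃ → 0 ≤ β₄ → 0 ≤ β₅ → 0 ≤ β₆ → 0 ≤ β₇ →
      stNorm0 (Qj' Ω x₀ J j) (timeDeriv T e) ≤ ENNReal.ofReal α₁ →
      stNorm1 (Qj' Ω x₀ J j) e ≤ ENNReal.ofReal α₂ →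
      norm1 (Omj' Ω x₀ J j) (H10.val ((initialValue T φh : Sh Ω 𝒯 r) : H10 Ω)) ≤
        ENNReal.ofReal β₁ →
      norm0 (Omj' Ω x₀ J j) (H10.val ((initialValue T φh : Sh Ω 𝒯 r) : H10 Ω)) ≤
        ENNReal.ofReal β₂ →
      stNorm0 (Qj' Ω x₀ J j) e ≤ ENNReal.ofReal β₃ →
      stNorm0 (Qj' Ω x₀ J j) η ≤ ENNReal.ofReal β₄ →
      stNorm0 (Qj' Ω x₀ J j) (timeDeriv T η) ≤ ENNReal.ofReal β₅ →
      stNorm1 (Qj' Ω x₀ J j) η ≤ ENNReal.ofReal β₆ →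
      stNorm1 (Qj' Ω x₀ J j) (timeDeriv T η) ≤ ENNReal.ofReal β₇ →
      ∀ δ, δ = dy j / 8 → ∀ B, B = C * (√(h / δ) + ε) * (α₁ + δ⁻¹ * α₂) +
        C * ε⁻¹ ^ 3 * (β₁ + δ⁻¹ * β₂ + δ⁻¹ ^ 2 * β₃ + δ⁻¹ ^ 2 * β₄ + β₅ + δ⁻¹ * β₆ + δ * β₇) →
      stNorm0 (Qj Ω x₀ J j) (timeDeriv T e) ≤ ENNReal.ofReal (2 * B) ∧
        stNorm1 (Qj Ω x₀ J j) e ≤ ENNReal.ofReal (β₃ + 2 * (δ * B)) := by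
  obtain ⟨C, hC, H⟩ := exists_sublevel_estimate N hr hK
  refine ⟨C, hC, ?_⟩
  intro Ω 𝒯 h T hΩ hT hh hT1 φ φh hφ e η he hη x₀ J j hJ hj hKδ hhδ hinit ε hε hε1 α₁ α₂ β₁ β₂ β₃ β₄
    β₅ β₆ β₇ hα₁0 hα₂0 hβ₁0 hβ₂0 hβ₃0 hβ₄0 hβ₅0 hβ₆0 hβ₇0 hα₁ hα₂ hβ₁ hβ₂ hβ₃ hβ₄ hβ₅ hβ₆ hβ₇ δ hδd
    B hB
  have hd := dy_pos j
  have hδ : 0 < δ := by rw [hδd]; positivity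
  have hB0 : 0 ≤ B := by rw [hB]; positivity
  rw [← hδd] at hKδ hhδ
  have hfd := finiteDimensional_Sh (r := r) hT hΩ hr
  have hcs : CompleteSpace (Sh Ω 𝒯 r) := FiniteDimensional.complete ℝ _
  have hw : MemL2Time T fun t => φ t - (φh t : H10 Ω) :=
    MemLp.sub hφ.memL2 (hφ.memH1_h.1.clm (Sh Ω 𝒯 r).subtypeL)
  -- the local estimate for the sublevel sets of a function `ρ`
  have key := fun ρ hρ t₀ s t₁ h1 h2 h3 h4 h5 h6 a₁ a₁' a₂ a₂' k1 k2 k3 k4 k5 k6 k7 k8 l1 l2 =>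
    H Ω 𝒯 h T hΩ hT hh (by linarith) φ φh hφ e η he hη ρ hρ δ hδ hKδ hhδ t₀ s t₁ h1 h2 h3 h4 h5 h6
      a₁ a₁' a₂ a₂' k1 k2 k3 k4 k5 k6 k7 k8 (Qj' Ω x₀ J j) (Omj' Ω x₀ J j) l1 l2 ε hε hε1
      α₁ α₂ β₁ β₂ β₃ β₄ β₅ β₆ β₇ hα₁0 hα₂0 hβ₁0 hβ₂0 hβ₃0 hβ₄0 hβ₅0 hβ₆0 hβ₇0 hα₁ hα₂ hβ₁ hβ₂ hβ₃
      hβ₄ hβ₅ hβ₆ hβ₇ B hB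
  have fin : ∀ {E₁ E₂ : Set (Sp N)} {s b : ℝ}, IsCoveredBy (Qj Ω x₀ J j) E₁ E₂ s b →
      MeasurableSet E₁ → MeasurableSet E₂ → E₁ ⊆ Ω → E₂ ⊆ Ω → b ≤ 1 →
      ∫⁻ t in Ioc 0 s, norm0 E₁ (timeDeriv T e t : L2 Ω) ^ 2 ≤ ENNReal.ofReal (B ^ 2) →
      ∫⁻ t in Ioc s b, norm0 E₂ (timeDeriv T e t : L2 Ω) ^ 2 ≤ ENNReal.ofReal (B ^ 2) →
      ∫⁻ t in Ioc 0 s, eLpNorm (H10.grad (φ t - (φh t : H10 Ω))) 2 (volume.restrict E₁) ^ 2 ≤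
        ENNReal.ofReal ((δ * B) ^ 2) →
      ∫⁻ t in Ioc s b, eLpNorm (H10.grad (φ t - (φh t : H10 Ω))) 2 (volume.restrict E₂) ^ 2 ≤
        ENNReal.ofReal ((δ * B) ^ 2) →
      stNorm0 (Qj Ω x₀ J j) (timeDeriv T e) ≤ ENNReal.ofReal (2 * B) ∧
        stNorm1 (Qj Ω x₀ J j) e ≤ ENNReal.ofReal (β₃ + 2 * (δ * B)) := by
    intro E₁ E₂ s b hcov m1 m2 o1 o2 hb i1 i2 i3 i4
    refine ⟨hcov.stNorm0_le hB0 i1 i2, ?_⟩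
    have := hcov.stNorm1_le (fun t x hx => (Qj_subset_cyl hx).2) m1 m2 o1 o2 (hb.trans hT1) hβ₃0
      (mul_nonneg hδ.le hB0) hw ?_ i3 i4
    · rwa [he]
    · have h1 := (stNorm0_mono (Qj_subset_Qj' (Ω := Ω) (x₀ := x₀) (J := J) (j := j)) e).trans hβ₃
      rwa [he] at h1
  have hone : ∀ a b, IsPrimOn a b (fun _ => (1 : ℝ)) fun _ => 0 := fun a b => IsPrimOn.const a b 1
  rcases hj.eq_or_lt with rfl | hj
  · -- the outermost region: it is at distance at least `1` from `x₀` for all times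
    rw [dy_zero] at hδd
    have hρ := abs_sub_norm_sub_le (1 : ℝ) x₀
    have hm := measurableSet_inter_sublevel hΩ.isOpen hρ
    have hlow : ∀ {x : Sp N} {c : ℝ}, 1 - ‖x - x₀‖ < c → 1 - c ≤ ‖x - x₀‖ := fun h => by linarith
    obtain ⟨h1, h2⟩ := key _ hρ 0 0 1 le_rfl le_rfl one_pos hT1 (by rw [hδd]; norm_num)
      (by rw [hδd]; norm_num) _ _ _ _ (hone 0 1) (hone 0 1) (fun _ => zero_le_one)
      (fun _ => le_rfl) (fun _ => le_rfl) (fun t => by simp only [abs_zero]; positivity)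
      (fun t => by simp only [abs_zero]; positivity) (fun _ _ => rfl)
      (fun t ht x hx => mem_Qj'_zero hJ ⟨ht, hx.1⟩ (le_max_of_le_left (by
        have := hlow hx.2
        rw [hδd] at this
        linarith)))
      (Or.inr ⟨rfl, fun x hx => mem_Omj'_zero hJ hx.1 (by
        have := hlow hx.2
        rw [hδd] at this
        linarith), ae_restrict_of_ae_restrict_of_subset (fun x hx => mem_Omj''_zero hJ hx.1 (by
          have := hlow hx.2
          rw [hδd] at this
          linarith)) hinit⟩)
    exact fin isCoveredBy_Qj_zero hm hm inter_subset_left inter_subset_left le_rfl h1 (by simp) h2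
      (by simp)
  · have hj1 : 1 ≤ j := hj
    have hd1 := two_mul_dy_le_one hj1
    have hb : 4 * dy j ^ 2 ≤ 1 := by
      have h1 : (2 * dy j) ^ 2 ≤ 1 := pow_le_one₀ (by positivity) hd1
      linarith only [h1]
    have hδ2 : δ⁻¹ ^ 2 = 64 * (dy j ^ 2)⁻¹ := by
      rw [hδd]
      field_simp
      norm_num
    have hpos : 0 < (dy j ^ 2)⁻¹ := by positivity
    -- times less than `4 d_j²` have square root less than `2 d_j`
    have hsq : ∀ {t}, t < 4 * dy j ^ 2 → √t < 2 * dy j := fun ht =>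
      (Real.sqrt_lt' (by positivity)).2 (by linarith)
    have hρ₁ : ∀ x y : Sp N, |max (dy j - ‖x - x₀‖) (‖x - x₀‖ - 2 * dy j) -
        max (dy j - ‖y - x₀‖) (‖y - x₀‖ - 2 * dy j)| ≤ dist x y := fun x y =>
      (abs_max_sub_max_le_max _ _ _ _).trans
        (max_le (abs_sub_norm_sub_le _ _ _ _) (abs_norm_sub_sub_le _ _ _ _))
    have hρ₂ := abs_norm_sub_sub_le (2 * dy j) x₀
    have hlow : ∀ {x : Sp N} {c : ℝ}, max (dy j - ‖x - x₀‖) (‖x - x₀‖ - 2 * dy j) < c →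
        dy j - c ≤ ‖x - x₀‖ ∧ ‖x - x₀‖ ≤ 2 * dy j + c := fun h => by
      obtain ⟨h1, h2⟩ := max_lt_iff.1 h
      exact ⟨by linarith, by linarith⟩
    obtain ⟨h1, h2⟩ := key _ hρ₁ 0 0 (4 * dy j ^ 2) le_rfl le_rfl (by positivity) (hb.trans hT1)
      (by rw [hδd]; apply le_of_eq; ring)
      (by
        rw [hδ2, sub_zero, mul_inv]
        linarith)
      _ _ _ _ (hone 0 _) (hone 0 _) (fun _ => zero_le_one)
      (fun _ => le_rfl) (fun _ => le_rfl) (fun t => by simp only [abs_zero]; positivity)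
      (fun t => by simp only [abs_zero]; positivity) (fun _ _ => rfl)
      (fun t ht x hx => by
        obtain ⟨g1, g2⟩ := hlow hx.2
        rw [hδd] at g1 g2
        have g3 := hsq ht.2
        exact mem_Qj'_of_le hJ hj1 ⟨⟨ht.1, ht.2.trans_le hb⟩, hx.1⟩
          (le_max_of_le_left (by linarith)) (max_le (by linarith) (by linarith)))
      (Or.inr ⟨rfl, fun x hx => by
        obtain ⟨g1, g2⟩ := hlow hx.2
        rw [hδd] at g1 g2
        exact mem_Omj'_of_le hJ hj1 hx.1 (by linarith) (by linarith),
        ae_restrict_of_ae_restrict_of_subset (fun x hx => by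
          obtain ⟨g1, g2⟩ := hlow hx.2
          rw [hδd] at g1 g2
          exact mem_Omj''_of_le hJ hj1 hx.1 (by linarith) (by linarith)) hinit⟩)
    have hl : 0 < dy j ^ 2 / 8 := by positivity
    have hsub : Ioc 0 (7 / 8 * dy j ^ 2) ⊆ Ioc 0 (4 * dy j ^ 2) :=
      Ioc_subset_Ioc_right (by linarith)
    obtain ⟨h3, h4⟩ := key _ hρ₂ (dy j ^ 2 / 2) (7 / 8 * dy j ^ 2) (4 * dy j ^ 2) (by positivity)
      (by linarith) (by linarith) (hb.trans hT1)
      (by rw [hδd]; linarith)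
      (by
        rw [hδ2, show 4 * dy j ^ 2 - dy j ^ 2 / 2 = 7 / 2 * dy j ^ 2 by ring, mul_inv]
        linarith)
      (timeRamp (3 / 4 * dy j ^ 2) (dy j ^ 2 / 8)) _ (timeRamp (dy j ^ 2 / 2) (dy j ^ 2 / 8)) _
      (isPrimOn_timeRamp hl (by linarith)) (isPrimOn_timeRamp hl le_rfl)
      (timeRamp_nonneg _ _)
      (timeRamp_anti hl (by linarith)) (timeRamp_le_one _ _)
      (fun t => by
        by_cases ht : t ∈ Ioc (3 / 4 * dy j ^ 2) (3 / 4 * dy j ^ 2 + dy j ^ 2 / 8)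
        · rw [indicator_of_mem ht, timeRamp_of_ge hl (by linarith [ht.1]),
            abs_of_pos (by positivity),
            hδ2, div_eq_mul_inv, mul_inv, inv_inv]
          linarith
        · rw [indicator_of_notMem ht, abs_zero]
          exact mul_nonneg (by positivity) (timeRamp_nonneg _ _ _))
      (fun t => by
        by_cases ht : t ∈ Ioc (dy j ^ 2 / 2) (dy j ^ 2 / 2 + dy j ^ 2 / 8)
        · rw [indicator_of_mem ht, abs_of_pos (by positivity), hδ2, div_eq_mul_inv, mul_inv,
          inv_inv]
          linarith
        · rw [indicator_of_notMem ht, abs_zero]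
          positivity)
      (fun t ht => timeRamp_of_ge hl (by linarith [ht.1]))
      (fun t ht x hx => by
        have g1 : ‖x - x₀‖ - 2 * dy j < 4 * δ := hx.2
        rw [hδd] at g1
        have g3 := hsq ht.2
        have g4 : dy j / 2 ≤ √t := Real.le_sqrt_of_sq_le (by
          linarith only [ht.1, sq_nonneg (dy j)])
        exact mem_Qj'_of_le hJ hj1 ⟨⟨lt_trans (by positivity) ht.1, ht.2.trans_le hb⟩, hx.1⟩
          (le_max_of_le_right g4) (max_le (by linarith) (by linarith)))
      (Or.inl (timeRamp_of_le hl le_rfl))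
    exact fin (isCoveredBy_Qj hj1) (measurableSet_inter_sublevel hΩ.isOpen hρ₁)
      (measurableSet_inter_sublevel hΩ.isOpen hρ₂) inter_subset_left inter_subset_left hb
      ((lintegral_mono_set hsub).trans h1) h3 ((lintegral_mono_set hsub).trans h2) h4

end Local
end HeatFEM

namespace HeatFEM

/-! ### The dichotomy of scales and the final estimate -/

section Final

theorem exists_eq_ofReal_of_mul_ne_top {a : ℝ} {x : ℝ≥0∞} (ha : 0 < a)
    (h : ENNReal.ofReal a * x ≠ ⊤) : ∃ y, 0 ≤ y ∧ x = ENNReal.ofReal y := by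
  have hx : x ≠ ⊤ := by
    rintro rfl
    exact h (ENNReal.mul_top (ENNReal.ofReal_pos.2 ha).ne')
  exact ⟨x.toReal, ENNReal.toReal_nonneg, (ENNReal.ofReal_toReal hx).symm⟩

theorem exists_eq_ofReal_of_ne_top {x : ℝ≥0∞} (h : x ≠ ⊤) :
    ∃ y, 0 ≤ y ∧ x = ENNReal.ofReal y :=
  ⟨x.toReal, ENNReal.toReal_nonneg, (ENNReal.ofReal_toReal h).symm⟩

theorem rpow_half_mul_rpow_neg_half {h d : ℝ} (hh : 0 < h) (hd : 0 < d) :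
    h ^ (1 / 2 : ℝ) * d ^ (-(1 / 2) : ℝ) = √(h / d) := by
  rw [Real.rpow_neg hd.le, ← Real.sqrt_eq_rpow, ← Real.sqrt_eq_rpow, Real.sqrt_div hh.le,
    div_eq_mul_inv]

theorem ofReal_bound_eq {d c₁ c₂ α₁ α₂ β₁ β₂ β₃ β₄ β₅ β₆ β₇ : ℝ} (hd : 0 < d) (hc₁ : 0 < c₁)
    (hc₂ : 0 < c₂) (hα₁ : 0 ≤ α₁) (hα₂ : 0 ≤ α₂) (hβ₁ : 0 ≤ β₁) (hβ₂ : 0 ≤ β₂) (hβ₃ : 0 ≤ β₃)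
    (hβ₄ : 0 ≤ β₄) (hβ₅ : 0 ≤ β₅) (hβ₆ : 0 ≤ β₆) (hβ₇ : 0 ≤ β₇) :
    ENNReal.ofReal (c₁ * (β₁ + d⁻¹ * β₂ + (d * β₇ + β₅ + d⁻¹ * β₆ + d⁻¹ ^ 2 * β₄) +
      d⁻¹ ^ 2 * β₃) + c₂ * (α₁ + d⁻¹ * α₂)) =
    ENNReal.ofReal c₁ * (ENNReal.ofReal β₁ + ENNReal.ofReal d⁻¹ * ENNReal.ofReal β₂ +
      (ENNReal.ofReal d * ENNReal.ofReal β₇ + ENNReal.ofReal β₅ +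
        ENNReal.ofReal d⁻¹ * ENNReal.ofReal β₆ + ENNReal.ofReal (d⁻¹ ^ 2) * ENNReal.ofReal β₄) +
      ENNReal.ofReal (d⁻¹ ^ 2) * ENNReal.ofReal β₃) +
    ENNReal.ofReal c₂ * (ENNReal.ofReal α₁ + ENNReal.ofReal d⁻¹ * ENNReal.ofReal α₂) := by
  have hd₁ : 0 ≤ d⁻¹ := (inv_pos.2 hd).le
  have hd₂ : 0 ≤ d⁻¹ ^ 2 := by positivity
  rw [ENNReal.ofReal_add, ENNReal.ofReal_mul hc₁.le, ENNReal.ofReal_mul hc₂.le, ENNReal.ofReal_add,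
    ENNReal.ofReal_add, ENNReal.ofReal_add, ENNReal.ofReal_add, ENNReal.ofReal_add,
    ENNReal.ofReal_add, ENNReal.ofReal_add, ENNReal.ofReal_mul hd₁, ENNReal.ofReal_mul hd₁,
    ENNReal.ofReal_mul hd₁, ENNReal.ofReal_mul hd.le, ENNReal.ofReal_mul hd₂,
    ENNReal.ofReal_mul hd₂] <;> positivity

/-- Passage from the length `d / 8` to `d` in the constants, with the choice
`ε' = ε / (24 C)` of the small parameter. -/
theorem three_mul_bound_le {C h d ε α₁ α₂ β₁ β₂ β₃ β₄ β₅ β₆ β₇ B : ℝ} (hC : 1 ≤ C) (hh : 0 < h)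
    (hd : 0 < d) (hd1 : d ≤ 1) (hε : 0 < ε) (hε1 : ε < 1) (hα₁ : 0 ≤ α₁) (hα₂ : 0 ≤ α₂)
    (hβ₁ : 0 ≤ β₁) (hβ₂ : 0 ≤ β₂) (hβ₃ : 0 ≤ β₃) (hβ₄ : 0 ≤ β₄) (hβ₅ : 0 ≤ β₅) (hβ₆ : 0 ≤ β₆)
    (hβ₇ : 0 ≤ β₇)
    (hB : B = C * (√(h / (d / 8)) + ε / (24 * C)) * (α₁ + (d / 8)⁻¹ * α₂) +
      C * (ε / (24 * C))⁻¹ ^ 3 * (β₁ + (d / 8)⁻¹ * β₂ + (d / 8)⁻¹ ^ 2 * β₃ + (d / 8)⁻¹ ^ 2 * β₄ +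
        β₅ + (d / 8)⁻¹ * β₆ + d / 8 * β₇)) :
    2 * B + d⁻¹ * (β₃ + 2 * (d / 8 * B)) ≤
      193 * C * (24 * C) ^ 3 * ε⁻¹ ^ 3 * (β₁ + d⁻¹ * β₂ + (d * β₇ + β₅ + d⁻¹ * β₆ + d⁻¹ ^ 2 * β₄) +
        d⁻¹ ^ 2 * β₃) + (72 * C * √(h / d) + ε) * (α₁ + d⁻¹ * α₂) := by
  obtain ⟨q, hq⟩ : ∃ q, q = √(h / d) := ⟨_, rfl⟩
  have hq0 : 0 ≤ q := hq ▸ Real.sqrt_nonneg _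
  have hq8 : √(h / (d / 8)) ≤ 3 * q := by
    rw [hq]
    refine Real.sqrt_le_iff.2 ⟨by positivity, ?_⟩
    rw [mul_pow, Real.sq_sqrt (by positivity), div_div_eq_mul_div, div_le_iff₀ hd]
    field_simp
    linarith
  have hinv : (d / 8)⁻¹ = 8 * d⁻¹ := by rw [inv_div, div_eq_mul_inv]
  have hdi : 1 ≤ d⁻¹ := (one_le_inv₀ hd).2 hd1
  have hdd : d⁻¹ * d = 1 := inv_mul_cancel₀ hd.ne'
  have hεC : 24 * C * (ε / (24 * C)) = ε := by field_simp
  have hεi : (ε / (24 * C))⁻¹ ^ 3 = (24 * C) ^ 3 * ε⁻¹ ^ 3 := by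
    rw [inv_div, div_eq_mul_inv, mul_pow]
  rw [← hq]
  obtain ⟨A, hA⟩ : ∃ A, A = α₁ + d⁻¹ * α₂ := ⟨_, rfl⟩
  obtain ⟨S, hS⟩ : ∃ S, S = β₁ + d⁻¹ * β₂ + (d * β₇ + β₅ + d⁻¹ * β₆ + d⁻¹ ^ 2 * β₄) +
    d⁻¹ ^ 2 * β₃ := ⟨_, rfl⟩
  obtain ⟨M, hM⟩ : ∃ M, M = (24 * C) ^ 3 * ε⁻¹ ^ 3 := ⟨_, rfl⟩
  have hM1 : 1 ≤ M := by
    rw [hM, ← mul_pow]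
    refine one_le_pow₀ (one_le_mul_of_one_le_of_one_le (by linarith) ((one_le_inv₀ hε).2 hε1.le))
  have hA1 : α₁ + (d / 8)⁻¹ * α₂ ≤ 8 * A := by
    rw [hA, hinv]
    linarith
  have hS1 : β₁ + (d / 8)⁻¹ * β₂ + (d / 8)⁻¹ ^ 2 * β₃ + (d / 8)⁻¹ ^ 2 * β₄ +
      β₅ + (d / 8)⁻¹ * β₆ + d / 8 * β₇ ≤ 64 * S := by
    have h2 : 0 ≤ d⁻¹ * β₂ := by positivity
    have h6 : 0 ≤ d⁻¹ * β₆ := by positivity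
    have h7 : 0 ≤ d * β₇ := by positivity
    have h8 : (8 * d⁻¹) ^ 2 = 64 * d⁻¹ ^ 2 := by ring
    rw [hS, hinv, h8]
    linarith
  have hA0 : 0 ≤ A := by rw [hA]; positivity
  have hS0 : 0 ≤ S := by rw [hS]; positivity
  have hBle : B ≤ C * (3 * q + ε / (24 * C)) * (8 * A) + C * M * (64 * S) := by
    rw [hB, hεi, ← hM]
    gcongr
  have hβ₃S : d⁻¹ * β₃ ≤ S := by
    have h1 : d⁻¹ * β₃ ≤ d⁻¹ ^ 2 * β₃ := by
      gcongr
      exact le_self_pow₀ hdi two_ne_zero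
    have h2 : 0 ≤ β₁ + d⁻¹ * β₂ + (d * β₇ + β₅ + d⁻¹ * β₆ + d⁻¹ ^ 2 * β₄) := by positivity
    rw [hS]
    linarith
  have hB0 : 0 ≤ B := by rw [hB]; positivity
  have hCM : S ≤ C * M * S := le_mul_of_one_le_left hS0 (one_le_mul_of_one_le_of_one_le hC hM1)
  rw [← hA, ← hS, show 193 * C * (24 * C) ^ 3 * ε⁻¹ ^ 3 = 193 * (C * M) by rw [hM]; ring]
  calc 2 * B + d⁻¹ * (β₃ + 2 * (d / 8 * B)) = 2 * B + d⁻¹ * β₃ + (d⁻¹ * d) * (B / 4) := by ring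
    _ ≤ 3 * B + S := by rw [hdd]; linarith
    _ ≤ 3 * (C * (3 * q + ε / (24 * C)) * (8 * A) + C * M * (64 * S)) + C * M * S := by gcongr
    _ = 193 * (C * M) * S + (72 * C * q + 24 * C * (ε / (24 * C))) * A := by ring
    _ = _ := by rw [hεC]

theorem energyNorm_mono {N : ℕ} {Ω : Set (Sp N)} {T : ℝ} {j : ℤ} {Q Q' : Set (ℝ × Sp N)}
    (h : Q ⊆ Q') (e : ℝ → L2 Ω) : energyNorm T j Q e ≤ energyNorm T j Q' e :=
  add_le_add (stNorm0_mono h _) (mul_le_mul_right (stNorm1_mono h e) _)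

/-- When the mesh is not fine compared with `d`, the factor of the energy on the right hand side
is at least `1`. -/
theorem one_le_mul_sqrt {K h d C : ℝ} (hK : 0 < K) (hh : 0 < h) (hd : 0 < d)
    (hC : 8 * (1 + K) ≤ C) (hhd : ¬ (K * h ≤ d / 8 ∧ h ≤ d / 8)) : 1 ≤ C * √(h / d) := by
  have h1 : d ≤ 8 * (1 + K) * h := by
    by_contra! hlt
    have := mul_pos hK hh
    exact hhd ⟨by linarith, by linarith⟩
  have h2 : 1 ≤ 8 * (1 + K) * (h / d) := by
    rw [← mul_div_assoc, one_le_div hd]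
    exact h1
  have h3 : 1 ≤ C * (h / d) := h2.trans (by gcongr)
  rcases le_total (h / d) 1 with h4 | h4
  · refine h3.trans ?_
    have h5 : h / d ≤ √(h / d) := Real.le_sqrt_of_sq_le
      (pow_le_of_le_one (div_pos hh hd).le h4 two_ne_zero)
    have : 0 ≤ C := by linarith
    gcongr
  · exact one_le_mul_of_one_le_of_one_le (by linarith) (Real.one_le_sqrt.2 h4)

end Final
end HeatFEM

theorem mainTheorem5 {N : ℕ} (hN : N = 2 ∨ N = 3) (Ω : Set (HeatFEM.Sp N))
    (hΩ : HeatFEM.IsPolyhedralDomain Ω) (r : ℕ) (hr : 1 ≤ r) (K : ℝ) (hK : 0 < K) :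
    ∃ C : ℝ, 0 < C ∧
      ∀ (h Cstar : ℝ) (J : ℤ), 0 < h → 16 ≤ Cstar → HeatFEM.dy J = Cstar * h →
        h < 1 / (4 * Cstar) →
      ∀ 𝒯 : Geometry.SimplicialComplex ℝ (HeatFEM.Sp N),
        HeatFEM.IsQuasiUniformTriangulation Ω 𝒯 K h →
      ∀ T : ℝ, 1 ≤ T → ∀ x₀ ∈ Ω, ∀ j : ℤ, 0 ≤ j →
      ∀ (φ : ℝ → HeatFEM.H10 Ω) (φh : ℝ → HeatFEM.Sh Ω 𝒯 r),
        HeatFEM.MemL2Time T φ →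
        HeatFEM.MemH1Time T (fun t => HeatFEM.H10.val (φ t)) →
        HeatFEM.MemH1Time T φh →
        -- Galerkin orthogonality
        (∀ᵐ t ∂(volume.restrict (Ioo 0 T)), ∀ χ : HeatFEM.Sh Ω 𝒯 r,
          inner ℝ (HeatFEM.timeDeriv T (fun s => HeatFEM.H10.val (φ s - (φh s : HeatFEM.H10 Ω))) t)
              (HeatFEM.H10.val (χ : HeatFEM.H10 Ω)) +
            inner ℝ (HeatFEM.H10.grad (φ t - (φh t : HeatFEM.H10 Ω)))
              (HeatFEM.H10.grad (χ : HeatFEM.H10 Ω)) = 0) →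
        -- the initial value of `φ` vanishes on `Ω_j''`
        (∀ᵐ x ∂(volume.restrict (HeatFEM.Omj'' Ω x₀ J j)),
          HeatFEM.initialValue T (fun t => HeatFEM.H10.val (φ t)) x = 0) →
      ∀ ε : ℝ, 0 < ε → ε < 1 →
        HeatFEM.energyNorm T j (HeatFEM.Qj Ω x₀ J j)
            (fun t => HeatFEM.H10.val (φ t - (φh t : HeatFEM.H10 Ω))) ≤
          ENNReal.ofReal (C * ε⁻¹ ^ 3) *
            (HeatFEM.initTerm x₀ J j
                (HeatFEM.H10.val
                  ((HeatFEM.initialValue T φh : HeatFEM.Sh Ω 𝒯 r) : HeatFEM.H10 Ω)) +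
              HeatFEM.interpTerm T x₀ J j
                (fun t => HeatFEM.Ih Ω 𝒯 r (HeatFEM.H10.val (φ t)) - HeatFEM.H10.val (φ t)) +
              ENNReal.ofReal ((HeatFEM.dy j)⁻¹ ^ 2) * HeatFEM.stNorm0 (HeatFEM.Qj' Ω x₀ J j)
                (fun t => HeatFEM.H10.val (φ t - (φh t : HeatFEM.H10 Ω)))) +
          ENNReal.ofReal (C * h ^ (1 / 2 : ℝ) * (HeatFEM.dy j) ^ (-(1 / 2) : ℝ) +
              C * ε⁻¹ * h * (HeatFEM.dy j)⁻¹ + ε) *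
            HeatFEM.energyNorm T j (HeatFEM.Qj' Ω x₀ J j)
              (fun t => HeatFEM.H10.val (φ t - (φh t : HeatFEM.H10 Ω))) := by
  obtain ⟨C, hC, H⟩ := HeatFEM.exists_dyadic_estimate N hr hK
  obtain ⟨C', hC', hC'1, hC'2, hC'3⟩ : ∃ C', 0 < C' ∧ 193 * C * (24 * C) ^ 3 ≤ C' ∧ 72 * C ≤ C' ∧
      8 * (1 + K) ≤ C' := by
    have h1 : 0 ≤ 193 * C * (24 * C) ^ 3 := by positivity
    exact ⟨193 * C * (24 * C) ^ 3 + 72 * C + 8 * (1 + K), by positivity, by linarith, by linarith,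
      by linarith⟩
  refine ⟨C', hC', ?_⟩
  intro h Cstar J hh hCs hJ hhC 𝒯 hT T hT1 x₀ hx₀ j hj φ φh hφ hφ' hφh hgal hinit ε hε hε1
  have hd := HeatFEM.dy_pos j
  have hd1 : HeatFEM.dy j ≤ 1 := by
    rw [← HeatFEM.dy_zero]
    exact HeatFEM.dy_anti hj
  have hJ1 : HeatFEM.dy J < 1 := by
    rw [hJ]
    rw [lt_div_iff₀ (by positivity)] at hhC
    linarith
  rw [mul_assoc C', HeatFEM.rpow_half_mul_rpow_neg_half hh hd]
  obtain ⟨d, hdj⟩ : ∃ d, d = HeatFEM.dy j := ⟨_, rfl⟩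
  by_cases hfine : K * h ≤ HeatFEM.dy j / 8 ∧ h ≤ HeatFEM.dy j / 8
  swap
  · -- a coarse mesh: the energy on the right hand side has a factor at least `1`
    refine (HeatFEM.energyNorm_mono HeatFEM.Qj_subset_Qj' _).trans (le_add_left ?_)
    refine le_mul_of_one_le_left' ?_
    rw [ENNReal.one_le_ofReal]
    have h1 := HeatFEM.one_le_mul_sqrt hK hh hd hC'3 hfine
    have h2 : 0 ≤ C' * ε⁻¹ * h * (HeatFEM.dy j)⁻¹ := by positivity
    linarith
  have H' := H Ω 𝒯 h T hΩ hT hh hT1 φ φh ⟨hφ, hφ', hφh, hgal⟩ _ _ rfl rfl x₀ J j hJ1 hj hfine.1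
    hfine.2 hinit (ε / (24 * C)) (by positivity) (by
      rw [div_le_one (by positivity)]
      linarith)
  generalize (fun t => HeatFEM.H10.val (φ t - (φh t : HeatFEM.H10 Ω))) = e at H' ⊢
  generalize (fun t => HeatFEM.Ih Ω 𝒯 r (HeatFEM.H10.val (φ t)) - HeatFEM.H10.val (φ t)) = η
    at H' ⊢
  generalize HeatFEM.H10.val ((HeatFEM.initialValue T φh : HeatFEM.Sh Ω 𝒯 r) : HeatFEM.H10 Ω) = w
    at H' ⊢
  -- an infinite right hand side leaves nothing to prove; otherwise all the norms in it are finite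
  refine le_of_not_gt fun hlt => (hlt.trans_le ?_).false
  have hfin := hlt.ne_top
  simp only [HeatFEM.energyNorm, HeatFEM.initTerm, HeatFEM.interpTerm] at hfin ⊢
  have hc₁ : 0 < C' * ε⁻¹ ^ 3 := by positivity
  obtain ⟨c₂, hc₂⟩ : ∃ c₂, c₂ = C' * √(h / HeatFEM.dy j) + C' * ε⁻¹ * h * (HeatFEM.dy j)⁻¹ + ε :=
    ⟨_, rfl⟩
  have hc₂0 : 0 < c₂ := by rw [hc₂]; positivity
  rw [← hc₂] at hfin ⊢
  rw [← hdj] at hd hd1 hc₂ hfin H' ⊢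
  have hdi : 0 < d⁻¹ := inv_pos.2 hd
  have hdi2 : 0 < d⁻¹ ^ 2 := by positivity
  obtain ⟨g1, g2⟩ := ENNReal.add_ne_top.1 hfin
  obtain ⟨y₁, -, hy₁⟩ := HeatFEM.exists_eq_ofReal_of_mul_ne_top hc₁ g1
  obtain ⟨y₂, -, hy₂⟩ := HeatFEM.exists_eq_ofReal_of_mul_ne_top hc₂0 g2
  have g1 := hy₁.trans_ne ENNReal.ofReal_ne_top
  have g2 := hy₂.trans_ne ENNReal.ofReal_ne_top
  simp only [ne_eq, ENNReal.add_eq_top, not_or] at g1 g2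
  obtain ⟨⟨⟨k1, k2⟩, ⟨⟨k7, k5⟩, k6⟩, k4⟩, k3⟩ := g1
  obtain ⟨α₁, hα₁, e1⟩ := HeatFEM.exists_eq_ofReal_of_ne_top g2.1
  obtain ⟨α₂, hα₂, e2⟩ := HeatFEM.exists_eq_ofReal_of_mul_ne_top hdi g2.2
  obtain ⟨β₁, hβ₁, f1⟩ := HeatFEM.exists_eq_ofReal_of_ne_top k1
  obtain ⟨β₂, hβ₂, f2⟩ := HeatFEM.exists_eq_ofReal_of_mul_ne_top hdi k2
  obtain ⟨β₃, hβ₃, f3⟩ := HeatFEM.exists_eq_ofReal_of_mul_ne_top hdi2 k3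
  obtain ⟨β₄, hβ₄, f4⟩ := HeatFEM.exists_eq_ofReal_of_mul_ne_top hdi2 k4
  obtain ⟨β₅, hβ₅, f5⟩ := HeatFEM.exists_eq_ofReal_of_ne_top k5
  obtain ⟨β₆, hβ₆, f6⟩ := HeatFEM.exists_eq_ofReal_of_mul_ne_top hdi k6
  obtain ⟨β₇, hβ₇, f7⟩ := HeatFEM.exists_eq_ofReal_of_mul_ne_top hd k7
  obtain ⟨B, hB⟩ : ∃ B, B = C * (√(h / (d / 8)) + ε / (24 * C)) * (α₁ + (d / 8)⁻¹ * α₂) +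
      C * (ε / (24 * C))⁻¹ ^ 3 * (β₁ + (d / 8)⁻¹ * β₂ + (d / 8)⁻¹ ^ 2 * β₃ + (d / 8)⁻¹ ^ 2 * β₄ +
        β₅ + (d / 8)⁻¹ * β₆ + d / 8 * β₇) := ⟨_, rfl⟩
  obtain ⟨r1, r2⟩ := H' α₁ α₂ β₁ β₂ β₃ β₄ β₅ β₆ β₇ hα₁ hα₂ hβ₁ hβ₂ hβ₃ hβ₄ hβ₅ hβ₆ hβ₇ e1.le e2.le
    f1.le f2.le f3.le f4.le f5.le f6.le f7.le (d / 8) rfl B hB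
  have hB0 : 0 ≤ B := by rw [hB]; positivity
  rw [e1, e2, f1, f2, f3, f4, f5, f6, f7]
  refine (add_le_add r1 (mul_le_mul_right r2 _)).trans ?_
  have hnum := HeatFEM.three_mul_bound_le hC hh hd hd1 hε hε1 hα₁ hα₂ hβ₁ hβ₂ hβ₃ hβ₄ hβ₅ hβ₆ hβ₇ hB
  have hle : 2 * B + d⁻¹ * (β₃ + 2 * (d / 8 * B)) ≤ C' * ε⁻¹ ^ 3 * (β₁ + d⁻¹ * β₂ +
      (d * β₇ + β₅ + d⁻¹ * β₆ + d⁻¹ ^ 2 * β₄) + d⁻¹ ^ 2 * β₃) + c₂ * (α₁ + d⁻¹ * α₂) := by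
    refine hnum.trans (add_le_add (by gcongr) (mul_le_mul_of_nonneg_right ?_ (by positivity)))
    have h1 : 72 * C * √(h / d) ≤ C' * √(h / d) := by gcongr
    have h2 : 0 ≤ C' * ε⁻¹ * h * d⁻¹ := by positivity
    rw [hc₂]
    linarith
  refine Eq.trans_le ?_ ((ENNReal.ofReal_le_ofReal hle).trans_eq ?_)
  · rw [← ENNReal.ofReal_mul hdi.le, ← ENNReal.ofReal_add (by positivity) (by positivity)]
  · exact HeatFEM.ofReal_bound_eq hd hc₁ hc₂0 hα₁ hα₂ hβ₁ hβ₂ hβ₃ hβ₄ hβ₅ hβ₆ hβ₇
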